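/- All manifolds and maps are $C^\infty$. A *$(2,3,5)$-distribution* is a rank-$2$ subbundle $D\subset TY$, $\dim Y=5$, having near each point local sections $\eta_1,\eta_2$ such that $\eta_1,\eta_2,[\eta_1,\eta_2],[\eta_1,[\eta_1,\eta_2]],[\eta_2,[\eta_1,\eta_2]]$ is a local frame of $TY$. For a distribution $E$ with sheaf of sections $\mathcal E$ put $\partial^{(0)}\mathcal E=\mathcal E$, $\partial^{(k+1)}\mathcal E=[\mathcal E,\partial^{(k)}\mathcal E]$, $\partial=\partial^{(1)}$, where $[\mathcal A,\mathcal B]$ means $\mathcal A+\mathcal B+[\mathcal A,\mathcal B]$. A *pseudo-product structure of $G_2$-type* on a $6$-manifold $Z$ is a pair of line subbundles $K,L\subset TZ$ with $K\cap L=0$ such that $E=K\oplus L$ satisfies $\operatorname{rank}\partial^{(k)}E=k+2$ for $0\le k\le4$ and $$[\mathcal K,\mathcal L]=\partial\mathcal E,\quad [\mathcal K,\partial\mathcal E]=\partial^{(2)}\mathcal E,\quad [\mathcal L,\partial\mathcal E]=\partial\mathcal E,\quad [\mathcal K,\partial^{(2)}\mathcal E]=\partial^{(3)}\mathcal E,\quad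 [\mathcal L,\partial^{(2)}\mathcal E]=\partial^{(2)}\mathcal E,$$ $$[\mathcal K,\partial^{(3)}\mathcal E]=\partial^{(3)}\mathcal E,\quad [\mathcal L,\partial^{(3)}\mathcal E]=\partial^{(4)}\mathcal E.$$ For a $(2,3,5)$-distribution $D$ on $Y$ let $P(D)=\{(y,\ell):\ell\subset D_y,\ \dim\ell=1\}$ with projection $\pi:P(D)\to Y$, let $E_{(y,\ell)}=\pi_*^{-1}(\ell)$ be the Cartan prolongation, and $L=\operatorname{Ker}\pi_*$. A *reduction* of a distribution $F$ by $L\subset F$ on an open set $U\subset Z$ is a surjective submersion $p:U\to Y$ onto a manifold $Y$ whose fibres are connected and have tangent spaces $L$ (so $Y$ is the leaf space of $L|_U$), with a distribution $D$ on $Y$ such that $F|_U=p_*^{-1}(D)$. **Theorem.** 1. For every $(2,3,5)$-distribution $(Y,D)$ there is a line subbundle $K\subset E$ such that $E=K\oplus L$ and $(K,L)$ is a pseudo-product structure of $G_2$-type on $P(D)$; it is the only line subbundle $K$ with $E=K\oplus L$ and $[\mathcal K,\partial^{(3)}\mathcal E]=\partial^{(3)}\mathcal E$. Moreover $D$, with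 $\pi$, is the reduction of $\partial E$ by $L$. 2. Let $(Y,D)$, $(Y',D')$ be $(2,3,5)$-distributions. Each diffeomorphism $\varphi$ between open subsets of $Y$ and $Y'$ with $\varphi_*D=D'$ lifts to the diffeomorphism $(y,\ell)\mapsto(\varphi(y),\varphi_*\ell)$ between open subsets of $P(D)$ and $P(D')$, which preserves $K$ and $L$; and each diffeomorphism between open subsets of $P(D)$ and $P(D')$ that preserves $K$ and $L$ is, near each point, such a lift. In particular $D$ at $y$ and $D'$ at $y'$ are locally isomorphic if and only if $(P(D),K,L)$ and $(P(D'),K',L')$ are locally isomorphic at some points over $y$ and $y'$. 3. Conversely, let $(K,L)$ be a pseudo-product structure of $G_2$-type on $Z$ and $E=K\oplus L$. Then $L$ is the Cauchy characteristic of $\partial E$; near each point $\partial E$ has a reduction by $L$; and every reduction $(U,p,Y,D)$ of $\partial E$ by $L$ (with $\dim Y=5$ and $D$ of rank $2$) is a $(2,3,5)$-distribution, the map $w\mapsto(p(w),p_*K_w)$ being, near each point of $U$, a diffeomorphism onto an open subset of $P(D)$ that carries $(K,L)$ to the pseudo-product structure of part 1. 4. The assignment $(Y,D,(y,\ell))\mapsto(P(D),K,L,(y,\ell))$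 induces a bijection between the local isomorphism classes of $(2,3,5)$-distributions with a base point $y$ and a direction $\ell\subset D_y$, and the local isomorphism classes of pseudo-product structures of $G_2$-type with a base point. Here a local isomorphism is a diffeomorphism between neighbourhoods of the base points which preserves the structures, the base points, and (on the left) the directions. -/

import Mathlib

open Set Filter Topology Manifold Bundle
open scoped ContDiff

universe u

noncomputable section

namespace TwoThreeFive

/-! ## Distributions and derived systems

An `n`-dimensional manifold is a smooth manifold modelled on a real vector space `V` of
dimension `n`.  Everything below is local, so no separation or countability axiom is needed. -/

section Distributions

variable {V : Type*} [NormedAddCommGroup V] [NormedSpace ℝ V]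
variable {M : Type*} [TopologicalSpace M] [ChartedSpace V M] [IsManifold 𝓘(ℝ, V) ∞ M]

/-- A (not necessarily continuous) vector field on `M`. -/
abbrev VField (V : Type*) [NormedAddCommGroup V] [NormedSpace ℝ V]
    (M : Type*) [TopologicalSpace M] [ChartedSpace V M] : Type _ :=
  ∀ x : M, TangentSpace 𝓘(ℝ, V) x

/-- A field of tangent subspaces `x ↦ A x ⊆ T_x M` (without regularity condition). -/
abbrev SubspaceField (V : Type*) [NormedAddCommGroup V] [NormedSpace ℝ V]
    (M : Type*) [TopologicalSpace M] [ChartedSpace V M] : Type _ :=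
  ∀ x : M, Submodule ℝ (TangentSpace 𝓘(ℝ, V) x)

/-- `X` is a smooth section of `A` over `U`. -/
def IsSectionOn (A : SubspaceField V M) (U : Set M) (X : VField V M) : Prop :=
  ContMDiffOn 𝓘(ℝ, V) 𝓘(ℝ, V).tangent ∞
      (fun x => (⟨x, X x⟩ : TangentBundle 𝓘(ℝ, V) M)) U ∧
    ∀ x ∈ U, X x ∈ A x

/-- `A` is a smooth distribution of rank `r` (a subbundle of rank `r` of the tangent bundle):
it has smooth local frames. -/
def IsDistribution (r : ℕ) (A : SubspaceField V M) : Prop :=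
  ∀ x : M, ∃ U : Set M, IsOpen U ∧ x ∈ U ∧ ∃ s : Fin r → VField V M,
    (∀ i, IsSectionOn A U (s i)) ∧
    ∀ y ∈ U, LinearIndependent ℝ (fun i => s i y) ∧
      A y = Submodule.span ℝ (Set.range fun i => s i y)

/-- `[𝓐, 𝓑] = 𝓐 + 𝓑 + [𝓐, 𝓑]`: the subspace at `x` is spanned by the values at `x` of local
sections of `A`, of `B`, and of Lie brackets of these. -/
def bracket (A B : SubspaceField V M) : SubspaceField V M := fun x =>
  A x ⊔ B x ⊔ Submodule.span ℝ
    {v | ∃ U : Set M, IsOpen U ∧ x ∈ U ∧ ∃ X Y : VField V M,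
      IsSectionOn A U X ∧ IsSectionOn B U Y ∧ VectorField.mlieBracket 𝓘(ℝ, V) X Y x = v}

/-- The derived systems `∂⁽⁰⁾E = E`, `∂⁽ᵏ⁺¹⁾E = [E, ∂⁽ᵏ⁾E]`.  As long as the ranks are constant,
the local sections of `derived E k` form the sheaf `∂⁽ᵏ⁾𝓔`. -/
def derived (E : SubspaceField V M) : ℕ → SubspaceField V M
  | 0 => E
  | k + 1 => bracket E (derived E k)

/-- The Cauchy characteristic of `F` at `x`: the values at `x` of the local sections `X` of `F`
with `[X, 𝓕] ⊆ 𝓕`. -/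
def cauchyChar (F : SubspaceField V M) (x : M) : Set (TangentSpace 𝓘(ℝ, V) x) :=
  {v | ∃ U : Set M, IsOpen U ∧ x ∈ U ∧ ∃ X : VField V M, IsSectionOn F U X ∧ X x = v ∧
    ∀ W : Set M, IsOpen W → W ⊆ U → ∀ Y : VField V M, IsSectionOn F W Y →
      ∀ w ∈ W, VectorField.mlieBracket 𝓘(ℝ, V) X Y w ∈ F w}

/-- `(2,3,5)`-distributions: around each point there are local sections `η₁, η₂` such that
`η₁, η₂, [η₁,η₂], [η₁,[η₁,η₂]], [η₂,[η₁,η₂]]` are pointwise linearly independent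
(on a `5`-dimensional manifold: form a local frame). -/
structure Is235 (D : SubspaceField V M) : Prop where
  dim : Module.finrank ℝ V = 5
  isDistribution : IsDistribution 2 D
  frame : ∀ x : M, ∃ U : Set M, IsOpen U ∧ x ∈ U ∧ ∃ η₁ η₂ : VField V M,
    IsSectionOn D U η₁ ∧ IsSectionOn D U η₂ ∧
    ∀ y ∈ U, LinearIndependent ℝ ![η₁ y, η₂ y,
      VectorField.mlieBracket 𝓘(ℝ, V) η₁ η₂ y,
      VectorField.mlieBracket 𝓘(ℝ, V) η₁ (VectorField.mlieBracket 𝓘(ℝ, V) η₁ η₂) y,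
      VectorField.mlieBracket 𝓘(ℝ, V) η₂ (VectorField.mlieBracket 𝓘(ℝ, V) η₁ η₂) y]

/-- The sum `K + L` of two fields of subspaces. -/
def sumField (K L : SubspaceField V M) : SubspaceField V M := fun x => K x ⊔ L x

/-- Pseudo-product structures `E = K ⊕ L` of `G₂`-type on a `6`-dimensional manifold. -/
structure IsPseudoProductG2 (K L : SubspaceField V M) : Prop where
  dim : Module.finrank ℝ V = 6
  rank_K : IsDistribution 1 K
  rank_L : IsDistribution 1 L
  disjoint : ∀ x, Disjoint (K x) (L x)
  growth : ∀ k ≤ 4, ∀ x, Module.finrank ℝ (derived (sumField K L) k x) = k + 2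
  bracket_K_L : bracket K L = derived (sumField K L) 1
  bracket_K_1 : bracket K (derived (sumField K L) 1) = derived (sumField K L) 2
  bracket_L_1 : bracket L (derived (sumField K L) 1) = derived (sumField K L) 1
  bracket_K_2 : bracket K (derived (sumField K L) 2) = derived (sumField K L) 3
  bracket_L_2 : bracket L (derived (sumField K L) 2) = derived (sumField K L) 2
  bracket_K_3 : bracket K (derived (sumField K L) 3) = derived (sumField K L) 3
  bracket_L_3 : bracket L (derived (sumField K L) 3) = derived (sumField K L) 4

end Distributions

/-! ## Local diffeomorphisms and reduction -/

section Maps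

variable {V : Type*} [NormedAddCommGroup V] [NormedSpace ℝ V]
variable {M : Type*} [TopologicalSpace M] [ChartedSpace V M]
variable {V' : Type*} [NormedAddCommGroup V'] [NormedSpace ℝ V']
variable {M' : Type*} [TopologicalSpace M'] [ChartedSpace V' M']
variable {V'' : Type*} [NormedAddCommGroup V''] [NormedSpace ℝ V'']
variable {M'' : Type*} [TopologicalSpace M''] [ChartedSpace V'' M'']

/-- The image `dφ_x(A) ⊆ T_{φ x} M'` of a tangent subspace `A ⊆ T_x M`. -/
def push (V V' : Type*) [NormedAddCommGroup V] [NormedSpace ℝ V]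
    [NormedAddCommGroup V'] [NormedSpace ℝ V']
    {M : Type*} [TopologicalSpace M] [ChartedSpace V M]
    {M' : Type*} [TopologicalSpace M'] [ChartedSpace V' M']
    (φ : M → M') (x : M) (A : Submodule ℝ (TangentSpace 𝓘(ℝ, V) x)) :
    Submodule ℝ (TangentSpace 𝓘(ℝ, V') (φ x)) :=
  A.map (mfderiv 𝓘(ℝ, V) 𝓘(ℝ, V') φ x).toLinearMap

/-- The preimage `dφ_x⁻¹(B) ⊆ T_x M` of a tangent subspace `B ⊆ T_{φ x} M'`. -/
def pull (V V' : Type*) [NormedAddCommGroup V] [NormedSpace ℝ V]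
    [NormedAddCommGroup V'] [NormedSpace ℝ V']
    {M : Type*} [TopologicalSpace M] [ChartedSpace V M]
    {M' : Type*} [TopologicalSpace M'] [ChartedSpace V' M']
    (φ : M → M') (x : M) (B : Submodule ℝ (TangentSpace 𝓘(ℝ, V') (φ x))) :
    Submodule ℝ (TangentSpace 𝓘(ℝ, V) x) :=
  B.comap (mfderiv 𝓘(ℝ, V) 𝓘(ℝ, V') φ x).toLinearMap

/-- A homeomorphism between open subsets is a smooth diffeomorphism. -/
def IsDiffeo (V V' : Type*) [NormedAddCommGroup V] [NormedSpace ℝ V]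
    [NormedAddCommGroup V'] [NormedSpace ℝ V']
    {M : Type*} [TopologicalSpace M] [ChartedSpace V M]
    {M' : Type*} [TopologicalSpace M'] [ChartedSpace V' M']
    (φ : OpenPartialHomeomorph M M') : Prop :=
  ContMDiffOn 𝓘(ℝ, V) 𝓘(ℝ, V') ∞ φ φ.source ∧
    ContMDiffOn 𝓘(ℝ, V') 𝓘(ℝ, V) ∞ φ.symm φ.target

/-- `φ` carries the field of subspaces `A` to `A'`. -/
def Carries (φ : OpenPartialHomeomorph M M') (A : SubspaceField V M)
    (A' : SubspaceField V' M') : Prop :=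
  ∀ x ∈ φ.source, push V V' φ x (A x) = A' (φ x)

/-- `D` on `M'` is the reduction of `F` on the open set `U ⊆ M` by the line field (or, more
generally, integrable distribution) `L`: the map `p : U → M'` is a surjective submersion whose
fibres are the leaves of `L` (so that `M'` is the leaf space of `L` on `U`), and
`F = (dp)⁻¹(D)`. -/
structure IsReduction (U : Set M) (p : M → M') (L F : SubspaceField V M)
    (D : SubspaceField V' M') : Prop where
  isOpen : IsOpen U
  smooth : ContMDiffOn 𝓘(ℝ, V) 𝓘(ℝ, V') ∞ p U
  submersion : ∀ x ∈ U, Function.Surjective (mfderiv 𝓘(ℝ, V) 𝓘(ℝ, V') p x)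
  ker_eq : ∀ x ∈ U, pull V V' p x ⊥ = L x
  image_eq : p '' U = Set.univ
  fibre : ∀ y : M', IsConnected (U ∩ p ⁻¹' {y})
  pull_eq : ∀ x ∈ U, pull V V' p x (D (p x)) = F x

lemma isDiffeo_refl : IsDiffeo V V (OpenPartialHomeomorph.refl M) :=
  ⟨contMDiffOn_id, contMDiffOn_id⟩

lemma IsDiffeo.symm {φ : OpenPartialHomeomorph M M'} (h : IsDiffeo V V' φ) :
    IsDiffeo V' V φ.symm := ⟨h.2, h.1⟩

lemma IsDiffeo.trans {φ : OpenPartialHomeomorph M M'} {ψ : OpenPartialHomeomorph M' M''}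
    (h : IsDiffeo V V' φ) (h' : IsDiffeo V' V'' ψ) : IsDiffeo V V'' (φ.trans ψ) := by
  constructor
  · rw [OpenPartialHomeomorph.coe_trans, OpenPartialHomeomorph.trans_source]
    exact h'.1.comp (h.1.mono inter_subset_left) (fun x hx => hx.2)
  · rw [OpenPartialHomeomorph.coe_trans_symm, OpenPartialHomeomorph.trans_target]
    exact h.2.comp (h'.2.mono inter_subset_left) (fun x hx => hx.2)

lemma IsDiffeo.mdifferentiableAt {φ : OpenPartialHomeomorph M M'} (h : IsDiffeo V V' φ)
    {x : M} (hx : x ∈ φ.source) : MDifferentiableAt 𝓘(ℝ, V) 𝓘(ℝ, V') φ x :=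
  (h.1.contMDiffAt (φ.open_source.mem_nhds hx)).mdifferentiableAt (by simp)

/-- The map induced by `φ` on points equipped with a tangent subspace: `(x, A) ↦ (φ x, dφ_x(A))`. -/
def pushPt (V V' : Type*) [NormedAddCommGroup V] [NormedSpace ℝ V]
    [NormedAddCommGroup V'] [NormedSpace ℝ V']
    {M : Type*} [TopologicalSpace M] [ChartedSpace V M]
    {M' : Type*} [TopologicalSpace M'] [ChartedSpace V' M']
    (φ : M → M') (p : Σ x : M, Submodule ℝ (TangentSpace 𝓘(ℝ, V) x)) :
    Σ y : M', Submodule ℝ (TangentSpace 𝓘(ℝ, V') y) :=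
  ⟨φ p.1, push V V' φ p.1 p.2⟩

lemma pushPt_comp {φ : M → M'} {ψ : M' → M''}
    {p : Σ x : M, Submodule ℝ (TangentSpace 𝓘(ℝ, V) x)}
    (hφ : MDifferentiableAt 𝓘(ℝ, V) 𝓘(ℝ, V') φ p.1)
    (hψ : MDifferentiableAt 𝓘(ℝ, V') 𝓘(ℝ, V'') ψ (φ p.1)) :
    pushPt V V'' (ψ ∘ φ) p = pushPt V' V'' ψ (pushPt V V' φ p) := by
  unfold pushPt push
  rw [mfderiv_comp p.1 hψ hφ]
  refine Sigma.ext rfl (heq_of_eq ?_)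
  exact Submodule.map_comp _ _ _

lemma pushPt_id (p : Σ x : M, Submodule ℝ (TangentSpace 𝓘(ℝ, V) x)) :
    pushPt V V (id : M → M) p = p := by
  unfold pushPt push
  rw [mfderiv_id]
  exact Sigma.ext rfl (heq_of_eq (Submodule.map_id _))

lemma pushPt_congr {φ ψ : M → M'} {p : Σ x : M, Submodule ℝ (TangentSpace 𝓘(ℝ, V) x)}
    (h : φ =ᶠ[𝓝 p.1] ψ) : pushPt V V' φ p = pushPt V V' ψ p := by
  have h2 : mfderiv 𝓘(ℝ, V) 𝓘(ℝ, V') φ p.1 = mfderiv 𝓘(ℝ, V) 𝓘(ℝ, V') ψ p.1 := h.mfderiv_eq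
  refine Sigma.ext h.eq_of_nhds (heq_of_eq ?_)
  unfold pushPt push
  rw [h2]
  rfl

lemma IsDiffeo.pushPt_symm {φ : OpenPartialHomeomorph M M'} (h : IsDiffeo V V' φ)
    {p : Σ x : M, Submodule ℝ (TangentSpace 𝓘(ℝ, V) x)} (hp : p.1 ∈ φ.source) :
    pushPt V' V φ.symm (pushPt V V' φ p) = p := by
  refine (pushPt_comp (h.mdifferentiableAt hp)
    (h.symm.mdifferentiableAt (φ.map_source hp))).symm.trans ?_
  exact (pushPt_congr (φ := φ.symm ∘ φ) (ψ := id) (φ.eventually_left_inverse hp)).trans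
    (pushPt_id p)

lemma carries_iff {φ : OpenPartialHomeomorph M M'} {A : SubspaceField V M}
    {A' : SubspaceField V' M'} :
    Carries φ A A' ↔ ∀ x ∈ φ.source, pushPt V V' φ ⟨x, A x⟩ = ⟨φ x, A' (φ x)⟩ := by
  refine forall₂_congr fun x _ => ⟨fun h => Sigma.ext rfl (heq_of_eq h), fun h => ?_⟩
  exact eq_of_heq (Sigma.ext_iff.1 h).2

lemma carries_refl (A : SubspaceField V M) : Carries (OpenPartialHomeomorph.refl M) A A :=
  carries_iff.2 fun _ _ => pushPt_id _

lemma Carries.symm {φ : OpenPartialHomeomorph M M'} {A : SubspaceField V M}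
    {A' : SubspaceField V' M'} (h : Carries φ A A') (hφ : IsDiffeo V V' φ) :
    Carries φ.symm A' A := by
  rw [carries_iff] at h ⊢
  intro y hy
  have hx := φ.map_target hy
  have h1 := h _ hx
  rw [φ.right_inv hy] at h1
  rw [← h1]
  exact hφ.pushPt_symm hx

lemma Carries.trans {φ : OpenPartialHomeomorph M M'} {ψ : OpenPartialHomeomorph M' M''}
    {A : SubspaceField V M} {A' : SubspaceField V' M'} {A'' : SubspaceField V'' M''}
    (h : Carries φ A A') (hφ : IsDiffeo V V' φ) (hψ : IsDiffeo V' V'' ψ) (h' : Carries ψ A' A'') :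
    Carries (φ.trans ψ) A A'' := by
  rw [carries_iff] at h h' ⊢
  intro x hx
  rw [OpenPartialHomeomorph.trans_source] at hx
  have h1 := pushPt_comp (p := ⟨x, A x⟩) (hφ.mdifferentiableAt hx.1)
    (hψ.mdifferentiableAt hx.2)
  rw [h x hx.1, h' _ hx.2] at h1
  exact h1

end Maps

/-! ## The projectivization `P(D)` of a rank two distribution -/

section LinearAlgebra

variable {W : Type*} [AddCommGroup W] [Module ℝ W]

/-- `a, b` are linear coordinates on the plane `F`. -/
def Separates (F : Submodule ℝ W) (a b : W →ₗ[ℝ] ℝ) : Prop :=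
  ∀ v ∈ F, a v = 0 → b v = 0 → v = 0

/-- The line of slope `t` in `F` with respect to the coordinates `a, b`. -/
def slopeLine (F : Submodule ℝ W) (a b : W →ₗ[ℝ] ℝ) (t : ℝ) : Submodule ℝ W :=
  F ⊓ LinearMap.ker (b - t • a)

lemma slopeLine_le (F : Submodule ℝ W) (a b : W →ₗ[ℝ] ℝ) (t : ℝ) : slopeLine F a b t ≤ F :=
  inf_le_left

open Classical in
/-- The slope `b / a` of a line. -/
def slope (l : Submodule ℝ W) (a b : W →ₗ[ℝ] ℝ) : ℝ :=
  if h : ∃ t : ℝ, ∀ v ∈ l, b v = t * a v then h.choose else 0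

lemma exists_dual {F : Submodule ℝ W} (hF : Module.finrank ℝ F = 2) {a b : W →ₗ[ℝ] ℝ}
    (h : Separates F a b) (x y : ℝ) : ∃ v ∈ F, a v = x ∧ b v = y := by
  let f : F →ₗ[ℝ] (ℝ × ℝ) := (a.prod b).comp F.subtype
  have : FiniteDimensional ℝ F := Module.finite_of_finrank_pos (by omega)
  have hinj : Function.Injective f := by
    rw [← LinearMap.ker_eq_bot, LinearMap.ker_eq_bot']
    rintro ⟨v, hv⟩ h0
    have h1 : a v = 0 := congrArg Prod.fst h0
    have h2 : b v = 0 := congrArg Prod.snd h0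
    exact Subtype.ext (h v hv h1 h2)
  have hsurj : Function.Surjective f :=
    (LinearMap.injective_iff_surjective_of_finrank_eq_finrank (by simp [hF])).1 hinj
  obtain ⟨⟨v, hv⟩, hvv⟩ := hsurj (x, y)
  exact ⟨v, hv, congrArg Prod.fst hvv, congrArg Prod.snd hvv⟩

lemma slopeLine_eq {F : Submodule ℝ W} {a b : W →ₗ[ℝ] ℝ} (h : Separates F a b) {t : ℝ} {w : W}
    (hw : w ∈ F) (ha : a w = 1) (hb : b w = t) : slopeLine F a b t = Submodule.span ℝ {w} := by
  ext v
  rw [Submodule.mem_span_singleton]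
  constructor
  · rintro ⟨hv, hv'⟩
    have hv' : b v - t * a v = 0 := by simpa using hv'
    refine ⟨a v, ?_⟩
    have := h (v - a v • w) (F.sub_mem hv (F.smul_mem _ hw)) (by simp [ha])
      (by simp [hb]; linarith)
    exact (sub_eq_zero.1 this).symm
  · rintro ⟨c, rfl⟩
    refine ⟨F.smul_mem _ hw, ?_⟩
    simp [ha, hb]

lemma finrank_slopeLine {F : Submodule ℝ W} (hF : Module.finrank ℝ F = 2) {a b : W →ₗ[ℝ] ℝ}
    (h : Separates F a b) (t : ℝ) : Module.finrank ℝ (slopeLine F a b t) = 1 := by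
  obtain ⟨w, hw, ha, hb⟩ := exists_dual hF h 1 t
  rw [slopeLine_eq h hw ha hb]
  apply finrank_span_singleton
  rintro rfl
  simp at ha

lemma slope_spec {l : Submodule ℝ W} (hl : Module.finrank ℝ l = 1) {a : W →ₗ[ℝ] ℝ}
    (b : W →ₗ[ℝ] ℝ) (h : ∀ v ∈ l, a v = 0 → v = 0) : ∀ v ∈ l, b v = slope l a b * a v := by
  have hex : ∃ t : ℝ, ∀ v ∈ l, b v = t * a v := by
    obtain ⟨⟨w, hw⟩, hw0, hspan⟩ := finrank_eq_one_iff'.1 hl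
    have haw : a w ≠ 0 := fun h0 => hw0 (Subtype.ext (h w hw h0))
    refine ⟨b w / a w, fun v hv => ?_⟩
    obtain ⟨c, hc⟩ := hspan ⟨v, hv⟩
    have hc : c • w = v := congrArg Subtype.val hc
    rw [← hc]
    simp
    field_simp
  unfold slope
  rw [dif_pos hex]
  exact hex.choose_spec

lemma slope_eq {l : Submodule ℝ W} (hl : Module.finrank ℝ l = 1) {a b : W →ₗ[ℝ] ℝ} {w : W}
    (h : ∀ v ∈ l, a v = 0 → v = 0) (hw : w ∈ l) (hw0 : a w ≠ 0) : slope l a b = b w / a w := by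
  have := slope_spec hl b h w hw
  field_simp
  linarith

end LinearAlgebra

section Prolongation

variable {V : Type*} [NormedAddCommGroup V] [NormedSpace ℝ V]
variable {Y : Type*} [TopologicalSpace Y] [ChartedSpace V Y] [IsManifold 𝓘(ℝ, V) ∞ Y]
variable {D : SubspaceField V Y}

/-- `P(D) = {(y, ℓ) : ℓ ⊆ D_y, dim ℓ = 1}`, for a distribution `D` of rank two. -/
@[ext]
structure ProjSpace (hD : IsDistribution 2 D) where
  base : Y
  line : Submodule ℝ (TangentSpace 𝓘(ℝ, V) base)
  finrank_line : Module.finrank ℝ line = 1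
  line_le : line ≤ D base

lemma IsDistribution.finrank {r : ℕ} {A : SubspaceField V Y} (hA : IsDistribution r A) (y : Y) :
    Module.finrank ℝ (A y) = r := by
  obtain ⟨U, -, hyU, s, -, hs⟩ := hA y
  rw [(hs y hyU).2, finrank_span_eq_card (hs y hyU).1, Fintype.card_fin]

/-- The expression `α(v)` of a linear form `α` on the model space at a tangent vector `v ∈ T_y Y`,
in the preferred chart at `y₀`. -/
def formAt (y₀ : Y) (α : V →L[ℝ] ℝ) (y : Y) : TangentSpace 𝓘(ℝ, V) y →ₗ[ℝ] ℝ :=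
  α.toLinearMap ∘ₗ ((trivializationAt V (TangentSpace 𝓘(ℝ, V)) y₀).linearMapAt ℝ y)

open Classical in
/-- The point `(y, ℓ)` of `P(D)` with `ℓ = {v ∈ D_y : β(v) = t α(v)}`, if `α, β` are linear
coordinates on `D_y` (and the point `z₀` otherwise). -/
def pointOfSlope (hD : IsDistribution 2 D) (z₀ : ProjSpace hD) (α β : V →L[ℝ] ℝ) (y : Y) (t : ℝ) :
    ProjSpace hD :=
  if h : Separates (D y) (formAt z₀.base α y) (formAt z₀.base β y) then
    { base := y
      line := slopeLine (D y) (formAt z₀.base α y) (formAt z₀.base β y) t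
      finrank_line := finrank_slopeLine (hD.finrank y) h t
      line_le := slopeLine_le _ _ _ _ }
  else z₀

/-- The chart `(y, ℓ) ↦ (y, β(v)/α(v))`, `0 ≠ v ∈ ℓ`, of `P(D)`, in the preferred chart of `Y` at
the base point of `z₀`.  It is defined where `α, β` are linear coordinates on `D_y` and `α` does
not vanish on `ℓ`. -/
def projChart (hD : IsDistribution 2 D) (z₀ : ProjSpace hD) (α β : V →L[ℝ] ℝ) :
    PartialEquiv (ProjSpace hD) (V × ℝ) where
  toFun z := (chartAt V z₀.base z.base,
    slope z.line (formAt z₀.base α z.base) (formAt z₀.base β z.base))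
  invFun q := pointOfSlope hD z₀ α β ((chartAt V z₀.base).symm q.1) q.2
  source := {z | z.base ∈ (chartAt V z₀.base).source ∧
    Separates (D z.base) (formAt z₀.base α z.base) (formAt z₀.base β z.base) ∧
    ∀ v ∈ z.line, formAt z₀.base α z.base v = 0 → v = 0}
  target := {q | q.1 ∈ (chartAt V z₀.base).target ∧
    Separates (D ((chartAt V z₀.base).symm q.1))
      (formAt z₀.base α ((chartAt V z₀.base).symm q.1))
      (formAt z₀.base β ((chartAt V z₀.base).symm q.1))}
  map_source' z hz := by
    refine ⟨(chartAt V z₀.base).map_source hz.1, ?_⟩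
    simp only
    rw [(chartAt V z₀.base).left_inv hz.1]
    exact hz.2.1
  map_target' q hq := by
    rw [pointOfSlope, dif_pos hq.2]
    refine ⟨(chartAt V z₀.base).map_target hq.1, hq.2, ?_⟩
    rintro v ⟨hv, hv'⟩ h0
    refine hq.2 v hv h0 ?_
    have : formAt z₀.base β _ v - q.2 * formAt z₀.base α _ v = 0 := by simpa using hv'
    rw [h0] at this
    linarith
  left_inv' z hz := by
    obtain ⟨y, l, hl, hle⟩ := z
    obtain ⟨h1, h2, h3⟩ := hz
    simp only at h1 h2 h3 ⊢
    rw [(chartAt V z₀.base).left_inv h1, pointOfSlope, dif_pos h2]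
    have key : l = slopeLine (D y) (formAt z₀.base α y) (formAt z₀.base β y)
        (slope l (formAt z₀.base α y) (formAt z₀.base β y)) := by
      have hfin := finrank_slopeLine (hD.finrank y) h2
        (slope l (formAt z₀.base α y) (formAt z₀.base β y))
      have : FiniteDimensional ℝ (slopeLine (D y) (formAt z₀.base α y) (formAt z₀.base β y)
        (slope l (formAt z₀.base α y) (formAt z₀.base β y))) :=
        Module.finite_of_finrank_pos (by omega)
      refine Submodule.eq_of_le_of_finrank_eq (fun v hv => ⟨hle hv, ?_⟩) (by rw [hl, hfin])
      have := slope_spec hl (formAt z₀.base β y) h3 v hv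
      simp [this]
    congr 1
    exact key.symm
  right_inv' q hq := by
    rw [pointOfSlope, dif_pos hq.2]
    refine Prod.ext ((chartAt V z₀.base).right_inv hq.1) ?_
    simp only
    obtain ⟨w, hw, ha, hb⟩ := exists_dual (hD.finrank _) hq.2 1 q.2
    rw [slope_eq (w := w) (finrank_slopeLine (hD.finrank _) hq.2 _), ha, hb, div_one]
    · rw [slopeLine_eq hq.2 hw ha hb]
      intro v hv h0
      obtain ⟨c, rfl⟩ := Submodule.mem_span_singleton.1 hv
      have : c = 0 := by simpa [ha] using h0
      simp [this]
    · rw [slopeLine_eq hq.2 hw ha hb]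
      exact Submodule.mem_span_singleton_self w
    · simp [ha]

lemma separates_span_iff {W : Type*} [AddCommGroup W] [Module ℝ W] {s : Fin 2 → W}
    (hs : LinearIndependent ℝ s) (a b : W →ₗ[ℝ] ℝ) :
    Separates (Submodule.span ℝ (Set.range s)) a b ↔ a (s 0) * b (s 1) - a (s 1) * b (s 0) ≠ 0 := by
  have hspan : ∀ v, v ∈ Submodule.span ℝ (Set.range s) ↔
      ∃ c d : ℝ, v = c • s 0 + d • s 1 := by
    intro v
    rw [Submodule.mem_span_range_iff_exists_fun]
    constructor
    · rintro ⟨c, rfl⟩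
      exact ⟨c 0, c 1, by simp [Fin.sum_univ_two]⟩
    · rintro ⟨c, d, rfl⟩
      exact ⟨![c, d], by simp [Fin.sum_univ_two]⟩
  have hli : ∀ c d : ℝ, c • s 0 + d • s 1 = 0 → c = 0 ∧ d = 0 := by
    intro c d h
    have := Fintype.linearIndependent_iff.1 hs ![c, d] (by simpa [Fin.sum_univ_two] using h)
    exact ⟨this 0, this 1⟩
  constructor
  · intro h hdet
    have h1 := hli _ _ (h (a (s 1) • s 0 + (-a (s 0)) • s 1) ((hspan _).2 ⟨_, _, rfl⟩)
      (by simp; ring) (by simp; linarith))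
    have h2 := hli _ _ (h (b (s 1) • s 0 + (-b (s 0)) • s 1) ((hspan _).2 ⟨_, _, rfl⟩)
      (by simp; linarith) (by simp; ring))
    have h3 := hli 1 0 (by
      simpa using h (s 0) ((hspan _).2 ⟨1, 0, by simp⟩) (by linarith [h1.2]) (by linarith [h2.2]))
    simp at h3
  · rintro hdet v hv ha hb
    obtain ⟨c, d, rfl⟩ := (hspan v).1 hv
    simp only [map_add, map_smul, smul_eq_mul] at ha hb
    have hc : (a (s 0) * b (s 1) - a (s 1) * b (s 0)) * c = 0 := by
      linear_combination b (s 1) * ha - a (s 1) * hb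
    have hd : (a (s 0) * b (s 1) - a (s 1) * b (s 0)) * d = 0 := by
      linear_combination a (s 0) * hb - b (s 0) * ha
    have hc := (mul_eq_zero.1 hc).resolve_left hdet
    have hd := (mul_eq_zero.1 hd).resolve_left hdet
    simp [hc, hd]

lemma contMDiffOn_formAt {U : Set Y} (hU : IsOpen U) {X : VField V Y} (hX : IsSectionOn D U X)
    (y₀ : Y) (α : V →L[ℝ] ℝ) :
    ContMDiffOn 𝓘(ℝ, V) 𝓘(ℝ, ℝ) ∞ (fun y => formAt y₀ α y (X y))
      (U ∩ (chartAt V y₀).source) := by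
  have hb : (trivializationAt V (TangentSpace 𝓘(ℝ, V)) y₀).baseSet = (chartAt V y₀).source := rfl
  have h := ((trivializationAt V (TangentSpace 𝓘(ℝ, V)) y₀).contMDiffOn_section_iff
    (IB := 𝓘(ℝ, V)) (n := ∞) (s := X) (a := U ∩ (chartAt V y₀).source)
    (hU.inter (chartAt V y₀).open_source) (hb ▸ inter_subset_right)).1
    (hX.1.mono inter_subset_left)
  have h2 := (α.contDiff (n := ∞)).contMDiff.comp_contMDiffOn h
  refine h2.congr fun y hy => ?_
  simp only [formAt, LinearMap.comp_apply, Function.comp_apply]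
  rw [Trivialization.coe_linearMapAt_of_mem _ (hb ▸ hy.2)]
  rfl

lemma mem_projChart_source (hD : IsDistribution 2 D) (z : ProjSpace hD) :
    ∃ α β : V →L[ℝ] ℝ, z ∈ (projChart hD z α β).source := by
  obtain ⟨y, l, hl, hle⟩ := z
  have hF := hD.finrank y
  have : FiniteDimensional ℝ (D y) := Module.finite_of_finrank_pos (by omega)
  have hb : y ∈ (trivializationAt V (TangentSpace 𝓘(ℝ, V)) y).baseSet :=
    mem_chart_source V y
  set A := (trivializationAt V (TangentSpace 𝓘(ℝ, V)) y).linearMapAt ℝ y with hA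
  have hinj : ∀ v, A v = 0 → v = 0 := by
    intro v hv
    have := (trivializationAt V (TangentSpace 𝓘(ℝ, V)) y).symmₗ_linearMapAt (R := ℝ) hb v
    rw [← this, ← hA, hv, map_zero]
  obtain ⟨⟨w, hw⟩, hw0, hspan⟩ := finrank_eq_one_iff'.1 hl
  have hw0 : w ≠ 0 := fun h => hw0 (Subtype.ext h)
  obtain ⟨α, hα⟩ := SeparatingDual.exists_eq_one (R := ℝ) (x := A w) (fun h => hw0 (hinj _ h))
  -- a vector of the plane outside the line, normalised by `α = 0`
  have hlt : ∃ u ∈ D y, u ∉ l := by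
    by_contra! h
    have := le_antisymm hle h
    rw [this, hF] at hl
    omega
  obtain ⟨u, hu, hul⟩ := hlt
  have hu' : u - α (A u) • w ∉ l := fun h => hul (by
    have := l.add_mem h (l.smul_mem (α (A u)) hw)
    simpa using this)
  have hu0 : A (u - α (A u) • w) ≠ 0 := fun h => hu' (by rw [hinj _ h]; exact l.zero_mem)
  obtain ⟨β, hβ⟩ := SeparatingDual.exists_eq_one (R := ℝ) hu0
  have hαu : α (A (u - α (A u) • w)) = 0 := by simp [hα]
  set u' := u - α (A u) • w with hu'def
  have hu'F : u' ∈ D y := (D y).sub_mem hu ((D y).smul_mem _ (hle hw))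
  have hwF := hle hw
  have hli : LinearIndependent ℝ ![w, u'] := by
    rw [LinearIndependent.pair_iff]
    intro c d h
    have h1 : c = 0 := by
      have := congrArg (fun v => α (A v)) h
      simpa [hα, hαu] using this
    subst h1
    refine ⟨rfl, ?_⟩
    have := congrArg (fun v => β (A v)) h
    simpa [hβ] using this
  have hFs : D y = Submodule.span ℝ (Set.range ![w, u']) := by
    symm
    apply Submodule.eq_of_le_of_finrank_eq
    · rw [Submodule.span_le]
      rintro _ ⟨i, rfl⟩
      fin_cases i
      · exact hwF
      · exact hu'F
    · rw [finrank_span_eq_card hli, hF, Fintype.card_fin]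
  refine ⟨α, β, mem_chart_source V y, ?_, ?_⟩
  · simp only
    rw [hFs, separates_span_iff hli]
    change α (A w) * β (A u') - α (A u') * β (A w) ≠ 0
    rw [hα, hβ, hαu]
    simp
  · intro v hv h0
    obtain ⟨c, hc⟩ := hspan ⟨v, hv⟩
    have hc : c • w = v := congrArg Subtype.val hc
    have h0 : α (A v) = 0 := h0
    rw [← hc] at h0 ⊢
    have : c = 0 := by simpa [hα] using h0
    simp [this]

/-- The changes of charts are smooth, with open domains. -/
lemma projChart_transition (hD : IsDistribution 2 D) (z₀ z₁ : ProjSpace hD)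
    (α β α' β' : V →L[ℝ] ℝ) (q₀ : V × ℝ)
    (hq₀ : q₀ ∈ ((projChart hD z₀ α β).symm.trans (projChart hD z₁ α' β')).source) :
    ∃ N : Set (V × ℝ), IsOpen N ∧ q₀ ∈ N ∧
      N ⊆ ((projChart hD z₀ α β).symm.trans (projChart hD z₁ α' β')).source ∧
      ContDiffOn ℝ ∞ ((projChart hD z₀ α β).symm.trans (projChart hD z₁ α' β')) N := by
  set φ := chartAt V z₀.base with hφ
  set ψ := chartAt V z₁.base with hψ
  obtain ⟨U, hU, hyU, s, hs, hsF⟩ := hD (φ.symm q₀.1)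
  -- coefficients of the four forms on the frame
  let c : Y → (V →L[ℝ] ℝ) → Fin 2 → V × ℝ → ℝ := fun y₀ γ i q =>
    formAt y₀ γ (φ.symm q.1) (s i (φ.symm q.1))
  let det : V × ℝ → ℝ := fun q =>
    c z₀.base α 0 q * c z₀.base β 1 q - c z₀.base α 1 q * c z₀.base β 0 q
  let det' : V × ℝ → ℝ := fun q =>
    c z₁.base α' 0 q * c z₁.base β' 1 q - c z₁.base α' 1 q * c z₁.base β' 0 q
  let p : V × ℝ → ℝ := fun q => c z₀.base β 1 q - q.2 * c z₀.base α 1 q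
  let r : V × ℝ → ℝ := fun q => q.2 * c z₀.base α 0 q - c z₀.base β 0 q
  let den : V × ℝ → ℝ := fun q => p q * c z₁.base α' 0 q + r q * c z₁.base α' 1 q
  let num : V × ℝ → ℝ := fun q => p q * c z₁.base β' 0 q + r q * c z₁.base β' 1 q
  let N₁ : Set (V × ℝ) := (φ.target ∩ φ.symm ⁻¹' (U ∩ ψ.source)) ×ˢ univ
  have hN₁ : IsOpen N₁ := (φ.isOpen_inter_preimage_symm (hU.inter ψ.open_source)).prod isOpen_univ
  have hsep : ∀ q ∈ N₁, Separates (D (φ.symm q.1)) (formAt z₀.base α (φ.symm q.1))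
      (formAt z₀.base β (φ.symm q.1)) ↔ det q ≠ 0 := by
    intro q hq
    rw [(hsF _ hq.1.2.1).2, separates_span_iff (hsF _ hq.1.2.1).1]
  have hsep' : ∀ q ∈ N₁, Separates (D (φ.symm q.1)) (formAt z₁.base α' (φ.symm q.1))
      (formAt z₁.base β' (φ.symm q.1)) ↔ det' q ≠ 0 := by
    intro q hq
    rw [(hsF _ hq.1.2.1).2, separates_span_iff (hsF _ hq.1.2.1).1]
  -- the line of slope `q.2`
  have hline : ∀ q ∈ N₁, det q ≠ 0 → ∃ w : TangentSpace 𝓘(ℝ, V) (φ.symm q.1), w ∈ D (φ.symm q.1) ∧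
      slopeLine (D (φ.symm q.1)) (formAt z₀.base α (φ.symm q.1))
        (formAt z₀.base β (φ.symm q.1)) q.2 = Submodule.span ℝ {w} ∧
      formAt z₁.base α' (φ.symm q.1) w = den q / det q ∧
      formAt z₁.base β' (φ.symm q.1) w = num q / det q := by
    intro q hq hdet
    have hmem : ∀ i, s i (φ.symm q.1) ∈ D (φ.symm q.1) := fun i => (hs i).2 _ hq.1.2.1
    refine ⟨(p q / det q) • s 0 (φ.symm q.1) + (r q / det q) • s 1 (φ.symm q.1),
      (D _).add_mem ((D _).smul_mem _ (hmem 0)) ((D _).smul_mem _ (hmem 1)), ?_, ?_, ?_⟩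
    · refine slopeLine_eq ((hsep q hq).2 hdet)
        ((D _).add_mem ((D _).smul_mem _ (hmem 0)) ((D _).smul_mem _ (hmem 1))) ?_ ?_
      · rw [map_add, map_smul, map_smul]
        change p q / det q * c z₀.base α 0 q + r q / det q * c z₀.base α 1 q = 1
        field_simp
        simp only [p, r, det]
        ring
      · rw [map_add, map_smul, map_smul]
        change p q / det q * c z₀.base β 0 q + r q / det q * c z₀.base β 1 q = q.2
        field_simp
        simp only [p, r, det]
        ring
    · rw [map_add, map_smul, map_smul]
      change p q / det q * c z₁.base α' 0 q + r q / det q * c z₁.base α' 1 q = _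
      simp only [den]
      ring
    · rw [map_add, map_smul, map_smul]
      change p q / det q * c z₁.base β' 0 q + r q / det q * c z₁.base β' 1 q = _
      simp only [num]
      ring
  have hpt : ∀ q ∈ N₁, det q ≠ 0 →
      (projChart hD z₀ α β).symm q = pointOfSlope hD z₀ α β (φ.symm q.1) q.2 := fun _ _ _ => rfl
  -- nonvanishing of the coordinate on the line
  have hnv : ∀ q ∈ N₁, ∀ w : TangentSpace 𝓘(ℝ, V) (φ.symm q.1), det q ≠ 0 →
      formAt z₁.base α' (φ.symm q.1) w = den q / det q →
      ((∀ v ∈ Submodule.span ℝ {w}, formAt z₁.base α' (φ.symm q.1) v = 0 → v = 0) ↔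
        (w = 0 ∨ den q ≠ 0)) := by
    intro q hq w hdet hw
    constructor
    · intro h
      by_contra! h'
      exact h'.1 (h w (Submodule.mem_span_singleton_self w) (by rw [hw, h'.2, zero_div]))
    · rintro h v hv h0
      obtain ⟨k, rfl⟩ := Submodule.mem_span_singleton.1 hv
      rcases h with h | h
      · simp [h]
      · rw [map_smul, hw, smul_eq_mul] at h0
        have := (mul_eq_zero.1 h0).resolve_right (div_ne_zero h hdet)
        simp [this]
  -- membership
  have hmem : ∀ q ∈ N₁, q ∈ ((projChart hD z₀ α β).symm.trans (projChart hD z₁ α' β')).source ↔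
      det q ≠ 0 ∧ det' q ≠ 0 ∧ den q ≠ 0 := by
    intro q hq
    rw [PartialEquiv.trans_source]
    constructor
    · rintro ⟨⟨-, h1⟩, h2⟩
      have hdet := (hsep q hq).1 h1
      have h2 : (projChart hD z₀ α β).symm q ∈ (projChart hD z₁ α' β').source := h2
      rw [hpt q hq hdet, pointOfSlope, dif_pos h1] at h2
      refine ⟨hdet, (hsep' q hq).1 h2.2.1, ?_⟩
      obtain ⟨w, -, hw, hw1, hw2⟩ := hline q hq hdet
      have h3 : ∀ v ∈ Submodule.span ℝ {w}, formAt z₁.base α' (φ.symm q.1) v = 0 → v = 0 :=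
        fun v hv => h2.2.2 v ((Submodule.ext_iff.1 hw v).2 hv)
      rcases (hnv q hq w hdet hw1).1 h3 with h4 | h4
      · have := finrank_slopeLine (hD.finrank (φ.symm q.1)) h1 q.2
        rw [hw, h4, Submodule.span_zero_singleton, finrank_bot] at this
        omega
      · exact h4
    · rintro ⟨hdet, hdet', hden⟩
      have h1 := (hsep q hq).2 hdet
      refine ⟨⟨hq.1.1, h1⟩, ?_⟩
      change (projChart hD z₀ α β).symm q ∈ (projChart hD z₁ α' β').source
      rw [hpt q hq hdet, pointOfSlope, dif_pos h1]
      refine ⟨hq.1.2.2, (hsep' q hq).2 hdet', ?_⟩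
      obtain ⟨w, -, hw, hw1, hw2⟩ := hline q hq hdet
      exact fun v hv =>
        (hnv q hq w hdet hw1).2 (Or.inr hden) v ((Submodule.ext_iff.1 hw v).1 hv)
  have hval : ∀ q ∈ N₁, det q ≠ 0 → det' q ≠ 0 → den q ≠ 0 →
      ((projChart hD z₀ α β).symm.trans (projChart hD z₁ α' β')) q =
        (ψ (φ.symm q.1), num q / den q) := by
    intro q hq hdet hdet' hden
    have h1 := (hsep q hq).2 hdet
    change projChart hD z₁ α' β' ((projChart hD z₀ α β).symm q) = _
    rw [hpt q hq hdet, pointOfSlope, dif_pos h1]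
    refine Prod.ext rfl ?_
    change slope (slopeLine (D (φ.symm q.1)) _ _ q.2) (formAt z₁.base α' (φ.symm q.1))
      (formAt z₁.base β' (φ.symm q.1)) = _
    obtain ⟨w, hwF, hw, hw1, hw2⟩ := hline q hq hdet
    have hfin := finrank_slopeLine (hD.finrank (φ.symm q.1)) h1 q.2
    rw [hw] at hfin ⊢
    rw [slope_eq hfin ((hnv q hq w hdet hw1).2 (Or.inr hden))
      (Submodule.mem_span_singleton_self w) (by rw [hw1]; exact div_ne_zero hden hdet), hw1, hw2]
    field_simp
  -- smoothness of the coefficients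
  have hφN : ContMDiffOn 𝓘(ℝ, V × ℝ) 𝓘(ℝ, V) ∞ (fun q : V × ℝ => φ.symm q.1) N₁ :=
    (contMDiffOn_chart_symm (I := 𝓘(ℝ, V)) (n := ∞) (x := z₀.base)).comp
      (contDiff_fst.contMDiff.contMDiffOn) (fun q hq => hq.1.1)
  have hc₀ : ∀ γ i, ContDiffOn ℝ ∞ (c z₀.base γ i) N₁ := fun γ i =>
    ((contMDiffOn_formAt hU (hs i) z₀.base γ).comp hφN
      (fun q hq => ⟨hq.1.2.1, φ.map_target hq.1.1⟩)).contDiffOn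
  have hc₁ : ∀ γ i, ContDiffOn ℝ ∞ (c z₁.base γ i) N₁ := fun γ i =>
    ((contMDiffOn_formAt hU (hs i) z₁.base γ).comp hφN
      (fun q hq => ⟨hq.1.2.1, hq.1.2.2⟩)).contDiffOn
  have hsnd : ContDiffOn ℝ ∞ (fun q : V × ℝ => q.2) N₁ := contDiff_snd.contDiffOn
  have hp : ContDiffOn ℝ ∞ p N₁ := (hc₀ β 1).sub (hsnd.mul (hc₀ α 1))
  have hr : ContDiffOn ℝ ∞ r N₁ := (hsnd.mul (hc₀ α 0)).sub (hc₀ β 0)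
  have hden : ContDiffOn ℝ ∞ den N₁ := (hp.mul (hc₁ α' 0)).add (hr.mul (hc₁ α' 1))
  have hnum : ContDiffOn ℝ ∞ num N₁ := (hp.mul (hc₁ β' 0)).add (hr.mul (hc₁ β' 1))
  have hdet : ContDiffOn ℝ ∞ det N₁ :=
    ((hc₀ α 0).mul (hc₀ β 1)).sub ((hc₀ α 1).mul (hc₀ β 0))
  have hdet' : ContDiffOn ℝ ∞ det' N₁ :=
    ((hc₁ α' 0).mul (hc₁ β' 1)).sub ((hc₁ α' 1).mul (hc₁ β' 0))
  have hψN : ContDiffOn ℝ ∞ (fun q : V × ℝ => ψ (φ.symm q.1)) N₁ :=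
    ((contMDiffOn_chart (I := 𝓘(ℝ, V)) (n := ∞) (x := z₁.base)).comp hφN
      (fun q hq => hq.1.2.2)).contDiffOn
  have hq₀N : q₀ ∈ N₁ := by
    rw [PartialEquiv.trans_source] at hq₀
    obtain ⟨⟨h0, h1⟩, h2⟩ := hq₀
    have h2 : pointOfSlope hD z₀ α β (φ.symm q₀.1) q₀.2 ∈ (projChart hD z₁ α' β').source := h2
    rw [pointOfSlope, dif_pos h1] at h2
    exact ⟨⟨h0, hyU, h2.1⟩, trivial⟩
  have hopen : ∀ {f : V × ℝ → ℝ} {S : Set (V × ℝ)}, IsOpen S → S ⊆ N₁ → ContDiffOn ℝ ∞ f N₁ →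
      IsOpen (S ∩ {q | f q ≠ 0}) := fun hS hSN hf =>
    (hf.continuousOn.mono hSN).isOpen_inter_preimage hS isOpen_ne
  have hO₁ := hopen hN₁ subset_rfl hdet
  have hO₂ := hopen hO₁ inter_subset_left hdet'
  have hO₃ := hopen hO₂ (inter_subset_left.trans inter_subset_left) hden
  refine ⟨_, hO₃, ?_, ?_, ?_⟩
  · obtain ⟨h1, h2, h3⟩ := (hmem q₀ hq₀N).1 hq₀
    exact ⟨⟨⟨hq₀N, h1⟩, h2⟩, h3⟩
  · rintro q ⟨⟨⟨hq, h1⟩, h2⟩, h3⟩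
    exact (hmem q hq).2 ⟨h1, h2, h3⟩
  · have hsub : N₁ ∩ {q | det q ≠ 0} ∩ {q | det' q ≠ 0} ∩ {q | den q ≠ 0} ⊆ N₁ :=
      fun q hq => hq.1.1.1
    refine ContDiffOn.congr (f := fun q => (ψ (φ.symm q.1), num q / den q)) ?_ ?_
    · exact (hψN.mono hsub).prodMk ((hnum.mono hsub).div (hden.mono hsub) fun q hq => hq.2)
    · rintro q ⟨⟨⟨hq, h1⟩, h2⟩, h3⟩
      exact hval q hq h1 h2 h3

/-- The smooth atlas of `P(D)`. -/
def projCore (hD : IsDistribution 2 D) : ChartedSpaceCore (V × ℝ) (ProjSpace hD) where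
  atlas := {e | ∃ z₀ α β, e = projChart hD z₀ α β}
  chartAt z := projChart hD z (mem_projChart_source hD z).choose
    (mem_projChart_source hD z).choose_spec.choose
  mem_chart_source z := (mem_projChart_source hD z).choose_spec.choose_spec
  chart_mem_atlas _ := ⟨_, _, _, rfl⟩
  open_source := by
    rintro _ _ ⟨z₀, α, β, rfl⟩ ⟨z₁, α', β', rfl⟩
    rw [isOpen_iff_forall_mem_open]
    intro q hq
    obtain ⟨N, hN, hqN, hNs, -⟩ := projChart_transition hD z₀ z₁ α β α' β' q hq
    exact ⟨N, hNs, hN, hqN⟩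
  continuousOn_toFun := by
    rintro _ _ ⟨z₀, α, β, rfl⟩ ⟨z₁, α', β', rfl⟩ q hq
    obtain ⟨N, hN, hqN, hNs, hc⟩ := projChart_transition hD z₀ z₁ α β α' β' q hq
    exact (hc.continuousOn.continuousAt (hN.mem_nhds hqN)).continuousWithinAt

instance (hD : IsDistribution 2 D) : TopologicalSpace (ProjSpace hD) :=
  (projCore hD).toTopologicalSpace

instance (hD : IsDistribution 2 D) : ChartedSpace (V × ℝ) (ProjSpace hD) :=
  (projCore hD).toChartedSpace

instance (hD : IsDistribution 2 D) : IsManifold 𝓘(ℝ, V × ℝ) ∞ (ProjSpace hD) := by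
  apply isManifold_of_contDiffOn
  intro e e' he he'
  change e ∈ ⋃ (f : PartialEquiv (ProjSpace hD) (V × ℝ)) (hf : f ∈ (projCore hD).atlas),
    {(projCore hD).openPartialHomeomorph f hf} at he
  change e' ∈ ⋃ (f : PartialEquiv (ProjSpace hD) (V × ℝ)) (hf : f ∈ (projCore hD).atlas),
    {(projCore hD).openPartialHomeomorph f hf} at he'
  simp only [mem_iUnion, mem_singleton_iff] at he he'
  obtain ⟨_, ⟨z₀, α, β, rfl⟩, rfl⟩ := he
  obtain ⟨_, ⟨z₁, α', β', rfl⟩, rfl⟩ := he'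
  rintro q ⟨hq, -⟩
  obtain ⟨N, hN, hqN, hNs, hc⟩ := projChart_transition hD z₀ z₁ α β α' β' q hq
  exact (hc.contDiffAt (hN.mem_nhds hqN)).contDiffWithinAt

/-- The point `(y, ℓ)` of `P(D)` as a point of `Y` with a tangent subspace at this point. -/
def ProjSpace.toSigma {hD : IsDistribution 2 D} (z : ProjSpace hD) :
    Σ y : Y, Submodule ℝ (TangentSpace 𝓘(ℝ, V) y) := ⟨z.base, z.line⟩

/-- The vertical distribution `L = Ker(π_*)` of the projection `π : P(D) → Y`. -/
def vertical (hD : IsDistribution 2 D) : SubspaceField (V × ℝ) (ProjSpace hD) :=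
  fun z => pull (V × ℝ) V (ProjSpace.base (hD := hD)) z ⊥

/-- The Cartan prolongation `E_{(y, ℓ)} = π_*⁻¹(ℓ)` of `D`. -/
def cartanProlongation (hD : IsDistribution 2 D) : SubspaceField (V × ℝ) (ProjSpace hD) :=
  fun z => pull (V × ℝ) V (ProjSpace.base (hD := hD)) z z.line

/-- `K` is a complement of `L = Ker(π_*)` in the Cartan prolongation `E` of `D`, such that
`E = K ⊕ L` is a pseudo-product structure of `G₂`-type. -/
def IsG2Splitting (hD : IsDistribution 2 D) (K : SubspaceField (V × ℝ) (ProjSpace hD)) : Prop :=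
  IsPseudoProductG2 K (vertical hD) ∧ sumField K (vertical hD) = cartanProlongation hD

end Prolongation

/-! ## Local isomorphism classes -/

/-- The model `ℝ⁵` of `5`-dimensional manifolds; `6`-dimensional manifolds are modelled
on `ℝ⁵ × ℝ`. -/
abbrev R5 : Type := EuclideanSpace ℝ (Fin 5)

/-- A `(2,3,5)`-distribution `D` on a `5`-dimensional manifold `Y`, with a base point `y` and a
direction `ℓ ⊆ D_y`. -/
structure DirectedGerm235 : Type (u + 1) where
  Y : Type u
  [top : TopologicalSpace Y]
  [charted : ChartedSpace R5 Y]
  [manifold : IsManifold 𝓘(ℝ, R5) ∞ Y]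
  D : SubspaceField R5 Y
  is235 : Is235 D
  point : ProjSpace is235.isDistribution

attribute [instance] DirectedGerm235.top DirectedGerm235.charted DirectedGerm235.manifold

/-- A pseudo-product structure of `G₂`-type on a `6`-dimensional manifold, with a base point. -/
structure PseudoProductGerm : Type (u + 1) where
  Z : Type u
  [top : TopologicalSpace Z]
  [charted : ChartedSpace (R5 × ℝ) Z]
  [manifold : IsManifold 𝓘(ℝ, R5 × ℝ) ∞ Z]
  K : SubspaceField (R5 × ℝ) Z
  L : SubspaceField (R5 × ℝ) Z
  isG2 : IsPseudoProductG2 K L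
  point : Z

attribute [instance] PseudoProductGerm.top PseudoProductGerm.charted PseudoProductGerm.manifold

/-- Local isomorphism: a diffeomorphism between neighbourhoods of the base points which carries
one distribution to the other, and the one direction to the other. -/
def DirectedGerm235.Iso (G G' : DirectedGerm235.{u}) : Prop :=
  ∃ φ : OpenPartialHomeomorph G.Y G'.Y, IsDiffeo R5 R5 φ ∧ G.point.base ∈ φ.source ∧
    Carries φ G.D G'.D ∧ pushPt R5 R5 φ G.point.toSigma = G'.point.toSigma

/-- Local isomorphism: a diffeomorphism between neighbourhoods of the base points which carries
one decomposition to the other. -/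
def PseudoProductGerm.Iso (H H' : PseudoProductGerm.{u}) : Prop :=
  ∃ φ : OpenPartialHomeomorph H.Z H'.Z, IsDiffeo (R5 × ℝ) (R5 × ℝ) φ ∧ H.point ∈ φ.source ∧
    φ H.point = H'.point ∧ Carries φ H.K H'.K ∧ Carries φ H.L H'.L

instance DirectedGerm235.setoid : Setoid DirectedGerm235.{u} where
  r := DirectedGerm235.Iso
  iseqv :=
    { refl := fun G => ⟨OpenPartialHomeomorph.refl _, isDiffeo_refl, mem_univ _, carries_refl _,
        pushPt_id _⟩
      symm := by
        rintro G G' ⟨φ, hφ, hx, hD, hl⟩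
        have hb : φ G.point.base = G'.point.base := congrArg Sigma.fst hl
        refine ⟨φ.symm, hφ.symm, ?_, hD.symm hφ, ?_⟩
        · rw [← hb]
          exact φ.map_source hx
        · rw [← hl]
          exact hφ.pushPt_symm hx
      trans := by
        rintro G G' G'' ⟨φ, hφ, hx, hD, hl⟩ ⟨ψ, hψ, hx', hD', hl'⟩
        have hb : φ G.point.base = G'.point.base := congrArg Sigma.fst hl
        have hx'' : φ G.point.base ∈ ψ.source := by rw [hb]; exact hx'
        refine ⟨φ.trans ψ, hφ.trans hψ, ?_, hD.trans hφ hψ hD', ?_⟩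
        · rw [OpenPartialHomeomorph.trans_source]
          exact ⟨hx, hx''⟩
        · rw [← hl', ← hl]
          exact pushPt_comp (hφ.mdifferentiableAt hx) (hψ.mdifferentiableAt hx'') }

instance PseudoProductGerm.setoid : Setoid PseudoProductGerm.{u} where
  r := PseudoProductGerm.Iso
  iseqv :=
    { refl := fun H => ⟨OpenPartialHomeomorph.refl _, isDiffeo_refl, mem_univ _, rfl,
        carries_refl _, carries_refl _⟩
      symm := by
        rintro H H' ⟨φ, hφ, hx, hp, hK, hL⟩
        refine ⟨φ.symm, hφ.symm, ?_, ?_, hK.symm hφ, hL.symm hφ⟩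
        · rw [← hp]
          exact φ.map_source hx
        · rw [← hp]
          exact φ.left_inv hx
      trans := by
        rintro H H' H'' ⟨φ, hφ, hx, hp, hK, hL⟩ ⟨ψ, hψ, hx', hp', hK', hL'⟩
        refine ⟨φ.trans ψ, hφ.trans hψ, ?_, ?_, hK.trans hφ hψ hK', hL.trans hφ hψ hL'⟩
        · rw [OpenPartialHomeomorph.trans_source]
          exact ⟨hx, by rw [mem_preimage, hp]; exact hx'⟩
        · rw [OpenPartialHomeomorph.coe_trans, Function.comp_apply, hp, hp'] }

/-- The germ at `(y, ℓ)` of `P(D)` with the pseudo-product structure `K ⊕ Ker(π_*)`. -/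
def DirectedGerm235.prolong (G : DirectedGerm235.{u})
    (K : SubspaceField (R5 × ℝ) (ProjSpace G.is235.isDistribution))
    (hK : IsG2Splitting G.is235.isDistribution K) : PseudoProductGerm.{u} where
  Z := ProjSpace G.is235.isDistribution
  K := K
  L := vertical G.is235.isDistribution
  isG2 := hK.1
  point := G.point

end TwoThreeFive

end

open TwoThreeFive

set_option linter.unusedSectionVars false
set_option linter.style.longLine false

noncomputable section

namespace TwoThreeFive

/-! ### Vector fields, smooth combinations, brackets and coefficients. -/

section VectorFields

variable {V : Type*} [NormedAddCommGroup V] [NormedSpace ℝ V]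
variable {M : Type*} [TopologicalSpace M] [ChartedSpace V M] [IsManifold 𝓘(ℝ, V) ∞ M]
variable {V' : Type*} [NormedAddCommGroup V'] [NormedSpace ℝ V']
variable {M' : Type*} [TopologicalSpace M'] [ChartedSpace V' M'] [IsManifold 𝓘(ℝ, V') ∞ M']

/-! Everything is read off from adapted local frames `f 0, …, f 5` with `L = ⟨f 0⟩` and `K = ⟨f 1⟩`
(`IsG2Frame`). In such a frame the derived systems of `E` are the partial flags of the frame; the
successive new directions come from `[f 0, f 1]`, `[f 1, f 2]`, `[f 1, f 3]` and `[f 0, f 4]`. By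
the Leibniz rule, bracketing with sections of a distribution is determined by the brackets of a
frame up to the distributions themselves, so all bracket conditions reduce to a few brackets of
frame fields (`IsFrameOn.bracket_le`, `isPseudoProductG2_of_frames`,
`IsPseudoProductG2.exists_frame`).

Prolongation. On `P(D)` let `T` be vertical, `g₁, g₂` lifts of a local frame of `D`, `g₃ = [g₁,
g₂]`, `g₄ = [g₁, g₃]`, `g₅ = [g₂, g₃]`, and `t` the slope of the line. Then `E` is spanned by `T`
and `u = g₁ + t g₂`, and a complement of `L` is spanned by `u + λT`. Since `T` projects to zero, its
bracket with a lift is a multiple of `T`; it acts only through `T(t)`, which does not vanish. With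
`v = g₄ + t g₅` one gets `[T, v] ≡ T(t) g₅` modulo `T`, while `[u, v]` has some coefficient `c₅` at
`g₅`. Invariance of `∂⁽³⁾E` under `K` is the equation `c₅ + λ T(t) = 0`, which fixes `λ`
(`IsLiftFrame.exists_isG2Frame`). Intrinsically, `K` consists of the directions of `E` along which
`∂⁽³⁾E` is invariant. This description, `charDir`, needs no gluing and gives uniqueness and
naturality at once (`charDir_eq`, `eq_charDir`, `Carries.charDir`).

Local isomorphisms. A diffeomorphism preserving `D` acts on lines and preserves `L` and `E`, hence
`K`. Conversely a diffeomorphism preserving `L` is infinitesimally constant along fibres after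
projection, so it covers a map of the bases (`exists_factor`); as `D` is the image of `∂E` and `ℓ`
that of `E`, the covered map preserves `D` and induces the given one (`exists_covered`).

Reduction. In a flow box for `L`, a frame of `∂E` satisfies a linear differential equation along the
flow lines, because `[L, ∂E] = ∂E`. So `∂E` is constant along them and descends
(`exists_flowBox_univ`, `eq_of_bracket_lastDirection`, `exists_isReduction`). The flow box rests on
smooth dependence of solutions on initial values, which follows from the inverse function theorem in
a space of continuous paths (`exists_smooth_flow`). The descended `D` has growth `(2,3,5)` because
the iterated brackets forming the frame upstairs lie in the span of `T` and the five iterated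
brackets of lifts (`IsReduction.is235`). The map `w ↦ (p w, p_* K_w)` is a local diffeomorphism
because `[f 0, f 1] ∉ E` means that the line `p_* K` turns along the fibres
(`mfderiv_lineMap_ne_zero`). The bijection of isomorphism classes is then formal. -/

lemma isManifold_two : IsManifold 𝓘(ℝ, V) 2 M :=
  IsManifold.of_le (n := ∞) (WithTop.coe_le_coe.2 (le_top : (2 : ℕ∞) ≤ ⊤))

/-- `X` is a smooth vector field over `U`. -/
def SmoothVF (U : Set M) (X : VField V M) : Prop :=
  ContMDiffOn 𝓘(ℝ, V) 𝓘(ℝ, V).tangent ∞ (fun x => (⟨x, X x⟩ : TangentBundle 𝓘(ℝ, V) M)) U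

/-- `c` is a smooth function over `U`. -/
abbrev SmoothFn (V : Type*) [NormedAddCommGroup V] [NormedSpace ℝ V]
    {M : Type*} [TopologicalSpace M] [ChartedSpace V M] (U : Set M) (c : M → ℝ) : Prop :=
  ContMDiffOn 𝓘(ℝ, V) 𝓘(ℝ, ℝ) ∞ c U

/-- `X` is smooth over `U`, as a section of the tangent bundle of `M'` along the map `p`. -/
def SmoothAlong (U : Set M) (p : M → M') (X : ∀ w, TangentSpace 𝓘(ℝ, V') (p w)) : Prop :=
  ContMDiffOn 𝓘(ℝ, V) 𝓘(ℝ, V').tangent ∞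
    (fun w => (⟨p w, X w⟩ : TangentBundle 𝓘(ℝ, V') M')) U

/-- The Lie bracket of vector fields. -/
abbrev lieB (X Y : VField V M) : VField V M := VectorField.mlieBracket 𝓘(ℝ, V) X Y

/-- The derivative of a function along a vector field. -/
def dirDeriv (c : M → ℝ) (X : VField V M) : M → ℝ := fun x => mvfderiv 𝓘(ℝ, V) c x (X x)

lemma SmoothVF.mono {U U' : Set M} {X : VField V M} (h : SmoothVF U X) (hU : U' ⊆ U) :
    SmoothVF U' X := ContMDiffOn.mono h hU

lemma SmoothVF.add {U : Set M} {X Y : VField V M} (hX : SmoothVF U X) (hY : SmoothVF U Y) :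
    SmoothVF U (X + Y) := ContMDiffOn.add_section hX hY

lemma SmoothVF.sub {U : Set M} {X Y : VField V M} (hX : SmoothVF U X) (hY : SmoothVF U Y) :
    SmoothVF U (X - Y) := ContMDiffOn.sub_section hX hY

lemma SmoothVF.smul {U : Set M} {c : M → ℝ} {X : VField V M} (hc : SmoothFn V U c)
    (hX : SmoothVF U X) : SmoothVF U (c • X) := ContMDiffOn.smul_section hc hX

lemma SmoothVF.sum {ι : Type*} {s : Finset ι} {U : Set M} {X : ι → VField V M}
    (hX : ∀ i ∈ s, SmoothVF U (X i)) : SmoothVF U (∑ i ∈ s, X i) := by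
  have := ContMDiffOn.sum_section (V := (TangentSpace 𝓘(ℝ, V) : M → Type _)) hX
  refine this.congr fun x _ => ?_
  simp

lemma SmoothVF.congr {U : Set M} {X Y : VField V M} (hX : SmoothVF U X)
    (h : ∀ x ∈ U, Y x = X x) : SmoothVF U Y :=
  ContMDiffOn.congr hX fun x hx => by simp only [h x hx]

lemma SmoothVF.mdifferentiableAt {U : Set M} {X : VField V M} (hX : SmoothVF U X) (hU : IsOpen U)
    {x : M} (hx : x ∈ U) : MDifferentiableAt 𝓘(ℝ, V) 𝓘(ℝ, V).tangent
      (fun x => (⟨x, X x⟩ : TangentBundle 𝓘(ℝ, V) M)) x :=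
  (ContMDiffOn.contMDiffAt hX (hU.mem_nhds hx)).mdifferentiableAt (by simp)

lemma SmoothFn.mdifferentiableAt {U : Set M} {c : M → ℝ} (hX : SmoothFn V U c) (hU : IsOpen U)
    {x : M} (hx : x ∈ U) : MDifferentiableAt 𝓘(ℝ, V) 𝓘(ℝ, ℝ) c x :=
  (ContMDiffOn.contMDiffAt hX (hU.mem_nhds hx)).mdifferentiableAt (by simp)

lemma SmoothVF.lieB [CompleteSpace V] {U : Set M} (hU : IsOpen U) {X Y : VField V M}
    (hX : SmoothVF U X) (hY : SmoothVF U Y) : SmoothVF U (lieB X Y) := by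
  intro x hx
  -- Since `∞ + 1 = ∞`, the derivative lost in a bracket costs nothing.
  have : IsManifold 𝓘(ℝ, V) (((⊤ : ℕ∞) : WithTop ℕ∞) + 1) M := by
    change IsManifold 𝓘(ℝ, V) ∞ M
    infer_instance
  have : IsManifold 𝓘(ℝ, V) (minSmoothness ℝ 2) M := by
    rw [minSmoothness_of_isRCLikeNormedField]
    exact isManifold_two
  exact (ContMDiffAt.mlieBracket_vectorField (n := ⊤) (m := ⊤)
    (ContMDiffOn.contMDiffAt hX (hU.mem_nhds hx))
    (ContMDiffOn.contMDiffAt hY (hU.mem_nhds hx)) (by simp [minSmoothness_of_isRCLikeNormedField])).contMDiffWithinAt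

/-- The push-forward of a smooth vector field is smooth as a section along the map. -/
lemma SmoothVF.mfderiv_apply {U : Set M} (hU : IsOpen U) {f : M → M'}
    (hf : ContMDiffOn 𝓘(ℝ, V) 𝓘(ℝ, V') ∞ f U) {X : VField V M} (hX : SmoothVF U X) :
    SmoothAlong (V := V) U f fun x => mfderiv 𝓘(ℝ, V) 𝓘(ℝ, V') f x (X x) := by
  have h := hf.contMDiffOn_tangentMapWithin (m := ∞) (by simp) hU.uniqueMDiffOn
  refine (h.comp hX fun x hx => hx).congr fun x hx => ?_
  simp [tangentMapWithin, mfderivWithin_of_isOpen hU hx]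

lemma SmoothFn.dirDeriv {U : Set M} (hU : IsOpen U) {c : M → ℝ} (hc : SmoothFn V U c)
    {X : VField V M} (hX : SmoothVF U X) : SmoothFn V U (dirDeriv c X) := by
  have := SmoothVF.mfderiv_apply hU hc hX
  exact (contMDiff_snd_tangentBundle_modelSpace ℝ 𝓘(ℝ, ℝ)).comp_contMDiffOn this

lemma lieB_congr {X X' Y Y' : VField V M} {U : Set M} (hU : IsOpen U) {x : M} (hx : x ∈ U)
    (hX : ∀ w ∈ U, X w = X' w) (hY : ∀ w ∈ U, Y w = Y' w) : lieB X Y x = lieB X' Y' x :=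
  Filter.EventuallyEq.mlieBracket_vectorField_eq
    (Filter.eventually_of_mem (hU.mem_nhds hx) hX) (Filter.eventually_of_mem (hU.mem_nhds hx) hY)

lemma lieB_swap (X Y : VField V M) (x : M) : lieB X Y x = - lieB Y X x :=
  VectorField.mlieBracket_swap_apply

lemma lieB_self (X : VField V M) (x : M) : lieB X X x = 0 := by
  have h := lieB_swap X X x
  have h2 : (2 : ℝ) • lieB X X x = 0 := by
    rw [two_smul]
    nth_rewrite 1 [h]
    simp
  exact (smul_eq_zero.1 h2).resolve_left two_ne_zero

variable [CompleteSpace V]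

lemma lieB_add_left {U : Set M} (hU : IsOpen U) {X X' Y : VField V M} (hX : SmoothVF U X)
    (hX' : SmoothVF U X') {x : M} (hx : x ∈ U) :
    lieB (X + X') Y x = lieB X Y x + lieB X' Y x := by
  have : IsManifold 𝓘(ℝ, V) 2 M := isManifold_two
  exact VectorField.mlieBracket_add_left (hX.mdifferentiableAt hU hx) (hX'.mdifferentiableAt hU hx)

lemma lieB_add_right {U : Set M} (hU : IsOpen U) {X Y Y' : VField V M} (hY : SmoothVF U Y)
    (hY' : SmoothVF U Y') {x : M} (hx : x ∈ U) :
    lieB X (Y + Y') x = lieB X Y x + lieB X Y' x := by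
  have : IsManifold 𝓘(ℝ, V) 2 M := isManifold_two
  exact VectorField.mlieBracket_add_right (hY.mdifferentiableAt hU hx)
    (hY'.mdifferentiableAt hU hx)

lemma lieB_smul_right {U : Set M} (hU : IsOpen U) {c : M → ℝ} (hc : SmoothFn V U c)
    {X Y : VField V M} (hY : SmoothVF U Y) {x : M} (hx : x ∈ U) :
    lieB X (c • Y) x = dirDeriv c X x • Y x + c x • lieB X Y x := by
  have : IsManifold 𝓘(ℝ, V) 2 M := isManifold_two
  exact VectorField.mlieBracket_smul_right (SmoothFn.mdifferentiableAt hc hU hx)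
    (hY.mdifferentiableAt hU hx)

lemma lieB_smul_left {U : Set M} (hU : IsOpen U) {c : M → ℝ} (hc : SmoothFn V U c)
    {X Y : VField V M} (hX : SmoothVF U X) {x : M} (hx : x ∈ U) :
    lieB (c • X) Y x = -dirDeriv c Y x • X x + c x • lieB X Y x := by
  have : IsManifold 𝓘(ℝ, V) 2 M := isManifold_two
  exact VectorField.mlieBracket_smul_left (SmoothFn.mdifferentiableAt hc hU hx)
    (hX.mdifferentiableAt hU hx)

lemma lieB_zero_right (X : VField V M) (x : M) : lieB X 0 x = 0 := by
  have : IsManifold 𝓘(ℝ, V) 2 M := isManifold_two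
  have h := congrFun (VectorField.mlieBracket_zero_right (I := 𝓘(ℝ, V)) (W := X)) x
  exact h

lemma lieB_sum_right {ι : Type*} (s : Finset ι) {U : Set M} (hU : IsOpen U) {X : VField V M}
    {Y : ι → VField V M} (hY : ∀ i, SmoothVF U (Y i)) {x : M} (hx : x ∈ U) :
    lieB X (∑ i ∈ s, Y i) x = ∑ i ∈ s, lieB X (Y i) x := by
  classical
  induction s using Finset.induction_on with
  | empty => exact lieB_zero_right X x
  | insert i s hi ih =>
    rw [Finset.sum_insert hi, Finset.sum_insert hi, lieB_add_right hU (hY i)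
      (SmoothVF.sum fun j _ => hY j) hx, ih]

/-- `X` is a combination of the fields `g i` over `U`, with smooth coefficients. -/
def SmoothComb {ι : Type*} [Fintype ι] (g : ι → VField V M) (U : Set M) (X : VField V M) : Prop :=
  ∃ c : ι → M → ℝ, (∀ i, SmoothFn V U (c i)) ∧ ∀ x ∈ U, X x = ∑ i, c i x • g i x

/-- By the Leibniz rule, differentiating the coefficients only produces multiples of the `g i`
themselves. Modulo their span, the bracket is therefore linear over functions. -/
lemma lieB_comb_right {ι : Type*} [Fintype ι] {g : ι → VField V M} {U : Set M} (hU : IsOpen U)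
    (hg : ∀ i, SmoothVF U (g i)) {c : ι → M → ℝ} (hc : ∀ i, SmoothFn V U (c i))
    {X Y : VField V M} (hY : ∀ x ∈ U, Y x = ∑ i, c i x • g i x) {x : M} (hx : x ∈ U) :
    lieB X Y x = ∑ i, (dirDeriv (c i) X x • g i x + c i x • lieB X (g i) x) := by
  rw [lieB_congr (X' := X) (Y' := ∑ i, c i • g i) hU hx (fun _ _ => rfl)
    (fun w hw => by rw [hY w hw]; simp),
    lieB_sum_right _ hU (fun i => (hg i).smul (hc i)) hx]
  exact Finset.sum_congr rfl fun i _ => lieB_smul_right hU (hc i) (hg i) hx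

lemma lieB_comb_left {ι : Type*} [Fintype ι] {g : ι → VField V M} {U : Set M} (hU : IsOpen U)
    (hg : ∀ i, SmoothVF U (g i)) {c : ι → M → ℝ} (hc : ∀ i, SmoothFn V U (c i))
    {X Y : VField V M} (hX : ∀ x ∈ U, X x = ∑ i, c i x • g i x) {x : M} (hx : x ∈ U) :
    lieB X Y x = ∑ i, (-dirDeriv (c i) Y x • g i x + c i x • lieB (g i) Y x) := by
  rw [lieB_swap, lieB_comb_right hU hg hc hX hx, ← Finset.sum_neg_distrib]
  refine Finset.sum_congr rfl fun i _ => ?_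
  rw [lieB_swap Y (g i)]
  simp [add_comm]

section Comb

variable {ι κ μ : Type*} [Fintype ι] [Fintype κ] [Fintype μ]

lemma SmoothComb.smoothVF {g : ι → VField V M} {U : Set M} {X : VField V M}
    (h : SmoothComb g U X) (hg : ∀ i, SmoothVF U (g i)) : SmoothVF U X := by
  obtain ⟨c, hc, hX⟩ := h
  exact (SmoothVF.sum (s := Finset.univ) fun i _ => (hg i).smul (hc i)).congr
    fun x hx => by rw [hX x hx]; simp

lemma SmoothComb.mem_span {g : ι → VField V M} {U : Set M} {X : VField V M}
    (h : SmoothComb g U X) {x : M} (hx : x ∈ U) :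
    X x ∈ Submodule.span ℝ (Set.range fun i => g i x) := by
  obtain ⟨c, hc, hX⟩ := h
  rw [hX x hx]
  exact Submodule.sum_mem _ fun i _ => Submodule.smul_mem _ _ (Submodule.subset_span ⟨i, rfl⟩)

lemma SmoothComb.congr {g : ι → VField V M} {U : Set M} {X Y : VField V M}
    (h : SmoothComb g U X) (hXY : ∀ x ∈ U, Y x = X x) : SmoothComb g U Y := by
  obtain ⟨c, hc, hX⟩ := h
  exact ⟨c, hc, fun x hx => by rw [hXY x hx, hX x hx]⟩

lemma SmoothComb.add {g : ι → VField V M} {U : Set M} {X Y : VField V M}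
    (hX : SmoothComb g U X) (hY : SmoothComb g U Y) : SmoothComb g U (X + Y) := by
  obtain ⟨c, hc, hX⟩ := hX
  obtain ⟨d, hd, hY⟩ := hY
  refine ⟨fun i => c i + d i, fun i => (hc i).add (hd i), fun x hx => ?_⟩
  simp [hX x hx, hY x hx, add_smul, Finset.sum_add_distrib]

lemma SmoothComb.smul {g : ι → VField V M} {U : Set M} {a : M → ℝ} {X : VField V M}
    (ha : SmoothFn V U a) (hX : SmoothComb g U X) : SmoothComb g U (a • X) := by
  obtain ⟨c, hc, hX⟩ := hX
  refine ⟨fun i => a * c i, fun i => ContMDiffOn.mul ha (hc i), fun x hx => ?_⟩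
  simp [hX x hx, Finset.smul_sum, mul_smul]

lemma SmoothComb.neg {g : ι → VField V M} {U : Set M} {X : VField V M}
    (hX : SmoothComb g U X) : SmoothComb g U (-X) :=
  (hX.smul (a := fun _ => -1) contMDiffOn_const).congr fun x _ => by simp

lemma SmoothComb.zero (g : ι → VField V M) (U : Set M) : SmoothComb g U 0 :=
  ⟨fun _ _ => 0, fun _ => contMDiffOn_const, fun x _ => by simp⟩

lemma SmoothComb.sum {g : ι → VField V M} {U : Set M} (s : Finset κ) {X : κ → VField V M}
    (hX : ∀ i, SmoothComb g U (X i)) : SmoothComb g U (∑ i ∈ s, X i) := by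
  classical
  induction s using Finset.induction_on with
  | empty => exact SmoothComb.zero g U
  | insert i s hi ih =>
    rw [Finset.sum_insert hi]
    exact (hX i).add ih

lemma SmoothComb.self (g : ι → VField V M) (U : Set M) (i : ι) : SmoothComb g U (g i) := by
  classical
  exact ⟨fun j _ => if j = i then 1 else 0, fun _ => contMDiffOn_const, fun x _ => by simp⟩

lemma SmoothComb.trans {g : ι → VField V M} {h : κ → VField V M} {U : Set M} {X : VField V M}
    (hX : SmoothComb g U X) (hg : ∀ i, SmoothComb h U (g i)) : SmoothComb h U X := by
  obtain ⟨c, hc, hX⟩ := hX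
  exact (SmoothComb.sum Finset.univ fun i => (hg i).smul (hc i)).congr
    fun x hx => by rw [hX x hx]; simp

/-- The bracket of combinations of the `g i` and of the `h j` is a combination of these fields and
of their brackets. -/
lemma SmoothComb.lieB {g : ι → VField V M} {h : κ → VField V M} {k : μ → VField V M} {U : Set M}
    (hU : IsOpen U) {X Y : VField V M} (hX : SmoothComb g U X) (hY : SmoothComb h U Y)
    (hg : ∀ i, SmoothVF U (g i)) (hh : ∀ i, SmoothVF U (h i))
    (hgk : ∀ i, SmoothComb k U (g i)) (hhk : ∀ i, SmoothComb k U (h i))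
    (hk : ∀ i j, SmoothComb k U (lieB (g i) (h j))) : SmoothComb k U (lieB X Y) := by
  have hXs := hX.smoothVF hg
  obtain ⟨c, hc, hX⟩ := hX
  obtain ⟨d, hd, hY⟩ := hY
  refine SmoothComb.congr (X := ∑ j, (dirDeriv (d j) X • h j + d j •
    ∑ i, (-dirDeriv (c i) (h j) • g i + c i • TwoThreeFive.lieB (g i) (h j)))) ?_ ?_
  · exact SmoothComb.sum _ fun j => ((hhk j).smul (SmoothFn.dirDeriv hU (hd j) hXs)).add
      ((SmoothComb.sum _ fun i => ((hgk i).smul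
        (ContMDiffOn.neg (SmoothFn.dirDeriv hU (hc i) (hh j)))).add
          ((hk i j).smul (hc i))).smul (hd j))
  · intro x hx
    rw [lieB_comb_right hU hh hd hY hx]
    simp only [Finset.sum_apply, Pi.add_apply, Pi.smul_apply', Pi.neg_apply]
    refine Finset.sum_congr rfl fun j _ => ?_
    rw [lieB_comb_left hU hg hc hX hx]

/-- The value at a point of the bracket of combinations of the `g i` and of the `h j`. -/
lemma SmoothComb.lieB_mem {g : ι → VField V M} {h : κ → VField V M} {U : Set M}
    (hU : IsOpen U) {X Y : VField V M} (hX : SmoothComb g U X) (hY : SmoothComb h U Y)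
    (hg : ∀ i, SmoothVF U (g i)) (hh : ∀ i, SmoothVF U (h i)) {x : M} (hx : x ∈ U)
    {S : Submodule ℝ (TangentSpace 𝓘(ℝ, V) x)} (hgS : ∀ i, g i x ∈ S) (hhS : ∀ i, h i x ∈ S)
    (hS : ∀ i j, TwoThreeFive.lieB (g i) (h j) x ∈ S) : TwoThreeFive.lieB X Y x ∈ S := by
  obtain ⟨c, hc, hX⟩ := hX
  obtain ⟨d, hd, hY⟩ := hY
  rw [lieB_comb_right hU hh hd hY hx]
  refine S.sum_mem fun j _ => S.add_mem (S.smul_mem _ (hhS j)) (S.smul_mem _ ?_)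
  rw [lieB_comb_left hU hg hc hX hx]
  exact S.sum_mem fun i _ => S.add_mem (S.smul_mem _ (hgS i)) (S.smul_mem _ (hS i j))

end Comb

section Coefficients

variable {ι : Type*} [Fintype ι]

lemma smoothFn_det [DecidableEq ι] {U : Set M} {G : ι → ι → M → ℝ}
    (hG : ∀ i j, SmoothFn V U (G i j)) :
    SmoothFn V U fun w => Matrix.det (Matrix.of fun i j => G i j w) := by
  simp only [Matrix.det_apply, Matrix.of_apply]
  refine contMDiffOn_finsetSum fun σ _ => ?_
  have h : ContMDiffOn 𝓘(ℝ, V) 𝓘(ℝ, ℝ) ∞ (fun w => ∏ i, G (σ i) i w) U :=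
    contMDiffOn_finsetProd fun i _ => hG _ _
  rcases Int.units_eq_one_or (Equiv.Perm.sign σ) with hs | hs
  · simpa [hs] using h
  · simpa [hs] using h.neg

lemma SmoothAlong.base {U : Set M} {p : M → M'} {X : ∀ w, TangentSpace 𝓘(ℝ, V') (p w)}
    (hX : SmoothAlong (V := V) U p X) : ContMDiffOn 𝓘(ℝ, V) 𝓘(ℝ, V') ∞ p U :=
  (contMDiff_proj (TangentSpace 𝓘(ℝ, V') : M' → Type _)).comp_contMDiffOn hX

lemma SmoothAlong.mono {U U' : Set M} {p : M → M'} {X : ∀ w, TangentSpace 𝓘(ℝ, V') (p w)}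
    (hX : SmoothAlong (V := V) U p X) (h : U' ⊆ U) : SmoothAlong (V := V) U' p X :=
  ContMDiffOn.mono hX h

lemma SmoothVF.comp {U : Set M} {U' : Set M'} {p : M → M'}
    (hp : ContMDiffOn 𝓘(ℝ, V) 𝓘(ℝ, V') ∞ p U) (hpU : MapsTo p U U') {X : VField V' M'}
    (hX : SmoothVF U' X) : SmoothAlong (V := V) U p fun w => X (p w) :=
  ContMDiffOn.comp hX hp hpU

lemma SmoothAlong.formAt {U : Set M} {p : M → M'} {X : ∀ w, TangentSpace 𝓘(ℝ, V') (p w)}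
    (hX : SmoothAlong (V := V) U p X) (x₀ : M') (α : V' →L[ℝ] ℝ) :
    SmoothFn V (U ∩ p ⁻¹' (chartAt V' x₀).source) fun w => formAt x₀ α (p w) (X w) := by
  have h := ((trivializationAt V' (TangentSpace 𝓘(ℝ, V')) x₀).contMDiffOn_iff
    (IB := 𝓘(ℝ, V')) (IM := 𝓘(ℝ, V)) (n := ∞)
    (f := fun w => (⟨p w, X w⟩ : TangentBundle 𝓘(ℝ, V') M'))
    (s := U ∩ p ⁻¹' (chartAt V' x₀).source) (fun w hw => by
      rw [Trivialization.mem_source]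
      exact hw.2)).1 (ContMDiffOn.mono hX inter_subset_left)
  refine ((α.contDiff (n := ∞)).contMDiff.comp_contMDiffOn h.2).congr fun y hy => ?_
  simp only [TwoThreeFive.formAt, LinearMap.comp_apply, Function.comp_apply]
  rw [Trivialization.coe_linearMapAt_of_mem]
  · rfl
  · exact hy.2

/-- The map from coefficients to combinations is injective, and the components of a left inverse are
the dual forms. -/
lemma exists_dual_family {W : Type*} [NormedAddCommGroup W] [NormedSpace ℝ W]
    [FiniteDimensional ℝ W] [DecidableEq ι] {v : ι → W}
    (hv : LinearIndependent ℝ v) :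
    ∃ l : ι → W →L[ℝ] ℝ, ∀ i j, l i (v j) = if i = j then 1 else 0 := by
  obtain ⟨f, hf⟩ := LinearMap.exists_leftInverse_of_injective
    (Fintype.linearCombination ℝ v) (LinearMap.ker_eq_bot.2
      (linearIndependent_iff_injective_fintypeLinearCombination.1 hv))
  refine ⟨fun i => LinearMap.toContinuousLinearMap ((LinearMap.proj i).comp f), fun i j => ?_⟩
  have := congrArg (fun F => F (Pi.single j 1) i) hf
  simpa [Fintype.linearCombination_apply_single, Pi.single_apply] using this

lemma formAt_injective (x₀ : M) {w : M} (hw : w ∈ (chartAt V x₀).source) :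
    Function.Injective ((trivializationAt V (TangentSpace 𝓘(ℝ, V)) x₀).linearMapAt ℝ w) := by
  have hb : w ∈ (trivializationAt V (TangentSpace 𝓘(ℝ, V)) x₀).baseSet := hw
  intro v v' h
  rw [← (trivializationAt V (TangentSpace 𝓘(ℝ, V)) x₀).symmₗ_linearMapAt (R := ℝ) hb v, h,
    (trivializationAt V (TangentSpace 𝓘(ℝ, V)) x₀).symmₗ_linearMapAt (R := ℝ) hb v']

/-- Near a point where the sections `g i` are independent there are linear forms whose matrix on
the sections is invertible. -/
lemma exists_forms [FiniteDimensional ℝ V'] [DecidableEq ι] {U : Set M} {p : M → M'}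
    {g : ι → ∀ w, TangentSpace 𝓘(ℝ, V') (p w)} (hU : IsOpen U)
    (hp : ContMDiffOn 𝓘(ℝ, V) 𝓘(ℝ, V') ∞ p U)
    (hg : ∀ i, SmoothAlong (V := V) U p (g i)) {x : M} (hx : x ∈ U)
    (hli : LinearIndependent ℝ fun i => g i x) :
    ∃ (l : ι → V' →L[ℝ] ℝ) (N : Set M), IsOpen N ∧ x ∈ N ∧
      N ⊆ U ∩ p ⁻¹' (chartAt V' (p x)).source ∧
      ∀ w ∈ N, Matrix.det (Matrix.of fun i j => formAt (p x) (l i) (p w) (g j w)) ≠ 0 := by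
  have hinj := formAt_injective (p x) (mem_chart_source V' (p x))
  -- The forms are dual to the sections at `x` in the trivialization there. Their matrix is the
  -- identity at `x`, so its determinant stays nonzero nearby.
  obtain ⟨l, hl⟩ := exists_dual_family
    (hli.map' ((trivializationAt V' (TangentSpace 𝓘(ℝ, V')) (p x)).linearMapAt ℝ (p x))
      (LinearMap.ker_eq_bot.2 hinj))
  have hO : IsOpen (U ∩ p ⁻¹' (chartAt V' (p x)).source) :=
    hp.continuousOn.isOpen_inter_preimage hU (chartAt V' (p x)).open_source
  have hdet := smoothFn_det (V := V) (U := U ∩ p ⁻¹' (chartAt V' (p x)).source)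
    (G := fun i j w => formAt (p x) (l i) (p w) (g j w)) (fun i j => (hg j).formAt (p x) (l i))
  refine ⟨l, _, hdet.continuousOn.isOpen_inter_preimage hO isOpen_ne,
    ⟨⟨hx, mem_chart_source V' (p x)⟩, ?_⟩, inter_subset_left, fun w hw => hw.2⟩
  have : (Matrix.of fun i j => formAt (p x) (l i) (p x) (g j x)) = (1 : Matrix ι ι ℝ) := by
    ext i j
    rw [Matrix.of_apply, Matrix.one_apply]
    exact hl i j
  simp [this]

lemma linearIndependent_of_det [DecidableEq ι] {W : Type*} [AddCommGroup W] [Module ℝ W]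
    {v : ι → W} (l : ι → W →ₗ[ℝ] ℝ) (h : Matrix.det (Matrix.of fun i j => l i (v j)) ≠ 0) :
    LinearIndependent ℝ v := by
  rw [Fintype.linearIndependent_iff]
  intro c hc
  have : Matrix.mulVec (Matrix.of fun i j => l i (v j)) c = 0 := by
    ext i
    have := congrArg (l i) hc
    simpa [Matrix.mulVec, dotProduct, mul_comm] using this
  exact fun i => congrFun (Matrix.eq_zero_of_mulVec_eq_zero h this) i

/-- Independence is witnessed by a nonvanishing determinant, an open condition. Sections along a map
are allowed because lifts through a submersion need them; for frames the map is the identity. -/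
lemma exists_open_linearIndependent [FiniteDimensional ℝ V'] {U : Set M} {p : M → M'}
    {g : ι → ∀ w, TangentSpace 𝓘(ℝ, V') (p w)} (hU : IsOpen U)
    (hp : ContMDiffOn 𝓘(ℝ, V) 𝓘(ℝ, V') ∞ p U)
    (hg : ∀ i, SmoothAlong (V := V) U p (g i)) {x : M} (hx : x ∈ U)
    (hli : LinearIndependent ℝ fun i => g i x) :
    ∃ N : Set M, IsOpen N ∧ x ∈ N ∧ N ⊆ U ∧ ∀ w ∈ N, LinearIndependent ℝ fun i => g i w := by
  classical
  obtain ⟨l, N, hN, hxN, hNU, hdet⟩ := exists_forms hU hp hg hx hli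
  exact ⟨N, hN, hxN, hNU.trans inter_subset_left, fun w hw =>
    linearIndependent_of_det (fun i => formAt (p x) (l i) (p w)) (hdet w hw)⟩

/-- A smooth section with values in the span of independent smooth sections has smooth
coefficients. -/
lemma exists_smooth_coeff [FiniteDimensional ℝ V'] {U : Set M} {p : M → M'}
    {g : ι → ∀ w, TangentSpace 𝓘(ℝ, V') (p w)} (hU : IsOpen U)
    (hp : ContMDiffOn 𝓘(ℝ, V) 𝓘(ℝ, V') ∞ p U)
    (hg : ∀ i, SmoothAlong (V := V) U p (g i))
    (hli : ∀ x ∈ U, LinearIndependent ℝ fun i => g i x)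
    {X : ∀ w, TangentSpace 𝓘(ℝ, V') (p w)} (hX : SmoothAlong (V := V) U p X)
    (hmem : ∀ x ∈ U, X x ∈ Submodule.span ℝ (Set.range fun i => g i x)) :
    ∃ c : ι → M → ℝ, (∀ i, SmoothFn V U (c i)) ∧ ∀ x ∈ U, X x = ∑ i, c i x • g i x := by
  classical
  -- Coefficients are chosen point by point. No gluing is needed, since Cramer's rule identifies
  -- every choice with the same smooth expression.
  have hex : ∀ x, ∃ c : ι → ℝ, x ∈ U → X x = ∑ i, c i • g i x := by
    intro x
    by_cases hx : x ∈ U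
    · obtain ⟨c, hc⟩ := (Submodule.mem_span_range_iff_exists_fun ℝ).1 (hmem x hx)
      exact ⟨c, fun _ => hc.symm⟩
    · exact ⟨0, fun h => absurd h hx⟩
  choose c hc using hex
  refine ⟨fun i x => c x i, fun i x hx => ?_, fun x hx => hc x hx⟩
  obtain ⟨l, N, hN, hxN, hNU, hdet⟩ := exists_forms hU hp hg hx (hli x hx)
  let G : ι → ι → M → ℝ := fun i j w => formAt (p x) (l i) (p w) (g j w)
  have hG : ∀ i j, SmoothFn V N (G i j) := fun i j =>
    ((hg j).formAt (p x) (l i)).mono hNU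
  have hb : ∀ i, SmoothFn V N fun w => formAt (p x) (l i) (p w) (X w) := fun i =>
    (hX.formAt (p x) (l i)).mono hNU
  -- Cramer's rule
  have key : ∀ w ∈ N, c w i = (∑ j, Matrix.det (Matrix.of fun k m =>
      if k = j then (Pi.single i 1 : ι → ℝ) m else G k m w) * formAt (p x) (l j) (p w) (X w)) /
      Matrix.det (Matrix.of fun i j => G i j w) := by
    intro w hw
    have h1 : Matrix.mulVec (Matrix.of fun i j => G i j w) (c w) =
        fun j => formAt (p x) (l j) (p w) (X w) := by
      ext j
      rw [hc w (hNU hw).1]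
      simp [Matrix.mulVec, dotProduct, G, mul_comm]
    have h2 := congrArg (fun v => Matrix.mulVec
      (Matrix.adjugate (Matrix.of fun i j => G i j w)) v i) h1
    simp only [Matrix.mulVec_mulVec, Matrix.adjugate_mul] at h2
    rw [eq_div_iff (hdet w hw)]
    -- An entry of the adjugate is the determinant with one row replaced by a unit vector. In this
    -- form its smoothness follows from that of determinants.
    have h3 : ∀ j, Matrix.adjugate (Matrix.of fun i j => G i j w) i j =
        Matrix.det (Matrix.of fun k m =>
          if k = j then (Pi.single i 1 : ι → ℝ) m else G k m w) := by
      intro j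
      rw [Matrix.adjugate_apply]
      congr 1
      ext k m
      by_cases hk : k = j
      · subst hk; simp
      · simp [hk]
    simp only [Matrix.smul_mulVec, Matrix.one_mulVec, Pi.smul_apply, smul_eq_mul] at h2
    rw [mul_comm, h2]
    simp only [Matrix.mulVec, dotProduct, h3]
  refine ContMDiffAt.contMDiffWithinAt (ContMDiffOn.contMDiffAt ?_ (hN.mem_nhds hxN))
  refine ContMDiffOn.congr ?_ key
  refine ContMDiffOn.div₀ (contMDiffOn_finsetSum fun j _ => ContMDiffOn.mul ?_ (hb j))
    (smoothFn_det hG) hdet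
  refine smoothFn_det (G := fun k m w => if k = j then (Pi.single i 1 : ι → ℝ) m else G k m w) ?_
  intro k m
  by_cases hk : k = j
  · simpa [hk] using contMDiffOn_const
  · simpa [hk] using hG k m

lemma smoothComb_of_mem_span [FiniteDimensional ℝ V] {g : ι → VField V M} {U : Set M}
    (hU : IsOpen U) (hg : ∀ i, SmoothVF U (g i))
    (hli : ∀ x ∈ U, LinearIndependent ℝ fun i => g i x) {X : VField V M} (hX : SmoothVF U X)
    (hmem : ∀ x ∈ U, X x ∈ Submodule.span ℝ (Set.range fun i => g i x)) : SmoothComb g U X :=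
  exists_smooth_coeff (p := fun x => x) hU contMDiffOn_id hg hli hX hmem

lemma SmoothVF.exists_open_linearIndependent [FiniteDimensional ℝ V] {g : ι → VField V M}
    {U : Set M} (hU : IsOpen U) (hg : ∀ i, SmoothVF U (g i)) {x : M} (hx : x ∈ U)
    (hli : LinearIndependent ℝ fun i => g i x) :
    ∃ N : Set M, IsOpen N ∧ x ∈ N ∧ N ⊆ U ∧ ∀ w ∈ N, LinearIndependent ℝ fun i => g i w :=
  TwoThreeFive.exists_open_linearIndependent (p := fun x => x) hU contMDiffOn_id hg hx hli

end Coefficients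

end VectorFields

/-! ### Derivatives of local diffeomorphisms. -/

section Diffeomorphisms

variable {V : Type*} [NormedAddCommGroup V] [NormedSpace ℝ V]
variable {M : Type*} [TopologicalSpace M] [ChartedSpace V M]
variable {V' : Type*} [NormedAddCommGroup V'] [NormedSpace ℝ V']
variable {M' : Type*} [TopologicalSpace M'] [ChartedSpace V' M']

lemma IsDiffeo.mfderiv_symm_apply {φ : OpenPartialHomeomorph M M'} (h : IsDiffeo V V' φ) {x : M}
    (hx : x ∈ φ.source) (v : TangentSpace 𝓘(ℝ, V) x) :
    mfderiv 𝓘(ℝ, V') 𝓘(ℝ, V) φ.symm (φ x) (mfderiv 𝓘(ℝ, V) 𝓘(ℝ, V') φ x v) = v := by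
  have h1 := mfderiv_comp x (h.symm.mdifferentiableAt (φ.map_source hx)) (h.mdifferentiableAt hx)
  have h2 : mfderiv 𝓘(ℝ, V) 𝓘(ℝ, V) (φ.symm ∘ φ) x = mfderiv 𝓘(ℝ, V) 𝓘(ℝ, V) id x :=
    Filter.EventuallyEq.mfderiv_eq (φ.eventually_left_inverse hx)
  rw [h1, mfderiv_id] at h2
  exact congrArg (fun A : V →L[ℝ] V => A v) h2

lemma IsDiffeo.mfderiv_apply_symm {φ : OpenPartialHomeomorph M M'} (h : IsDiffeo V V' φ) {x : M}
    (hx : x ∈ φ.source) (v : TangentSpace 𝓘(ℝ, V') (φ x)) :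
    mfderiv 𝓘(ℝ, V) 𝓘(ℝ, V') φ x (mfderiv 𝓘(ℝ, V') 𝓘(ℝ, V) φ.symm (φ x) v) = v := by
  have := h.symm.mfderiv_symm_apply (φ.map_source hx) v
  rw [OpenPartialHomeomorph.symm_symm] at this
  rw [φ.left_inv hx] at this
  exact this

lemma IsDiffeo.mfderiv_injective {φ : OpenPartialHomeomorph M M'} (h : IsDiffeo V V' φ) {x : M}
    (hx : x ∈ φ.source) : Function.Injective (mfderiv 𝓘(ℝ, V) 𝓘(ℝ, V') φ x) :=
  Function.LeftInverse.injective (h.mfderiv_symm_apply hx)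

lemma IsDiffeo.mfderiv_surjective {φ : OpenPartialHomeomorph M M'} (h : IsDiffeo V V' φ) {x : M}
    (hx : x ∈ φ.source) : Function.Surjective (mfderiv 𝓘(ℝ, V) 𝓘(ℝ, V') φ x) :=
  Function.RightInverse.surjective (h.mfderiv_apply_symm hx)

lemma IsDiffeo.isInvertible_mfderiv {φ : OpenPartialHomeomorph M M'} (h : IsDiffeo V V' φ) {x : M}
    (hx : x ∈ φ.source) : (mfderiv 𝓘(ℝ, V) 𝓘(ℝ, V') φ x).IsInvertible :=
  ContinuousLinearMap.IsInvertible.of_inverse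
    (ContinuousLinearMap.ext fun v => h.mfderiv_apply_symm hx v)
    (ContinuousLinearMap.ext fun v => h.mfderiv_symm_apply hx v)

lemma isDiffeo_chartAt [IsManifold 𝓘(ℝ, V) ∞ M] (x : M) : IsDiffeo V V (chartAt V x) :=
  ⟨contMDiffOn_chart, contMDiffOn_chart_symm⟩

end Diffeomorphisms

/-! ### Derivatives along brackets and brackets of related fields. -/

section Related

variable {V : Type*} [NormedAddCommGroup V] [NormedSpace ℝ V] [CompleteSpace V]
variable {M : Type*} [TopologicalSpace M] [ChartedSpace V M] [IsManifold 𝓘(ℝ, V) ∞ M]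
variable {V' : Type*} [NormedAddCommGroup V'] [NormedSpace ℝ V'] [CompleteSpace V']
variable {M' : Type*} [TopologicalSpace M'] [ChartedSpace V' M'] [IsManifold 𝓘(ℝ, V') ∞ M']
variable {F : Type*} [NormedAddCommGroup F] [NormedSpace ℝ F]

/-- The derivative of a vector valued function along a vector field. -/
def dirDerivV (h : M → F) (X : VField V M) : M → F := fun w => mvfderiv 𝓘(ℝ, V) h w (X w)

lemma contMDiffOn_dirDerivV {U : Set M} (hU : IsOpen U) {h : M → F}
    (hh : ContMDiffOn 𝓘(ℝ, V) 𝓘(ℝ, F) ∞ h U) {X : VField V M} (hX : SmoothVF U X) :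
    ContMDiffOn 𝓘(ℝ, V) 𝓘(ℝ, F) ∞ (dirDerivV h X) U :=
  (contMDiff_snd_tangentBundle_modelSpace F 𝓘(ℝ, F)).comp_contMDiffOn
    (SmoothVF.mfderiv_apply hU hh hX)

/-- The derivative of a function along a Lie bracket. -/
lemma dirDerivV_lieB {U : Set M} (hU : IsOpen U) {h : M → F}
    (hh : ContMDiffOn 𝓘(ℝ, V) 𝓘(ℝ, F) ∞ h U) {X Y : VField V M} (hX : SmoothVF U X)
    (hY : SmoothVF U Y) {x : M} (hx : x ∈ U) :
    dirDerivV h (lieB X Y) x = dirDerivV (dirDerivV h Y) X x - dirDerivV (dirDerivV h X) Y x := by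
  have hφ := isDiffeo_chartAt (V := V) x
  set φ := chartAt V x with hφdef
  set f : V → M := ⇑φ.symm with hf
  set q₀ : V := φ x with hq₀
  have hxs : x ∈ φ.source := mem_chart_source V x
  have hq : q₀ ∈ φ.target := φ.map_source hxs
  have hfx : f q₀ = x := φ.left_inv hxs
  let N : Set V := φ.target ∩ f ⁻¹' U
  have hN : IsOpen N := φ.isOpen_inter_preimage_symm hU
  have hqN : q₀ ∈ N := ⟨hq, by rw [mem_preimage, hfx]; exact hx⟩
  have hfs : ContMDiffOn 𝓘(ℝ, V) 𝓘(ℝ, V) ∞ f φ.target := hφ.2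
  have hfat : ∀ q ∈ N, ContMDiffAt 𝓘(ℝ, V) 𝓘(ℝ, V) ∞ f q := fun q hq =>
    hfs.contMDiffAt (φ.open_target.mem_nhds hq.1)
  have hinv : ∀ q ∈ N, (mfderiv 𝓘(ℝ, V) 𝓘(ℝ, V) f q).IsInvertible := fun q hq =>
    hφ.symm.isInvertible_mfderiv hq.1
  have hm : IsManifold 𝓘(ℝ, V) 2 M := isManifold_two
  have hm' : IsManifold 𝓘(ℝ, V) (minSmoothness ℝ 2) M := by
    rw [minSmoothness_of_isRCLikeNormedField]
    exact hm
  -- Pulled back by the inverse chart, the fields live on an open set of `V`. There the claim is the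
  -- symmetry of the second derivative of `h ∘ f`.
  let pb : VField V M → V → V := fun Z => VectorField.mpullback 𝓘(ℝ, V) 𝓘(ℝ, V) f Z
  -- chain rule
  have chain : ∀ (g : M → F), (∀ w ∈ U, MDifferentiableAt 𝓘(ℝ, V) 𝓘(ℝ, F) g w) →
      ∀ (Z : VField V M), ∀ q ∈ N, fderiv ℝ (g ∘ f) q (pb Z q) = dirDerivV g Z (f q) := by
    intro g hg Z q hq
    have h1 := mfderiv_comp q (hg _ hq.2) ((hfat q hq).mdifferentiableAt (by simp))
    rw [← mfderiv_eq_fderiv, h1]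
    change mfderiv 𝓘(ℝ, V) 𝓘(ℝ, F) g (f q) (mfderiv 𝓘(ℝ, V) 𝓘(ℝ, V) f q
      ((mfderiv 𝓘(ℝ, V) 𝓘(ℝ, V) f q).inverse (Z (f q)))) = _
    obtain ⟨e, he⟩ := hinv q hq
    rw [← he, ContinuousLinearMap.inverse_equiv]
    simp only [ContinuousLinearEquiv.coe_coe, ContinuousLinearEquiv.apply_symm_apply]
    rfl
  have hpb : ∀ Z : VField V M, SmoothVF U Z → DifferentiableAt ℝ (pb Z) q₀ := by
    intro Z hZ
    have h1 : ContMDiffAt 𝓘(ℝ, V) 𝓘(ℝ, V).tangent 1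
        (fun q => (⟨q, pb Z q⟩ : TangentBundle 𝓘(ℝ, V) V)) q₀ := by
      refine ContMDiffAt.mpullback_vectorField_preimage (n := ∞) ?_ (hfat q₀ hqN) (hinv q₀ hqN)
        (WithTop.coe_le_coe.2 (le_top : (2 : ℕ∞) ≤ ⊤))
      refine (ContMDiffOn.contMDiffAt hZ (hU.mem_nhds hqN.2)).of_le ?_
      exact WithTop.coe_le_coe.2 (le_top : (1 : ℕ∞) ≤ ⊤)
    exact (contMDiffAt_vectorSpace_iff_contDiffAt.1 h1).differentiableAt one_ne_zero
  have hbr : pb (lieB X Y) q₀ = VectorField.lieBracket ℝ (pb X) (pb Y) q₀ := by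
    have h1 := VectorField.mpullback_mlieBracket (f := f) (x₀ := q₀) (n := ∞)
      (V := X) (W := Y) (I := 𝓘(ℝ, V)) (I' := 𝓘(ℝ, V))
      (hX.mdifferentiableAt hU hqN.2) (hY.mdifferentiableAt hU hqN.2) (hfat q₀ hqN)
      (by rw [minSmoothness_of_isRCLikeNormedField]
          exact WithTop.coe_le_coe.2 (le_top : (2 : ℕ∞) ≤ ⊤))
    refine h1.trans ?_
    rw [← VectorField.mlieBracketWithin_univ, VectorField.mlieBracketWithin_eq_lieBracketWithin]
    exact congrFun VectorField.lieBracketWithin_univ q₀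
  have hdiff : ∀ g : M → F, ContMDiffOn 𝓘(ℝ, V) 𝓘(ℝ, F) ∞ g U →
      ∀ w ∈ U, MDifferentiableAt 𝓘(ℝ, V) 𝓘(ℝ, F) g w := fun g hg w hw =>
    (hg.contMDiffAt (hU.mem_nhds hw)).mdifferentiableAt (by simp)
  have hhat : ContDiffAt ℝ ∞ (h ∘ f) q₀ := by
    rw [← contMDiffAt_iff_contDiffAt]
    exact (hh.contMDiffAt (hU.mem_nhds hqN.2)).comp q₀ (hfat q₀ hqN)
  have h2 := VectorField.fderiv_apply_lieBracket (f := h ∘ f) (x := q₀) hhat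
    (by rw [minSmoothness_of_isRCLikeNormedField]
        exact WithTop.coe_le_coe.2 (le_top : (2 : ℕ∞) ≤ ⊤)) (hpb Y hY) (hpb X hX)
  have h3 : ∀ Z W : VField V M, SmoothVF U Z →
      fderiv ℝ (fun q => fderiv ℝ (h ∘ f) q (pb Z q)) q₀ (pb W q₀) =
        dirDerivV (dirDerivV h Z) W x := by
    intro Z W hZ
    have h4 : (fun q => fderiv ℝ (h ∘ f) q (pb Z q)) =ᶠ[𝓝 q₀] (dirDerivV h Z) ∘ f :=
      Filter.eventually_of_mem (hN.mem_nhds hqN) fun q hq => chain h (hdiff h hh) Z q hq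
    rw [h4.fderiv_eq, chain _ (hdiff _ (contMDiffOn_dirDerivV hU hh hZ)) W q₀ hqN, hfx]
  rw [h3 Y X hY, h3 X Y hX, ← hbr, chain h (hdiff h hh) _ q₀ hqN, hfx] at h2
  exact h2

/-- Vector fields related by a map have related Lie brackets. -/
lemma mfderiv_lieB {U : Set M} (hU : IsOpen U) {U' : Set M'} (hU' : IsOpen U') {f : M → M'}
    (hf : ContMDiffOn 𝓘(ℝ, V) 𝓘(ℝ, V') ∞ f U) (hfU : MapsTo f U U') {X Y : VField V M}
    {X' Y' : VField V' M'} (hX : SmoothVF U X) (hY : SmoothVF U Y)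
    (hX' : SmoothVF U' X') (hY' : SmoothVF U' Y')
    (hXX' : ∀ w ∈ U, mfderiv 𝓘(ℝ, V) 𝓘(ℝ, V') f w (X w) = X' (f w))
    (hYY' : ∀ w ∈ U, mfderiv 𝓘(ℝ, V) 𝓘(ℝ, V') f w (Y w) = Y' (f w)) {x : M} (hx : x ∈ U) :
    mfderiv 𝓘(ℝ, V) 𝓘(ℝ, V') f x (lieB X Y x) = lieB X' Y' (f x) := by
  -- A tangent vector at `f x` is determined by the derivative of the chart `ψ` along it. So it
  -- suffices to compare the derivatives of `ψ` along both sides, using `dirDerivV_lieB` upstairs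
  -- for `ψ ∘ f` and downstairs for `ψ`.
  have hψ := isDiffeo_chartAt (V := V') (f x)
  set ψ := chartAt V' (f x) with hψdef
  have hxs : f x ∈ ψ.source := mem_chart_source V' (f x)
  let O' : Set M' := U' ∩ ψ.source
  have hO' : IsOpen O' := hU'.inter ψ.open_source
  let O : Set M := U ∩ f ⁻¹' ψ.source
  have hO : IsOpen O := hf.continuousOn.isOpen_inter_preimage hU ψ.open_source
  have hxO : x ∈ O := ⟨hx, hxs⟩
  have hfO : MapsTo f O O' := fun w hw => ⟨hfU hw.1, hw.2⟩
  have hψO : ContMDiffOn 𝓘(ℝ, V') 𝓘(ℝ, V') ∞ ψ O' := hψ.1.mono inter_subset_right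
  have hfO' : ContMDiffOn 𝓘(ℝ, V) 𝓘(ℝ, V') ∞ f O := hf.mono inter_subset_left
  have hdf : ∀ w ∈ O, MDifferentiableAt 𝓘(ℝ, V) 𝓘(ℝ, V') f w := fun w hw =>
    (hfO'.contMDiffAt (hO.mem_nhds hw)).mdifferentiableAt (by simp)
  have chain : ∀ g : M' → V', ContMDiffOn 𝓘(ℝ, V') 𝓘(ℝ, V') ∞ g O' →
      ∀ (Z : VField V M), ∀ w ∈ O, dirDerivV (g ∘ f) Z w =
        mfderiv 𝓘(ℝ, V') 𝓘(ℝ, V') g (f w) (mfderiv 𝓘(ℝ, V) 𝓘(ℝ, V') f w (Z w)) := by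
    intro g hg Z w hw
    have h1 := mfderiv_comp w ((hg.contMDiffAt (hO'.mem_nhds (hfO hw))).mdifferentiableAt
      (by simp)) (hdf w hw)
    change mfderiv 𝓘(ℝ, V) 𝓘(ℝ, V') (g ∘ f) w (Z w) = _
    rw [h1]
    rfl
  have hcongr : ∀ (g g' : M → V') (Z : VField V M), (∀ w ∈ O, g w = g' w) →
      dirDerivV g Z x = dirDerivV g' Z x := by
    intro g g' Z h
    have : mfderiv 𝓘(ℝ, V) 𝓘(ℝ, V') g x = mfderiv 𝓘(ℝ, V) 𝓘(ℝ, V') g' x :=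
      Filter.EventuallyEq.mfderiv_eq (Filter.eventually_of_mem (hO.mem_nhds hxO) h)
    exact congrArg (fun A : V →L[ℝ] V' => A (Z x)) this
  have hXO' := hX'.mono (U' := O') inter_subset_left
  have hYO' := hY'.mono (U' := O') inter_subset_left
  have h1 := dirDerivV_lieB hO (hψO.comp hfO' hfO) (hX.mono inter_subset_left)
    (hY.mono inter_subset_left) hxO
  rw [hcongr _ (dirDerivV ψ Y' ∘ f) X (fun w hw => by
      rw [chain ψ hψO Y w hw, hYY' w hw.1]; rfl),
    hcongr _ (dirDerivV ψ X' ∘ f) Y (fun w hw => by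
      rw [chain ψ hψO X w hw, hXX' w hw.1]; rfl),
    chain _ (contMDiffOn_dirDerivV hO' hψO hYO') X x hxO,
    chain _ (contMDiffOn_dirDerivV hO' hψO hXO') Y x hxO,
    chain ψ hψO _ x hxO, hXX' x hx, hYY' x hx] at h1
  have h2 := dirDerivV_lieB hO' hψO hXO' hYO' (hfO hxO)
  exact hψ.mfderiv_injective hxs (h1.trans h2.symm)

end Related

/-! ### Fields of subspaces, frames and the bracket of distributions. -/

section Brackets

variable {V : Type*} [NormedAddCommGroup V] [NormedSpace ℝ V]
variable {M : Type*} [TopologicalSpace M] [ChartedSpace V M] [IsManifold 𝓘(ℝ, V) ∞ M]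
variable {V' : Type*} [NormedAddCommGroup V'] [NormedSpace ℝ V']
variable {M' : Type*} [TopologicalSpace M'] [ChartedSpace V' M'] [IsManifold 𝓘(ℝ, V') ∞ M']

lemma le_bracket_left (A B : SubspaceField V M) (x : M) : A x ≤ bracket A B x :=
  le_sup_left.trans le_sup_left

lemma le_bracket_right (A B : SubspaceField V M) (x : M) : B x ≤ bracket A B x :=
  le_sup_right.trans le_sup_left

lemma IsSectionOn.mono {A : SubspaceField V M} {U U' : Set M} {X : VField V M}
    (h : IsSectionOn A U X) (hU : U' ⊆ U) : IsSectionOn A U' X :=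
  ⟨h.1.mono hU, fun x hx => h.2 x (hU hx)⟩

lemma lieB_mem_bracket {A B : SubspaceField V M} {U : Set M} (hU : IsOpen U) {X Y : VField V M}
    (hX : IsSectionOn A U X) (hY : IsSectionOn B U Y) {x : M} (hx : x ∈ U) :
    lieB X Y x ∈ bracket A B x :=
  (le_sup_right : _ ≤ bracket A B x) (Submodule.subset_span ⟨U, hU, hx, X, Y, hX, hY, rfl⟩)

/-- The field of subspaces spanned by vector fields. -/
def spanField {ι : Type*} (g : ι → VField V M) : SubspaceField V M :=
  fun x => Submodule.span ℝ (Set.range fun i => g i x)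

lemma mem_spanField {ι : Type*} (g : ι → VField V M) (i : ι) (x : M) : g i x ∈ spanField g x :=
  Submodule.subset_span ⟨i, rfl⟩

lemma spanField_le {ι : Type*} {g : ι → VField V M} {x : M}
    {S : Submodule ℝ (TangentSpace 𝓘(ℝ, V) x)} (h : ∀ i, g i x ∈ S) : spanField g x ≤ S :=
  Submodule.span_le.2 (by rintro _ ⟨i, rfl⟩; exact h i)

/-- The smooth vector fields `g i` form a frame of `A` over the open set `U`. -/
structure IsFrameOn {ι : Type*} (A : SubspaceField V M) (U : Set M) (g : ι → VField V M) :
    Prop where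
  isOpen : IsOpen U
  smooth : ∀ i, SmoothVF U (g i)
  indep : ∀ x ∈ U, LinearIndependent ℝ fun i => g i x
  eq : ∀ x ∈ U, A x = spanField g x

lemma IsFrameOn.mono {ι : Type*} {A : SubspaceField V M} {U U' : Set M} {g : ι → VField V M}
    (h : IsFrameOn A U g) (hU' : IsOpen U') (hU : U' ⊆ U) : IsFrameOn A U' g :=
  ⟨hU', fun i => (h.smooth i).mono hU, fun x hx => h.indep x (hU hx), fun x hx => h.eq x (hU hx)⟩

lemma IsFrameOn.isSectionOn {ι : Type*} {A : SubspaceField V M} {U : Set M} {g : ι → VField V M}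
    (h : IsFrameOn A U g) (i : ι) : IsSectionOn A U (g i) :=
  ⟨h.smooth i, fun x hx => h.eq x hx ▸ mem_spanField g i x⟩

lemma IsDistribution.exists_frame {r : ℕ} {A : SubspaceField V M} (h : IsDistribution r A)
    (x : M) : ∃ U : Set M, x ∈ U ∧ ∃ g : Fin r → VField V M, IsFrameOn A U g := by
  obtain ⟨U, hU, hx, s, hs, hsA⟩ := h x
  exact ⟨U, hx, s, hU, fun i => (hs i).1, fun y hy => (hsA y hy).1, fun y hy => (hsA y hy).2⟩

lemma isDistribution_of_frames {r : ℕ} {A : SubspaceField V M}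
    (h : ∀ x, ∃ U : Set M, x ∈ U ∧ ∃ g : Fin r → VField V M, IsFrameOn A U g) :
    IsDistribution r A := by
  intro x
  obtain ⟨U, hx, g, hg⟩ := h x
  exact ⟨U, hg.isOpen, hx, g, hg.isSectionOn, fun y hy => ⟨hg.indep y hy, hg.eq y hy⟩⟩

variable [CompleteSpace V] [FiniteDimensional ℝ V]

lemma IsFrameOn.smoothComb {ι : Type*} [Fintype ι] {A : SubspaceField V M} {U U' : Set M}
    {g : ι → VField V M} (h : IsFrameOn A U g) (hU' : IsOpen U') (hU : U' ⊆ U) {X : VField V M}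
    (hX : IsSectionOn A U' X) : SmoothComb g U' X :=
  smoothComb_of_mem_span hU' (fun i => (h.smooth i).mono hU) (fun x hx => h.indep x (hU hx)) hX.1
    (fun x hx => (h.eq x (hU hx)).le (hX.2 x hx))

/-- Local sections are smooth combinations of the frames, so the Leibniz rule reduces all their
brackets at `x` to finitely many. This makes `bracket` computable. -/
lemma IsFrameOn.bracket_le {ι κ : Type*} [Fintype ι] [Fintype κ] {A B : SubspaceField V M}
    {U : Set M} {g : ι → VField V M} {h : κ → VField V M} (hA : IsFrameOn A U g)
    (hB : IsFrameOn B U h) {x : M} (hx : x ∈ U) {S : Submodule ℝ (TangentSpace 𝓘(ℝ, V) x)}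
    (hg : ∀ i, g i x ∈ S) (hh : ∀ i, h i x ∈ S) (hS : ∀ i j, lieB (g i) (h j) x ∈ S) :
    bracket A B x ≤ S := by
  refine sup_le (sup_le ?_ ?_) (Submodule.span_le.2 ?_)
  · rw [hA.eq x hx]; exact spanField_le hg
  · rw [hB.eq x hx]; exact spanField_le hh
  · rintro v ⟨W, hW, hxW, X, Y, hX, hY, rfl⟩
    have hO := hA.isOpen.inter hW
    exact SmoothComb.lieB_mem hO
      (hA.smoothComb hO inter_subset_left (hX.mono inter_subset_right))
      (hB.smoothComb hO inter_subset_left (hY.mono inter_subset_right))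
      (fun i => (hA.smooth i).mono inter_subset_left)
      (fun i => (hB.smooth i).mono inter_subset_left) ⟨hx, hxW⟩ hg hh hS

end Brackets

/-! ### Invariance of brackets, derived systems and characteristic directions under diffeomorphisms.
-/

section Naturality

variable {V : Type*} [NormedAddCommGroup V] [NormedSpace ℝ V] [CompleteSpace V]
variable {M : Type*} [TopologicalSpace M] [ChartedSpace V M] [IsManifold 𝓘(ℝ, V) ∞ M]
variable {V' : Type*} [NormedAddCommGroup V'] [NormedSpace ℝ V'] [CompleteSpace V']
variable {M' : Type*} [TopologicalSpace M'] [ChartedSpace V' M'] [IsManifold 𝓘(ℝ, V') ∞ M']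

/-- The image of a vector field under a local diffeomorphism. -/
def pushVF (φ : OpenPartialHomeomorph M M') (X : VField V M) : VField V' M' := fun y =>
  -- The vector lives in the tangent space at `φ (φ.symm y)`; reading it in the model space avoids a
  -- transport to `y`.
  (fun w => (mfderiv 𝓘(ℝ, V) 𝓘(ℝ, V') φ w (X w) : V')) (φ.symm y)

lemma pushVF_apply (φ : OpenPartialHomeomorph M M') (X : VField V M) {w : M}
    (hw : w ∈ φ.source) :
    (pushVF φ X : VField V' M') (φ w) = mfderiv 𝓘(ℝ, V) 𝓘(ℝ, V') φ w (X w) := by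
  unfold pushVF
  rw [φ.left_inv hw]

lemma SmoothVF.pushVF {φ : OpenPartialHomeomorph M M'} (hφ : IsDiffeo V V' φ) {U : Set M}
    (hU : IsOpen U) (hUφ : U ⊆ φ.source) {X : VField V M} (hX : SmoothVF U X) :
    SmoothVF (φ.target ∩ φ.symm ⁻¹' U) (pushVF φ X : VField V' M') := by
  have h := SmoothVF.mfderiv_apply hU (hφ.1.mono hUφ) hX
  have h2 := ContMDiffOn.comp (t := U) h (hφ.2.mono (inter_subset_left (t := φ.symm ⁻¹' U)))
    (fun y hy => hy.2)
  refine h2.congr fun y hy => ?_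
  obtain ⟨w, hw, rfl⟩ : ∃ w ∈ φ.source, φ w = y :=
    ⟨φ.symm y, φ.map_target hy.1, φ.right_inv hy.1⟩
  simp only [Function.comp_apply]
  rw [pushVF_apply φ X hw, φ.left_inv hw]

lemma IsSectionOn.pushVF {φ : OpenPartialHomeomorph M M'} (hφ : IsDiffeo V V' φ) {U : Set M}
    (hU : IsOpen U) (hUφ : U ⊆ φ.source) {A : SubspaceField V M} {A' : SubspaceField V' M'}
    (hA : Carries φ A A') {X : VField V M} (hX : IsSectionOn A U X) :
    IsSectionOn A' (φ.target ∩ φ.symm ⁻¹' U) (pushVF φ X) := by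
  refine ⟨SmoothVF.pushVF hφ hU hUφ hX.1, fun y hy => ?_⟩
  obtain ⟨w, hw, rfl⟩ : ∃ w ∈ φ.source, φ w = y :=
    ⟨φ.symm y, φ.map_target hy.1, φ.right_inv hy.1⟩
  rw [pushVF_apply φ X hw, ← hA w hw]
  have hwU : w ∈ U := by
    have := hy.2
    rwa [mem_preimage, φ.left_inv hw] at this
  exact Submodule.mem_map_of_mem (hX.2 w hwU)

lemma mfderiv_lieB_pushVF {φ : OpenPartialHomeomorph M M'} (hφ : IsDiffeo V V' φ) {U : Set M}
    (hU : IsOpen U) (hUφ : U ⊆ φ.source) {X Y : VField V M} (hX : SmoothVF U X)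
    (hY : SmoothVF U Y) {w : M} (hw : w ∈ U) :
    mfderiv 𝓘(ℝ, V) 𝓘(ℝ, V') φ w (lieB X Y w) =
      lieB (pushVF φ X : VField V' M') (pushVF φ Y) (φ w) :=
  mfderiv_lieB hU (φ.isOpen_inter_preimage_symm hU) (hφ.1.mono hUφ)
    (fun w hw => ⟨φ.map_source (hUφ hw), by rwa [mem_preimage, φ.left_inv (hUφ hw)]⟩) hX hY
    (SmoothVF.pushVF hφ hU hUφ hX) (SmoothVF.pushVF hφ hU hUφ hY)
    (fun w hw => (pushVF_apply φ X (hUφ hw)).symm)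
    (fun w hw => (pushVF_apply φ Y (hUφ hw)).symm) hw

/-- An inclusion of fields of subspaces that holds for all diffeomorphisms is an equality. -/
lemma carries_of_push_le {φ : OpenPartialHomeomorph M M'} (hφ : IsDiffeo V V' φ)
    {A : SubspaceField V M} {A' : SubspaceField V' M'}
    (h : ∀ x ∈ φ.source, push V V' φ x (A x) ≤ A' (φ x))
    (h' : ∀ y ∈ φ.target, push V' V φ.symm y (A' y) ≤ A (φ.symm y)) : Carries φ A A' := by
  intro x hx
  refine le_antisymm (h x hx) fun v hv => ?_
  have h1 : mfderiv 𝓘(ℝ, V') 𝓘(ℝ, V) φ.symm (φ x) v ∈ A (φ.symm (φ x)) :=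
    h' _ (φ.map_source hx) (Submodule.mem_map_of_mem hv)
  have h2 : (mfderiv 𝓘(ℝ, V') 𝓘(ℝ, V) φ.symm (φ x) v : V) ∈ A x := by
    -- The inverse lands over `φ.symm (φ x)`, which equals `x` only propositionally; membership is
    -- moved along this equality in the model space.
    have key : ∀ z, z = x → ∀ u : V, u ∈ A z → u ∈ A x := by rintro z rfl u hu; exact hu
    exact key _ (φ.left_inv hx) _ h1
  have h3 := Submodule.mem_map_of_mem (f := (mfderiv 𝓘(ℝ, V) 𝓘(ℝ, V') φ x).toLinearMap) h2
  have h4 : (mfderiv 𝓘(ℝ, V) 𝓘(ℝ, V') φ x).toLinearMap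
      (mfderiv 𝓘(ℝ, V') 𝓘(ℝ, V) φ.symm (φ x) v) = v := hφ.mfderiv_apply_symm hx v
  rw [h4] at h3
  exact h3

/-- Pushing forward local sections gives local sections, and related fields have related brackets.
Only an inclusion is proved, because the inverse diffeomorphism supplies the other one. -/
lemma push_bracket_le {φ : OpenPartialHomeomorph M M'} (hφ : IsDiffeo V V' φ)
    {A B : SubspaceField V M} {A' B' : SubspaceField V' M'} (hA : Carries φ A A')
    (hB : Carries φ B B') {x : M} (hx : x ∈ φ.source) :
    push V V' φ x (bracket A B x) ≤ bracket A' B' (φ x) := by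
  unfold push
  rw [Submodule.map_le_iff_le_comap]
  refine sup_le (sup_le ?_ ?_) (Submodule.span_le.2 ?_)
  · rw [← Submodule.map_le_iff_le_comap]
    exact (hA x hx).le.trans (le_bracket_left A' B' (φ x))
  · rw [← Submodule.map_le_iff_le_comap]
    exact (hB x hx).le.trans (le_bracket_right A' B' (φ x))
  · rintro v ⟨W, hW, hxW, X, Y, hX, hY, rfl⟩
    have hO : IsOpen (W ∩ φ.source) := hW.inter φ.open_source
    change mfderiv 𝓘(ℝ, V) 𝓘(ℝ, V') φ x (lieB X Y x) ∈ bracket A' B' (φ x)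
    rw [mfderiv_lieB_pushVF hφ hO inter_subset_right (hX.1.mono inter_subset_left)
      (hY.1.mono inter_subset_left) ⟨hxW, hx⟩]
    exact lieB_mem_bracket (φ.isOpen_inter_preimage_symm hO)
      (IsSectionOn.pushVF hφ hO inter_subset_right hA (hX.mono inter_subset_left))
      (IsSectionOn.pushVF hφ hO inter_subset_right hB (hY.mono inter_subset_left))
      ⟨φ.map_source hx, by rw [mem_preimage, φ.left_inv hx]; exact ⟨hxW, hx⟩⟩

lemma Carries.bracket {φ : OpenPartialHomeomorph M M'} (hφ : IsDiffeo V V' φ)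
    {A B : SubspaceField V M} {A' B' : SubspaceField V' M'} (hA : Carries φ A A')
    (hB : Carries φ B B') : Carries φ (bracket A B) (bracket A' B') :=
  carries_of_push_le hφ (fun _ hx => push_bracket_le hφ hA hB hx)
    (fun _ hy => push_bracket_le hφ.symm (hA.symm hφ) (hB.symm hφ) hy)

lemma Carries.derived {φ : OpenPartialHomeomorph M M'} (hφ : IsDiffeo V V' φ)
    {E : SubspaceField V M} {E' : SubspaceField V' M'} (hE : Carries φ E E') (k : ℕ) :
    Carries φ (derived E k) (derived E' k) := by
  induction k with
  | zero => exact hE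
  | succ k ih => exact Carries.bracket hφ hE ih

lemma Carries.sumField {φ : OpenPartialHomeomorph M M'} {A B : SubspaceField V M}
    {A' B' : SubspaceField V' M'} (hA : Carries φ A A') (hB : Carries φ B B') :
    Carries φ (sumField A B) (sumField A' B') := by
  intro x hx
  have h1 := hA x hx
  have h2 := hB x hx
  unfold push at h1 h2 ⊢
  unfold TwoThreeFive.sumField
  rw [Submodule.map_sup, h1, h2]

/-- The directions in `E` along which `F` is infinitesimally invariant. -/
def charDir (E F : SubspaceField V M) : SubspaceField V M := fun z => Submodule.span ℝ
  {v | ∃ U : Set M, IsOpen U ∧ z ∈ U ∧ ∃ X : VField V M, IsSectionOn E U X ∧ X z = v ∧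
    ∀ W : Set M, IsOpen W → z ∈ W → ∀ Y : VField V M, IsSectionOn F W Y → lieB X Y z ∈ F z}

/-- A witness `X` is pushed forward. Its invariance property is tested by pulling the test section
back to the source, where the property of `X` applies. -/
lemma push_charDir_le {φ : OpenPartialHomeomorph M M'} (hφ : IsDiffeo V V' φ)
    {E F : SubspaceField V M} {E' F' : SubspaceField V' M'} (hE : Carries φ E E')
    (hF : Carries φ F F') {x : M} (hx : x ∈ φ.source) :
    push V V' φ x (charDir E F x) ≤ charDir E' F' (φ x) := by
  unfold push
  rw [Submodule.map_le_iff_le_comap]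
  refine Submodule.span_le.2 ?_
  rintro v ⟨U, hU, hxU, X, hX, rfl, hXF⟩
  have hO : IsOpen (U ∩ φ.source) := hU.inter φ.open_source
  refine Submodule.subset_span ⟨_, φ.isOpen_inter_preimage_symm hO,
    ⟨φ.map_source hx, by rw [mem_preimage, φ.left_inv hx]; exact ⟨hxU, hx⟩⟩, pushVF φ X,
    IsSectionOn.pushVF hφ hO inter_subset_right hE (hX.mono inter_subset_left),
    pushVF_apply φ X hx, fun W hW hxW Y hY => ?_⟩
  -- The test section on the target, transported back.
  let Y₀ : VField V M := pushVF φ.symm Y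
  have hOW : IsOpen (φ.target ∩ W) := φ.open_target.inter hW
  have hY₀ : IsSectionOn F (φ.source ∩ φ ⁻¹' (φ.target ∩ W)) Y₀ := by
    have := IsSectionOn.pushVF hφ.symm hOW inter_subset_left (hF.symm hφ)
      (hY.mono inter_subset_right)
    simpa using this
  let O : Set M := U ∩ (φ.source ∩ φ ⁻¹' (φ.target ∩ W))
  have hO' : IsOpen O := hU.inter (φ.isOpen_inter_preimage hOW)
  have hxO : x ∈ O := ⟨hxU, hx, φ.map_source hx, hxW⟩
  have hrel : ∀ w ∈ O, mfderiv 𝓘(ℝ, V) 𝓘(ℝ, V') φ w (Y₀ w) = Y (φ w) := by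
    intro w hw
    have h1 := pushVF_apply (V := V') (V' := V) φ.symm Y (w := φ w) (φ.map_source hw.2.1)
    have h2 : Y₀ w = mfderiv 𝓘(ℝ, V') 𝓘(ℝ, V) φ.symm (φ w) (Y (φ w)) := by
      have key : ∀ z, z = w → ∀ u : V, (Y₀ z : V) = u → (Y₀ w : V) = u := by
        rintro z rfl u hu; exact hu
      exact key _ (φ.left_inv hw.2.1) _ h1
    rw [h2]
    exact hφ.mfderiv_apply_symm hw.2.1 _
  have hOφ : O ⊆ φ.source := fun w hw => hw.2.1
  have hsub : φ.target ∩ φ.symm ⁻¹' O ⊆ W := by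
    rintro y ⟨hy, hyO⟩
    have := hyO.2.2.2
    rwa [φ.right_inv hy] at this
  have hb := mfderiv_lieB hO' (φ.isOpen_inter_preimage_symm hO') (hφ.1.mono hOφ)
    (fun w hw => ⟨φ.map_source (hOφ hw), by rwa [mem_preimage, φ.left_inv (hOφ hw)]⟩)
    (hX.1.mono inter_subset_left) (hY₀.1.mono inter_subset_right)
    (SmoothVF.pushVF hφ hO' hOφ (hX.1.mono inter_subset_left)) (hY.1.mono hsub)
    (fun w hw => (pushVF_apply φ X (hOφ hw)).symm) hrel hxO
  rw [← hb, ← hF x hx]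
  exact Submodule.mem_map_of_mem (hXF O hO' hxO Y₀ (hY₀.mono inter_subset_right))

lemma Carries.charDir {φ : OpenPartialHomeomorph M M'} (hφ : IsDiffeo V V' φ)
    {E F : SubspaceField V M} {E' F' : SubspaceField V' M'} (hE : Carries φ E E')
    (hF : Carries φ F F') : Carries φ (charDir E F) (charDir E' F') :=
  carries_of_push_le hφ (fun _ hx => push_charDir_le hφ hE hF hx)
    (fun _ hy => push_charDir_le hφ.symm (hE.symm hφ) (hF.symm hφ) hy)

end Naturality

/-! ### Lifting vector fields through submersions. -/

section Lifts

variable {V : Type*} [NormedAddCommGroup V] [NormedSpace ℝ V] [CompleteSpace V]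
variable {M : Type*} [TopologicalSpace M] [ChartedSpace V M] [IsManifold 𝓘(ℝ, V) ∞ M]
variable {V' : Type*} [NormedAddCommGroup V'] [NormedSpace ℝ V'] [FiniteDimensional ℝ V']
variable {M' : Type*} [TopologicalSpace M'] [ChartedSpace V' M'] [IsManifold 𝓘(ℝ, V') ∞ M']

lemma exists_smoothVF_extend {x : M} (v : TangentSpace 𝓘(ℝ, V) x) :
    ∃ N : Set M, IsOpen N ∧ x ∈ N ∧ ∃ X : VField V M, SmoothVF N X ∧ X x = v := by
  obtain ⟨s, hs, h⟩ := FiberBundle.exists_contMDiffOn_extend (I := 𝓘(ℝ, V)) (k := ∞) (F := V)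
    (V := (TangentSpace 𝓘(ℝ, V) : M → Type _)) v
  obtain ⟨N, hNs, hN, hxN⟩ := mem_nhds_iff.1 hs
  exact ⟨N, hN, hxN, _, h.mono hNs, FiberBundle.extend_apply_self V v⟩

/-- Sections along a submersion have smooth lifts. -/
lemma exists_lift {U : Set M} (hU : IsOpen U) {p : M → M'}
    (hp : ContMDiffOn 𝓘(ℝ, V) 𝓘(ℝ, V') ∞ p U) {x : M} (hx : x ∈ U)
    (hsurj : Function.Surjective (mfderiv 𝓘(ℝ, V) 𝓘(ℝ, V') p x))
    {Y : ∀ w, TangentSpace 𝓘(ℝ, V') (p w)} (hY : SmoothAlong (V := V) U p Y) :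
    ∃ N : Set M, IsOpen N ∧ x ∈ N ∧ N ⊆ U ∧ ∃ X : VField V M, SmoothVF N X ∧
      (∀ w ∈ N, mfderiv 𝓘(ℝ, V) 𝓘(ℝ, V') p w (X w) = Y w) ∧ (Y x = 0 → X x = 0) := by
  -- Preimages at `x` of a basis, extended smoothly, still push forward to a basis nearby. The lift
  -- uses the coefficients of `Y` in this moving basis, so it vanishes at `x` whenever `Y` does.
  let b := Module.finBasis ℝ V'
  choose k hk using fun i => hsurj (b i)
  choose N hN hxN e he hek using fun i => exists_smoothVF_extend (V := V) (x := x) (k i)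
  let O : Set M := U ∩ ⋂ i, N i
  have hO : IsOpen O := hU.inter (isOpen_iInter_of_finite hN)
  have hxO : x ∈ O := ⟨hx, mem_iInter.2 hxN⟩
  have heO : ∀ i, SmoothVF O (e i) := fun i =>
    (he i).mono (inter_subset_right.trans (iInter_subset N i))
  have hpO := hp.mono (inter_subset_left : O ⊆ U)
  have hge := fun i => SmoothVF.mfderiv_apply hO hpO (heO i)
  obtain ⟨W, hW, hxW, hWO, hli⟩ := exists_open_linearIndependent hO hpO hge hxO (by
    have : (fun i => mfderiv 𝓘(ℝ, V) 𝓘(ℝ, V') p x (e i x)) = b := by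
      ext i
      rw [hek, hk]
    rw [this]
    exact b.linearIndependent)
  have htop : ∀ w ∈ W, Submodule.span ℝ
      (Set.range fun i => mfderiv 𝓘(ℝ, V) 𝓘(ℝ, V') p w (e i w)) = ⊤ := fun w hw =>
    have : FiniteDimensional ℝ (TangentSpace 𝓘(ℝ, V') (p w)) :=
      inferInstanceAs (FiniteDimensional ℝ V')
    (hli w hw).span_eq_top_of_card_eq_finrank' (by rw [Fintype.card_fin]; rfl)
  obtain ⟨c, hc, hYc⟩ := exists_smooth_coeff hW (hpO.mono hWO) (fun i => (hge i).mono hWO) hli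
    (hY.mono (hWO.trans inter_subset_left)) (fun w hw => by rw [htop w hw]; trivial)
  refine ⟨W, hW, hxW, hWO.trans inter_subset_left, ∑ i, c i • e i,
    SmoothVF.sum fun i _ => ((heO i).mono hWO).smul (hc i), fun w hw => ?_, fun h0 => ?_⟩
  · rw [hYc w hw]
    simp only [Finset.sum_apply, Pi.smul_apply']
    rw [map_sum]
    simp
  · rw [hYc x hxW] at h0
    have := Fintype.linearIndependent_iff.1 (hli x hxW) _ h0
    simp [this]

/-- Vectors in the kernel of a submersion extend to smooth fields in the kernel. -/
lemma exists_kernel_extend {U : Set M} (hU : IsOpen U) {p : M → M'}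
    (hp : ContMDiffOn 𝓘(ℝ, V) 𝓘(ℝ, V') ∞ p U) {x : M} (hx : x ∈ U)
    (hsurj : Function.Surjective (mfderiv 𝓘(ℝ, V) 𝓘(ℝ, V') p x))
    {v : TangentSpace 𝓘(ℝ, V) x} (hv : mfderiv 𝓘(ℝ, V) 𝓘(ℝ, V') p x v = 0) :
    ∃ N : Set M, IsOpen N ∧ x ∈ N ∧ N ⊆ U ∧ ∃ X : VField V M, SmoothVF N X ∧
      (∀ w ∈ N, mfderiv 𝓘(ℝ, V) 𝓘(ℝ, V') p w (X w) = 0) ∧ X x = v := by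
  -- Any extension of `v` is corrected by a lift of its own push-forward. As the push-forward
  -- vanishes at `x`, so does the correction.
  obtain ⟨O, hO, hxO, Z, hZ, hZx⟩ := exists_smoothVF_extend (V := V) (x := x) v
  have hOU : IsOpen (U ∩ O) := hU.inter hO
  obtain ⟨N, hN, hxN, hNU, X, hX, hXZ, hX0⟩ := exists_lift hOU (hp.mono inter_subset_left)
    ⟨hx, hxO⟩ hsurj (SmoothVF.mfderiv_apply hOU (hp.mono inter_subset_left)
      (hZ.mono inter_subset_right))
  refine ⟨N, hN, hxN, hNU.trans inter_subset_left, Z - X,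
    (hZ.mono (hNU.trans inter_subset_right)).sub hX, fun w hw => ?_, ?_⟩
  · rw [Pi.sub_apply, map_sub, hXZ w hw, sub_self]
  · rw [Pi.sub_apply, hX0 (by rw [hZx, hv]), hZx, sub_zero]

end Lifts

/-! ### Adapted frames of pseudo-product structures. -/

section G2Frames

variable {V : Type*} [NormedAddCommGroup V] [NormedSpace ℝ V]
variable {M : Type*} [TopologicalSpace M] [ChartedSpace V M] [IsManifold 𝓘(ℝ, V) ∞ M]

/-- The span of the fields `f i`, `i ∈ s`. -/
def spanOn (f : Fin 6 → VField V M) (s : Finset (Fin 6)) : SubspaceField V M :=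
  spanField fun i : s => f i

/-- The indices below `k`. -/
def below (k : ℕ) : Finset (Fin 6) := Finset.univ.filter fun i => i.val < k

/-- The span of the first `k` of six vector fields. -/
def flag (f : Fin 6 → VField V M) (k : ℕ) : SubspaceField V M := spanOn f (below k)

lemma mem_below {k : ℕ} {i : Fin 6} : i ∈ below k ↔ i.val < k := by simp [below]

lemma mem_spanOn (f : Fin 6 → VField V M) {s : Finset (Fin 6)} {i : Fin 6} (hi : i ∈ s) (x : M) :
    f i x ∈ spanOn f s x := mem_spanField (fun i : s => f i) ⟨i, hi⟩ x

lemma spanOn_le {f : Fin 6 → VField V M} {s : Finset (Fin 6)} {x : M}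
    {S : Submodule ℝ (TangentSpace 𝓘(ℝ, V) x)} (h : ∀ i ∈ s, f i x ∈ S) : spanOn f s x ≤ S :=
  spanField_le fun i => h i i.2

lemma mem_flag (f : Fin 6 → VField V M) {k : ℕ} {i : Fin 6} (hi : i.val < k) (x : M) :
    f i x ∈ flag f k x := mem_spanOn f (mem_below.2 hi) x

lemma flag_le {f : Fin 6 → VField V M} {k : ℕ} {x : M}
    {S : Submodule ℝ (TangentSpace 𝓘(ℝ, V) x)} (h : ∀ i : Fin 6, i.val < k → f i x ∈ S) :
    flag f k x ≤ S := spanOn_le fun i hi => h i (mem_below.1 hi)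

lemma flag_mono (f : Fin 6 → VField V M) {k l : ℕ} (hkl : k ≤ l) (x : M) :
    flag f k x ≤ flag f l x := flag_le fun _ hi => mem_flag f (hi.trans_le hkl) x

lemma not_mem_flag {f : Fin 6 → VField V M} {x : M}
    (h : LinearIndependent ℝ fun i => f i x) (i : Fin 6) : f i x ∉ flag f i x := by
  have h1 := h.notMem_span_image (s := {j : Fin 6 | j.val < i.val}) (x := i) (by simp)
  intro h2
  refine h1 ?_
  refine (flag_le (S := Submodule.span ℝ _) fun j hj => ?_) h2
  exact Submodule.subset_span ⟨j, hj, rfl⟩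

lemma mem_sup_of_mem_sup {W : Type*} [AddCommGroup W] [Module ℝ W] {A B S : Submodule ℝ W} {v : W}
    (h : v ∈ A ⊔ S) : v ∈ (B ⊔ A) ⊔ S :=
  (sup_le (le_sup_right.trans le_sup_left) le_sup_right : A ⊔ S ≤ (B ⊔ A) ⊔ S) h

/-- Vector fields `f₀, …, f₅` over the open set `U` which are adapted to a pseudo-product structure
of `G₂`-type with `L = ⟨f₀⟩` and `K = ⟨f₁⟩`. -/
structure IsG2Frame (U : Set M) (f : Fin 6 → VField V M) : Prop where
  isOpen : IsOpen U
  smooth : ∀ i, SmoothVF U (f i)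
  indep : ∀ x ∈ U, LinearIndependent ℝ fun i => f i x
  br_01 : ∀ x ∈ U, lieB (f 0) (f 1) x ∈ flag f 3 x
  br_02 : ∀ x ∈ U, lieB (f 0) (f 2) x ∈ flag f 3 x
  br_03 : ∀ x ∈ U, lieB (f 0) (f 3) x ∈ flag f 4 x
  br_12 : ∀ x ∈ U, lieB (f 1) (f 2) x ∈ flag f 4 x
  br_13 : ∀ x ∈ U, lieB (f 1) (f 3) x ∈ flag f 5 x
  br_14 : ∀ x ∈ U, lieB (f 1) (f 4) x ∈ flag f 5 x
  -- These conditions say that a bracket produces the next direction modulo the earlier ones.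
  -- Membership instead of equality admits both frames of iterated brackets and frames built from
  -- lifts.
  gen_2 : ∀ x ∈ U, f 2 x ∈ flag f 2 x ⊔ Submodule.span ℝ {lieB (f 0) (f 1) x}
  gen_3 : ∀ x ∈ U, f 3 x ∈ flag f 3 x ⊔ Submodule.span ℝ {lieB (f 1) (f 2) x}
  gen_4 : ∀ x ∈ U, f 4 x ∈ flag f 4 x ⊔ Submodule.span ℝ {lieB (f 1) (f 3) x}
  gen_5 : ∀ x ∈ U, f 5 x ∈ flag f 5 x ⊔ Submodule.span ℝ {lieB (f 0) (f 4) x}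

namespace IsG2Frame

variable {U : Set M} {f : Fin 6 → VField V M}

lemma isFrameOn_spanOn (hf : IsG2Frame U f) (s : Finset (Fin 6)) {A : SubspaceField V M}
    (hA : ∀ x ∈ U, A x = spanOn f s x) : IsFrameOn A U fun i : s => f i :=
  ⟨hf.isOpen, fun i => hf.smooth i, fun x hx => (hf.indep x hx).comp _ Subtype.val_injective, hA⟩

/-- If the bracket were in the flag, the sum would collapse to the flag and `f m` would depend on
its predecessors. -/
lemma gen_not_mem {x : M} (hli : LinearIndependent ℝ fun i => f i x) {m : Fin 6}
    {k : ℕ} (hk : m.val = k) {v : TangentSpace 𝓘(ℝ, V) x}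
    (h : f m x ∈ flag f k x ⊔ Submodule.span ℝ {v}) : v ∉ flag f k x := by
  subst hk
  exact fun hv => not_mem_flag hli m
    ((sup_le le_rfl ((Submodule.span_singleton_le_iff_mem _ _).2 hv)) h)

lemma br_12_not_mem (hf : IsG2Frame U f) {x : M} (hx : x ∈ U) :
    lieB (f 1) (f 2) x ∉ flag f 3 x := by
  have h := hf.gen_3 x hx
  exact gen_not_mem (m := 3) (k := 3) (hf.indep x hx) (by simp) h

lemma br_04_not_mem (hf : IsG2Frame U f) {x : M} (hx : x ∈ U) :
    lieB (f 0) (f 4) x ∉ flag f 5 x := by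
  have h := hf.gen_5 x hx
  exact gen_not_mem (m := 5) (k := 5) (hf.indep x hx) (by simp) h

variable [CompleteSpace V] [FiniteDimensional ℝ V]

lemma flag_six (hf : IsG2Frame U f) (hV : Module.finrank ℝ V = 6) {x : M} (hx : x ∈ U) :
    flag f 6 x = ⊤ := by
  have : FiniteDimensional ℝ (TangentSpace 𝓘(ℝ, V) x) := inferInstanceAs (FiniteDimensional ℝ V)
  rw [eq_top_iff, ← (hf.indep x hx).span_eq_top_of_card_eq_finrank'
    (by rw [Fintype.card_fin]; exact hV.symm), Submodule.span_le]
  rintro _ ⟨i, rfl⟩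
  exact mem_flag f i.2 x

lemma br_0_flag3 (hf : IsG2Frame U f) {x : M} (hx : x ∈ U) (j : Fin 6) (hj : j.val < 3) :
    lieB (f 0) (f j) x ∈ flag f 3 x := by
  fin_cases j <;> first | (exfalso; simp at hj; done) | skip
  · exact (lieB_self (f 0) x).symm ▸ Submodule.zero_mem _
  · exact hf.br_01 x hx
  · exact hf.br_02 x hx

lemma br_0_flag4 (hf : IsG2Frame U f) {x : M} (hx : x ∈ U) (j : Fin 6) (hj : j.val < 4) :
    lieB (f 0) (f j) x ∈ flag f 4 x := by
  rcases Nat.lt_succ_iff_lt_or_eq.1 hj with h | h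
  · exact flag_mono f (by norm_num) x (hf.br_0_flag3 hx j h)
  · obtain rfl : j = 3 := Fin.ext h
    exact hf.br_03 x hx

lemma br_1_flag3 (hf : IsG2Frame U f) {x : M} (hx : x ∈ U) (j : Fin 6) (hj : j.val < 2) :
    lieB (f 1) (f j) x ∈ flag f 3 x := by
  fin_cases j <;> first | (exfalso; simp at hj; done) | skip
  · exact (lieB_swap (f 1) (f 0) x).symm ▸ Submodule.neg_mem _ (hf.br_01 x hx)
  · exact (lieB_self (f 1) x).symm ▸ Submodule.zero_mem _

lemma br_1_flag4 (hf : IsG2Frame U f) {x : M} (hx : x ∈ U) (j : Fin 6) (hj : j.val < 3) :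
    lieB (f 1) (f j) x ∈ flag f 4 x := by
  rcases Nat.lt_succ_iff_lt_or_eq.1 hj with h | h
  · exact flag_mono f (by norm_num) x (hf.br_1_flag3 hx j h)
  · obtain rfl : j = 2 := Fin.ext h
    exact hf.br_12 x hx

lemma br_1_flag5 (hf : IsG2Frame U f) {x : M} (hx : x ∈ U) (j : Fin 6) (hj : j.val < 5) :
    lieB (f 1) (f j) x ∈ flag f 5 x := by
  rcases Nat.lt_succ_iff_lt_or_eq.1 hj with h | h
  · rcases Nat.lt_succ_iff_lt_or_eq.1 h with h | h
    · exact flag_mono f (by norm_num) x (hf.br_1_flag4 hx j h)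
    · obtain rfl : j = 3 := Fin.ext h
      exact hf.br_13 x hx
  · obtain rfl : j = 4 := Fin.ext h
    exact hf.br_14 x hx

/-- The bracket of spans of some of the `f i`. -/
lemma bracket_spanOn (hf : IsG2Frame U f) {s t : Finset (Fin 6)} {k : ℕ}
    {A B : SubspaceField V M} (hA : ∀ x ∈ U, A x = spanOn f s x)
    (hB : ∀ x ∈ U, B x = spanOn f t x) (hs : ∀ i ∈ s, i.val < k) (ht : ∀ i ∈ t, i.val < k)
    (hst : ∀ x ∈ U, ∀ i ∈ s, ∀ j ∈ t, lieB (f i) (f j) x ∈ flag f k x)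
    (hgen : ∀ x ∈ U, ∀ m : Fin 6, m.val < k → m ∉ s → m ∉ t →
      ∃ i ∈ s, ∃ j ∈ t, f m x ∈ (A x ⊔ B x) ⊔ Submodule.span ℝ {lieB (f i) (f j) x}) :
    ∀ x ∈ U, bracket A B x = flag f k x := by
  intro x hx
  refine le_antisymm ?_ ?_
  -- The upper bound uses all brackets of the generators. Conversely, each `f m` outside the two
  -- given spans is supplied by one bracket through `hgen`.
  · exact (hf.isFrameOn_spanOn s hA).bracket_le (hf.isFrameOn_spanOn t hB) hx
      (fun i => mem_flag f (hs i i.2) x) (fun i => mem_flag f (ht i i.2) x)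
      (fun i j => hst x hx i i.2 j j.2)
  · refine flag_le fun m hm => ?_
    by_cases hms : m ∈ s
    · exact le_bracket_left A B x ((hA x hx).symm ▸ mem_spanOn f hms x)
    by_cases hmt : m ∈ t
    · exact le_bracket_right A B x ((hB x hx).symm ▸ mem_spanOn f hmt x)
    obtain ⟨i, hi, j, hj, h⟩ := hgen x hx m hm hms hmt
    refine sup_le (sup_le (le_bracket_left A B x) (le_bracket_right A B x))
      ((Submodule.span_singleton_le_iff_mem _ _).2 ?_) h
    exact lieB_mem_bracket hf.isOpen
      ((hf.isFrameOn_spanOn s hA).isSectionOn ⟨i, hi⟩)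
      ((hf.isFrameOn_spanOn t hB).isSectionOn ⟨j, hj⟩) hx

variable {K L : SubspaceField V M}

lemma spanOn_singleton (f : Fin 6 → VField V M) (i : Fin 6) (x : M) :
    spanOn f {i} x = Submodule.span ℝ {f i x} := by
  refine le_antisymm (spanOn_le fun j hj => ?_) ?_
  · rw [Finset.mem_singleton.1 hj]
    exact Submodule.mem_span_singleton_self _
  · exact (Submodule.span_singleton_le_iff_mem _ _).2 (mem_spanOn f (by simp) x)

lemma sumField_eq (hK : ∀ x ∈ U, K x = spanOn f {1} x) (hL : ∀ x ∈ U, L x = spanOn f {0} x) :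
    ∀ x ∈ U, sumField K L x = flag f 2 x := by
  intro x hx
  unfold sumField
  rw [hK x hx, hL x hx]
  refine le_antisymm (sup_le ?_ ?_) (flag_le fun i hi => ?_)
  · exact spanOn_le fun i hi => by
      rw [Finset.mem_singleton.1 hi]; exact mem_flag f (by simp) x
  · exact spanOn_le fun i hi => by
      rw [Finset.mem_singleton.1 hi]; exact mem_flag f (by simp) x
  · fin_cases i <;> first | (exfalso; simp at hi; done) | skip
    · exact (le_sup_right : _ ≤ spanOn f {1} x ⊔ spanOn f {0} x) (mem_spanOn f (by simp) x)
    · exact (le_sup_left : _ ≤ spanOn f {1} x ⊔ spanOn f {0} x) (mem_spanOn f (by simp) x)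

/-- The `br` conditions bound the bracket from above, and a single `gen` condition supplies the one
missing vector. The other derived systems follow the same pattern, with `f 3`, `f 4` and `f 5`
entering in turn. -/
lemma derived_eq_one (hf : IsG2Frame U f) {E : SubspaceField V M}
    (hE : ∀ x ∈ U, E x = flag f 2 x) : ∀ x ∈ U, derived E 1 x = flag f 3 x := by
  refine hf.bracket_spanOn (s := below 2) (t := below 2) hE hE
    (fun i hi => (mem_below.1 hi).trans (by norm_num))
    (fun i hi => (mem_below.1 hi).trans (by norm_num)) (fun x hx i hi j hj => ?_)
    (fun x hx m hm hms _ => ⟨0, by simp [mem_below], 1, by simp [mem_below], ?_⟩)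
  · have hi := mem_below.1 hi
    have hj := mem_below.1 hj
    fin_cases i <;> first | (exfalso; simp at hi; done) | skip
    · exact hf.br_0_flag3 hx j (hj.trans (by norm_num))
    · exact hf.br_1_flag3 hx j hj
  · rw [mem_below] at hms
    obtain rfl : m = 2 := Fin.ext (by simp; omega)
    have h := hf.gen_2 x hx
    change f 2 x ∈ (E x ⊔ E x) ⊔ _
    rwa [hE x hx, sup_idem]

lemma derived_eq_two (hf : IsG2Frame U f) {E : SubspaceField V M}
    (hE : ∀ x ∈ U, E x = flag f 2 x) : ∀ x ∈ U, derived E 2 x = flag f 4 x := by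
  refine hf.bracket_spanOn (s := below 2) (t := below 3) hE (hf.derived_eq_one hE)
    (fun i hi => (mem_below.1 hi).trans (by norm_num))
    (fun i hi => (mem_below.1 hi).trans (by norm_num)) (fun x hx i hi j hj => ?_)
    (fun x hx m hm _ hms => ⟨1, by simp [mem_below], 2, by simp [mem_below], ?_⟩)
  · have hi := mem_below.1 hi
    have hj := mem_below.1 hj
    fin_cases i <;> first | (exfalso; simp at hi; done) | skip
    · exact hf.br_0_flag4 hx j (hj.trans (by norm_num))
    · exact hf.br_1_flag4 hx j hj
  · rw [mem_below] at hms
    obtain rfl : m = 3 := Fin.ext (by simp; omega)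
    have h := hf.gen_3 x hx
    change f 3 x ∈ (E x ⊔ derived E 1 x) ⊔ _
    rw [hf.derived_eq_one hE x hx]
    exact mem_sup_of_mem_sup h

lemma derived_eq_three (hf : IsG2Frame U f) {E : SubspaceField V M}
    (hE : ∀ x ∈ U, E x = flag f 2 x) : ∀ x ∈ U, derived E 3 x = flag f 5 x := by
  refine hf.bracket_spanOn (s := below 2) (t := below 4) hE (hf.derived_eq_two hE)
    (fun i hi => (mem_below.1 hi).trans (by norm_num))
    (fun i hi => (mem_below.1 hi).trans (by norm_num)) (fun x hx i hi j hj => ?_)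
    (fun x hx m hm _ hms => ⟨1, by simp [mem_below], 3, by simp [mem_below], ?_⟩)
  · have hi := mem_below.1 hi
    have hj := mem_below.1 hj
    fin_cases i <;> first | (exfalso; simp at hi; done) | skip
    · exact flag_mono f (by norm_num) x (hf.br_0_flag4 hx j hj)
    · exact hf.br_1_flag5 hx j (hj.trans (by norm_num))
  · rw [mem_below] at hms
    obtain rfl : m = 4 := Fin.ext (by simp; omega)
    have h := hf.gen_4 x hx
    change f 4 x ∈ (E x ⊔ derived E 2 x) ⊔ _
    rw [hf.derived_eq_two hE x hx]
    exact mem_sup_of_mem_sup h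

lemma derived_eq_four (hf : IsG2Frame U f) (hV : Module.finrank ℝ V = 6) {E : SubspaceField V M}
    (hE : ∀ x ∈ U, E x = flag f 2 x) : ∀ x ∈ U, derived E 4 x = flag f 6 x := by
  refine hf.bracket_spanOn (s := below 2) (t := below 5) hE (hf.derived_eq_three hE)
    (fun i hi => (mem_below.1 hi).trans (by norm_num))
    (fun i hi => (mem_below.1 hi).trans (by norm_num)) (fun x hx i hi j hj => ?_)
    (fun x hx m hm _ hms => ⟨0, by simp [mem_below], 4, by simp [mem_below], ?_⟩)
  · rw [hf.flag_six hV hx]; trivial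
  · rw [mem_below] at hms
    obtain rfl : m = 5 := Fin.ext (by simp; omega)
    have h := hf.gen_5 x hx
    change f 5 x ∈ (E x ⊔ derived E 3 x) ⊔ _
    rw [hf.derived_eq_three hE x hx]
    exact mem_sup_of_mem_sup h

lemma bracket_K_L (hf : IsG2Frame U f) (hK : ∀ x ∈ U, K x = spanOn f {1} x)
    (hL : ∀ x ∈ U, L x = spanOn f {0} x) : ∀ x ∈ U, bracket K L x = flag f 3 x := by
  refine hf.bracket_spanOn hK hL (by simp) (by simp) (fun x hx i hi j hj => ?_)
    (fun x hx m hm h1 h0 => ⟨1, by simp, 0, by simp, ?_⟩)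
  · rw [Finset.mem_singleton.1 hi, Finset.mem_singleton.1 hj]
    exact hf.br_1_flag3 hx 0 (by simp)
  · obtain rfl : m = 2 := by
      simp only [Finset.mem_singleton] at h1 h0
      fin_cases m <;> simp_all
    have h := hf.gen_2 x hx
    rw [← sumField_eq hK hL x hx] at h
    rwa [lieB_swap, ← Set.neg_singleton, Submodule.span_neg]

lemma bracket_K_1 (hf : IsG2Frame U f) (hK : ∀ x ∈ U, K x = spanOn f {1} x)
    {F : SubspaceField V M} (hF : ∀ x ∈ U, F x = flag f 3 x) :
    ∀ x ∈ U, bracket K F x = flag f 4 x := by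
  refine hf.bracket_spanOn (t := below 3) hK hF (by simp)
    (fun i hi => (mem_below.1 hi).trans (by norm_num)) (fun x hx i hi j hj => ?_)
    (fun x hx m hm _ hms => ⟨1, by simp, 2, by simp [mem_below], ?_⟩)
  · rw [Finset.mem_singleton.1 hi]
    exact hf.br_1_flag4 hx j (mem_below.1 hj)
  · rw [mem_below] at hms
    obtain rfl : m = 3 := Fin.ext (by simp; omega)
    have h := hf.gen_3 x hx
    rw [hF x hx]
    exact mem_sup_of_mem_sup h

lemma bracket_K_2 (hf : IsG2Frame U f) (hK : ∀ x ∈ U, K x = spanOn f {1} x)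
    {F : SubspaceField V M} (hF : ∀ x ∈ U, F x = flag f 4 x) :
    ∀ x ∈ U, bracket K F x = flag f 5 x := by
  refine hf.bracket_spanOn (t := below 4) hK hF (by simp)
    (fun i hi => (mem_below.1 hi).trans (by norm_num)) (fun x hx i hi j hj => ?_)
    (fun x hx m hm _ hms => ⟨1, by simp, 3, by simp [mem_below], ?_⟩)
  · rw [Finset.mem_singleton.1 hi]
    exact hf.br_1_flag5 hx j ((mem_below.1 hj).trans (by norm_num))
  · rw [mem_below] at hms
    obtain rfl : m = 4 := Fin.ext (by simp; omega)
    have h := hf.gen_4 x hx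
    rw [hF x hx]
    exact mem_sup_of_mem_sup h

lemma bracket_K_3 (hf : IsG2Frame U f) (hK : ∀ x ∈ U, K x = spanOn f {1} x)
    {F : SubspaceField V M} (hF : ∀ x ∈ U, F x = flag f 5 x) :
    ∀ x ∈ U, bracket K F x = flag f 5 x := by
  refine hf.bracket_spanOn (t := below 5) hK hF (by simp)
    (fun i hi => mem_below.1 hi) (fun x hx i hi j hj => ?_)
    (fun x hx m hm _ hms => absurd (mem_below.2 hm) hms)
  rw [Finset.mem_singleton.1 hi]
  exact hf.br_1_flag5 hx j (mem_below.1 hj)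

lemma bracket_L_1 (hf : IsG2Frame U f) (hL : ∀ x ∈ U, L x = spanOn f {0} x)
    {F : SubspaceField V M} (hF : ∀ x ∈ U, F x = flag f 3 x) :
    ∀ x ∈ U, bracket L F x = flag f 3 x := by
  refine hf.bracket_spanOn (t := below 3) hL hF (by simp)
    (fun i hi => mem_below.1 hi) (fun x hx i hi j hj => ?_)
    (fun x hx m hm _ hms => absurd (mem_below.2 hm) hms)
  rw [Finset.mem_singleton.1 hi]
  exact hf.br_0_flag3 hx j (mem_below.1 hj)

lemma bracket_L_2 (hf : IsG2Frame U f) (hL : ∀ x ∈ U, L x = spanOn f {0} x)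
    {F : SubspaceField V M} (hF : ∀ x ∈ U, F x = flag f 4 x) :
    ∀ x ∈ U, bracket L F x = flag f 4 x := by
  refine hf.bracket_spanOn (t := below 4) hL hF (by simp)
    (fun i hi => mem_below.1 hi) (fun x hx i hi j hj => ?_)
    (fun x hx m hm _ hms => absurd (mem_below.2 hm) hms)
  rw [Finset.mem_singleton.1 hi]
  exact hf.br_0_flag4 hx j (mem_below.1 hj)

lemma bracket_L_3 (hf : IsG2Frame U f) (hV : Module.finrank ℝ V = 6)
    (hL : ∀ x ∈ U, L x = spanOn f {0} x)
    {F : SubspaceField V M} (hF : ∀ x ∈ U, F x = flag f 5 x) :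
    ∀ x ∈ U, bracket L F x = flag f 6 x := by
  refine hf.bracket_spanOn (t := below 5) hL hF (by simp)
    (fun i hi => (mem_below.1 hi).trans (by norm_num)) (fun x hx i hi j hj => ?_)
    (fun x hx m hm _ hms => ⟨0, by simp, 4, by simp [mem_below], ?_⟩)
  · rw [hf.flag_six hV hx]; trivial
  · rw [mem_below] at hms
    obtain rfl : m = 5 := Fin.ext (by simp; omega)
    have h := hf.gen_5 x hx
    rw [hF x hx]
    exact mem_sup_of_mem_sup h

lemma finrank_flag (hf : IsG2Frame U f) {x : M} (hx : x ∈ U) {k : ℕ} (hk : k ≤ 6) :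
    Module.finrank ℝ (flag f k x) = k := by
  have h := finrank_span_eq_card
    ((hf.indep x hx).comp (fun i : below k => (i : Fin 6)) Subtype.val_injective)
  refine h.trans ?_
  rw [Fintype.card_coe]
  interval_cases k <;> rfl

lemma isFrameOn_singleton (hf : IsG2Frame U f) (i : Fin 6) {A : SubspaceField V M}
    (hA : ∀ x ∈ U, A x = spanOn f {i} x) : IsFrameOn A U fun _ : Fin 1 => f i :=
  ⟨hf.isOpen, fun _ => hf.smooth i, fun x hx =>
    LinearIndependent.of_subsingleton (0 : Fin 1) ((hf.indep x hx).ne_zero i), fun x hx => by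
      rw [hA x hx, spanOn_singleton]
      simp [spanField]⟩

/-- The direction `K` is determined by `E`. -/
lemma charDir_eq (hf : IsG2Frame U f) {E : SubspaceField V M}
    (hE : ∀ x ∈ U, E x = flag f 2 x) : ∀ x ∈ U, charDir E (derived E 3) x = spanOn f {1} x := by
  intro x hx
  have h3 := hf.derived_eq_three hE
  have hfE := hf.isFrameOn_spanOn (below 2) hE
  have hf3 := hf.isFrameOn_spanOn (below 5) h3
  refine le_antisymm (Submodule.span_le.2 ?_) (spanOn_le fun i hi => ?_)
  · rintro v ⟨W, hW, hxW, X, hX, rfl, hXF⟩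
    have hO : IsOpen (U ∩ W) := hf.isOpen.inter hW
    obtain ⟨c, hc, hXc⟩ := hfE.smoothComb hO inter_subset_left (hX.mono inter_subset_right)
    -- The field `f 4` detects the component of `X` along `f 0`: its bracket with `f 0` leaves the
    -- flag, its bracket with `f 1` does not.
    have h4 : IsSectionOn (derived E 3) U (f 4) :=
      hf3.isSectionOn ⟨4, by simp [mem_below]⟩
    have hb := hXF U hf.isOpen hx (f 4) h4
    rw [h3 x hx, lieB_comb_left hO (g := fun i : below 2 => f i) (fun i => (hf.smooth i).mono inter_subset_left) hc hXc
      ⟨hx, hxW⟩] at hb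
    rw [Finset.sum_add_distrib] at hb
    have hb' := (Submodule.add_mem_iff_right _ (Submodule.sum_mem _ fun i _ =>
      Submodule.smul_mem _ _ (mem_flag f ((mem_below.1 i.2).trans (by norm_num)) x))).1 hb
    have i0 : (0 : Fin 6) ∈ below 2 := by simp [mem_below]
    have i1 : (1 : Fin 6) ∈ below 2 := by simp [mem_below]
    have hu : (Finset.univ : Finset (below 2)) = {⟨0, i0⟩, ⟨1, i1⟩} := by
      ext ⟨i, hi⟩
      have := mem_below.1 hi
      fin_cases i <;> simp_all
    rw [hu, Finset.sum_pair (by simp)] at hb'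
    have hb2 := (Submodule.add_mem_iff_left _ (Submodule.smul_mem _ _ (hf.br_14 x hx))).1 hb'
    have hc0 : c ⟨0, i0⟩ x = 0 := by
      by_contra hne
      exact hf.br_04_not_mem hx ((Submodule.smul_mem_iff _ hne).1 hb2)
    have := hXc x ⟨hx, hxW⟩
    rw [hu, Finset.sum_pair (by simp), hc0, zero_smul, zero_add] at this
    rw [SetLike.mem_coe, this]
    exact Submodule.smul_mem _ _ (mem_spanOn f (by simp) x)
  · rw [Finset.mem_singleton.1 hi]
    refine Submodule.subset_span ⟨U, hf.isOpen, hx, f 1,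
      hfE.isSectionOn ⟨1, by simp [mem_below]⟩, rfl, fun W hW hxW Y hY => ?_⟩
    rw [← hf.bracket_K_3 (K := spanOn f {1}) (fun _ _ => rfl) h3 x hx |>.trans (h3 x hx).symm]
    have h1 : IsSectionOn (spanOn f {1}) U (f 1) :=
      ⟨hf.smooth 1, fun x _ => mem_spanOn f (by simp) x⟩
    exact lieB_mem_bracket (hf.isOpen.inter hW) (h1.mono inter_subset_left)
      (hY.mono inter_subset_right) ⟨hx, hxW⟩

/-- The Cauchy characteristic of `∂E` is `L`. -/
lemma cauchyChar_eq (hf : IsG2Frame U f) (hL : ∀ x ∈ U, L x = spanOn f {0} x)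
    {F : SubspaceField V M} (hF : ∀ x ∈ U, F x = flag f 3 x) :
    ∀ x ∈ U, cauchyChar F x = (L x : Set _) := by
  intro x hx
  have hfF := hf.isFrameOn_spanOn (below 3) hF
  ext v
  constructor
  · rintro ⟨W, hW, hxW, X, hX, rfl, hXF⟩
    have hO : IsOpen (U ∩ W) := hf.isOpen.inter hW
    obtain ⟨c, hc, hXc⟩ := hfF.smoothComb hO inter_subset_left (hX.mono inter_subset_right)
    have i0 : (0 : Fin 6) ∈ below 3 := by simp [mem_below]
    have i1 : (1 : Fin 6) ∈ below 3 := by simp [mem_below]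
    have i2 : (2 : Fin 6) ∈ below 3 := by simp [mem_below]
    have hu : (Finset.univ : Finset (below 3)) = {⟨0, i0⟩, ⟨1, i1⟩, ⟨2, i2⟩} := by
      ext ⟨i, hi⟩
      have := mem_below.1 hi
      fin_cases i <;> simp_all
    -- Modulo the flag the derivatives of the coefficients disappear. Since `[f 1, f 2]` is not in
    -- the flag, `j = 1` kills the coefficient of `f 2` and `j = 2` that of `f 1`.
    have key : ∀ j : Fin 6, j.val < 3 → c ⟨0, i0⟩ x • lieB (f 0) (f j) x +
        (c ⟨1, i1⟩ x • lieB (f 1) (f j) x + c ⟨2, i2⟩ x • lieB (f 2) (f j) x) ∈ flag f 3 x := by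
      intro j hj
      have hb := hXF (U ∩ W) hO inter_subset_right (f j)
        ((hfF.isSectionOn ⟨j, mem_below.2 hj⟩).mono inter_subset_left) x ⟨hx, hxW⟩
      change lieB X (f j) x ∈ _ at hb
      rw [hF x hx, lieB_comb_left hO (g := fun i : below 3 => f i) (fun i => (hf.smooth i).mono inter_subset_left) hc hXc
        ⟨hx, hxW⟩] at hb
      rw [Finset.sum_add_distrib] at hb
      have hb' := (Submodule.add_mem_iff_right _ (Submodule.sum_mem _ fun i _ =>
        Submodule.smul_mem _ _ (mem_flag f (mem_below.1 i.2) x))).1 hb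
      rwa [hu, Finset.sum_insert (by simp), Finset.sum_pair (by simp)] at hb'
    have hc2 : c ⟨2, i2⟩ x = 0 := by
      have h := key 1 (by simp)
      rw [lieB_self, smul_zero, zero_add, lieB_swap (f 2)] at h
      have h' := (Submodule.add_mem_iff_right _ (Submodule.smul_mem _ _ (hf.br_01 x hx))).1 h
      by_contra hne
      exact hf.br_12_not_mem hx (neg_mem_iff.1 ((Submodule.smul_mem_iff _ hne).1 h'))
    have hc1 : c ⟨1, i1⟩ x = 0 := by
      have h := key 2 (by simp)
      rw [lieB_self, smul_zero, add_zero] at h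
      have h' := (Submodule.add_mem_iff_right _ (Submodule.smul_mem _ _ (hf.br_02 x hx))).1 h
      by_contra hne
      exact hf.br_12_not_mem hx ((Submodule.smul_mem_iff _ hne).1 h')
    have := hXc x ⟨hx, hxW⟩
    rw [hu, Finset.sum_insert (by simp), Finset.sum_pair (by simp), hc1, hc2, zero_smul, zero_smul,
      add_zero, add_zero] at this
    rw [this, hL x hx]
    exact Submodule.smul_mem _ _ (mem_spanOn f (by simp) x)
  · intro hv
    rw [hL x hx, spanOn_singleton] at hv
    obtain ⟨a, rfl⟩ := Submodule.mem_span_singleton.1 hv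
    -- The vector is extended with a constant coefficient; invariance of `F` along this field is
    -- `bracket_L_1`.
    have h0 : IsSectionOn L U ((fun _ => a) • f 0) :=
      ⟨(hf.smooth 0).smul contMDiffOn_const, fun w hw => by
        rw [hL w hw]
        exact Submodule.smul_mem _ _ (mem_spanOn f (by simp) w)⟩
    have hLF := hf.bracket_L_1 hL hF
    refine ⟨U, hf.isOpen, hx, (fun _ => a) • f 0, ⟨h0.1, fun w hw => ?_⟩, rfl,
      fun W hW hWU Y hY w hw => ?_⟩
    · rw [hF w hw, ← hLF w hw]
      exact le_bracket_left L F w (h0.2 w hw)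
    · rw [hF w (hWU hw), ← hLF w (hWU hw)]
      exact lieB_mem_bracket hW (h0.mono hWU) hY hw

end IsG2Frame

variable [CompleteSpace V] [FiniteDimensional ℝ V]

/-- All conditions are pointwise equalities of subspaces or local existence statements, so each can
be checked in an adapted frame around the point. -/
lemma isPseudoProductG2_of_frames {K L : SubspaceField V M} (hV : Module.finrank ℝ V = 6)
    (h : ∀ z, ∃ U : Set M, z ∈ U ∧ ∃ f : Fin 6 → VField V M, IsG2Frame U f ∧
      (∀ x ∈ U, K x = spanOn f {1} x) ∧ ∀ x ∈ U, L x = spanOn f {0} x) :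
    IsPseudoProductG2 K L where
  dim := hV
  rank_K := isDistribution_of_frames fun z => by
    obtain ⟨U, hz, f, hf, hK, -⟩ := h z
    exact ⟨U, hz, _, hf.isFrameOn_singleton 1 hK⟩
  rank_L := isDistribution_of_frames fun z => by
    obtain ⟨U, hz, f, hf, -, hL⟩ := h z
    exact ⟨U, hz, _, hf.isFrameOn_singleton 0 hL⟩
  disjoint z := by
    obtain ⟨U, hz, f, hf, hK, hL⟩ := h z
    rw [hK z hz, hL z hz, IsG2Frame.spanOn_singleton, IsG2Frame.spanOn_singleton]
    have h1 := (hf.indep z hz).disjoint_span_image (s := {1}) (t := {0}) (by simp)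
    simpa using h1
  growth k hk z := by
    obtain ⟨U, hz, f, hf, hK, hL⟩ := h z
    have hE := IsG2Frame.sumField_eq hK hL
    rw [← hf.finrank_flag hz (k := k + 2) (by omega)]
    interval_cases k
    · rw [← hE z hz]; rfl
    · rw [hf.derived_eq_one hE z hz]
    · rw [hf.derived_eq_two hE z hz]
    · rw [hf.derived_eq_three hE z hz]
    · rw [hf.derived_eq_four hV hE z hz]
  bracket_K_L := funext fun z => by
    obtain ⟨U, hz, f, hf, hK, hL⟩ := h z
    rw [hf.bracket_K_L hK hL z hz, hf.derived_eq_one (IsG2Frame.sumField_eq hK hL) z hz]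
  bracket_K_1 := funext fun z => by
    obtain ⟨U, hz, f, hf, hK, hL⟩ := h z
    have hE := IsG2Frame.sumField_eq hK hL
    rw [hf.bracket_K_1 hK (hf.derived_eq_one hE) z hz, hf.derived_eq_two hE z hz]
  bracket_L_1 := funext fun z => by
    obtain ⟨U, hz, f, hf, hK, hL⟩ := h z
    have hE := IsG2Frame.sumField_eq hK hL
    rw [hf.bracket_L_1 hL (hf.derived_eq_one hE) z hz, hf.derived_eq_one hE z hz]
  bracket_K_2 := funext fun z => by
    obtain ⟨U, hz, f, hf, hK, hL⟩ := h z
    have hE := IsG2Frame.sumField_eq hK hL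
    rw [hf.bracket_K_2 hK (hf.derived_eq_two hE) z hz, hf.derived_eq_three hE z hz]
  bracket_L_2 := funext fun z => by
    obtain ⟨U, hz, f, hf, hK, hL⟩ := h z
    have hE := IsG2Frame.sumField_eq hK hL
    rw [hf.bracket_L_2 hL (hf.derived_eq_two hE) z hz, hf.derived_eq_two hE z hz]
  bracket_K_3 := funext fun z => by
    obtain ⟨U, hz, f, hf, hK, hL⟩ := h z
    have hE := IsG2Frame.sumField_eq hK hL
    rw [hf.bracket_K_3 hK (hf.derived_eq_three hE) z hz, hf.derived_eq_three hE z hz]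
  bracket_L_3 := funext fun z => by
    obtain ⟨U, hz, f, hf, hK, hL⟩ := h z
    have hE := IsG2Frame.sumField_eq hK hL
    rw [hf.bracket_L_3 hV hL (hf.derived_eq_three hE) z hz, hf.derived_eq_four hV hE z hz]

/-- Fields spanning an upper bound of the right dimension form a frame. -/
lemma isFrameOn_of_le {ι : Type*} [Fintype ι] {U : Set M} (hU : IsOpen U) {g : ι → VField V M}
    (hg : ∀ i, SmoothVF U (g i)) {A : SubspaceField V M} (hA : ∀ x ∈ U, A x ≤ spanField g x)
    (hr : ∀ x ∈ U, Module.finrank ℝ (A x) = Fintype.card ι) : IsFrameOn A U g := by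
  have heq : ∀ x ∈ U, A x = spanField g x := fun x hx => by
    have : FiniteDimensional ℝ (TangentSpace 𝓘(ℝ, V) x) := inferInstanceAs (FiniteDimensional ℝ V)
    exact Submodule.eq_of_le_of_finrank_le (hA x hx)
      ((finrank_range_le_card (R := ℝ) (fun i => g i x)).trans (hr x hx).ge)
  refine ⟨hU, hg, fun x hx => ?_, heq⟩
  rw [linearIndependent_iff_card_eq_finrank_span]
  exact ((heq x hx) ▸ (hr x hx)).symm

lemma isFrameOn_flag {U : Set M} (hU : IsOpen U) {f : Fin 6 → VField V M} {k : ℕ}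
    (hf : ∀ i : Fin 6, i.val < k → SmoothVF U (f i)) {A : SubspaceField V M} (hk : k ≤ 6)
    (hA : ∀ x ∈ U, A x ≤ flag f k x) (hr : ∀ x ∈ U, Module.finrank ℝ (A x) = k) :
    IsFrameOn A U fun i : below k => f i := by
  refine isFrameOn_of_le (g := fun i : below k => f i) hU (fun i => hf i (mem_below.1 i.2)) hA fun x hx => ?_
  rw [hr x hx, Fintype.card_coe]
  interval_cases k <;> rfl

/-- A frame of a pseudo-product structure whose members are iterated brackets of `f₀` and `f₁`. -/
structure IsBracketFrame (U : Set M) (K L : SubspaceField V M) (f : Fin 6 → VField V M) : Prop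
    extends IsG2Frame U f where
  K_eq : ∀ x ∈ U, K x = spanOn f {1} x
  L_eq : ∀ x ∈ U, L x = spanOn f {0} x
  eq_2 : f 2 = lieB (f 0) (f 1)
  eq_3 : f 3 = lieB (f 1) (f 2)
  eq_4 : f 4 = lieB (f 1) (f 3)
  eq_5 : f 5 = lieB (f 0) (f 4)

lemma IsG2Frame.mono {U U' : Set M} {f : Fin 6 → VField V M} (h : IsG2Frame U f)
    (hU' : IsOpen U') (hU : U' ⊆ U) : IsG2Frame U' f :=
  ⟨hU', fun i => (h.smooth i).mono hU, fun x hx => h.indep x (hU hx), fun x hx => h.br_01 x (hU hx), fun x hx => h.br_02 x (hU hx),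
    fun x hx => h.br_03 x (hU hx), fun x hx => h.br_12 x (hU hx),
    fun x hx => h.br_13 x (hU hx), fun x hx => h.br_14 x (hU hx),
    fun x hx => h.gen_2 x (hU hx), fun x hx => h.gen_3 x (hU hx),
    fun x hx => h.gen_4 x (hU hx), fun x hx => h.gen_5 x (hU hx)⟩

lemma IsBracketFrame.mono {U U' : Set M} {K L : SubspaceField V M} {f : Fin 6 → VField V M}
    (h : IsBracketFrame U K L f) (hU' : IsOpen U') (hU : U' ⊆ U) : IsBracketFrame U' K L f :=
  ⟨h.toIsG2Frame.mono hU' hU, fun x hx => h.K_eq x (hU hx), fun x hx => h.L_eq x (hU hx),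
    h.eq_2, h.eq_3, h.eq_4, h.eq_5⟩

/-- Generators of `L` and `K` and their iterated brackets span upper bounds for the derived systems,
by the identities for `[𝓚, ·]` and `[𝓛, ·]`. The prescribed ranks then force equality and
independence, one step of the flag after another. -/
lemma IsPseudoProductG2.exists_frame {K L : SubspaceField V M} (h : IsPseudoProductG2 K L)
    (z : M) : ∃ U : Set M, z ∈ U ∧ ∃ f : Fin 6 → VField V M, IsBracketFrame U K L f := by
  obtain ⟨U₁, hz₁, gK, hK⟩ := h.rank_K.exists_frame z
  obtain ⟨U₂, hz₂, gL, hL⟩ := h.rank_L.exists_frame z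
  have hU := hK.isOpen.inter hL.isOpen
  replace hK := hK.mono hU inter_subset_left
  replace hL := hL.mono hU inter_subset_right
  set U := U₁ ∩ U₂
  let f0 := gL 0
  let f1 := gK 0
  let f2 := lieB f0 f1
  let f3 := lieB f1 f2
  let f4 := lieB f1 f3
  let f5 := lieB f0 f4
  let f : Fin 6 → VField V M := ![f0, f1, f2, f3, f4, f5]
  have s0 : SmoothVF U f0 := hL.smooth 0
  have s1 : SmoothVF U f1 := hK.smooth 0
  have s2 : SmoothVF U f2 := s0.lieB hU s1
  have s3 : SmoothVF U f3 := s1.lieB hU s2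
  have s4 : SmoothVF U f4 := s1.lieB hU s3
  have s5 : SmoothVF U f5 := s0.lieB hU s4
  have hs : ∀ i, SmoothVF U (f i) := fun i => by fin_cases i <;> assumption
  have hKx : ∀ x ∈ U, K x = spanOn f {1} x := fun x hx => by
    rw [hK.eq x hx, IsG2Frame.spanOn_singleton, spanField, range_unique]
    rfl
  have hLx : ∀ x ∈ U, L x = spanOn f {0} x := fun x hx => by
    rw [hL.eq x hx, IsG2Frame.spanOn_singleton, spanField, range_unique]
    rfl
  have h1K : IsSectionOn K U f1 := hK.isSectionOn 0
  have h0L : IsSectionOn L U f0 := hL.isSectionOn 0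
  set E := sumField K L
  have m0 : ∀ {k : ℕ}, 0 < k → ∀ x, f0 x ∈ flag f k x := fun hk x => mem_flag f (i := 0) hk x
  have m1 : ∀ {k : ℕ}, 1 < k → ∀ x, f1 x ∈ flag f k x := fun hk x => mem_flag f (i := 1) hk x
  have m2 : ∀ {k : ℕ}, 2 < k → ∀ x, f2 x ∈ flag f k x := fun hk x => mem_flag f (i := 2) hk x
  have m3 : ∀ {k : ℕ}, 3 < k → ∀ x, f3 x ∈ flag f k x := fun hk x => mem_flag f (i := 3) hk x
  have m4 : ∀ {k : ℕ}, 4 < k → ∀ x, f4 x ∈ flag f k x := fun hk x => mem_flag f (i := 4) hk x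
  have m5 : ∀ {k : ℕ}, 5 < k → ∀ x, f5 x ∈ flag f k x := fun hk x => mem_flag f (i := 5) hk x
  have n10 : ∀ {k : ℕ}, 2 < k → ∀ x, lieB f1 f0 x ∈ flag f k x := fun hk x => by
    rw [lieB_swap]
    exact neg_mem (m2 hk x)
  have n11 : ∀ (k : ℕ) x, lieB f1 f1 x ∈ flag f k x := fun k x => by
    rw [lieB_self]
    exact Submodule.zero_mem _
  have n00 : ∀ (k : ℕ) x, lieB f0 f0 x ∈ flag f k x := fun k x => by
    rw [lieB_self]
    exact Submodule.zero_mem _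
  have d1 : IsFrameOn (derived E 1) U fun i : below 3 => f i := by
    refine isFrameOn_flag hU (fun i _ => hs i) (by norm_num) (fun x hx => ?_)
      (fun x _ => h.growth 1 (by norm_num) x)
    rw [← h.bracket_K_L]
    refine hK.bracket_le hL hx (fun i => ?_) (fun i => ?_) fun i j => ?_
    · rw [Subsingleton.elim i 0]; exact m1 (by norm_num) x
    · rw [Subsingleton.elim i 0]; exact m0 (by norm_num) x
    · rw [Subsingleton.elim i 0, Subsingleton.elim j 0]; exact n10 (by norm_num) x
  have d2 : IsFrameOn (derived E 2) U fun i : below 4 => f i := by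
    refine isFrameOn_flag hU (fun i _ => hs i) (by norm_num) (fun x hx => ?_)
      (fun x _ => h.growth 2 (by norm_num) x)
    rw [← h.bracket_K_1]
    refine hK.bracket_le d1 hx (fun i => ?_) (fun i => ?_) fun i j => ?_
    · rw [Subsingleton.elim i 0]; exact m1 (by norm_num) x
    · exact mem_flag f ((mem_below.1 i.2).trans (by norm_num)) x
    · rw [Subsingleton.elim i 0]
      obtain ⟨j, hj⟩ := j
      rw [mem_below] at hj
      fin_cases j <;> first | (exfalso; simp at hj; done) | skip
      · exact n10 (by norm_num) x
      · exact n11 4 x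
      · exact m3 (by norm_num) x
  have d3 : IsFrameOn (derived E 3) U fun i : below 5 => f i := by
    refine isFrameOn_flag hU (fun i _ => hs i) (by norm_num) (fun x hx => ?_)
      (fun x _ => h.growth 3 (by norm_num) x)
    rw [← h.bracket_K_2]
    refine hK.bracket_le d2 hx (fun i => ?_) (fun i => ?_) fun i j => ?_
    · rw [Subsingleton.elim i 0]; exact m1 (by norm_num) x
    · exact mem_flag f ((mem_below.1 i.2).trans (by norm_num)) x
    · rw [Subsingleton.elim i 0]
      obtain ⟨j, hj⟩ := j
      rw [mem_below] at hj
      fin_cases j <;> first | (exfalso; simp at hj; done) | skip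
      · exact n10 (by norm_num) x
      · exact n11 5 x
      · exact m3 (by norm_num) x
      · exact m4 (by norm_num) x
  -- The bounds on brackets that produce nothing new are the three conditions where a bracket with
  -- `𝓚` or `𝓛` leaves a derived system unchanged.
  have b02 : ∀ x ∈ U, lieB f0 f2 x ∈ flag f 3 x := fun x hx => by
    have h1 := lieB_mem_bracket hU h0L (d1.isSectionOn ⟨2, by simp [mem_below]⟩) hx
    rw [h.bracket_L_1] at h1
    exact (d1.eq x hx).le h1
  have b03 : ∀ x ∈ U, lieB f0 f3 x ∈ flag f 4 x := fun x hx => by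
    have h1 := lieB_mem_bracket hU h0L (d2.isSectionOn ⟨3, by simp [mem_below]⟩) hx
    rw [h.bracket_L_2] at h1
    exact (d2.eq x hx).le h1
  have b14 : ∀ x ∈ U, lieB f1 f4 x ∈ flag f 5 x := fun x hx => by
    have h1 := lieB_mem_bracket hU h1K (d3.isSectionOn ⟨4, by simp [mem_below]⟩) hx
    rw [h.bracket_K_3] at h1
    exact (d3.eq x hx).le h1
  -- The last step uses `𝓛`: among its brackets with the five known fields, only `[f 0, f 4]` can
  -- leave their span.
  have d4 : IsFrameOn (derived E 4) U fun i : below 6 => f i := by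
    refine isFrameOn_flag hU (fun i _ => hs i) (by norm_num) (fun x hx => ?_)
      (fun x _ => h.growth 4 (by norm_num) x)
    rw [← h.bracket_L_3]
    refine hL.bracket_le d3 hx (fun i => ?_) (fun i => ?_) fun i j => ?_
    · rw [Subsingleton.elim i 0]; exact m0 (by norm_num) x
    · exact mem_flag f ((mem_below.1 i.2).trans (by norm_num)) x
    · rw [Subsingleton.elim i 0]
      obtain ⟨j, hj⟩ := j
      rw [mem_below] at hj
      fin_cases j <;> first | (exfalso; simp at hj; done) | skip
      · exact n00 6 x
      · exact m2 (by norm_num) x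
      · exact flag_mono f (by norm_num) x (b02 x hx)
      · exact flag_mono f (by norm_num) x (b03 x hx)
      · exact m5 (by norm_num) x
  have hsub : ∀ {A : Submodule ℝ V} {v : V}, v ∈ A ⊔ Submodule.span ℝ {v} := fun {A v} =>
    (le_sup_right : _ ≤ A ⊔ Submodule.span ℝ {v}) (Submodule.mem_span_singleton_self v)
  refine ⟨U, ⟨hz₁, hz₂⟩, f, ?_⟩
  exact
    { isOpen := hU
      smooth := hs
      indep := fun x hx => (d4.indep x hx).comp
        (fun i : Fin 6 => (⟨i, mem_below.2 i.2⟩ : below 6)) fun i j hij => congrArg Subtype.val hij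
      br_01 := fun x _ => m2 (by norm_num) x
      br_02 := b02
      br_03 := b03
      br_12 := fun x _ => m3 (by norm_num) x
      br_13 := fun x _ => m4 (by norm_num) x
      br_14 := b14
      gen_2 := fun x _ => hsub
      gen_3 := fun x _ => hsub
      gen_4 := fun x _ => hsub
      gen_5 := fun x _ => hsub
      K_eq := hKx
      L_eq := hLx
      eq_2 := rfl
      eq_3 := rfl
      eq_4 := rfl
      eq_5 := rfl }

/-- This recovers `K` from `E` alone. Hence diffeomorphisms preserving `E` preserve `K`, and `K` is
unique. -/
lemma IsPseudoProductG2.eq_charDir {K L : SubspaceField V M} (h : IsPseudoProductG2 K L) :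
    K = charDir (sumField K L) (derived (sumField K L) 3) := by
  funext z
  obtain ⟨U, hz, f, hf⟩ := h.exists_frame z
  rw [hf.toIsG2Frame.charDir_eq (IsG2Frame.sumField_eq hf.K_eq hf.L_eq) z hz, hf.K_eq z hz]

lemma IsPseudoProductG2.cauchyChar_eq {K L : SubspaceField V M} (h : IsPseudoProductG2 K L)
    (z : M) : cauchyChar (derived (sumField K L) 1) z = (L z : Set _) := by
  obtain ⟨U, hz, f, hf⟩ := h.exists_frame z
  exact hf.toIsG2Frame.cauchyChar_eq hf.L_eq
    (hf.toIsG2Frame.derived_eq_one (IsG2Frame.sumField_eq hf.K_eq hf.L_eq)) z hz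

/-- A line field which preserves `∂⁽³⁾E` is contained in `charDir`. -/
lemma le_charDir {K E F : SubspaceField V M} (hK : IsDistribution 1 K) (hKE : ∀ x, K x ≤ E x)
    (hKF : bracket K F = F) (z : M) : K z ≤ charDir E F z := by
  obtain ⟨U, hz, g, hg⟩ := hK.exists_frame z
  rw [hg.eq z hz]
  refine spanField_le fun i => Submodule.subset_span ⟨U, hg.isOpen, hz, g i,
    ⟨hg.smooth i, fun x hx => hKE x ((hg.isSectionOn i).2 x hx)⟩, rfl, fun W hW hzW Y hY => ?_⟩
  rw [← congrFun hKF z]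
  exact lieB_mem_bracket (hg.isOpen.inter hW) ((hg.isSectionOn i).mono inter_subset_left)
    (hY.mono inter_subset_right) ⟨hz, hzW⟩

lemma IsDistribution.finrank_eq {r : ℕ} {A : SubspaceField V M} (h : IsDistribution r A) (x : M) :
    Module.finrank ℝ (A x) = r := by
  obtain ⟨U, hx, g, hg⟩ := h.exists_frame x
  rw [hg.eq x hx]
  exact (finrank_span_eq_card (hg.indep x hx)).trans (Fintype.card_fin r)

/-- A line field preserving `∂⁽³⁾E` lies in `charDir`, which is the line field `K`; equal ranks
finish. -/
lemma IsPseudoProductG2.eq_of_bracket {K K' L : SubspaceField V M} (h : IsPseudoProductG2 K L)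
    (hK' : IsDistribution 1 K') (hE : sumField K' L = sumField K L)
    (hb : bracket K' (derived (sumField K L) 3) = derived (sumField K L) 3) : K' = K := by
  funext z
  have : FiniteDimensional ℝ (TangentSpace 𝓘(ℝ, V) z) := inferInstanceAs (FiniteDimensional ℝ V)
  refine Submodule.eq_of_le_of_finrank_eq ?_
    ((hK'.finrank_eq z).trans (h.rank_K.finrank_eq z).symm)
  rw [congrFun h.eq_charDir z]
  exact le_charDir hK' (fun x => by rw [← hE]; exact le_sup_left) hb z

end G2Frames

/-! ### The inverse function theorem in Banach spaces. -/

section InverseFunction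

variable {V V' : Type*} [NormedAddCommGroup V] [NormedSpace ℝ V] [CompleteSpace V]
  [NormedAddCommGroup V'] [NormedSpace ℝ V']

/-- The inverse function theorem in Banach spaces, with a smooth inverse. -/
lemma exists_isDiffeo_of_hasFDerivAt {O : Set V} (hO : IsOpen O) {g : V → V'}
    (hg : ContDiffOn ℝ ∞ g O) {x : V} (hx : x ∈ O) {A : V ≃L[ℝ] V'}
    (hA : HasFDerivAt g (A : V →L[ℝ] V') x) :
    ∃ e : OpenPartialHomeomorph V V', x ∈ e.source ∧ e.source ⊆ O ∧ IsDiffeo V V' e ∧ ⇑e = g := by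
  have hgx := hg.contDiffAt (hO.mem_nhds hx)
  let e := hgx.toOpenPartialHomeomorph g hA (by simp)
  have hcont : ContinuousOn (fderiv ℝ g) O := hg.continuousOn_fderiv_of_isOpen hO (by simp)
  -- Restricting to the open set where the derivative is invertible makes the inverse smooth on its
  -- whole domain, and not only at the image of `x`.
  let N : Set V := O ∩ fderiv ℝ g ⁻¹' range ((↑) : (V ≃L[ℝ] V') → V →L[ℝ] V')
  have hN : IsOpen N := hcont.isOpen_inter_preimage hO (ContinuousLinearEquiv.isOpen (𝕜 := ℝ))
  have hxN : x ∈ N := ⟨hx, A, hA.fderiv.symm⟩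
  have hes : (e.restrOpen N hN).source = e.source ∩ N := e.restrOpen_source N hN
  refine ⟨e.restrOpen N hN, ?_, ?_, ⟨?_, ?_⟩, rfl⟩
  · rw [hes]
    exact ⟨hgx.mem_toOpenPartialHomeomorph_source hA (by simp), hxN⟩
  · rw [hes]
    exact fun y hy => hy.2.1
  · rw [contMDiffOn_iff_contDiffOn, hes]
    exact hg.mono fun y hy => hy.2.1
  · rw [contMDiffOn_iff_contDiffOn]
    intro y hy
    have h1 := (e.restrOpen N hN).map_target hy
    rw [hes] at h1
    obtain ⟨-, h2, B, hB⟩ := h1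
    have h3 := hg.contDiffAt (hO.mem_nhds h2)
    refine ((e.restrOpen N hN).contDiffAt_symm hy (f₀' := B) ?_ h3).contDiffWithinAt
    rw [hB]
    exact (h3.differentiableAt (by simp)).hasFDerivAt

end InverseFunction

/-! ### Derivatives of compositions and sections along maps. -/

section Composition

variable {V : Type*} [NormedAddCommGroup V] [NormedSpace ℝ V]
variable {M : Type*} [TopologicalSpace M] [ChartedSpace V M] [IsManifold 𝓘(ℝ, V) ∞ M]

/-- The derivative of the composition with a continuous linear map. -/
lemma mfderiv_clm_comp {F G : Type*} [NormedAddCommGroup F] [NormedSpace ℝ F]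
    [NormedAddCommGroup G] [NormedSpace ℝ G] (L : F →L[ℝ] G) {f : M → F} {x : M}
    (hf : MDifferentiableAt 𝓘(ℝ, V) 𝓘(ℝ, F) f x) (v : TangentSpace 𝓘(ℝ, V) x) :
    mfderiv 𝓘(ℝ, V) 𝓘(ℝ, G) (fun w => L (f w)) x v = L (mfderiv 𝓘(ℝ, V) 𝓘(ℝ, F) f x v) := by
  have h := mfderiv_comp x (g := L) (I' := 𝓘(ℝ, F)) L.mdifferentiableAt hf
  rw [mfderiv_eq_fderiv, L.fderiv] at h
  exact congrArg (fun A => A v) h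

variable {V' : Type*} [NormedAddCommGroup V'] [NormedSpace ℝ V']
variable {M' : Type*} [TopologicalSpace M'] [ChartedSpace V' M'] [IsManifold 𝓘(ℝ, V') ∞ M']

/-- Smoothness along `p` is tested on the fibre component in a trivialization near `p x`, and
trivializations are linear on fibres. -/
lemma SmoothAlong.add_smul {U : Set M} {p : M → M'}
    {X X' : ∀ w, TangentSpace 𝓘(ℝ, V') (p w)} {c : M → ℝ} (hX : SmoothAlong (V := V) U p X)
    (hc : SmoothFn V U c) (hX' : SmoothAlong (V := V) U p X') :
    SmoothAlong (V := V) U p fun w => X w + c w • X' w := by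
  intro x hx
  have hp := (Bundle.contMDiffWithinAt_totalSpace.1 (hX x hx)).1
  set τ := trivializationAt V' (TangentSpace 𝓘(ℝ, V')) (p x)
  have hxτ : p x ∈ τ.baseSet := FiberBundle.mem_baseSet_trivializationAt' (p x)
  have h1 := (Bundle.contMDiffWithinAt_totalSpace.1 (hX x hx)).2
  have h2 := (Bundle.contMDiffWithinAt_totalSpace.1 (hX' x hx)).2
  refine Bundle.contMDiffWithinAt_totalSpace.2 ⟨hp, ?_⟩
  refine (h1.add ((hc x hx).smul h2)).congr_of_eventuallyEq ?_ ?_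
  · filter_upwards [hp.continuousWithinAt.preimage_mem_nhdsWithin
      (τ.open_baseSet.mem_nhds hxτ)] with w hw
    have e : ∀ v : TangentSpace 𝓘(ℝ, V') (p w), (τ ⟨p w, v⟩).2 = τ.linearMapAt ℝ (p w) v :=
      fun v => (congrFun (τ.coe_linearMapAt_of_mem (R := ℝ) hw) v).symm
    change (τ _).2 = (τ _).2 + c w • (τ _).2
    rw [e, e, e, map_add, map_smul]
  · have e : ∀ v : TangentSpace 𝓘(ℝ, V') (p x), (τ ⟨p x, v⟩).2 = τ.linearMapAt ℝ (p x) v :=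
      fun v => (congrFun (τ.coe_linearMapAt_of_mem (R := ℝ) hxτ) v).symm
    change (τ _).2 = (τ _).2 + c x • (τ _).2
    rw [e, e, e, map_add, map_smul]

lemma SmoothAlong.mfderiv_apply {V'' : Type*} [NormedAddCommGroup V''] [NormedSpace ℝ V'']
    {M'' : Type*} [TopologicalSpace M''] [ChartedSpace V'' M''] [IsManifold 𝓘(ℝ, V'') ∞ M'']
    {U : Set M} {p : M → M'} {X : ∀ w, TangentSpace 𝓘(ℝ, V') (p w)}
    (hX : SmoothAlong (V := V) U p X) {O : Set M'} (hO : IsOpen O) (hpO : MapsTo p U O)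
    {f : M' → M''} (hf : ContMDiffOn 𝓘(ℝ, V') 𝓘(ℝ, V'') ∞ f O) :
    SmoothAlong (V := V) U (fun w => f (p w))
      fun w => mfderiv 𝓘(ℝ, V') 𝓘(ℝ, V'') f (p w) (X w) := by
  have h := hf.contMDiffOn_tangentMapWithin (m := ∞) (by simp) hO.uniqueMDiffOn
  refine (h.comp hX fun x hx => hpO hx).congr fun x hx => ?_
  simp [tangentMapWithin, mfderivWithin_of_isOpen hO (hpO hx)]

end Composition

/-! ### The inverse function theorem on manifolds, and local normal forms of submersions. -/

section InverseFunction

variable {V : Type*} [NormedAddCommGroup V] [NormedSpace ℝ V] [FiniteDimensional ℝ V]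
variable {M : Type*} [TopologicalSpace M] [ChartedSpace V M]
variable {V' : Type*} [NormedAddCommGroup V'] [NormedSpace ℝ V'] [FiniteDimensional ℝ V']
variable {M' : Type*} [TopologicalSpace M'] [ChartedSpace V' M']

/-- The inverse function theorem in finite dimensional spaces. -/
lemma exists_isDiffeo_model {O : Set V} (hO : IsOpen O) {g : V → V'} (hg : ContDiffOn ℝ ∞ g O)
    {x : V} (hx : x ∈ O) (hbij : Function.Bijective (fderiv ℝ g x)) :
    ∃ e : OpenPartialHomeomorph V V', x ∈ e.source ∧ e.source ⊆ O ∧ IsDiffeo V V' e ∧ ⇑e = g := by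
  have : CompleteSpace V := FiniteDimensional.complete ℝ V
  let A : V ≃L[ℝ] V' := (LinearEquiv.ofBijective (fderiv ℝ g x).toLinearMap
    hbij).toContinuousLinearEquiv
  exact exists_isDiffeo_of_hasFDerivAt hO hg hx (A := A)
    ((hg.contDiffAt (hO.mem_nhds hx)).differentiableAt (by simp)).hasFDerivAt

variable [IsManifold 𝓘(ℝ, V) ∞ M] [IsManifold 𝓘(ℝ, V') ∞ M']

/-- The inverse function theorem. -/
lemma exists_isDiffeo {U : Set M} (hU : IsOpen U) {f : M → M'}
    (hf : ContMDiffOn 𝓘(ℝ, V) 𝓘(ℝ, V') ∞ f U) {x : M} (hx : x ∈ U)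
    (hbij : Function.Bijective (mfderiv 𝓘(ℝ, V) 𝓘(ℝ, V') f x)) :
    ∃ Φ : OpenPartialHomeomorph M M', x ∈ Φ.source ∧ Φ.source ⊆ U ∧ IsDiffeo V V' Φ ∧
      ∀ w ∈ Φ.source, Φ w = f w := by
  have hφ := isDiffeo_chartAt (V := V) x
  have hψ := isDiffeo_chartAt (V := V') (f x)
  have hxφ := mem_chart_source V x
  have hxψ := mem_chart_source V' (f x)
  set φ := chartAt V x
  set ψ := chartAt V' (f x)
  have hS : IsOpen (U ∩ f ⁻¹' ψ.source) := hf.continuousOn.isOpen_inter_preimage hU ψ.open_source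
  let O := φ.target ∩ φ.symm ⁻¹' (U ∩ f ⁻¹' ψ.source)
  have hO : IsOpen O := φ.isOpen_inter_preimage_symm hS
  have h1 : ContMDiffOn 𝓘(ℝ, V) 𝓘(ℝ, V') ∞ (f ∘ φ.symm) O :=
    hf.comp (hφ.2.mono inter_subset_left) fun y hy => hy.2.1
  have hg : ContDiffOn ℝ ∞ (ψ ∘ f ∘ φ.symm) O :=
    (hψ.1.comp h1 fun y hy => hy.2.2).contDiffOn
  have hxO : φ x ∈ O := ⟨φ.map_source hxφ, by
    rw [mem_preimage, φ.left_inv hxφ]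
    exact ⟨hx, hxψ⟩⟩
  have hder : fderiv ℝ (ψ ∘ f ∘ φ.symm) (φ x) = (mfderiv 𝓘(ℝ, V') 𝓘(ℝ, V') ψ (f x)).comp
      ((mfderiv 𝓘(ℝ, V) 𝓘(ℝ, V') f x).comp (mfderiv 𝓘(ℝ, V) 𝓘(ℝ, V) φ.symm (φ x))) := by
    rw [← mfderiv_eq_fderiv]
    have d1 := hφ.symm.mdifferentiableAt (φ.map_source hxφ)
    have d2 : MDifferentiableAt 𝓘(ℝ, V) 𝓘(ℝ, V') f (φ.symm (φ x)) := by
      rw [φ.left_inv hxφ]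
      exact (hf.contMDiffAt (hU.mem_nhds hx)).mdifferentiableAt (by simp)
    have d3 : MDifferentiableAt 𝓘(ℝ, V') 𝓘(ℝ, V') ψ ((f ∘ φ.symm) (φ x)) := by
      rw [Function.comp_apply, φ.left_inv hxφ]
      exact hψ.mdifferentiableAt hxψ
    rw [mfderiv_comp (φ x) d3 (d2.comp (φ x) d1), mfderiv_comp (φ x) d2 d1,
      Function.comp_apply, φ.left_inv hxφ]
  obtain ⟨e, hxe, heO, he, heq⟩ := exists_isDiffeo_model hO hg hxO (by
    rw [hder]
    have b1 : Function.Bijective (mfderiv 𝓘(ℝ, V') 𝓘(ℝ, V') ψ (f x)) :=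
      ⟨hψ.mfderiv_injective hxψ, hψ.mfderiv_surjective hxψ⟩
    have b2 : Function.Bijective (mfderiv 𝓘(ℝ, V) 𝓘(ℝ, V) φ.symm (φ x)) :=
      ⟨hφ.symm.mfderiv_injective (φ.map_source hxφ), hφ.symm.mfderiv_surjective (φ.map_source hxφ)⟩
    have b3 : Function.Bijective (mfderiv 𝓘(ℝ, V) 𝓘(ℝ, V') f (φ.symm (φ x))) := by
      rw [φ.left_inv hxφ]
      exact hbij
    exact b1.comp (hbij.comp b2))
  have he' : ∀ y, e y = ψ (f (φ.symm y)) := fun y => congrFun heq y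
  refine ⟨φ.trans (e.trans ψ.symm), ?_, ?_, hφ.trans (he.trans hψ.symm), ?_⟩
  · rw [OpenPartialHomeomorph.trans_source, OpenPartialHomeomorph.trans_source]
    refine ⟨hxφ, hxe, ?_⟩
    change e (φ x) ∈ ψ.target
    rw [he', φ.left_inv hxφ]
    exact ψ.map_source hxψ
  · intro w hw
    rw [OpenPartialHomeomorph.trans_source, OpenPartialHomeomorph.trans_source] at hw
    have := (heO hw.2.1).2.1
    rwa [φ.left_inv hw.1] at this
  · intro w hw
    rw [OpenPartialHomeomorph.trans_source, OpenPartialHomeomorph.trans_source] at hw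
    have := (heO hw.2.1).2
    rw [mem_preimage, φ.left_inv hw.1] at this
    change ψ.symm (e (φ w)) = f w
    rw [he', φ.left_inv hw.1, ψ.left_inv this.2]

/-- Submersions are projections in suitable coordinates. -/
lemma exists_submersion_chart {U : Set M} (hU : IsOpen U) {p : M → M'}
    (hp : ContMDiffOn 𝓘(ℝ, V) 𝓘(ℝ, V') ∞ p U) {x : M} (hx : x ∈ U)
    (hsurj : Function.Surjective (mfderiv 𝓘(ℝ, V) 𝓘(ℝ, V') p x)) :
    ∃ (N : Submodule ℝ V) (e : OpenPartialHomeomorph M (V' × N)), x ∈ e.source ∧ e.source ⊆ U ∧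
      IsDiffeo V (V' × N) e ∧ ∀ w ∈ e.source, p w ∈ (chartAt V' (p x)).source ∧
        (e w).1 = chartAt V' (p x) (p w) := by
  have hφ := isDiffeo_chartAt (V := V) x
  have hψ := isDiffeo_chartAt (V := V') (p x)
  have hxφ := mem_chart_source V x
  have hxψ := mem_chart_source V' (p x)
  set φ := chartAt V x
  set ψ := chartAt V' (p x)
  have hpx : MDifferentiableAt 𝓘(ℝ, V) 𝓘(ℝ, V') p x :=
    (hp.contMDiffAt (hU.mem_nhds hx)).mdifferentiableAt (by simp)
  -- `A` is the derivative of `p` at `x` read in the chart of the source, and `N` its kernel.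
  -- Completing `ψ ∘ p` by a projection `C` onto `N` gives an injective derivative between spaces of
  -- equal dimension.
  let A : V →ₗ[ℝ] V' := (mfderiv 𝓘(ℝ, V) 𝓘(ℝ, V') p x).toLinearMap ∘ₗ
    (mfderiv 𝓘(ℝ, V) 𝓘(ℝ, V) φ.symm (φ x)).toLinearMap
  let N : Submodule ℝ V := LinearMap.ker A
  obtain ⟨C, hC⟩ := N.subtype.exists_leftInverse_of_injective (by simp)
  have hC' : ∀ v (hv : v ∈ N), C v = ⟨v, hv⟩ := fun v hv => LinearMap.congr_fun hC ⟨v, hv⟩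
  let C' : V →L[ℝ] N := C.toContinuousLinearMap
  let S := U ∩ p ⁻¹' ψ.source ∩ φ.source
  have hS : IsOpen S :=
    (hp.continuousOn.isOpen_inter_preimage hU ψ.open_source).inter φ.open_source
  have hxS : x ∈ S := ⟨⟨hx, hxψ⟩, hxφ⟩
  have hf : ContMDiffOn 𝓘(ℝ, V) 𝓘(ℝ, V' × N) ∞ (fun w => (ψ (p w), C' (φ w))) S :=
    (hψ.1.comp (hp.mono fun w hw => hw.1.1) fun w hw => hw.1.2).prodMk_space
      (C'.contDiff.contMDiff.comp_contMDiffOn (hφ.1.mono inter_subset_right))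
  have hfx := (hf.contMDiffAt (hS.mem_nhds hxS)).mdifferentiableAt (by simp)
  have hder : ∀ v : TangentSpace 𝓘(ℝ, V) x,
      mfderiv 𝓘(ℝ, V) 𝓘(ℝ, V' × N) (fun w => (ψ (p w), C' (φ w))) x v =
      ((mfderiv 𝓘(ℝ, V') 𝓘(ℝ, V') ψ (p x) (mfderiv 𝓘(ℝ, V) 𝓘(ℝ, V') p x v) : V'),
        C (mfderiv 𝓘(ℝ, V) 𝓘(ℝ, V) φ x v)) := by
    intro v
    refine Prod.ext ?_ ?_
    · refine (mfderiv_clm_comp (ContinuousLinearMap.fst ℝ V' N) hfx v).symm.trans ?_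
      exact congrArg (fun L => L v) (mfderiv_comp x (hψ.mdifferentiableAt hxψ) hpx)
    · refine (mfderiv_clm_comp (ContinuousLinearMap.snd ℝ V' N) hfx v).symm.trans ?_
      exact mfderiv_clm_comp C' (hφ.mdifferentiableAt hxφ) v
  have hAφ : ∀ v : TangentSpace 𝓘(ℝ, V) x, A (mfderiv 𝓘(ℝ, V) 𝓘(ℝ, V) φ x v) =
      mfderiv 𝓘(ℝ, V) 𝓘(ℝ, V') p x v := fun v =>
    congrArg (mfderiv 𝓘(ℝ, V) 𝓘(ℝ, V') p x) (hφ.mfderiv_symm_apply hxφ v)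
  have hAsurj : Function.Surjective A := fun u => by
    obtain ⟨v, hv⟩ := hsurj u
    exact ⟨_, (hAφ v).trans hv⟩
  have hinj : Function.Injective
      (mfderiv 𝓘(ℝ, V) 𝓘(ℝ, V' × N) (fun w => (ψ (p w), C' (φ w))) x) := by
    refine (injective_iff_map_eq_zero _).2 fun v hv => ?_
    rw [hder v] at hv
    have h1 : mfderiv 𝓘(ℝ, V) 𝓘(ℝ, V') p x v = 0 :=
      hψ.mfderiv_injective hxψ ((congrArg Prod.fst hv).trans (map_zero _).symm)
    have h2 : mfderiv 𝓘(ℝ, V) 𝓘(ℝ, V) φ x v ∈ N := by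
      change A _ = 0
      exact (hAφ v).trans h1
    have h3 : C (mfderiv 𝓘(ℝ, V) 𝓘(ℝ, V) φ x v) = 0 := congrArg Prod.snd hv
    rw [hC' _ h2] at h3
    exact hφ.mfderiv_injective hxφ ((congrArg Subtype.val h3).trans (map_zero _).symm)
  have hrank : Module.finrank ℝ V = Module.finrank ℝ (V' × N) := by
    rw [Module.finrank_prod, ← LinearMap.finrank_range_add_finrank_ker A,
      LinearMap.range_eq_top.2 hAsurj, finrank_top]
  obtain ⟨e, hxe, heS, he, hef⟩ := exists_isDiffeo hS hf hxS ⟨hinj,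
    (LinearMap.injective_iff_surjective_of_finrank_eq_finrank (V := V) (V₂ := V' × N)
      (f := (mfderiv 𝓘(ℝ, V) 𝓘(ℝ, V' × N) (fun w => (ψ (p w), C' (φ w))) x).toLinearMap)
      hrank).1 hinj⟩
  exact ⟨N, e, hxe, fun w hw => (heS hw).1.1, he, fun w hw =>
    ⟨(heS hw).1.2, by rw [hef w hw]⟩⟩

/-- A map which is infinitesimally constant along the fibres of a submersion factors locally
through it. -/
lemma exists_factor {V'' : Type*} [NormedAddCommGroup V''] [NormedSpace ℝ V'']
    [FiniteDimensional ℝ V''] {M'' : Type*} [TopologicalSpace M''] [ChartedSpace V'' M'']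
    [IsManifold 𝓘(ℝ, V'') ∞ M''] {U : Set M} (hU : IsOpen U) {p : M → M'}
    (hp : ContMDiffOn 𝓘(ℝ, V) 𝓘(ℝ, V') ∞ p U) {x : M} (hx : x ∈ U)
    (hsurj : Function.Surjective (mfderiv 𝓘(ℝ, V) 𝓘(ℝ, V') p x)) {h : M → M''}
    (hh : ContMDiffOn 𝓘(ℝ, V) 𝓘(ℝ, V'') ∞ h U)
    (hker : ∀ w ∈ U, ∀ v, mfderiv 𝓘(ℝ, V) 𝓘(ℝ, V') p w v = 0 →
      mfderiv 𝓘(ℝ, V) 𝓘(ℝ, V'') h w v = 0) :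
    ∃ (W : Set M) (O : Set M') (g : M' → M''), IsOpen W ∧ x ∈ W ∧ W ⊆ U ∧ IsOpen O ∧
      MapsTo p W O ∧ ContMDiffOn 𝓘(ℝ, V') 𝓘(ℝ, V'') ∞ g O ∧ ∀ w ∈ W, h w = g (p w) := by
  have hθ := isDiffeo_chartAt (V := V'') (h x)
  have hψ := isDiffeo_chartAt (V := V') (p x)
  have hxψ := mem_chart_source V' (p x)
  have hxθ := mem_chart_source V'' (h x)
  set θ := chartAt V'' (h x)
  have hS : IsOpen (U ∩ h ⁻¹' θ.source) := hh.continuousOn.isOpen_inter_preimage hU θ.open_source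
  obtain ⟨N, e, hxe, heS, he, hep⟩ := exists_submersion_chart hS (hp.mono inter_subset_left)
    ⟨hx, hxθ⟩ hsurj
  set ψ := chartAt V' (p x)
  obtain ⟨r, hr, hball⟩ := Metric.isOpen_iff.1 e.open_target (e x) (e.map_source hxe)
  have hmem : ∀ u n, u ∈ Metric.ball (e x).1 r → n ∈ Metric.ball (e x).2 r → (u, n) ∈ e.target :=
    fun u n hu hn => hball (by
      rw [← Prod.mk.eta (p := e x), ← ball_prod_same]
      exact ⟨hu, hn⟩)
  -- The map `h` in submersion coordinates and in a chart of the target; it will be constant in the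
  -- variable in `N`.
  let H : V' × N → V'' := fun q => θ (h (e.symm q))
  have hp1 : ∀ q ∈ e.target, q.1 = ψ (p (e.symm q)) := fun q hq => by
    rw [← (hep _ (e.map_target hq)).2, e.right_inv hq]
  -- `H` does not depend on the second variable
  have hconst : ∀ u ∈ Metric.ball (e x).1 r, ∀ n ∈ Metric.ball (e x).2 r,
      H (u, n) = H (u, (e x).2) := by
    intro u hu n hn
    have hd : ∀ k ∈ Metric.ball (e x).2 r, HasFDerivAt (fun k => H (u, k)) (0 : N →L[ℝ] V'') k := by
      intro k hk
      have hq := hmem u k hu hk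
      have hw := e.map_target hq
      have d1 := he.symm.mdifferentiableAt hq
      have d2 := (hh.contMDiffAt (hU.mem_nhds (heS hw).1)).mdifferentiableAt (n := ∞) (by simp)
      have d3 := hθ.mdifferentiableAt (heS hw).2
      have dp := (hp.contMDiffAt (hU.mem_nhds (heS hw).1)).mdifferentiableAt (n := ∞) (by simp)
      have dψ := hψ.mdifferentiableAt (hep _ hw).1
      have hHm : MDifferentiableAt 𝓘(ℝ, V' × N) 𝓘(ℝ, V'') H (u, k) :=
        MDifferentiableAt.comp (u, k) d3 (d2.comp (u, k) d1)
      have hH : HasFDerivAt H (fderiv ℝ H (u, k)) (u, k) :=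
        hHm.differentiableAt.hasFDerivAt
      have hcomp := hH.comp k (hasFDerivAt_prodMk_right u k)
      refine HasFDerivAt.congr_fderiv (f := fun k => H (u, k)) hcomp ?_
      ext v
      have e1 : mfderiv 𝓘(ℝ, V' × N) 𝓘(ℝ, V'') H (u, k) (0, v) =
          mfderiv 𝓘(ℝ, V'') 𝓘(ℝ, V'') θ (h (e.symm (u, k)))
            (mfderiv 𝓘(ℝ, V) 𝓘(ℝ, V'') h (e.symm (u, k))
              (mfderiv 𝓘(ℝ, V' × N) 𝓘(ℝ, V) e.symm (u, k) (0, v))) := by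
        have := mfderiv_comp (u, k) (g := θ) (f := h ∘ e.symm) d3 (d2.comp (u, k) d1)
        rw [mfderiv_comp (u, k) d2 d1] at this
        exact congrArg (fun L => L (0, v)) this
      -- In these coordinates `ψ ∘ p` is the first projection, so the direction `(0, v)` is tangent
      -- to the fibres of `p` and `hker` applies.
      have e2 : mfderiv 𝓘(ℝ, V') 𝓘(ℝ, V') ψ (p (e.symm (u, k)))
            (mfderiv 𝓘(ℝ, V) 𝓘(ℝ, V') p (e.symm (u, k))
              (mfderiv 𝓘(ℝ, V' × N) 𝓘(ℝ, V) e.symm (u, k) (0, v))) = 0 := by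
        have := mfderiv_comp (u, k) (g := ψ) (f := p ∘ e.symm) dψ (dp.comp (u, k) d1)
        rw [mfderiv_comp (u, k) dp d1] at this
        refine (congrArg (fun L => L (0, v)) this).symm.trans ?_
        have h3 : (ψ ∘ p ∘ e.symm) =ᶠ[𝓝 (u, k)] Prod.fst :=
          Filter.eventually_of_mem (e.open_target.mem_nhds hq) fun q hq => (hp1 q hq).symm
        rw [h3.mfderiv_eq, mfderiv_eq_fderiv, fderiv_fst]
        rfl
      have e3 := hker _ (heS hw).1 _
        (hψ.mfderiv_injective (hep _ hw).1 (e2.trans (map_zero _).symm))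
      rw [e3, map_zero, mfderiv_eq_fderiv] at e1
      exact e1
    exact (convex_ball _ _).is_const_of_fderivWithin_eq_zero (𝕜 := ℝ)
      (f := fun k => H (u, k))
      (fun k hk => (hd k hk).differentiableAt.differentiableWithinAt)
      (fun k hk => by
        rw [fderivWithin_of_isOpen Metric.isOpen_ball hk, (hd k hk).fderiv]) hn
      (Metric.mem_ball_self hr)
  -- The factor is `h` on the slice through `e x` on which the second coordinate is frozen.
  refine ⟨e.source ∩ e ⁻¹' Metric.ball (e x) r, ψ.source ∩ ψ ⁻¹' Metric.ball (e x).1 r,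
    fun y => h (e.symm (ψ y, (e x).2)), e.isOpen_inter_preimage Metric.isOpen_ball,
    ⟨hxe, Metric.mem_ball_self hr⟩, fun w hw => (heS hw.1).1,
    ψ.isOpen_inter_preimage Metric.isOpen_ball, ?_, ?_, ?_⟩
  · intro w hw
    refine ⟨(hep w hw.1).1, ?_⟩
    rw [mem_preimage, ← (hep w hw.1).2]
    have := hw.2
    rw [mem_preimage, ← Prod.mk.eta (p := e x), ← ball_prod_same] at this
    exact this.1
  · refine (hh.comp (he.2.comp (t := e.target)
      ((hψ.1.mono inter_subset_left).prodMk_space contMDiffOn_const)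
      fun y hy => hmem _ _ hy.2 (Metric.mem_ball_self hr)) fun y hy => ?_)
    exact (heS (e.map_target (hmem _ _ hy.2 (Metric.mem_ball_self hr)))).1
  · intro w hw
    have h1 := hw.2
    rw [mem_preimage, ← Prod.mk.eta (p := e x), ← ball_prod_same] at h1
    have h2 := hconst _ h1.1 _ h1.2
    simp only [H, Prod.mk.eta, e.left_inv hw.1] at h2
    rw [(hep w hw.1).2] at h2
    refine θ.injOn (heS hw.1).2 ?_ h2
    change h (e.symm (ψ (p w), (e x).2)) ∈ θ.source
    rw [← (hep w hw.1).2]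
    exact (heS (e.map_target (hmem _ _ h1.1 (Metric.mem_ball_self hr)))).2

/-- Submersions have local sections. -/
lemma exists_section {U : Set M} (hU : IsOpen U) {p : M → M'}
    (hp : ContMDiffOn 𝓘(ℝ, V) 𝓘(ℝ, V') ∞ p U) {x : M} (hx : x ∈ U)
    (hsurj : Function.Surjective (mfderiv 𝓘(ℝ, V) 𝓘(ℝ, V') p x)) :
    ∃ (O : Set M') (σ : M' → M), IsOpen O ∧ p x ∈ O ∧ ContMDiffOn 𝓘(ℝ, V') 𝓘(ℝ, V) ∞ σ O ∧
      MapsTo σ O U ∧ σ (p x) = x ∧ ∀ y ∈ O, p (σ y) = y := by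
  have hψ := isDiffeo_chartAt (V := V') (p x)
  have hxψ := mem_chart_source V' (p x)
  obtain ⟨N, e, hxe, heU, he, hep⟩ := exists_submersion_chart hU hp hx hsurj
  set ψ := chartAt V' (p x)
  -- The section is again the slice with second coordinate frozen at its value at `x`.
  have hq : ContMDiffOn 𝓘(ℝ, V') 𝓘(ℝ, V' × N) ∞ (fun y => (ψ y, (e x).2)) ψ.source :=
    hψ.1.prodMk_space contMDiffOn_const
  refine ⟨ψ.source ∩ (fun y => (ψ y, (e x).2)) ⁻¹' e.target, fun y => e.symm (ψ y, (e x).2),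
    hq.continuousOn.isOpen_inter_preimage ψ.open_source e.open_target, ⟨hxψ, ?_⟩,
    he.2.comp (hq.mono inter_subset_left) fun y hy => hy.2,
    fun y hy => heU (e.map_target hy.2), ?_, fun y hy => ?_⟩
  · rw [mem_preimage, ← (hep x hxe).2]
    exact e.map_source hxe
  · simp only
    rw [← (hep x hxe).2]
    exact e.left_inv hxe
  · have h1 := hep _ (e.map_target hy.2)
    rw [e.right_inv hy.2] at h1
    exact ψ.injOn h1.1 hy.1 h1.2.symm

end InverseFunction

/-! ### The smooth structure of the projectivization. -/

section ProjectiveSpace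

variable {V : Type*} [NormedAddCommGroup V] [NormedSpace ℝ V] [CompleteSpace V]
variable {Y : Type*} [TopologicalSpace Y] [ChartedSpace V Y] [IsManifold 𝓘(ℝ, V) ∞ Y]
variable {D : SubspaceField V Y} {hD : IsDistribution 2 D}

namespace ProjSpace

lemma exists_chartAt (z : ProjSpace hD) :
    ∃ α β, (chartAt (V × ℝ) z).toPartialEquiv = projChart hD z α β := ⟨_, _, rfl⟩

lemma contMDiff_base : ContMDiff 𝓘(ℝ, V × ℝ) 𝓘(ℝ, V) ∞ (ProjSpace.base (hD := hD)) := by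
  intro z
  obtain ⟨α, β, he⟩ := exists_chartAt z
  have hs : (chartAt (V × ℝ) z).source = (projChart hD z α β).source :=
    congrArg PartialEquiv.source he
  have hval : ∀ w, chartAt (V × ℝ) z w = projChart hD z α β w := fun w =>
    congrArg (fun e : PartialEquiv (ProjSpace hD) (V × ℝ) => e w) he
  have h1 : ContMDiffOn 𝓘(ℝ, V × ℝ) 𝓘(ℝ, V) ∞ (fun w => (chartAt (V × ℝ) z w).1)
      (chartAt (V × ℝ) z).source :=
    contDiff_fst.contMDiff.comp_contMDiffOn contMDiffOn_chart
  have h2 := (contMDiffOn_chart_symm (I := 𝓘(ℝ, V)) (n := ∞) (x := z.base)).comp h1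
    (fun w hw => by
      change (chartAt (V × ℝ) z w).1 ∈ (chartAt V z.base).target
      rw [hs] at hw
      rw [hval]
      exact (chartAt V z.base).map_source hw.1)
  refine (h2.congr fun w hw => ?_).contMDiffAt
    ((chartAt (V × ℝ) z).open_source.mem_nhds (mem_chart_source _ z))
  rw [hs] at hw
  simp only [Function.comp_apply, hval]
  exact ((chartAt V z.base).left_inv hw.1).symm

/-- Points of `P(D)` are compared through their images in the sigma type, since their lines live in
tangent spaces that depend on the base points. -/
lemma toSigma_injective : Function.Injective (toSigma (hD := hD)) := by
  rintro ⟨y, l, h, h'⟩ ⟨y', l', k, k'⟩ heq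
  cases heq
  rfl

lemma span_ne_zero {z : ProjSpace hD} {y : Y} {u : TangentSpace 𝓘(ℝ, V) y}
    (h : z.toSigma = ⟨y, Submodule.span ℝ {u}⟩) : u ≠ 0 := by
  obtain ⟨b, l, hl, hle⟩ := z
  obtain rfl : b = y := congrArg Sigma.fst h
  obtain rfl : l = Submodule.span ℝ {u} := eq_of_heq (Sigma.ext_iff.1 h).2
  rintro rfl
  change Module.finrank ℝ (Submodule.span ℝ {(0 : TangentSpace 𝓘(ℝ, V) b)}) = 1 at hl
  rw [Submodule.span_zero_singleton, finrank_bot] at hl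
  exact zero_ne_one hl

/-- With a spanning vector of the line, the domain of a chart is described by nonvanishing of forms,
which is an open condition when the vector varies smoothly. -/
lemma mem_projChart_source_iff {z₀ z : ProjSpace hD} {α β : V →L[ℝ] ℝ} {y : Y}
    {u : TangentSpace 𝓘(ℝ, V) y} (h : z.toSigma = ⟨y, Submodule.span ℝ {u}⟩) :
    z ∈ (projChart hD z₀ α β).source ↔ y ∈ (chartAt V z₀.base).source ∧
      Separates (D y) (formAt z₀.base α y) (formAt z₀.base β y) ∧ formAt z₀.base α y u ≠ 0 := by
  have hu := span_ne_zero h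
  obtain ⟨b, l, hl, hle⟩ := z
  obtain rfl : b = y := congrArg Sigma.fst h
  obtain rfl : l = Submodule.span ℝ {u} := eq_of_heq (Sigma.ext_iff.1 h).2
  refine and_congr_right fun _ => and_congr_right fun _ => ⟨fun h h0 => ?_, fun h v hv hv0 => ?_⟩
  · exact hu (h u (Submodule.mem_span_singleton_self u) h0)
  · obtain ⟨c, rfl⟩ := Submodule.mem_span_singleton.1 hv
    rw [map_smul, smul_eq_mul] at hv0
    rw [(mul_eq_zero.1 hv0).resolve_right h, zero_smul]

lemma projChart_apply {z₀ z : ProjSpace hD} {α β : V →L[ℝ] ℝ} {y : Y}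
    {u : TangentSpace 𝓘(ℝ, V) y} (h : z.toSigma = ⟨y, Submodule.span ℝ {u}⟩)
    (hz : z ∈ (projChart hD z₀ α β).source) :
    projChart hD z₀ α β z =
      (chartAt V z₀.base y, formAt z₀.base β y u / formAt z₀.base α y u) := by
  have hu := ((mem_projChart_source_iff h).1 hz).2.2
  obtain ⟨b, l, hl, hle⟩ := z
  obtain rfl : b = y := congrArg Sigma.fst h
  obtain rfl : l = Submodule.span ℝ {u} := eq_of_heq (Sigma.ext_iff.1 h).2
  exact Prod.ext rfl (slope_eq hl hz.2.2 (Submodule.mem_span_singleton_self u) hu)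

variable {V' : Type*} [NormedAddCommGroup V'] [NormedSpace ℝ V'] [CompleteSpace V']
variable {M : Type*} [TopologicalSpace M] [ChartedSpace V' M] [IsManifold 𝓘(ℝ, V') ∞ M]

/-- A map to `P(D)` is smooth if its lines are spanned by a smooth section along a map to the
base. -/
lemma contMDiffOn_of_toSigma {U : Set M} (hU : IsOpen U) {f : M → ProjSpace hD} {p : M → Y}
    {v : ∀ w, TangentSpace 𝓘(ℝ, V) (p w)} (hv : SmoothAlong (V := V') U p v)
    (hf : ∀ w ∈ U, (f w).toSigma = ⟨p w, Submodule.span ℝ {v w}⟩) :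
    ContMDiffOn 𝓘(ℝ, V') 𝓘(ℝ, V × ℝ) ∞ f U := by
  intro x hx
  obtain ⟨α, β, he⟩ := exists_chartAt (f x)
  have hs : (chartAt (V × ℝ) (f x)).source = (projChart hD (f x) α β).source :=
    congrArg PartialEquiv.source he
  have hval : ∀ w, chartAt (V × ℝ) (f x) w = projChart hD (f x) α β w := fun w =>
    congrArg (fun e : PartialEquiv (ProjSpace hD) (V × ℝ) => e w) he
  have hx1 := mem_chart_source (V × ℝ) (f x)
  rw [hs, mem_projChart_source_iff (hf x hx)] at hx1
  obtain ⟨hxc, hxS, hxα⟩ := hx1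
  set y₀ := (f x).base
  obtain ⟨O, hxO, s, hs'⟩ := hD.exists_frame (p x)
  have hp := hv.base
  let U' := (U ∩ p ⁻¹' O) ∩ p ⁻¹' (chartAt V y₀).source
  have hUO : IsOpen (U ∩ p ⁻¹' O) := hp.continuousOn.isOpen_inter_preimage hU hs'.isOpen
  have hU' : IsOpen U' := (hp.continuousOn.mono inter_subset_left).isOpen_inter_preimage hUO
    (chartAt V y₀).open_source
  have hsα : ∀ γ i, SmoothFn V' U' fun w => formAt y₀ γ (p w) (s i (p w)) := fun γ i =>
    SmoothAlong.formAt (SmoothVF.comp (hp.mono inter_subset_left) (fun w hw => hw.2)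
      (hs'.smooth i)) y₀ γ
  have hvα : ∀ γ, SmoothFn V' U' fun w => formAt y₀ γ (p w) (v w) := fun γ =>
    (hv.mono inter_subset_left).formAt y₀ γ
  let det : M → ℝ := fun w => formAt y₀ α (p w) (s 0 (p w)) * formAt y₀ β (p w) (s 1 (p w)) -
    formAt y₀ α (p w) (s 1 (p w)) * formAt y₀ β (p w) (s 0 (p w))
  have hdet : SmoothFn V' U' det := ((hsα α 0).mul (hsα β 1)).sub ((hsα α 1).mul (hsα β 0))
  have hsep : ∀ w ∈ U', Separates (D (p w)) (formAt y₀ α (p w)) (formAt y₀ β (p w)) ↔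
      det w ≠ 0 := fun w hw => by
    rw [hs'.eq _ hw.1.2]
    exact separates_span_iff (hs'.indep _ hw.1.2) _ _
  have hxU' : x ∈ U' := ⟨⟨hx, hxO⟩, hxc⟩
  -- Here `α, β` are coordinates on the plane and `α` does not vanish on `v`. The chart expression
  -- of `f` is then the base point and the quotient of `β` and `α` on `v`.
  let N := (U' ∩ det ⁻¹' {0}ᶜ) ∩ (fun w => formAt y₀ α (p w) (v w)) ⁻¹' {0}ᶜ
  have hN1 : IsOpen (U' ∩ det ⁻¹' {0}ᶜ) :=
    hdet.continuousOn.isOpen_inter_preimage hU' isOpen_compl_singleton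
  have hN : IsOpen N := ((hvα α).continuousOn.mono inter_subset_left).isOpen_inter_preimage hN1
    isOpen_compl_singleton
  have hNs : ∀ w ∈ N, f w ∈ (projChart hD (f x) α β).source := fun w hw =>
    (mem_projChart_source_iff (hf w hw.1.1.1.1)).2 ⟨hw.1.1.2, (hsep w hw.1.1).2 hw.1.2, hw.2⟩
  have h1 : ContMDiffOn 𝓘(ℝ, V') 𝓘(ℝ, V × ℝ) ∞ (fun w => (chartAt V y₀ (p w),
      formAt y₀ β (p w) (v w) / formAt y₀ α (p w) (v w))) N := by
    refine ContMDiffOn.prodMk_space ?_ ?_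
    · exact (contMDiffOn_chart (I := 𝓘(ℝ, V)) (n := ∞) (x := y₀)).comp
        (hp.mono fun w hw => hw.1.1.1.1) fun w hw => hw.1.1.2
    · exact ((hvα β).mono fun w hw => hw.1.1).div₀ ((hvα α).mono fun w hw => hw.1.1)
        fun w hw => hw.2
  have h2 := (contMDiffOn_chart_symm (I := 𝓘(ℝ, V × ℝ)) (n := ∞) (x := f x)).comp h1
    (fun w hw => by
      rw [mem_preimage, ← projChart_apply (hf w hw.1.1.1.1) (hNs w hw), ← hval]
      exact (chartAt (V × ℝ) (f x)).map_source (hs ▸ hNs w hw))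
  refine ((h2.congr fun w hw => ?_).contMDiffAt (hN.mem_nhds
    ⟨⟨hxU', (hsep x hxU').1 hxS⟩, hxα⟩)).contMDiffWithinAt
  rw [Function.comp_apply, ← projChart_apply (hf w hw.1.1.1.1) (hNs w hw), ← hval]
  exact ((chartAt (V × ℝ) (f x)).left_inv (hs ▸ hNs w hw)).symm

lemma exists_toSigma {y : Y} {u : TangentSpace 𝓘(ℝ, V) y} (hu : u ∈ D y) (h0 : u ≠ 0) :
    ∃ z : ProjSpace hD, z.toSigma = ⟨y, Submodule.span ℝ {u}⟩ :=
  ⟨⟨y, Submodule.span ℝ {u}, finrank_span_singleton h0,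
    (Submodule.span_singleton_le_iff_mem _ _).2 hu⟩, rfl⟩

lemma exists_line_eq (z : ProjSpace hD) :
    ∃ u : TangentSpace 𝓘(ℝ, V) z.base, u ∈ D z.base ∧ u ≠ 0 ∧ z.line = Submodule.span ℝ {u} := by
  obtain ⟨⟨u, hu⟩, hu0, hspan⟩ := finrank_eq_one_iff'.1 z.finrank_line
  refine ⟨u, z.line_le hu, fun h => hu0 (Subtype.ext h), le_antisymm (fun v hv => ?_)
    ((Submodule.span_singleton_le_iff_mem _ _).2 hu)⟩
  obtain ⟨c, hc⟩ := hspan ⟨v, hv⟩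
  exact Submodule.mem_span_singleton.2 ⟨c, congrArg Subtype.val hc⟩

/-- Near each point, the lines are the lines `⟨η₀ + t η₁⟩` for a frame `η₀, η₁` of `D` and a smooth
function `t`. -/
lemma exists_slope (z : ProjSpace hD) : ∃ (O : Set Y) (η : Fin 2 → VField V Y)
    (N : Set (ProjSpace hD)) (t : ProjSpace hD → ℝ), IsFrameOn D O η ∧ IsOpen N ∧ z ∈ N ∧
      MapsTo base N O ∧ SmoothFn (V × ℝ) N t ∧
      ∀ w ∈ N, w.line = Submodule.span ℝ {η 0 w.base + t w • η 1 w.base} := by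
  obtain ⟨α, β, he⟩ := exists_chartAt z
  have hs : (chartAt (V × ℝ) z).source = (projChart hD z α β).source :=
    congrArg PartialEquiv.source he
  have hval : ∀ w, chartAt (V × ℝ) z w = projChart hD z α β w := fun w =>
    congrArg (fun e : PartialEquiv (ProjSpace hD) (V × ℝ) => e w) he
  have hz := mem_chart_source (V × ℝ) z
  obtain ⟨O, hzO, s, hsO⟩ := hD.exists_frame z.base
  let r : ProjSpace hD → ℝ := fun w =>
    TwoThreeFive.slope w.line (formAt z.base α w.base) (formAt z.base β w.base)
  -- The form `β - r α` on the plane vanishes on the line of `w`. If it does not vanish on `η 1`,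
  -- the line is spanned by `η 0 - (lam (η 0) / lam (η 1)) η 1`.
  let lam : VField V Y → ProjSpace hD → ℝ := fun X w =>
    formAt z.base β w.base (X w.base) - r w * formAt z.base α w.base (X w.base)
  have key : ∀ η : Fin 2 → VField V Y, IsFrameOn D O η → lam (η 1) z ≠ 0 →
      ∃ (N : Set (ProjSpace hD)) (t : ProjSpace hD → ℝ), IsOpen N ∧ z ∈ N ∧
      MapsTo base N O ∧ SmoothFn (V × ℝ) N t ∧
      ∀ w ∈ N, w.line = Submodule.span ℝ {η 0 w.base + t w • η 1 w.base} := by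
    intro η hη hne
    let S := base ⁻¹' O ∩ (chartAt (V × ℝ) z).source
    have hS : IsOpen S := (contMDiff_base.continuous.isOpen_preimage O hη.isOpen).inter
      (chartAt (V × ℝ) z).open_source
    have hr : SmoothFn (V × ℝ) S r := by
      have h1 : ContMDiffOn 𝓘(ℝ, V × ℝ) 𝓘(ℝ, ℝ) ∞ (fun w => (chartAt (V × ℝ) z w).2)
          (chartAt (V × ℝ) z).source :=
        contDiff_snd.contMDiff.comp_contMDiffOn contMDiffOn_chart
      refine (h1.mono inter_subset_right).congr fun w hw => ?_
      rw [hval]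
      rfl
    have hform : ∀ γ i, SmoothFn (V × ℝ) S fun w => formAt z.base γ w.base (η i w.base) := by
      intro γ i
      refine (SmoothAlong.formAt (SmoothVF.comp (contMDiff_base.contMDiffOn (s := S))
        (fun w hw => hw.1) (hη.smooth i)) z.base γ).mono fun w hw => ⟨hw, ?_⟩
      have := hw.2
      rw [hs] at this
      exact this.1
    have hlam : ∀ i, SmoothFn (V × ℝ) S (lam (η i)) := fun i =>
      (hform β i).sub (hr.mul (hform α i))
    refine ⟨S ∩ lam (η 1) ⁻¹' {0}ᶜ, fun w => -(lam (η 0) w / lam (η 1) w),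
      (hlam 1).continuousOn.isOpen_inter_preimage hS isOpen_compl_singleton, ⟨⟨hzO, hz⟩, hne⟩,
      fun w hw => hw.1.1, ?_, fun w hw => ?_⟩
    · exact (((hlam 0).mono inter_subset_left).div₀ ((hlam 1).mono inter_subset_left)
        fun w hw => hw.2).neg
    · have hw1 : lam (η 1) w ≠ 0 := hw.2
      have hws := hw.1.2
      rw [hs] at hws
      have hle : w.line ≤ Submodule.span ℝ
          {η 0 w.base + (-(lam (η 0) w / lam (η 1) w)) • η 1 w.base} := by
        intro v hv
        have h1 := slope_spec w.finrank_line (formAt z.base β w.base) hws.2.2 v hv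
        have h2 := w.line_le hv
        rw [hη.eq _ hw.1.1] at h2
        obtain ⟨c, rfl⟩ := (Submodule.mem_span_range_iff_exists_fun ℝ).1 h2
        rw [Fin.sum_univ_two] at h1 ⊢
        rw [Submodule.mem_span_singleton]
        refine ⟨c 0, ?_⟩
        have h3 : c 1 = -(c 0 * (lam (η 0) w / lam (η 1) w)) := by
          simp only [map_add, map_smul, smul_eq_mul] at h1
          have h4 : c 0 * lam (η 0) w + c 1 * lam (η 1) w = 0 := by
            simp only [lam, r]
            linear_combination h1
          field_simp
          linear_combination h4
        rw [h3, smul_add, smul_smul]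
        congr 2
        ring
      have hfin : FiniteDimensional ℝ (Submodule.span ℝ
          {η 0 w.base + (-(lam (η 0) w / lam (η 1) w)) • η 1 w.base}) :=
        FiniteDimensional.span_singleton ℝ _
      exact Submodule.eq_of_le_of_finrank_le hle
        ((finrank_span_le_card (R := ℝ) _).trans (by simp [w.finrank_line]))
  rw [hs] at hz
  -- The form is nonzero on the plane, because it takes the value `1` at the vector with `α = 0` and
  -- `β = 1`. So it is nonzero on some member of the frame, which is made the second one.
  by_cases h1 : lam (s 1) z = 0
  · by_cases h0 : lam (s 0) z = 0
    · exfalso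
      obtain ⟨v, hv, hv0, hv1⟩ := exists_dual (hD.finrank z.base) hz.2.1 0 1
      rw [hsO.eq _ hzO] at hv
      obtain ⟨c, rfl⟩ := (Submodule.mem_span_range_iff_exists_fun ℝ).1 hv
      rw [Fin.sum_univ_two] at hv0 hv1
      simp only [map_add, map_smul, smul_eq_mul] at hv0 hv1
      simp only [lam] at h0 h1
      have : (1 : ℝ) = 0 := by
        linear_combination c 0 * h0 + c 1 * h1 - hv1 + r z * hv0
      exact one_ne_zero this
    · have hsw : IsFrameOn D O ![s 1, s 0] := by
        have e1 : ∀ y, (fun i => (![s 1, s 0] : Fin 2 → VField V Y) i y) =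
            (fun i => s i y) ∘ Equiv.swap 0 1 := fun y => by
          funext i
          fin_cases i <;> simp
        refine ⟨hsO.isOpen, fun i => ?_, fun y hy => ?_, fun y hy => ?_⟩
        · fin_cases i
          exacts [hsO.smooth 1, hsO.smooth 0]
        · rw [e1]
          exact (hsO.indep y hy).comp _ (Equiv.injective _)
        · rw [hsO.eq y hy, spanField, spanField, e1, EquivLike.range_comp]
      obtain ⟨N, t, h⟩ := key _ hsw h0
      exact ⟨O, _, N, t, hsw, h⟩
  · obtain ⟨N, t, h⟩ := key _ hsO h1
    exact ⟨O, _, N, t, hsO, h⟩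

lemma mem_vertical {z : ProjSpace hD} {v : TangentSpace 𝓘(ℝ, V × ℝ) z} :
    v ∈ vertical hD z ↔ mfderiv 𝓘(ℝ, V × ℝ) 𝓘(ℝ, V) (base (hD := hD)) z v = 0 := Iff.rfl

/-- The point of `P(D)` with given base point and direction (and `z` if there is none). -/
def ofSigma (z : ProjSpace hD) (q : Σ y : Y, Submodule ℝ (TangentSpace 𝓘(ℝ, V) y)) :
    ProjSpace hD :=
  open Classical in if h : ∃ w : ProjSpace hD, w.toSigma = q then h.choose else z

lemma toSigma_ofSigma (z : ProjSpace hD) {q : Σ y : Y, Submodule ℝ (TangentSpace 𝓘(ℝ, V) y)}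
    (h : ∃ w : ProjSpace hD, w.toSigma = q) : (ofSigma z q).toSigma = q := by
  rw [ofSigma, dif_pos h]
  exact h.choose_spec

/-- The point over `y` with the line `⟨η₀ + s η₁⟩`, in the chart `ψ` of the base. -/
lemma exists_param (z : ProjSpace hD) {O : Set Y} {η : Fin 2 → VField V Y}
    (hη : IsFrameOn D O η) : ∃ (S : Set (V × ℝ)) (G : V × ℝ → ProjSpace hD),
      IsOpen S ∧ (∀ y ∈ O ∩ (chartAt V z.base).source, ∀ s, (chartAt V z.base y, s) ∈ S) ∧
      ContMDiffOn 𝓘(ℝ, V × ℝ) 𝓘(ℝ, V × ℝ) ∞ G S ∧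
      ∀ y ∈ O ∩ (chartAt V z.base).source, ∀ s, (G (chartAt V z.base y, s)).toSigma =
        ⟨y, Submodule.span ℝ {η 0 y + s • η 1 y}⟩ := by
  set ψ := chartAt V z.base
  let S : Set (V × ℝ) := (ψ.target ∩ ψ.symm ⁻¹' O) ×ˢ univ
  have hS : IsOpen S := (ψ.isOpen_inter_preimage_symm hη.isOpen).prod isOpen_univ
  let p : V × ℝ → Y := fun q => ψ.symm q.1
  have hp : ContMDiffOn 𝓘(ℝ, V × ℝ) 𝓘(ℝ, V) ∞ p S :=
    (contMDiffOn_chart_symm (I := 𝓘(ℝ, V)) (n := ∞) (x := z.base)).comp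
      contDiff_fst.contMDiff.contMDiffOn fun q hq => hq.1.1
  let v : ∀ q, TangentSpace 𝓘(ℝ, V) (p q) := fun q => η 0 (p q) + q.2 • η 1 (p q)
  have hv : SmoothAlong (V := V × ℝ) S p v := by
    have h0 := SmoothVF.comp hp (fun q hq => hq.1.2) (hη.smooth 0)
    have h1 := SmoothVF.comp hp (fun q hq => hq.1.2) (hη.smooth 1)
    exact SmoothAlong.add_smul h0 contDiff_snd.contMDiff.contMDiffOn h1
  have hq : ∀ q ∈ S, ∃ w : ProjSpace hD, w.toSigma = ⟨p q, Submodule.span ℝ {v q}⟩ := by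
    intro q hq
    refine exists_toSigma ?_ ?_
    · exact (D _).add_mem ((hη.isSectionOn 0).2 _ hq.1.2)
        ((D _).smul_mem _ ((hη.isSectionOn 1).2 _ hq.1.2))
    · intro h0
      have := LinearIndependent.pair_iff.1 (by
        have := hη.indep _ hq.1.2
        rwa [show (fun i => η i (p q)) = ![η 0 (p q), η 1 (p q)] by
          funext i; fin_cases i <;> rfl] at this) 1 q.2 (by rwa [one_smul])
      exact one_ne_zero this.1
  have hmem : ∀ y ∈ O ∩ ψ.source, ∀ s : ℝ, (ψ y, s) ∈ S := fun y hy s =>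
    ⟨⟨ψ.map_source hy.2, by rw [mem_preimage, ψ.left_inv hy.2]; exact hy.1⟩, trivial⟩
  refine ⟨S, fun q => ofSigma z ⟨p q, Submodule.span ℝ {v q}⟩, hS, hmem,
    contMDiffOn_of_toSigma hS hv fun q hqS => toSigma_ofSigma z (hq q hqS), fun y hy s => ?_⟩
  rw [toSigma_ofSigma z (hq _ (hmem y hy s))]
  simp only [p, v]
  rw [ψ.left_inv hy.2]
  rfl

/-- Keeping the slope fixed at `t z` gives a smooth local section of the projection through `z`. -/
lemma mfderiv_base_surjective (z : ProjSpace hD) : Function.Surjective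
    (mfderiv 𝓘(ℝ, V × ℝ) 𝓘(ℝ, V) (base (hD := hD)) z) := by
  obtain ⟨O, η, N, t, hη, hN, hz, hNO, ht, hline⟩ := exists_slope z
  obtain ⟨S, G, hS, hmem, hG, hGs⟩ := exists_param z hη
  have hψ := isDiffeo_chartAt (V := V) z.base
  have hzψ := mem_chart_source V z.base
  set ψ := chartAt V z.base
  let σ : Y → ProjSpace hD := fun y => G (ψ y, t z)
  have hO : IsOpen (O ∩ ψ.source) := hη.isOpen.inter ψ.open_source
  have hσ : ContMDiffOn 𝓘(ℝ, V) 𝓘(ℝ, V × ℝ) ∞ σ (O ∩ ψ.source) :=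
    hG.comp ((hψ.1.mono inter_subset_right).prodMk_space contMDiffOn_const)
      fun y hy => hmem y hy _
  have hσz : σ z.base = z := toSigma_injective (by
    rw [hGs _ ⟨hNO hz, hzψ⟩, ← hline z hz]
    rfl)
  have hσb : base ∘ σ =ᶠ[𝓝 z.base] id :=
    Filter.eventually_of_mem (hO.mem_nhds ⟨hNO hz, hzψ⟩) fun y hy =>
      congrArg Sigma.fst (hGs y hy (t z))
  have d1 := (hσ.contMDiffAt (hO.mem_nhds ⟨hNO hz, hzψ⟩)).mdifferentiableAt (n := ∞) (by simp)
  have d2 : MDifferentiableAt 𝓘(ℝ, V × ℝ) 𝓘(ℝ, V) (base (hD := hD)) (σ z.base) :=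
    contMDiff_base.contMDiffAt.mdifferentiableAt (n := ∞) (by simp)
  have h := mfderiv_comp z.base d2 d1
  rw [hσb.mfderiv_eq, mfderiv_id, hσz] at h
  intro v
  exact ⟨mfderiv 𝓘(ℝ, V) 𝓘(ℝ, V × ℝ) σ z.base v, (congrArg (fun L => L v) h).symm⟩

lemma finrank_vertical [FiniteDimensional ℝ V] (z : ProjSpace hD) :
    Module.finrank ℝ (vertical hD z) = 1 := by
  let A : V × ℝ →ₗ[ℝ] V := (mfderiv 𝓘(ℝ, V × ℝ) 𝓘(ℝ, V) (base (hD := hD)) z).toLinearMap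
  have h := A.finrank_range_add_finrank_ker
  have hA : LinearMap.range A = ⊤ := LinearMap.range_eq_top.2 (mfderiv_base_surjective z)
  rw [hA, finrank_top, Module.finrank_prod,
    Module.finrank_self] at h
  exact Nat.add_left_cancel h

/-- The slope is a coordinate along the fibres. -/
lemma dirDeriv_slope_ne_zero (z : ProjSpace hD) {O : Set Y} {η : Fin 2 → VField V Y}
    {N : Set (ProjSpace hD)} {t : ProjSpace hD → ℝ} (hη : IsFrameOn D O η) (hN : IsOpen N)
    (hz : z ∈ N) (hNO : MapsTo base N O) (ht : SmoothFn (V × ℝ) N t)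
    (hline : ∀ w ∈ N, w.line = Submodule.span ℝ {η 0 w.base + t w • η 1 w.base})
    {T : VField (V × ℝ) (ProjSpace hD)} (hT : T z ∈ vertical hD z) (hT0 : T z ≠ 0) :
    dirDeriv t T z ≠ 0 := by
  intro h0
  obtain ⟨S, G, hS, hmem, hG, hGs⟩ := exists_param z hη
  have hψ := isDiffeo_chartAt (V := V) z.base
  have hzψ := mem_chart_source V z.base
  set ψ := chartAt V z.base
  -- The base point and the slope determine the point: `G` is a left inverse of `Q` near `z`. A
  -- vertical vector along which `t` has derivative zero is killed by `dQ`, hence is zero.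
  let Q : ProjSpace hD → V × ℝ := fun w => (ψ w.base, t w)
  have hN' : IsOpen (N ∩ base ⁻¹' ψ.source) :=
    hN.inter (contMDiff_base.continuous.isOpen_preimage _ ψ.open_source)
  have hQ : ContMDiffOn 𝓘(ℝ, V × ℝ) 𝓘(ℝ, V × ℝ) ∞ Q (N ∩ base ⁻¹' ψ.source) :=
    (hψ.1.comp contMDiff_base.contMDiffOn fun w hw => hw.2).prodMk_space
      (ht.mono inter_subset_left)
  have hGQ : G ∘ Q =ᶠ[𝓝 z] id :=
    Filter.eventually_of_mem (hN'.mem_nhds ⟨hz, hzψ⟩) fun w hw => toSigma_injective (by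
      rw [Function.comp_apply, hGs _ ⟨hNO hw.1, hw.2⟩, ← hline w hw.1]
      rfl)
  have dQ := (hQ.contMDiffAt (hN'.mem_nhds ⟨hz, hzψ⟩)).mdifferentiableAt (n := ∞) (by simp)
  have dG := (hG.contMDiffAt (hS.mem_nhds (hmem _ ⟨hNO hz, hzψ⟩ (t z)))).mdifferentiableAt
    (n := ∞) (by simp)
  have db : MDifferentiableAt 𝓘(ℝ, V × ℝ) 𝓘(ℝ, V) (base (hD := hD)) z :=
    contMDiff_base.contMDiffAt.mdifferentiableAt (n := ∞) (by simp)
  have h := mfderiv_comp z dG dQ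
  rw [hGQ.mfderiv_eq, mfderiv_id] at h
  have hQT : mfderiv 𝓘(ℝ, V × ℝ) 𝓘(ℝ, V × ℝ) Q z (T z) = 0 := by
    refine Prod.ext ?_ ?_
    · refine (mfderiv_clm_comp (ContinuousLinearMap.fst ℝ V ℝ) dQ (T z)).symm.trans ?_
      have := mfderiv_comp z (hψ.mdifferentiableAt hzψ) db
      refine (congrArg (fun L => L (T z)) this).trans ?_
      have h1 : mfderiv 𝓘(ℝ, V × ℝ) 𝓘(ℝ, V) (base (hD := hD)) z (T z) = 0 := hT
      simp only [ContinuousLinearMap.comp_apply]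
      rw [h1]
      exact map_zero _
    · refine (mfderiv_clm_comp (ContinuousLinearMap.snd ℝ V ℝ) dQ (T z)).symm.trans ?_
      exact h0
  have h2 := congrArg (fun L => L (T z)) h
  simp only [ContinuousLinearMap.comp_apply] at h2
  rw [hQT, map_zero] at h2
  exact hT0 h2

end ProjSpace

end ProjectiveSpace

/-! ### Iterated brackets of two vector fields. -/

section FiveFrames

variable {V : Type*} [NormedAddCommGroup V] [NormedSpace ℝ V] [CompleteSpace V]
variable {M : Type*} [TopologicalSpace M] [ChartedSpace V M] [IsManifold 𝓘(ℝ, V) ∞ M]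

/-- The fields `a, b, [a, b], [a, [a, b]], [b, [a, b]]`. -/
def fiveFrame (a b : VField V M) : Fin 5 → VField V M :=
  ![a, b, lieB a b, lieB a (lieB a b), lieB b (lieB a b)]

lemma fiveFrame_smooth {U : Set M} (hU : IsOpen U) {a b : VField V M} (ha : SmoothVF U a)
    (hb : SmoothVF U b) (i : Fin 5) : SmoothVF U (fiveFrame a b i) := by
  have hc := ha.lieB hU hb
  fin_cases i
  exacts [ha, hb, hc, ha.lieB hU hc, hb.lieB hU hc]

lemma fiveFrame_apply (a b : VField V M) (x : M) : (fun i => fiveFrame a b i x) =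
    ![a x, b x, lieB a b x, lieB a (lieB a b) x, lieB b (lieB a b) x] := by
  funext i
  fin_cases i <;> rfl

/-- Brackets of combinations of `a` and `b`. -/
lemma smoothComb_fiveFrame {U : Set M} (hU : IsOpen U) {a b X Y : VField V M} (ha : SmoothVF U a)
    (hb : SmoothVF U b) (hX : SmoothComb ![a, b] U X) (hY : SmoothComb ![a, b] U Y) (i : Fin 5) :
    SmoothComb (fiveFrame a b) U (fiveFrame X Y i) := by
  have hc := ha.lieB hU hb
  have s2 : ∀ i, SmoothVF U ((![a, b] : Fin 2 → VField V M) i) := by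
    intro i; fin_cases i; exacts [ha, hb]
  have s3 : ∀ i, SmoothVF U ((![a, b, lieB a b] : Fin 3 → VField V M) i) := by
    intro i; fin_cases i; exacts [ha, hb, hc]
  have m2 : ∀ i, SmoothComb (![a, b, lieB a b] : Fin 3 → VField V M) U
      ((![a, b] : Fin 2 → VField V M) i) := by
    intro i; fin_cases i
    exacts [SmoothComb.self ![a, b, lieB a b] U 0, SmoothComb.self ![a, b, lieB a b] U 1]
  have m3 : ∀ i, SmoothComb (fiveFrame a b) U ((![a, b, lieB a b] : Fin 3 → VField V M) i) := by
    intro i; fin_cases i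
    exacts [SmoothComb.self (fiveFrame a b) U 0, SmoothComb.self (fiveFrame a b) U 1,
      SmoothComb.self (fiveFrame a b) U 2]
  have n3 : SmoothComb ![a, b, lieB a b] U (lieB b a) :=
    (SmoothComb.self ![a, b, lieB a b] U 2).neg.congr fun x _ => lieB_swap b a x
  have z3 : ∀ c, SmoothComb ![a, b, lieB a b] U (lieB c c) := fun c =>
    (SmoothComb.zero _ U).congr fun x _ => lieB_self c x
  -- The outer brackets are taken only with combinations of `a` and `b`, so no bracket outside the
  -- list of five fields arises.
  have hXY : SmoothComb ![a, b, lieB a b] U (lieB X Y) := by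
    refine SmoothComb.lieB hU hX hY s2 s2 m2 m2 fun i j => ?_
    fin_cases i <;> fin_cases j
    exacts [z3 a, SmoothComb.self ![a, b, lieB a b] U 2, n3, z3 b]
  have key : ∀ Z, SmoothComb ![a, b] U Z → SmoothComb (fiveFrame a b) U (lieB Z (lieB X Y)) := by
    intro Z hZ
    refine SmoothComb.lieB hU hZ hXY s2 s3 (fun i => (m2 i).trans m3) m3 fun i j => ?_
    fin_cases i <;> fin_cases j
    exacts [(z3 a).trans m3, SmoothComb.self (fiveFrame a b) U 2,
      SmoothComb.self (fiveFrame a b) U 3, n3.trans m3, (z3 b).trans m3,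
      SmoothComb.self (fiveFrame a b) U 4]
  fin_cases i
  exacts [hX.trans fun i => (m2 i).trans m3, hY.trans fun i => (m2 i).trans m3, hXY.trans m3,
    key X hX, key Y hY]

variable [FiniteDimensional ℝ V] {D : SubspaceField V M}

/-- The defining property of a `(2,3,5)`-distribution holds for each local frame. -/
lemma Is235.linearIndependent (hD : Is235 D) {O : Set M} {η : Fin 2 → VField V M}
    (hη : IsFrameOn D O η) {y : M} (hy : y ∈ O) :
    LinearIndependent ℝ fun i => fiveFrame (η 0) (η 1) i y := by
  obtain ⟨U, hU, hyU, a, b, ha, hb, hab⟩ := hD.frame y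
  have hO := hη.isOpen.inter hU
  have hη2 : η = ![η 0, η 1] := by funext i; fin_cases i <;> rfl
  -- The five independent fields supplied by the definition are combinations of those of `η`. The
  -- latter therefore span the five-dimensional tangent space, and five spanning vectors are
  -- independent.
  have hcomb : ∀ i, SmoothComb (fiveFrame (η 0) (η 1)) (O ∩ U) (fiveFrame a b i) :=
    smoothComb_fiveFrame hO ((hη.smooth 0).mono inter_subset_left)
      ((hη.smooth 1).mono inter_subset_left)
      (hη2 ▸ hη.smoothComb hO inter_subset_left (ha.mono inter_subset_right))
      (hη2 ▸ hη.smoothComb hO inter_subset_left (hb.mono inter_subset_right))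
  have hfin : FiniteDimensional ℝ (TangentSpace 𝓘(ℝ, V) y) :=
    inferInstanceAs (FiniteDimensional ℝ V)
  have hcard : Fintype.card (Fin 5) = Module.finrank ℝ (TangentSpace 𝓘(ℝ, V) y) :=
    (Fintype.card_fin 5).trans hD.dim.symm
  refine linearIndependent_of_top_le_span_of_card_eq_finrank ?_ hcard
  have htop := (hab y hyU).span_eq_top_of_card_eq_finrank' hcard
  rw [← htop, Submodule.span_le]
  rw [show ![a y, b y, VectorField.mlieBracket 𝓘(ℝ, V) a b y, _, _] = _ from
    (fiveFrame_apply a b y).symm]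
  rintro _ ⟨i, rfl⟩
  exact (hcomb i).mem_span ⟨hy, hyU⟩

end FiveFrames

/-! ### Lifted frames and the choice of the complement. -/

section Splitting

variable {V : Type*} [NormedAddCommGroup V] [NormedSpace ℝ V] [CompleteSpace V]
  [FiniteDimensional ℝ V]
variable {M : Type*} [TopologicalSpace M] [ChartedSpace V M] [IsManifold 𝓘(ℝ, V) ∞ M]
variable {V' : Type*} [NormedAddCommGroup V'] [NormedSpace ℝ V'] [CompleteSpace V']
  [FiniteDimensional ℝ V']
variable {M' : Type*} [TopologicalSpace M'] [ChartedSpace V' M'] [IsManifold 𝓘(ℝ, V') ∞ M']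

/-- A line field `T` tangent to the fibres of `p`, and lifts of fields `a, b` on the base. -/
structure IsLiftFrame (U : Set M) (p : M → M') (O : Set M') (a b : VField V' M')
    (T g₁ g₂ : VField V M) : Prop where
  isOpen : IsOpen U
  isOpen_base : IsOpen O
  smooth_map : ContMDiffOn 𝓘(ℝ, V) 𝓘(ℝ, V') ∞ p U
  mapsTo : MapsTo p U O
  smooth_a : SmoothVF O a
  smooth_b : SmoothVF O b
  smooth_T : SmoothVF U T
  smooth_g₁ : SmoothVF U g₁
  smooth_g₂ : SmoothVF U g₂
  ne_zero : ∀ w ∈ U, T w ≠ 0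
  ker : ∀ w ∈ U, ∀ v, mfderiv 𝓘(ℝ, V) 𝓘(ℝ, V') p w v = 0 → v ∈ Submodule.span ℝ {T w}
  map_T : ∀ w ∈ U, mfderiv 𝓘(ℝ, V) 𝓘(ℝ, V') p w (T w) = 0
  map_g₁ : ∀ w ∈ U, mfderiv 𝓘(ℝ, V) 𝓘(ℝ, V') p w (g₁ w) = a (p w)
  map_g₂ : ∀ w ∈ U, mfderiv 𝓘(ℝ, V) 𝓘(ℝ, V') p w (g₂ w) = b (p w)

/-- Local existence of lifts. -/
lemma exists_isLiftFrame {U : Set M} (hU : IsOpen U) {p : M → M'}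
    (hp : ContMDiffOn 𝓘(ℝ, V) 𝓘(ℝ, V') ∞ p U) {x : M} (hx : x ∈ U)
    (hsurj : Function.Surjective (mfderiv 𝓘(ℝ, V) 𝓘(ℝ, V') p x)) {O : Set M'} (hO : IsOpen O)
    (hxO : p x ∈ O) {a b : VField V' M'} (ha : SmoothVF O a) (hb : SmoothVF O b)
    (hker : ∀ w ∈ U, Module.finrank ℝ (pull V V' p w ⊥) = 1) :
    ∃ (N : Set M) (T g₁ g₂ : VField V M), x ∈ N ∧ N ⊆ U ∧ IsLiftFrame N p O a b T g₁ g₂ := by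
  have hS : IsOpen (U ∩ p ⁻¹' O) := hp.continuousOn.isOpen_inter_preimage hU hO
  have hpS := hp.mono (inter_subset_left (t := p ⁻¹' O))
  obtain ⟨⟨v, hv⟩, hv0, -⟩ := finrank_eq_one_iff'.1 (hker x hx)
  obtain ⟨N₀, hN₀, hx₀, hNS₀, T, hT, hTp, hTx⟩ := exists_kernel_extend hS hpS ⟨hx, hxO⟩ hsurj hv
  obtain ⟨N₁, hN₁, hx₁, hNS₁, g₁, hg₁, hgp₁, -⟩ := exists_lift hS hpS ⟨hx, hxO⟩ hsurj
    (SmoothVF.comp hpS (fun w hw => hw.2) ha)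
  obtain ⟨N₂, hN₂, hx₂, hNS₂, g₂, hg₂, hgp₂, -⟩ := exists_lift hS hpS ⟨hx, hxO⟩ hsurj
    (SmoothVF.comp hpS (fun w hw => hw.2) hb)
  -- Applied to one field, openness of independence keeps `T` nonzero near `x`.
  obtain ⟨N₃, hN₃, hx₃, hNS₃, hli⟩ := SmoothVF.exists_open_linearIndependent
    (g := fun _ : Fin 1 => T) hN₀ (fun _ => hT) hx₀ (by
      refine LinearIndependent.of_subsingleton (0 : Fin 1) ?_
      rw [hTx]
      exact fun h => hv0 (Subtype.ext h))
  have hne : ∀ w ∈ N₃, T w ≠ 0 := fun w hw => (hli w hw).ne_zero 0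
  refine ⟨N₃ ∩ N₁ ∩ N₂, T, g₁, g₂, ⟨⟨hx₃, hx₁⟩, hx₂⟩, fun w hw => (hNS₁ hw.1.2).1,
    { isOpen := (hN₃.inter hN₁).inter hN₂
      isOpen_base := hO
      smooth_map := hp.mono fun w hw => (hNS₁ hw.1.2).1
      mapsTo := fun w hw => (hNS₁ hw.1.2).2
      smooth_a := ha
      smooth_b := hb
      smooth_T := hT.mono fun w hw => hNS₃ hw.1.1
      smooth_g₁ := hg₁.mono fun w hw => hw.1.2
      smooth_g₂ := hg₂.mono fun w hw => hw.2
      ne_zero := fun w hw => hne w hw.1.1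
      ker := fun w hw v hv => ?_
      map_T := fun w hw => hTp w (hNS₃ hw.1.1)
      map_g₁ := fun w hw => hgp₁ w hw.1.2
      map_g₂ := fun w hw => hgp₂ w hw.2 }⟩
  have hT1 : T w ∈ pull V V' p w ⊥ := hTp w (hNS₃ hw.1.1)
  have h1 := hker w (hNS₁ hw.1.2).1
  obtain ⟨c, hc⟩ := (finrank_eq_one_iff_of_nonzero' (⟨T w, hT1⟩ : pull V V' p w ⊥)
    (fun h => hne w hw.1.1 (congrArg Subtype.val h))).1 h1 ⟨v, hv⟩
  exact Submodule.mem_span_singleton.2 ⟨c, congrArg Subtype.val hc⟩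

namespace IsLiftFrame

variable {U : Set M} {p : M → M'} {O : Set M'} {a b : VField V' M'} {T g₁ g₂ : VField V M}

lemma smooth_five (h : IsLiftFrame U p O a b T g₁ g₂) (i : Fin 5) :
    SmoothVF U (fiveFrame g₁ g₂ i) := fiveFrame_smooth h.isOpen h.smooth_g₁ h.smooth_g₂ i

lemma map_five (h : IsLiftFrame U p O a b T g₁ g₂) (i : Fin 5) {w : M} (hw : w ∈ U) :
    mfderiv 𝓘(ℝ, V) 𝓘(ℝ, V') p w (fiveFrame g₁ g₂ i w) = fiveFrame a b i (p w) := by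
  have hc := h.smooth_a.lieB h.isOpen_base h.smooth_b
  have hg := h.smooth_g₁.lieB h.isOpen h.smooth_g₂
  have h3 : ∀ w ∈ U, mfderiv 𝓘(ℝ, V) 𝓘(ℝ, V') p w (lieB g₁ g₂ w) = lieB a b (p w) := fun w hw =>
    mfderiv_lieB h.isOpen h.isOpen_base h.smooth_map h.mapsTo h.smooth_g₁ h.smooth_g₂ h.smooth_a
      h.smooth_b h.map_g₁ h.map_g₂ hw
  fin_cases i
  · exact h.map_g₁ w hw
  · exact h.map_g₂ w hw
  · exact h3 w hw
  · exact mfderiv_lieB h.isOpen h.isOpen_base h.smooth_map h.mapsTo h.smooth_g₁ hg h.smooth_a hc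
      h.map_g₁ h3 hw
  · exact mfderiv_lieB h.isOpen h.isOpen_base h.smooth_map h.mapsTo h.smooth_g₂ hg h.smooth_b hc
      h.map_g₂ h3 hw

/-- Brackets of `T` with lifts are multiples of `T`. -/
lemma lieB_T (h : IsLiftFrame U p O a b T g₁ g₂) (i : Fin 5) {w : M} (hw : w ∈ U) :
    lieB T (fiveFrame g₁ g₂ i) w ∈ Submodule.span ℝ {T w} := by
  refine h.ker w hw _ ?_
  -- `T` is related to the zero field, so its bracket with a lift projects to zero.
  rw [mfderiv_lieB (X' := 0) h.isOpen h.isOpen_base h.smooth_map h.mapsTo h.smooth_T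
    (h.smooth_five i) (fun y _ => contMDiff_zeroSection ℝ (TangentSpace 𝓘(ℝ, V') : M' → Type _) y |>.contMDiffWithinAt)
    (fiveFrame_smooth h.isOpen_base h.smooth_a h.smooth_b i) h.map_T (fun w hw => h.map_five i hw) hw,
    lieB_swap, lieB_zero_right, neg_zero]

/-- The projection separates the five lifted fields, while `T` is nonzero in its kernel. -/
lemma linearIndependent (h : IsLiftFrame U p O a b T g₁ g₂) {w : M} (hw : w ∈ U)
    (hab : LinearIndependent ℝ fun i => fiveFrame a b i (p w)) :
    LinearIndependent ℝ (Fin.cons (T w) fun i => fiveFrame g₁ g₂ i w : Fin 6 → _) := by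
  have h5 : LinearIndependent ℝ fun i => fiveFrame g₁ g₂ i w := by
    refine LinearIndependent.of_comp (mfderiv 𝓘(ℝ, V) 𝓘(ℝ, V') p w).toLinearMap ?_
    convert hab using 1
    funext i
    exact h.map_five i hw
  refine LinearIndependent.finCons' (T w) _ h5 fun c y hy hcy => ?_
  by_contra hc
  obtain ⟨d, rfl⟩ := (Submodule.mem_span_range_iff_exists_fun ℝ).1 hy
  have h1 := congrArg (mfderiv 𝓘(ℝ, V) 𝓘(ℝ, V') p w) hcy
  rw [map_add, map_smul, h.map_T w hw, smul_zero, zero_add, map_zero, map_sum] at h1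
  have h2 := Fintype.linearIndependent_iff.1 hab d (by
    rw [← h1]
    refine Finset.sum_congr rfl fun i _ => ?_
    rw [map_smul, h.map_five i hw])
  simp only [h2, zero_smul, Finset.sum_const_zero, add_zero] at hcy
  exact h.ne_zero w hw ((smul_eq_zero.1 hcy).resolve_left hc)

/-- A vector differs from a lift of its image by a kernel vector, that is, by a multiple of `T`. -/
lemma pull_le (h : IsLiftFrame U p O a b T g₁ g₂) {w : M} (hw : w ∈ U)
    {B : Submodule ℝ (TangentSpace 𝓘(ℝ, V') (p w))} {S : Submodule ℝ (TangentSpace 𝓘(ℝ, V) w)}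
    (hT : T w ∈ S) (hB : ∀ u ∈ B, ∃ x ∈ S, mfderiv 𝓘(ℝ, V) 𝓘(ℝ, V') p w x = u) :
    pull V V' p w B ≤ S := by
  intro v hv
  obtain ⟨x, hx, hxv⟩ := hB _ hv
  have h1 : v - x ∈ S := (Submodule.span_singleton_le_iff_mem _ _).2 hT
    (h.ker w hw (v - x) (by rw [map_sub, hxv]; exact sub_self _))
  simpa using S.add_mem h1 hx

/-- The candidates for adapted frames. -/
def adapted (T g₁ g₂ : VField V M) (t lam : M → ℝ) : Fin 6 → VField V M :=
  -- The second field projects into the line of slope `t`; the term in `lam` is the freedom in the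
  -- choice of `K`. The fifth is the bracket of the second with `[g₁, g₂]`, up to `g₂` and `T`.
  ![T, (g₁ + t • g₂) + lam • T, g₂, lieB g₁ g₂, lieB g₁ (lieB g₁ g₂) + t • lieB g₂ (lieB g₁ g₂),
    lieB g₂ (lieB g₁ g₂)]

lemma adapted_smooth (h : IsLiftFrame U p O a b T g₁ g₂) {t lam : M → ℝ} (ht : SmoothFn V U t)
    (hlam : SmoothFn V U lam) (i : Fin 6) : SmoothVF U (adapted T g₁ g₂ t lam i) := by
  fin_cases i
  · exact h.smooth_T
  · exact (h.smooth_g₁.add (h.smooth_g₂.smul ht)).add (h.smooth_T.smul hlam)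
  · exact h.smooth_g₂
  · exact h.smooth_five 2
  · exact (h.smooth_five 3).add ((h.smooth_five 4).smul ht)
  · exact h.smooth_five 4

/-- The change from `T` and the five lifted fields is unitriangular up to order: the extra terms
involve only `T`, `g₂` and `g₅`, which are members themselves. -/
lemma adapted_span (h : IsLiftFrame U p O a b T g₁ g₂) (hV : Module.finrank ℝ V = 6)
    (t lam : M → ℝ) {w : M} (hw : w ∈ U)
    (hab : LinearIndependent ℝ fun i => fiveFrame a b i (p w)) :
    Submodule.span ℝ (range fun i => adapted T g₁ g₂ t lam i w) = ⊤ := by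
  have hfin : FiniteDimensional ℝ (TangentSpace 𝓘(ℝ, V) w) :=
    inferInstanceAs (FiniteDimensional ℝ V)
  set S := Submodule.span ℝ (range fun i => adapted T g₁ g₂ t lam i w)
  have hm : ∀ i, adapted T g₁ g₂ t lam i w ∈ S := fun i => Submodule.subset_span ⟨i, rfl⟩
  have m0 : T w ∈ S := hm 0
  have m1 : (g₁ w + t w • g₂ w) + lam w • T w ∈ S := hm 1
  have m2 : g₂ w ∈ S := hm 2
  have m3 : lieB g₁ g₂ w ∈ S := hm 3
  have m4 : lieB g₁ (lieB g₁ g₂) w + t w • lieB g₂ (lieB g₁ g₂) w ∈ S := hm 4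
  have m5 : lieB g₂ (lieB g₁ g₂) w ∈ S := hm 5
  rw [eq_top_iff, ← (h.linearIndependent hw hab).span_eq_top_of_card_eq_finrank'
    ((Fintype.card_fin 6).trans hV.symm), Submodule.span_le]
  rintro _ ⟨i, rfl⟩
  refine Fin.cases m0 (fun i => ?_) i
  rw [Fin.cons_succ]
  fin_cases i
  · exact (S.add_mem_iff_left (S.smul_mem _ m2)).1 ((S.add_mem_iff_left (S.smul_mem _ m0)).1 m1)
  · exact m2
  · exact m3
  · exact (S.add_mem_iff_left (S.smul_mem _ m5)).1 m4
  · exact m5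

lemma adapted_linearIndependent (h : IsLiftFrame U p O a b T g₁ g₂) (hV : Module.finrank ℝ V = 6)
    (t lam : M → ℝ) {w : M} (hw : w ∈ U)
    (hab : LinearIndependent ℝ fun i => fiveFrame a b i (p w)) :
    LinearIndependent ℝ fun i => adapted T g₁ g₂ t lam i w := by
  have hfin : FiniteDimensional ℝ (TangentSpace 𝓘(ℝ, V) w) :=
    inferInstanceAs (FiniteDimensional ℝ V)
  exact linearIndependent_of_top_le_span_of_card_eq_finrank
    (h.adapted_span hV t lam hw hab).ge ((Fintype.card_fin 6).trans hV.symm)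

/-- A lift of a frame of a `(2,3,5)`-distribution, and a coordinate `t` along the fibres, give
an adapted frame. -/
lemma exists_isG2Frame (h : IsLiftFrame U p O a b T g₁ g₂) (hV : Module.finrank ℝ V = 6)
    (hab : ∀ y ∈ O, LinearIndependent ℝ fun i => fiveFrame a b i y) {t : M → ℝ}
    (ht : SmoothFn V U t) (htT : ∀ w ∈ U, dirDeriv t T w ≠ 0) :
    ∃ lam : M → ℝ, IsG2Frame U (adapted T g₁ g₂ t lam) := by
  have hU := h.isOpen
  have s0 := h.smooth_T
  have s1 := h.smooth_g₁
  have s2 := h.smooth_g₂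
  have s3 : SmoothVF U (lieB g₁ g₂) := h.smooth_five 2
  have s4 : SmoothVF U (lieB g₁ (lieB g₁ g₂)) := h.smooth_five 3
  have s5 : SmoothVF U (lieB g₂ (lieB g₁ g₂)) := h.smooth_five 4
  have b1 : ∀ w ∈ U, ∃ c : ℝ, c • T w = lieB T g₁ w := fun w hw =>
    Submodule.mem_span_singleton.1 (h.lieB_T 0 hw)
  have b2 : ∀ w ∈ U, ∃ c : ℝ, c • T w = lieB T g₂ w := fun w hw =>
    Submodule.mem_span_singleton.1 (h.lieB_T 1 hw)
  have b3 : ∀ w ∈ U, ∃ c : ℝ, c • T w = lieB T (lieB g₁ g₂) w := fun w hw =>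
    Submodule.mem_span_singleton.1 (h.lieB_T 2 hw)
  have b4 : ∀ w ∈ U, ∃ c : ℝ, c • T w = lieB T (lieB g₁ (lieB g₁ g₂)) w := fun w hw =>
    Submodule.mem_span_singleton.1 (h.lieB_T 3 hw)
  have b5 : ∀ w ∈ U, ∃ c : ℝ, c • T w = lieB T (lieB g₂ (lieB g₁ g₂)) w := fun w hw =>
    Submodule.mem_span_singleton.1 (h.lieB_T 4 hw)
  set g₃ := lieB g₁ g₂ with hg₃
  set g₄ := lieB g₁ g₃ with hg₄
  set g₅ := lieB g₂ g₃ with hg₅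
  -- `u` and `T` span the prolongation, and `v` is the direction added by `∂⁽³⁾E`.
  let u := g₁ + t • g₂
  let v := g₄ + t • g₅
  have st2 : SmoothVF U (t • g₂) := s2.smul ht
  have st5 : SmoothVF U (t • g₅) := s5.smul ht
  have su : SmoothVF U u := s1.add st2
  have sv : SmoothVF U v := s4.add st5
  have s00 : SmoothFn V U (fun _ : M => (0 : ℝ)) := contMDiffOn_const
  -- the coefficients of `[u, v]`
  obtain ⟨c, hc, huv⟩ := smoothComb_of_mem_span hU
    (h.adapted_smooth ht s00)
    (fun w hw => h.adapted_linearIndependent hV t _ hw (hab _ (h.mapsTo hw)))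
    (su.lieB hU sv) (fun w hw => by
      rw [h.adapted_span hV t _ hw (hab _ (h.mapsTo hw))]
      trivial)
  have hdt : SmoothFn V U (dirDeriv t T) := SmoothFn.dirDeriv hU ht s0
  -- The coefficient of `g₅` in `[u + lam T, v]` is `c 5 + lam T(t)`. As `T(t)` does not vanish, it
  -- can be made zero.
  let lam : M → ℝ := fun w => -(c 5 w / dirDeriv t T w)
  have hlam : SmoothFn V U lam := ((hc 5).div₀ hdt htT).neg
  have slT : SmoothVF U (lam • T) := s0.smul hlam
  refine ⟨lam, ?_⟩
  set f := adapted T g₁ g₂ t lam with hf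
  have f0 : f 0 = T := rfl
  have f1 : f 1 = u + lam • T := rfl
  have f2 : f 2 = g₂ := rfl
  have f3 : f 3 = g₃ := rfl
  have f4 : f 4 = v := rfl
  have f5 : f 5 = g₅ := rfl
  have m0 : ∀ {k : ℕ}, 0 < k → ∀ w, T w ∈ flag f k w := fun hk w => mem_flag f (i := 0) hk w
  have m1 : ∀ {k : ℕ}, 1 < k → ∀ w, (u + lam • T) w ∈ flag f k w := fun hk w =>
    mem_flag f (i := 1) hk w
  have m2 : ∀ {k : ℕ}, 2 < k → ∀ w, g₂ w ∈ flag f k w := fun hk w => mem_flag f (i := 2) hk w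
  have m3 : ∀ {k : ℕ}, 3 < k → ∀ w, g₃ w ∈ flag f k w := fun hk w => mem_flag f (i := 3) hk w
  have m4 : ∀ {k : ℕ}, 4 < k → ∀ w, v w ∈ flag f k w := fun hk w => mem_flag f (i := 4) hk w
  -- the brackets
  have e01 : ∀ w ∈ U, ∃ r : ℝ, lieB (f 0) (f 1) w = dirDeriv t T w • g₂ w + r • T w := by
    intro w hw
    obtain ⟨c1, h1⟩ := b1 w hw
    obtain ⟨c2, h2⟩ := b2 w hw
    refine ⟨c1 + t w * c2 + dirDeriv lam T w, ?_⟩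
    rw [f0, f1, lieB_add_right hU su slT hw, lieB_add_right hU s1 st2 hw,
      lieB_smul_right hU ht s2 hw, lieB_smul_right hU hlam s0 hw, lieB_self, ← h1, ← h2]
    module
  have e04 : ∀ w ∈ U, ∃ r : ℝ, lieB (f 0) (f 4) w = dirDeriv t T w • g₅ w + r • T w := by
    intro w hw
    obtain ⟨c4, h4⟩ := b4 w hw
    obtain ⟨c5, h5⟩ := b5 w hw
    refine ⟨c4 + t w * c5, ?_⟩
    rw [f0, f4, lieB_add_right hU s4 st5 hw, lieB_smul_right hU ht s5 hw, ← h4, ← h5]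
    module
  have e12 : ∀ w ∈ U, ∃ r r' : ℝ, lieB (f 1) (f 2) w = g₃ w + r • g₂ w + r' • T w := by
    intro w hw
    obtain ⟨c2, h2⟩ := b2 w hw
    refine ⟨-dirDeriv t g₂ w, -dirDeriv lam g₂ w + lam w * c2, ?_⟩
    rw [f1, f2, lieB_add_left hU su slT hw, lieB_add_left hU s1 st2 hw,
      lieB_smul_left hU ht s2 hw, lieB_smul_left hU hlam s0 hw, lieB_self, ← h2, hg₃]
    module
  have e13 : ∀ w ∈ U, ∃ r r' : ℝ, lieB (f 1) (f 3) w = v w + r • g₂ w + r' • T w := by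
    intro w hw
    obtain ⟨c3, h3⟩ := b3 w hw
    refine ⟨-dirDeriv t g₃ w, -dirDeriv lam g₃ w + lam w * c3, ?_⟩
    rw [f1, f3, lieB_add_left hU su slT hw, lieB_add_left hU s1 st2 hw,
      lieB_smul_left hU ht s2 hw, lieB_smul_left hU hlam s0 hw, ← h3]
    change _ = (g₄ w + t w • g₅ w) + _ + _
    rw [hg₄, hg₅]
    module
  -- The bracket is `[u, v] + lam [T, v] - v(lam) T`. By the choice of `lam` its component along
  -- `g₅` cancels, and the rest lies in the flag.
  have e14 : ∀ w ∈ U, lieB (f 1) (f 4) w ∈ flag f 5 w := by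
    intro w hw
    obtain ⟨r, hr⟩ := e04 w hw
    rw [f0, f4] at hr
    rw [f1, f4, lieB_add_left hU su slT hw, lieB_smul_left hU hlam s0 hw, hr, huv w hw,
      Fin.sum_univ_six]
    have hu : u w ∈ flag f 5 w := (Submodule.add_mem_iff_left _
      (Submodule.smul_mem _ (lam w) (m0 (by norm_num) w))).1 (m1 (by norm_num) w)
    have hk : c 5 w + lam w * dirDeriv t T w = 0 := by
      simp only [lam]
      field_simp [htT w hw]
      ring
    -- The coefficients `c` refer to the frame with `lam = 0`, whose second member is `u + 0 • T`.
    have e : c 0 w • adapted T g₁ g₂ t (fun _ => 0) 0 w + c 1 w • adapted T g₁ g₂ t (fun _ => 0) 1 w +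
        c 2 w • adapted T g₁ g₂ t (fun _ => 0) 2 w + c 3 w • adapted T g₁ g₂ t (fun _ => 0) 3 w +
        c 4 w • adapted T g₁ g₂ t (fun _ => 0) 4 w + c 5 w • adapted T g₁ g₂ t (fun _ => 0) 5 w =
      c 0 w • T w + c 1 w • (u w + (0 : ℝ) • T w) + c 2 w • g₂ w + c 3 w • g₃ w + c 4 w • v w +
        c 5 w • g₅ w := rfl
    have e' : (c 0 w • T w + c 1 w • (u w + (0 : ℝ) • T w) + c 2 w • g₂ w + c 3 w • g₃ w +
        c 4 w • v w + c 5 w • g₅ w) + (-dirDeriv lam v w • T w +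
          lam w • (dirDeriv t T w • g₅ w + r • T w)) =
        (c 0 w - dirDeriv lam v w + lam w * r) • T w + c 1 w • u w + c 2 w • g₂ w + c 3 w • g₃ w +
          c 4 w • v w + (c 5 w + lam w * dirDeriv t T w) • g₅ w := by
      module
    rw [e, e', hk, zero_smul, add_zero]
    exact add_mem (add_mem (add_mem (add_mem (Submodule.smul_mem _ _ (m0 (by norm_num) w))
      (Submodule.smul_mem _ _ hu)) (Submodule.smul_mem _ _ (m2 (by norm_num) w)))
      (Submodule.smul_mem _ _ (m3 (by norm_num) w))) (Submodule.smul_mem _ _ (m4 (by norm_num) w))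
  have hsup : ∀ {k : ℕ} {w : M} (x : TangentSpace 𝓘(ℝ, V) w),
      x ∈ flag f k w ⊔ Submodule.span ℝ {x} := fun {k w} x =>
    (le_sup_right : _ ≤ flag f k w ⊔ Submodule.span ℝ {x}) (Submodule.mem_span_singleton_self x)
  have hsupl : ∀ {k : ℕ} {w : M} (x : TangentSpace 𝓘(ℝ, V) w) {y : TangentSpace 𝓘(ℝ, V) w},
      y ∈ flag f k w → y ∈ flag f k w ⊔ Submodule.span ℝ {x} := fun {k w} x {y} hy =>
    (le_sup_left : _ ≤ flag f k w ⊔ Submodule.span ℝ {x}) hy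
  exact
    { isOpen := hU
      smooth := h.adapted_smooth ht hlam
      indep := fun w hw => h.adapted_linearIndependent hV t lam hw (hab _ (h.mapsTo hw))
      br_01 := fun w hw => by
        obtain ⟨r, hr⟩ := e01 w hw
        rw [hr]
        exact add_mem (Submodule.smul_mem _ _ (m2 (by norm_num) w))
          (Submodule.smul_mem _ _ (m0 (by norm_num) w))
      br_02 := fun w hw => by
        obtain ⟨r, hr⟩ := b2 w hw
        rw [f0, f2, ← hr]
        exact Submodule.smul_mem _ _ (m0 (by norm_num) w)
      br_03 := fun w hw => by
        obtain ⟨r, hr⟩ := b3 w hw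
        rw [f0, f3, ← hr]
        exact Submodule.smul_mem _ _ (m0 (by norm_num) w)
      br_12 := fun w hw => by
        obtain ⟨r, r', hr⟩ := e12 w hw
        rw [hr]
        exact add_mem (add_mem (m3 (by norm_num) w) (Submodule.smul_mem _ _ (m2 (by norm_num) w)))
          (Submodule.smul_mem _ _ (m0 (by norm_num) w))
      br_13 := fun w hw => by
        obtain ⟨r, r', hr⟩ := e13 w hw
        rw [hr]
        exact add_mem (add_mem (m4 (by norm_num) w) (Submodule.smul_mem _ _ (m2 (by norm_num) w)))
          (Submodule.smul_mem _ _ (m0 (by norm_num) w))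
      br_14 := e14
      gen_2 := fun w hw => by
        obtain ⟨r, hr⟩ := e01 w hw
        -- `T(t) ≠ 0` is what makes `[T, u + lam T]` yield a new direction.
        refine (Submodule.smul_mem_iff _ (htT w hw)).1 ?_
        rw [f2, eq_sub_of_add_eq hr.symm]
        exact sub_mem (hsup _) (hsupl _ (Submodule.smul_mem _ _ (m0 (by norm_num) w)))
      gen_3 := fun w hw => by
        obtain ⟨r, r', hr⟩ := e12 w hw
        rw [f3, show g₃ w = lieB (f 1) (f 2) w - r' • T w - r • g₂ w by rw [hr]; module]
        exact sub_mem (sub_mem (hsup _) (hsupl _ (Submodule.smul_mem _ _ (m0 (by norm_num) w))))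
          (hsupl _ (Submodule.smul_mem _ _ (m2 (by norm_num) w)))
      gen_4 := fun w hw => by
        obtain ⟨r, r', hr⟩ := e13 w hw
        rw [f4, show v w = lieB (f 1) (f 3) w - r' • T w - r • g₂ w by rw [hr]; module]
        exact sub_mem (sub_mem (hsup _) (hsupl _ (Submodule.smul_mem _ _ (m0 (by norm_num) w))))
          (hsupl _ (Submodule.smul_mem _ _ (m2 (by norm_num) w)))
      gen_5 := fun w hw => by
        obtain ⟨r, hr⟩ := e04 w hw
        refine (Submodule.smul_mem_iff _ (htT w hw)).1 ?_
        rw [f5, eq_sub_of_add_eq hr.symm]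
        exact sub_mem (hsup _) (hsupl _ (Submodule.smul_mem _ _ (m0 (by norm_num) w))) }

end IsLiftFrame

end Splitting

/-! ### The prolongation of a (2,3,5)-distribution. -/

section CartanProlongation

variable {V : Type*} [NormedAddCommGroup V] [NormedSpace ℝ V] [CompleteSpace V]
  [FiniteDimensional ℝ V]
variable {Y : Type*} [TopologicalSpace Y] [ChartedSpace V Y] [IsManifold 𝓘(ℝ, V) ∞ Y]
variable {D : SubspaceField V Y}

open ProjSpace IsG2Frame

/-- Adapted frames of the prolongation of a `(2,3,5)`-distribution. -/
lemma Is235.exists_frame_proj (hD : Is235 D) (z : ProjSpace hD.isDistribution) :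
    ∃ U : Set (ProjSpace hD.isDistribution), z ∈ U ∧
      ∃ f : Fin 6 → VField (V × ℝ) (ProjSpace hD.isDistribution), IsG2Frame U f ∧
      (∀ w ∈ U, vertical hD.isDistribution w = spanOn f {0} w) ∧
      (∀ w ∈ U, cartanProlongation hD.isDistribution w = flag f 2 w) ∧
      ∀ w ∈ U, pull (V × ℝ) V (base (hD := hD.isDistribution)) w (D w.base) = flag f 3 w := by
  have hV : Module.finrank ℝ (V × ℝ) = 6 := by
    rw [Module.finrank_prod, hD.dim, Module.finrank_self]
  obtain ⟨O, η, N, t, hη, hN, hz, hNO, ht, hline⟩ := exists_slope z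
  obtain ⟨U, T, g₁, g₂, hzU, hUN, h⟩ := exists_isLiftFrame hN contMDiff_base.contMDiffOn hz
    (mfderiv_base_surjective z) hη.isOpen (hNO hz) (hη.smooth 0) (hη.smooth 1)
    fun w _ => finrank_vertical w
  obtain ⟨lam, hf⟩ := h.exists_isG2Frame hV (fun y hy => hD.linearIndependent hη hy)
    (ht.mono hUN) fun w hw => dirDeriv_slope_ne_zero w hη hN (hUN hw) hNO ht hline
      (h.map_T w hw) (h.ne_zero w hw)
  set f := IsLiftFrame.adapted T g₁ g₂ t lam
  have m0 : ∀ {k : ℕ}, 0 < k → ∀ w, T w ∈ flag f k w := fun hk w => mem_flag f (i := 0) hk w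
  have m1 : ∀ {k : ℕ}, 1 < k → ∀ w, (g₁ w + t w • g₂ w) + lam w • T w ∈ flag f k w :=
    fun hk w => mem_flag f (i := 1) hk w
  have m2 : ∀ {k : ℕ}, 2 < k → ∀ w, g₂ w ∈ flag f k w := fun hk w => mem_flag f (i := 2) hk w
  -- The second frame field projects to a generator of the line at `w`, whatever `lam` is.
  have d1 : ∀ w ∈ U, mfderiv 𝓘(ℝ, V × ℝ) 𝓘(ℝ, V) (base (hD := hD.isDistribution)) w
      ((g₁ w + t w • g₂ w) + lam w • T w) = η 0 w.base + t w • η 1 w.base := fun w hw => by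
    rw [map_add, map_add, map_smul, map_smul, h.map_T w hw, h.map_g₁ w hw, h.map_g₂ w hw,
      smul_zero, add_zero]
  refine ⟨U, hzU, f, hf, fun w hw => ?_, fun w hw => ?_, fun w hw => ?_⟩
  · rw [spanOn_singleton]
    refine le_antisymm (h.ker w hw) ((Submodule.span_singleton_le_iff_mem _ _).2 (h.map_T w hw))
  · refine le_antisymm (h.pull_le hw (m0 (by norm_num) w) fun u hu => ?_)
      (flag_le fun i hi => ?_)
    · rw [hline w (hUN hw)] at hu
      obtain ⟨c, rfl⟩ := Submodule.mem_span_singleton.1 hu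
      exact ⟨_, Submodule.smul_mem _ c (m1 (by norm_num) w), by rw [map_smul, d1 w hw]⟩
    · fin_cases i <;> first | (exfalso; simp at hi; done) | skip
      · change mfderiv 𝓘(ℝ, V × ℝ) 𝓘(ℝ, V) (base (hD := hD.isDistribution)) w (T w) ∈ w.line
        rw [h.map_T w hw]
        exact Submodule.zero_mem _
      · change mfderiv 𝓘(ℝ, V × ℝ) 𝓘(ℝ, V) (base (hD := hD.isDistribution)) w
          ((g₁ w + t w • g₂ w) + lam w • T w) ∈ w.line
        rw [d1 w hw, hline w (hUN hw)]
        exact Submodule.mem_span_singleton_self _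
  · have hwO := hNO (hUN hw)
    refine le_antisymm (h.pull_le hw (m0 (by norm_num) w) fun u hu => ?_)
      (flag_le fun i hi => ?_)
    · rw [hη.eq _ hwO] at hu
      obtain ⟨c, rfl⟩ := (Submodule.mem_span_range_iff_exists_fun ℝ).1 hu
      have mg : g₁ w ∈ flag f 3 w := by
        have := m1 (k := 3) (by norm_num) w
        rw [Submodule.add_mem_iff_left _ (Submodule.smul_mem _ _ (m0 (by norm_num) w))] at this
        exact (Submodule.add_mem_iff_left _ (Submodule.smul_mem _ _ (m2 (by norm_num) w))).1 this
      refine ⟨c 0 • g₁ w + c 1 • g₂ w, Submodule.add_mem _ (Submodule.smul_mem _ _ mg)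
        (Submodule.smul_mem _ _ (m2 (by norm_num) w)), ?_⟩
      rw [map_add, map_smul, map_smul, h.map_g₁ w hw, h.map_g₂ w hw, Fin.sum_univ_two]
    · have hη0 := (hη.isSectionOn 0).2 _ hwO
      have hη1 := (hη.isSectionOn 1).2 _ hwO
      fin_cases i <;> first | (exfalso; simp at hi; done) | skip
      · change mfderiv 𝓘(ℝ, V × ℝ) 𝓘(ℝ, V) (base (hD := hD.isDistribution)) w (T w) ∈ D w.base
        rw [h.map_T w hw]
        exact Submodule.zero_mem _
      · change mfderiv 𝓘(ℝ, V × ℝ) 𝓘(ℝ, V) (base (hD := hD.isDistribution)) w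
          ((g₁ w + t w • g₂ w) + lam w • T w) ∈ D w.base
        rw [d1 w hw]
        exact Submodule.add_mem _ hη0 (Submodule.smul_mem _ _ hη1)
      · change mfderiv 𝓘(ℝ, V × ℝ) 𝓘(ℝ, V) (base (hD := hD.isDistribution)) w (g₂ w) ∈ D w.base
        rw [h.map_g₂ w hw]
        exact hη1

/-- The complement of the vertical direction in the Cartan prolongation. -/
def prolongK (hD : IsDistribution 2 D) : SubspaceField (V × ℝ) (ProjSpace hD) :=
  charDir (cartanProlongation hD) (derived (cartanProlongation hD) 3)

/-- Since `charDir` is defined without choices, the local complements need no patching: adapted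
frames are used only to identify it near each point. -/
lemma Is235.isG2Splitting (hD : Is235 D) :
    IsG2Splitting hD.isDistribution (prolongK hD.isDistribution) := by
  refine ⟨isPseudoProductG2_of_frames ?_ fun z => ?_, funext fun z => ?_⟩
  · rw [Module.finrank_prod, hD.dim, Module.finrank_self]
  · obtain ⟨U, hz, f, hf, hL, hE, -⟩ := hD.exists_frame_proj z
    exact ⟨U, hz, f, hf, hf.charDir_eq hE, hL⟩
  · obtain ⟨U, hz, f, hf, hL, hE, -⟩ := hD.exists_frame_proj z
    rw [sumField_eq (K := prolongK hD.isDistribution) (hf.charDir_eq hE) hL z hz, hE z hz]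

/-- `K` is determined by `E`, so every splitting may be replaced by the canonical one. -/
lemma IsG2Splitting.eq_prolongK {hD : IsDistribution 2 D}
    {K : SubspaceField (V × ℝ) (ProjSpace hD)} (hK : IsG2Splitting hD K) : K = prolongK hD := by
  have h := hK.1.eq_charDir
  rwa [hK.2] at h

/-- The fibres of `P(D)` are connected. -/
lemma isConnected_fibre (hD : IsDistribution 2 D) (y : Y) :
    IsConnected (ProjSpace.base (hD := hD) ⁻¹' {y}) := by
  obtain ⟨O, hyO, s, hs⟩ := hD.exists_frame y
  have hli := LinearIndependent.pair_iff.1 (by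
    have := hs.indep y hyO
    rwa [show (fun i => s i y) = ![s 0 y, s 1 y] by funext i; fin_cases i <;> rfl] at this)
  -- The fibre is the image of the real line under the angle. The leading zero vector only puts the
  -- sum in the form required by `add_smul`.
  let v : ℝ → TangentSpace 𝓘(ℝ, V) y := fun θ =>
    (0 + Real.cos θ • s 0 y) + Real.sin θ • s 1 y
  have hconst : ∀ u : TangentSpace 𝓘(ℝ, V) y,
      SmoothAlong (V := ℝ) (M := ℝ) univ (fun _ => y) fun _ => u := fun u => contMDiffOn_const
  have hv : SmoothAlong (V := ℝ) univ (fun _ => y) v :=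
    ((hconst 0).add_smul Real.contDiff_cos.contMDiff.contMDiffOn (hconst _)).add_smul
      Real.contDiff_sin.contMDiff.contMDiffOn (hconst _)
  have hex : ∀ θ, ∃ w : ProjSpace hD, w.toSigma = ⟨y, Submodule.span ℝ {v θ}⟩ := by
    intro θ
    refine exists_toSigma ?_ fun h0 => ?_
    · exact (D y).add_mem ((D y).add_mem (D y).zero_mem
        ((D y).smul_mem _ ((hs.isSectionOn 0).2 y hyO)))
        ((D y).smul_mem _ ((hs.isSectionOn 1).2 y hyO))
    · obtain ⟨h1, h2⟩ := hli (Real.cos θ) (Real.sin θ) (by simpa [v] using h0)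
      have := Real.sin_sq_add_cos_sq θ
      rw [h1, h2] at this
      norm_num at this
  choose γ hγ using hex
  have hcont : Continuous γ := by
    have := contMDiffOn_of_toSigma isOpen_univ hv fun θ _ => hγ θ
    exact continuousOn_univ.1 this.continuousOn
  have hrange : ProjSpace.base (hD := hD) ⁻¹' {y} = range γ := by
    ext z
    constructor
    · intro hz
      obtain rfl : z.base = y := hz
      obtain ⟨u, hu, hu0, hzu⟩ := exists_line_eq z
      rw [hs.eq _ hyO] at hu
      obtain ⟨c, rfl⟩ := (Submodule.mem_span_range_iff_exists_fun ℝ).1 hu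
      rw [Fin.sum_univ_two] at hzu hu0
      -- Polar coordinates of the coefficient pair give the angle of the line.
      let ζ : ℂ := ⟨c 0, c 1⟩
      have hc0 : ‖ζ‖ * Real.cos ζ.arg = c 0 := Complex.norm_mul_cos_arg ζ
      have hc1 : ‖ζ‖ * Real.sin ζ.arg = c 1 := Complex.norm_mul_sin_arg ζ
      have huv : c 0 • s 0 z.base + c 1 • s 1 z.base = ‖ζ‖ • v ζ.arg := by
        rw [← hc0, ← hc1]
        simp only [v]
        module
      have hζ : ‖ζ‖ ≠ 0 := fun h0 => hu0 (by rw [huv, h0, zero_smul])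
      refine ⟨ζ.arg, toSigma_injective ?_⟩
      rw [hγ, ← Submodule.span_singleton_smul_eq (IsUnit.mk0 _ hζ), ← huv, ← hzu]
      rfl
    · rintro ⟨θ, rfl⟩
      exact congrArg Sigma.fst (hγ θ)
  rw [hrange]
  exact isConnected_range hcont

/-- In an adapted frame both `∂E` and the preimage of `D` are the span of the first three fields. -/
lemma Is235.isReduction_base (hD : Is235 D) :
    IsReduction univ (ProjSpace.base (hD := hD.isDistribution)) (vertical hD.isDistribution)
      (derived (cartanProlongation hD.isDistribution) 1) D where
  isOpen := isOpen_univ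
  smooth := contMDiff_base.contMDiffOn
  submersion z _ := mfderiv_base_surjective z
  ker_eq _ _ := rfl
  image_eq := by
    refine eq_univ_of_forall fun y => ?_
    obtain ⟨z, hz⟩ := (isConnected_fibre hD.isDistribution y).nonempty
    exact ⟨z, trivial, hz⟩
  fibre y := by
    rw [univ_inter]
    exact isConnected_fibre hD.isDistribution y
  pull_eq z _ := by
    obtain ⟨U, hz, f, hf, -, hE, hF⟩ := hD.exists_frame_proj z
    rw [hF z hz, hf.derived_eq_one hE z hz]

end CartanProlongation

/-! ### Lifts of local isomorphisms, and isomorphisms covered by them. -/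

section LocalIsomorphisms

variable {V : Type*} [NormedAddCommGroup V] [NormedSpace ℝ V] [CompleteSpace V]
  [FiniteDimensional ℝ V]
variable {Y : Type*} [TopologicalSpace Y] [ChartedSpace V Y] [IsManifold 𝓘(ℝ, V) ∞ Y]
variable {Y' : Type*} [TopologicalSpace Y'] [ChartedSpace V Y'] [IsManifold 𝓘(ℝ, V) ∞ Y']
variable {D : SubspaceField V Y} {D' : SubspaceField V Y'}

open ProjSpace

lemma pushPt_of_line {V₁ : Type*} [NormedAddCommGroup V₁] [NormedSpace ℝ V₁]
    {M : Type*} [TopologicalSpace M] [ChartedSpace V₁ M]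
    {V₂ : Type*} [NormedAddCommGroup V₂] [NormedSpace ℝ V₂]
    {M' : Type*} [TopologicalSpace M'] [ChartedSpace V₂ M'] (φ : M → M') {x : M}
    {A : Submodule ℝ (TangentSpace 𝓘(ℝ, V₁) x)} {u : TangentSpace 𝓘(ℝ, V₁) x}
    (h : A = Submodule.span ℝ {u}) :
    pushPt V₁ V₂ φ ⟨x, A⟩ =
      ⟨φ x, Submodule.span ℝ {mfderiv 𝓘(ℝ, V₁) 𝓘(ℝ, V₂) φ x u}⟩ := by
  subst h
  refine Sigma.ext rfl (heq_of_eq ?_)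
  exact (Submodule.map_span _ _).trans (congrArg _ image_singleton)

namespace ProjSpace

variable {hD : IsDistribution 2 D} {hD' : IsDistribution 2 D'}

lemma mdifferentiableAt_base (z : ProjSpace hD) :
    MDifferentiableAt 𝓘(ℝ, V × ℝ) 𝓘(ℝ, V) (base (hD := hD)) z :=
  contMDiff_base.contMDiffAt.mdifferentiableAt (n := ∞) (by simp)

lemma pushPt_base_pull (z : ProjSpace hD) (B : Submodule ℝ (TangentSpace 𝓘(ℝ, V) z.base)) :
    pushPt (V × ℝ) V (base (hD := hD)) ⟨z, pull (V × ℝ) V (base (hD := hD)) z B⟩ =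
      ⟨z.base, B⟩ :=
  Sigma.ext rfl (heq_of_eq (Submodule.map_comap_eq_of_surjective (mfderiv_base_surjective z) B))

lemma pushPt_base_cartan (z : ProjSpace hD) :
    pushPt (V × ℝ) V (base (hD := hD)) ⟨z, cartanProlongation hD z⟩ = z.toSigma :=
  pushPt_base_pull z z.line

lemma mem_line_iff {z : ProjSpace hD} {y : Y} {l : Submodule ℝ (TangentSpace 𝓘(ℝ, V) y)}
    (h : z.toSigma = ⟨y, l⟩) (v : V) :
    (show TangentSpace 𝓘(ℝ, V) z.base from v) ∈ z.line ↔ (show TangentSpace 𝓘(ℝ, V) y from v) ∈ l := by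
  obtain ⟨b, l', hl, hle⟩ := z
  obtain rfl : b = y := congrArg Sigma.fst h
  obtain rfl : l' = l := eq_of_heq (Sigma.ext_iff.1 h).2
  rfl

/-- A map which covers `φ` and is given by `dφ` on the lines. -/
def Covers (φ : Y → Y') (Φ : ProjSpace hD → ProjSpace hD') (S : Set (ProjSpace hD)) : Prop :=
  ∀ w ∈ S, (Φ w).toSigma = pushPt V V φ w.toSigma

/-- Differentiate `base ∘ Φ = φ ∘ base`. The two base points agree only propositionally, so the
equality is stated in the model space. -/
lemma Covers.mfderiv {φ : Y → Y'} {Φ : ProjSpace hD → ProjSpace hD'} {S : Set (ProjSpace hD)}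
    (h : Covers φ Φ S) (hS : IsOpen S) {w : ProjSpace hD} (hw : w ∈ S)
    (hΦ : MDifferentiableAt 𝓘(ℝ, V × ℝ) 𝓘(ℝ, V × ℝ) Φ w)
    (hφ : MDifferentiableAt 𝓘(ℝ, V) 𝓘(ℝ, V) φ w.base) (v : TangentSpace 𝓘(ℝ, V × ℝ) w) :
    (show V from mfderiv 𝓘(ℝ, V × ℝ) 𝓘(ℝ, V) (base (hD := hD')) (Φ w)
      (mfderiv 𝓘(ℝ, V × ℝ) 𝓘(ℝ, V × ℝ) Φ w v)) =
    mfderiv 𝓘(ℝ, V) 𝓘(ℝ, V) φ w.base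
      (mfderiv 𝓘(ℝ, V × ℝ) 𝓘(ℝ, V) (base (hD := hD)) w v) := by
  have h1 := mfderiv_comp w (mdifferentiableAt_base (Φ w)) hΦ
  have h2 := mfderiv_comp w hφ (mdifferentiableAt_base w)
  have h3 : base (hD := hD') ∘ Φ =ᶠ[𝓝 w] φ ∘ base :=
    Filter.eventually_of_mem (hS.mem_nhds hw) fun w hw => congrArg Sigma.fst (h w hw)
  have h4 := h3.mfderiv_eq (I := 𝓘(ℝ, V × ℝ)) (I' := 𝓘(ℝ, V))
  rw [h1, h2] at h4
  exact congrArg (fun L => L v) h4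

lemma Covers.push_vertical_le {φ : Y → Y'} {Φ : ProjSpace hD → ProjSpace hD'}
    {S : Set (ProjSpace hD)} (h : Covers φ Φ S) (hS : IsOpen S) {w : ProjSpace hD} (hw : w ∈ S)
    (hΦ : MDifferentiableAt 𝓘(ℝ, V × ℝ) 𝓘(ℝ, V × ℝ) Φ w)
    (hφ : MDifferentiableAt 𝓘(ℝ, V) 𝓘(ℝ, V) φ w.base) :
    push (V × ℝ) (V × ℝ) Φ w (vertical hD w) ≤ vertical hD' (Φ w) := by
  rintro _ ⟨v, hv, rfl⟩
  refine mem_vertical.2 ((h.mfderiv hS hw hΦ hφ v).trans ?_)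
  rw [mem_vertical.1 hv]
  exact map_zero _

lemma Covers.push_cartan_le {φ : Y → Y'} {Φ : ProjSpace hD → ProjSpace hD'}
    {S : Set (ProjSpace hD)} (h : Covers φ Φ S) (hS : IsOpen S) {w : ProjSpace hD} (hw : w ∈ S)
    (hΦ : MDifferentiableAt 𝓘(ℝ, V × ℝ) 𝓘(ℝ, V × ℝ) Φ w)
    (hφ : MDifferentiableAt 𝓘(ℝ, V) 𝓘(ℝ, V) φ w.base) :
    push (V × ℝ) (V × ℝ) Φ w (cartanProlongation hD w) ≤ cartanProlongation hD' (Φ w) := by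
  rintro _ ⟨v, hv, rfl⟩
  refine (mem_line_iff (h w hw) _).2 ?_
  have h1 := h.mfderiv hS hw hΦ hφ v
  refine ⟨_, hv, ?_⟩
  exact h1.symm

variable (hD hD') in
/-- The map `(y, ℓ) ↦ (φ y, dφ(ℓ))`. -/
def lift (φ : Y → Y') (w : ProjSpace hD) : ProjSpace hD' :=
  -- The arbitrary point over `φ w.base` is a default, returned only if the image is not a point of
  -- `P(D')`.
  ofSigma (isConnected_fibre hD' (φ w.base)).nonempty.some (pushPt V V φ w.toSigma)

variable {φ : OpenPartialHomeomorph Y Y'}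

lemma covers_lift (hφ : IsDiffeo V V φ) (hφD : Carries φ D D') :
    Covers φ (lift hD hD' φ) (base ⁻¹' φ.source) := by
  intro w hw
  refine toSigma_ofSigma _ ?_
  obtain ⟨u, hu, hu0, hwu⟩ := exists_line_eq w
  obtain ⟨z, hz⟩ := exists_toSigma (hD := hD') (u := mfderiv 𝓘(ℝ, V) 𝓘(ℝ, V) φ w.base u)
    (by rw [← hφD _ hw]; exact ⟨u, hu, rfl⟩)
    fun h0 => hu0 (hφ.mfderiv_injective hw (h0.trans (map_zero _).symm))
  exact ⟨z, hz.trans (pushPt_of_line φ hwu).symm⟩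

/-- Near a point the lines are spanned by `η 0 + t η 1`; the image lines are spanned by its image
under `dφ`, which is smooth along `φ ∘ base`. -/
lemma contMDiffOn_lift (hφ : IsDiffeo V V φ) (hφD : Carries φ D D') :
    ContMDiffOn 𝓘(ℝ, V × ℝ) 𝓘(ℝ, V × ℝ) ∞ (lift hD hD' φ) (base ⁻¹' φ.source) := by
  intro z hz
  obtain ⟨O, η, N, t, hη, hN, hzN, hNO, ht, hline⟩ := exists_slope z
  have hS : IsOpen (N ∩ base ⁻¹' φ.source) :=
    hN.inter (contMDiff_base.continuous.isOpen_preimage _ φ.open_source)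
  have hb := (contMDiff_base (hD := hD)).contMDiffOn (s := N ∩ base ⁻¹' φ.source)
  have hv := ((SmoothVF.comp hb (fun w hw => hNO hw.1) (hη.smooth 0)).add_smul
    (ht.mono inter_subset_left) (SmoothVF.comp hb (fun w hw => hNO hw.1) (hη.smooth 1)))
  have h := contMDiffOn_of_toSigma (hD := hD') hS (f := lift hD hD' φ)
    (hv.mfderiv_apply φ.open_source (fun w hw => hw.2) hφ.1) fun w hw =>
      (covers_lift hφ hφD w hw.2).trans (pushPt_of_line φ (hline w hw.1))
  exact (h.contMDiffAt (hS.mem_nhds ⟨hzN, hz⟩)).contMDiffWithinAt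

lemma lift_symm_lift (hφ : IsDiffeo V V φ) (hφD : Carries φ D D') {w : ProjSpace hD}
    (hw : w.base ∈ φ.source) : lift hD' hD φ.symm (lift hD hD' φ w) = w := by
  have h1 := covers_lift (hD := hD) (hD' := hD') hφ hφD w hw
  have h2 : (lift hD hD' φ w).base = φ w.base := congrArg Sigma.fst h1
  apply toSigma_injective
  rw [covers_lift hφ.symm (hφD.symm hφ) _ (by
    rw [mem_preimage, h2]
    exact φ.map_source hw), h1]
  exact hφ.pushPt_symm hw

variable (hD hD') in
/-- The lift of a local diffeomorphism to the projectivizations. -/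
def liftHomeo (hφ : IsDiffeo V V φ) (hφD : Carries φ D D') :
    OpenPartialHomeomorph (ProjSpace hD) (ProjSpace hD') where
  toFun := lift hD hD' φ
  invFun := lift hD' hD φ.symm
  source := base ⁻¹' φ.source
  target := base ⁻¹' φ.target
  map_source' w hw := by
    have h : (lift hD hD' φ w).base = φ w.base := congrArg Sigma.fst (covers_lift hφ hφD w hw)
    rw [mem_preimage, h]
    exact φ.map_source hw
  map_target' w hw := by
    have h : (lift hD' hD φ.symm w).base = φ.symm w.base :=
      congrArg Sigma.fst (covers_lift hφ.symm (hφD.symm hφ) w hw)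
    rw [mem_preimage, h]
    exact φ.map_target hw
  left_inv' w hw := lift_symm_lift hφ hφD hw
  right_inv' w hw := lift_symm_lift hφ.symm (hφD.symm hφ) hw
  open_source := contMDiff_base.continuous.isOpen_preimage _ φ.open_source
  open_target := contMDiff_base.continuous.isOpen_preimage _ φ.open_target
  continuousOn_toFun := (contMDiffOn_lift hφ hφD).continuousOn
  continuousOn_invFun := (contMDiffOn_lift hφ.symm (hφD.symm hφ)).continuousOn

lemma isDiffeo_liftHomeo (hφ : IsDiffeo V V φ) (hφD : Carries φ D D') :
    IsDiffeo (V × ℝ) (V × ℝ) (liftHomeo hD hD' hφ hφD) :=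
  ⟨contMDiffOn_lift hφ hφD, contMDiffOn_lift hφ.symm (hφD.symm hφ)⟩

lemma carries_vertical (hφ : IsDiffeo V V φ) (hφD : Carries φ D D') :
    Carries (liftHomeo hD hD' hφ hφD) (vertical hD) (vertical hD') := by
  have h := isDiffeo_liftHomeo (hD := hD) (hD' := hD') hφ hφD
  exact carries_of_push_le h
    (fun w hw => (covers_lift hφ hφD).push_vertical_le (liftHomeo hD hD' hφ hφD).open_source hw
      (h.mdifferentiableAt hw) (hφ.mdifferentiableAt hw))
    (fun w hw => (covers_lift hφ.symm (hφD.symm hφ)).push_vertical_le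
      (liftHomeo hD hD' hφ hφD).open_target hw (h.symm.mdifferentiableAt hw)
      (hφ.symm.mdifferentiableAt hw))

lemma carries_cartan (hφ : IsDiffeo V V φ) (hφD : Carries φ D D') :
    Carries (liftHomeo hD hD' hφ hφD) (cartanProlongation hD) (cartanProlongation hD') := by
  have h := isDiffeo_liftHomeo (hD := hD) (hD' := hD') hφ hφD
  exact carries_of_push_le h
    (fun w hw => (covers_lift hφ hφD).push_cartan_le (liftHomeo hD hD' hφ hφD).open_source hw
      (h.mdifferentiableAt hw) (hφ.mdifferentiableAt hw))
    (fun w hw => (covers_lift hφ.symm (hφD.symm hφ)).push_cartan_le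
      (liftHomeo hD hD' hφ hφD).open_target hw (h.symm.mdifferentiableAt hw)
      (hφ.symm.mdifferentiableAt hw))

/-- `prolongK` is built from `E` by derived systems and `charDir`, both natural. -/
lemma carries_prolongK {Φ : OpenPartialHomeomorph (ProjSpace hD) (ProjSpace hD')}
    (hΦ : IsDiffeo (V × ℝ) (V × ℝ) Φ)
    (h : Carries Φ (cartanProlongation hD) (cartanProlongation hD')) :
    Carries Φ (prolongK hD) (prolongK hD') :=
  Carries.charDir hΦ h (Carries.derived hΦ h 3)

end ProjSpace

/-- Local isomorphisms of the prolongations come from local isomorphisms of the distributions. -/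
lemma exists_covered (hD : Is235 D) (hD' : Is235 D')
    {Φ : OpenPartialHomeomorph (ProjSpace hD.isDistribution) (ProjSpace hD'.isDistribution)}
    (hΦ : IsDiffeo (V × ℝ) (V × ℝ) Φ)
    (hL : Carries Φ (vertical hD.isDistribution) (vertical hD'.isDistribution))
    (hE : Carries Φ (cartanProlongation hD.isDistribution) (cartanProlongation hD'.isDistribution))
    {z : ProjSpace hD.isDistribution} (hz : z ∈ Φ.source) :
    ∃ (φ : OpenPartialHomeomorph Y Y') (W : Set (ProjSpace hD.isDistribution)),
      IsDiffeo V V φ ∧ Carries φ D D' ∧ IsOpen W ∧ z ∈ W ∧ W ⊆ Φ.source ∧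
      W ⊆ base ⁻¹' φ.source ∧ Covers φ Φ W := by
  have hh : ContMDiffOn 𝓘(ℝ, V × ℝ) 𝓘(ℝ, V) ∞ (base ∘ Φ) Φ.source :=
    contMDiff_base.comp_contMDiffOn hΦ.1
  have hchain : ∀ w ∈ Φ.source, _ := fun w hw =>
    mfderiv_comp w (mdifferentiableAt_base (Φ w)) (hΦ.mdifferentiableAt hw)
  -- As `Φ` maps vertical vectors to vertical vectors, `base ∘ Φ` is infinitesimally constant along
  -- the fibres and factors locally through the projection.
  obtain ⟨W, O, g, hW, hzW, hWΦ, hO, hWO, hg, hgW⟩ := exists_factor Φ.open_source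
    contMDiff_base.contMDiffOn hz (mfderiv_base_surjective z) hh fun w hw v hv => by
      rw [hchain w hw]
      have : mfderiv 𝓘(ℝ, V × ℝ) 𝓘(ℝ, V × ℝ) Φ w v ∈ vertical hD'.isDistribution (Φ w) := by
        rw [← hL w hw]
        exact ⟨v, hv, rfl⟩
      exact this
  have hchain2 : ∀ w ∈ W, mfderiv 𝓘(ℝ, V × ℝ) 𝓘(ℝ, V) (base ∘ Φ) w =
      (mfderiv 𝓘(ℝ, V) 𝓘(ℝ, V) g w.base).comp
        (mfderiv 𝓘(ℝ, V × ℝ) 𝓘(ℝ, V) (base (hD := hD.isDistribution)) w) := fun w hw => by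
    rw [← mfderiv_comp w ((hg.contMDiffAt (hO.mem_nhds (hWO hw))).mdifferentiableAt (n := ∞)
      (by simp)) (mdifferentiableAt_base w)]
    exact Filter.EventuallyEq.mfderiv_eq (Filter.eventually_of_mem (hW.mem_nhds hw) hgW)
  have hsurj : Function.Surjective (mfderiv 𝓘(ℝ, V) 𝓘(ℝ, V) g z.base) := by
    have h1 : Function.Surjective (mfderiv 𝓘(ℝ, V × ℝ) 𝓘(ℝ, V)
        (base (hD := hD'.isDistribution) ∘ Φ) z) := by
      rw [hchain z hz]
      exact (mfderiv_base_surjective (Φ z)).comp (hΦ.mfderiv_surjective hz)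
    rw [hchain2 z hzW] at h1
    exact Function.Surjective.of_comp h1
  -- Source and target have the same model `V`, so surjectivity suffices.
  have hbij : Function.Bijective (mfderiv 𝓘(ℝ, V) 𝓘(ℝ, V) g z.base) :=
    let A : V →ₗ[ℝ] V := (mfderiv 𝓘(ℝ, V) 𝓘(ℝ, V) g z.base).toLinearMap
    have hA : Function.Surjective A := hsurj
    ⟨(LinearMap.injective_iff_surjective (f := A)).2 hA, hsurj⟩
  obtain ⟨φ, hzφ, hφO, hφ, hφg⟩ := exists_isDiffeo hO hg (hWO hzW) hbij
  -- Every point of `Q` lies under a point of `W`. Restricting `φ` to `Q` allows `D` to be compared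
  -- with `D'` at all points of its source.
  obtain ⟨Q, σ, hQ, hzQ, hσ, hσW, hσz, hbσ⟩ := exists_section hW contMDiff_base.contMDiffOn hzW
    (mfderiv_base_surjective z)
  have hbase : ∀ w ∈ W, w.base ∈ φ.source → (base ∘ Φ) w = (φ ∘ base) w := fun w hw hwφ =>
    (hgW w hw).trans (hφg _ hwφ).symm
  have hpush : ∀ w ∈ W, w.base ∈ φ.source → ∀ A, pushPt (V × ℝ) V base (pushPt (V × ℝ) (V × ℝ) Φ
      ⟨w, A⟩) = pushPt V V φ (pushPt (V × ℝ) V base ⟨w, A⟩) := by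
    intro w hw hwφ A
    rw [← pushPt_comp (p := ⟨w, A⟩) (hΦ.mdifferentiableAt (hWΦ hw)) (mdifferentiableAt_base (Φ w)),
      ← pushPt_comp (p := ⟨w, A⟩) (mdifferentiableAt_base w) (hφ.mdifferentiableAt hwφ)]
    refine pushPt_congr ?_
    filter_upwards [hW.mem_nhds hw, contMDiff_base.continuous.continuousAt.preimage_mem_nhds
      (φ.open_source.mem_nhds hwφ)] with w' h1 h2 using hbase w' h1 h2
  have hF := Carries.derived hΦ hE 1
  -- `D` and `D'` are the images of `∂E` and `∂E'`, and `Φ` carries one derived system to the other.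
  have hDD : ∀ w ∈ W, w.base ∈ φ.source →
      pushPt V V φ ⟨w.base, D w.base⟩ = ⟨φ w.base, D' (φ w.base)⟩ := by
    intro w hw hwφ
    have h1 := hpush w hw hwφ (derived (cartanProlongation hD.isDistribution) 1 w)
    rw [carries_iff.1 hF w (hWΦ hw), ← hD.isReduction_base.pull_eq w trivial,
      ← hD'.isReduction_base.pull_eq (Φ w) trivial, pushPt_base_pull, pushPt_base_pull] at h1
    have h2 : (Φ w).base = φ w.base := hbase w hw hwφ
    rw [← h1, h2]
  refine ⟨φ.restrOpen Q hQ, W ∩ base ⁻¹' (φ.source ∩ Q), ⟨?_, ?_⟩, ?_,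
    hW.inter (contMDiff_base.continuous.isOpen_preimage _ (φ.open_source.inter hQ)),
    ⟨hzW, hzφ, hzQ⟩, fun w hw => hWΦ hw.1, fun w hw => ?_, fun w hw => ?_⟩
  · rw [φ.restrOpen_source]
    exact hφ.1.mono inter_subset_left
  · refine hφ.2.mono ?_
    intro y hy
    have := (φ.restrOpen Q hQ).map_target hy
    rw [φ.restrOpen_source] at this
    exact hy.1
  · rw [carries_iff]
    intro y hy
    rw [φ.restrOpen_source] at hy
    have h1 := hDD (σ y) (hσW hy.2)
    rw [hbσ y hy.2] at h1
    exact h1 hy.1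
  · rw [φ.restrOpen_source]
    exact hw.2
  · have h1 := hpush w hw.1 hw.2.1 (cartanProlongation hD.isDistribution w)
    rw [carries_iff.1 hE w (hWΦ hw.1), pushPt_base_cartan, pushPt_base_cartan] at h1
    exact h1

end LocalIsomorphisms

/-! ### Smoothness of composition on spaces of continuous maps. -/

section CompositionOperator

variable {X : Type*} [TopologicalSpace X] [CompactSpace X]
variable {V W Z : Type*} [NormedAddCommGroup V] [NormedSpace ℝ V]
  [NormedAddCommGroup W] [NormedSpace ℝ W] [NormedAddCommGroup Z] [NormedSpace ℝ Z]

/-- The pointwise application of a bilinear map to continuous maps. -/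
def pointwiseBilin (b : Z →L[ℝ] V →L[ℝ] W) : C(X, Z) →L[ℝ] C(X, V) →L[ℝ] C(X, W) :=
  LinearMap.mkContinuous₂
    { toFun := fun A =>
        { toFun := fun h => ⟨fun t => b (A t) (h t), by fun_prop⟩
          map_add' := fun h k => by ext; simp
          map_smul' := fun c h => by ext; simp }
      map_add' := fun A B => by ext; simp
      map_smul' := fun c A => by ext; simp } ‖b‖ fun A h => by
    refine (ContinuousMap.norm_le _ (by positivity)).2 fun t => ?_
    refine (b.le_opNorm₂ (A t) (h t)).trans ?_
    gcongr
    · exact A.norm_coe_le_norm t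
    · exact h.norm_coe_le_norm t

/-- The mean value inequality is applied at each `t`, with a bound on the variation of `f'` near `γ
t` that is uniform in `t`. The bilinear map `b` lets the derivative of `f` take values in an
auxiliary space. -/
lemma hasFDerivAt_postcomp {b : Z →L[ℝ] V →L[ℝ] W} {f : C(V, W)} {f' : C(V, Z)}
    (hf : ∀ x, HasFDerivAt f (b (f' x)) x) (γ : C(X, V)) :
    HasFDerivAt (fun γ : C(X, V) => f.comp γ) (pointwiseBilin b (f'.comp γ)) γ := by
  rw [hasFDerivAt_iff_isLittleO_nhds_zero, Asymptotics.isLittleO_iff]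
  intro ε hε
  have hb0 : 0 < ‖b‖ + 1 := by positivity
  have hcont : Continuous fun γ : C(X, V) => f'.comp γ := f'.continuous_postcomp
  obtain ⟨δ, hδ, hδε⟩ := Metric.continuousAt_iff.1 (hcont.continuousAt (x := γ))
    (ε / (‖b‖ + 1)) (by positivity)
  filter_upwards [Metric.ball_mem_nhds (0 : C(X, V)) hδ] with h hh
  have hh : ‖h‖ < δ := by simpa using hh
  refine (ContinuousMap.norm_le _ (by positivity)).2 fun t => ?_
  have hb : ∀ y ∈ Metric.ball (γ t) δ, ‖b (f' y) - b (f' (γ t))‖ ≤ ε := fun y hy => by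
    -- Shifting `γ` by the constant `y - γ t` turns continuity of `γ ↦ f' ∘ γ` at `γ` into the
    -- required uniform estimate at the single point `y`.
    have h1 : dist (γ + ContinuousMap.const X (y - γ t)) γ < δ := by
      rw [dist_eq_norm, add_sub_cancel_left]
      refine ((ContinuousMap.norm_le _ (norm_nonneg (y - γ t))).2 fun t => le_rfl).trans_lt ?_
      rwa [← dist_eq_norm]
    have h2 : ‖f' (γ t + (y - γ t)) - f' (γ t)‖ ≤ ε / (‖b‖ + 1) := by
      rw [← dist_eq_norm]
      exact (ContinuousMap.dist_apply_le_dist t).trans (hδε h1).le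
    rw [add_sub_cancel] at h2
    rw [← map_sub]
    refine (b.le_opNorm _).trans ?_
    calc ‖b‖ * ‖f' y - f' (γ t)‖ ≤ (‖b‖ + 1) * (ε / (‖b‖ + 1)) := by gcongr; simp
      _ = ε := mul_div_cancel₀ _ hb0.ne'
  have h3 := (convex_ball (γ t) δ).norm_image_sub_le_of_norm_hasFDerivWithin_le'
    (fun y _ => (hf y).hasFDerivWithinAt) hb (Metric.mem_ball_self hδ) (y := γ t + h t) (by
      rw [Metric.mem_ball, dist_eq_norm, add_sub_cancel_left]
      exact (h.norm_coe_le_norm t).trans_lt hh)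
  rw [add_sub_cancel_left] at h3
  exact h3.trans (mul_le_mul_of_nonneg_left (h.norm_coe_le_norm t) hε.le)

end CompositionOperator

/-- The derivative is composition with `f'`, followed by a continuous bilinear map. The induction
therefore runs over all targets `W`, the next one being `V →L[ℝ] W`. -/
lemma contDiff_postcomp_nat {X : Type*} [TopologicalSpace X] [CompactSpace X]
    {V : Type u} [NormedAddCommGroup V] [NormedSpace ℝ V] (n : ℕ) :
    ∀ {W : Type u} [NormedAddCommGroup W] [NormedSpace ℝ W] (f : C(V, W)), ContDiff ℝ n f →
      ContDiff ℝ n (fun γ : C(X, V) => f.comp γ) := by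
  induction n with
  | zero =>
    intro W _ _ f _
    exact contDiff_zero.2 f.continuous_postcomp
  | succ n ih =>
    intro W _ _ f hf
    obtain ⟨f', hf', hff'⟩ := contDiff_succ_iff_hasFDerivAt.1 hf
    exact contDiff_succ_iff_hasFDerivAt.2 ⟨_,
      (pointwiseBilin (ContinuousLinearMap.id ℝ (V →L[ℝ] W))).contDiff.comp
        (ih (W := V →L[ℝ] W) ⟨f', hf'.continuous⟩ hf'),
      fun γ => hasFDerivAt_postcomp (b := ContinuousLinearMap.id ℝ (V →L[ℝ] W)) hff' γ⟩

/-- The composition with a smooth map is a smooth operator on spaces of continuous maps. -/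
lemma contDiff_postcomp {X : Type*} [TopologicalSpace X] [CompactSpace X]
    {V W : Type u} [NormedAddCommGroup V] [NormedSpace ℝ V] [NormedAddCommGroup W]
    [NormedSpace ℝ W] {f : C(V, W)} (hf : ContDiff ℝ ∞ f) :
    ContDiff ℝ ∞ (fun γ : C(X, V) => f.comp γ) :=
  contDiff_infty.2 fun n => contDiff_postcomp_nat n f (contDiff_infty.1 hf n)

/-! ### Smooth dependence of solutions of differential equations. -/

section Flow

open unitInterval intervalIntegral

variable {V : Type u} [NormedAddCommGroup V] [NormedSpace ℝ V]

/-- The primitive of a path. -/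
def primitiveCLM : C(I, V) →L[ℝ] C(I, V) :=
  LinearMap.mkContinuous
    { toFun := fun γ => ⟨fun t => ∫ s in (0 : ℝ)..t, IccExtend zero_le_one γ s,
        (continuous_primitive (fun a b => (γ.continuous.Icc_extend' (h := zero_le_one)).intervalIntegrable a b) 0).comp
          continuous_subtype_val⟩
      map_add' := fun γ δ => by
        ext t
        exact integral_add ((γ.continuous.Icc_extend' (h := zero_le_one)).intervalIntegrable 0 t)
          ((δ.continuous.Icc_extend' (h := zero_le_one)).intervalIntegrable 0 t)
      map_smul' := fun c γ => by
        ext t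
        exact integral_smul c _ } 1 fun γ => by
    refine (ContinuousMap.norm_le _ (by positivity)).2 fun t => ?_
    refine (norm_integral_le_of_norm_le_const fun s _ => γ.norm_coe_le_norm _).trans ?_
    rw [one_mul, sub_zero, abs_of_nonneg t.2.1]
    exact mul_le_of_le_one_right (norm_nonneg _) t.2.2

/-- The constant paths. -/
def constCLM : V →L[ℝ] C(I, V) :=
  LinearMap.mkContinuous
    { toFun := fun v => ContinuousMap.const I v
      map_add' := fun v w => rfl
      map_smul' := fun c v => rfl } 1 fun v => by
    rw [one_mul]
    exact (ContinuousMap.norm_le _ (norm_nonneg v)).2 fun t => le_rfl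

/-- The shear `(q, γ) ↦ (q, γ - B q)`. -/
def shearEquiv {E F : Type*} [NormedAddCommGroup E] [NormedSpace ℝ E] [NormedAddCommGroup F]
    [NormedSpace ℝ F] (B : E →L[ℝ] F) : (E × F) ≃L[ℝ] E × F :=
  ContinuousLinearEquiv.equivOfInverse
    ((ContinuousLinearMap.fst ℝ E F).prod
      (ContinuousLinearMap.snd ℝ E F - B.comp (ContinuousLinearMap.fst ℝ E F)))
    ((ContinuousLinearMap.fst ℝ E F).prod
      (ContinuousLinearMap.snd ℝ E F + B.comp (ContinuousLinearMap.fst ℝ E F)))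
    (fun q => by ext <;> simp) (fun q => by ext <;> simp)

/-- The solution of an autonomous equation depends smoothly on time and the initial value. -/
theorem exists_smooth_flow [CompleteSpace V] {f : V → V} (hf : ContDiff ℝ ∞ f) (x₀ : V) :
    ∃ (N : Set V) (ε : ℝ) (F : V × ℝ → V), IsOpen N ∧ x₀ ∈ N ∧ 0 < ε ∧
      ContDiffOn ℝ ∞ F (N ×ˢ Ioo (-ε) ε) ∧ (∀ x ∈ N, F (x, 0) = x) ∧
      ∀ x ∈ N, ∀ s ∈ Ioo (-ε) ε, HasDerivAt (fun s => F (x, s)) (f (F (x, s))) s := by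
  let fc : C(V, V) := ⟨f, hf.continuous⟩
  -- Zeros of `G` are the solutions of `γ t = x + s ∫₀ᵗ f (γ τ) dτ` on the unit interval. Rescaling
  -- time makes `s` a parameter on the same footing as the initial value `x`.
  let G : (V × ℝ) × C(I, V) → C(I, V) := fun q =>
    q.2 - (constCLM q.1.1 + q.1.2 • primitiveCLM (fc.comp q.2))
  let Ψ : (V × ℝ) × C(I, V) → (V × ℝ) × C(I, V) := fun q => (q.1, G q)
  have hN : ContDiff ℝ ∞ fun q : (V × ℝ) × C(I, V) => primitiveCLM (fc.comp q.2) :=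
    primitiveCLM.contDiff.comp ((contDiff_postcomp (f := fc) hf).comp contDiff_snd)
  have hΨ : ContDiff ℝ ∞ Ψ := contDiff_fst.prodMk (contDiff_snd.sub
    (((constCLM (V := V)).contDiff.comp (contDiff_fst.comp contDiff_fst)).add
      ((contDiff_snd.comp contDiff_fst).smul hN)))
  let q₀ : (V × ℝ) × C(I, V) := ((x₀, 0), constCLM x₀)
  -- At `s = 0` the integral term contributes no derivative in `γ`. The derivative of `Ψ` there is
  -- thus a shear, hence invertible.
  let B : V × ℝ →L[ℝ] C(I, V) := constCLM.comp (ContinuousLinearMap.fst ℝ V ℝ) +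
    (ContinuousLinearMap.snd ℝ V ℝ).smulRight (primitiveCLM (fc.comp q₀.2))
  have hA : HasFDerivAt Ψ (shearEquiv B : _ →L[ℝ] _) q₀ := by
    have h1 : HasFDerivAt (fun q : (V × ℝ) × C(I, V) => q.1)
      (ContinuousLinearMap.fst ℝ (V × ℝ) C(I, V)) q₀ := hasFDerivAt_fst
    have h2 : HasFDerivAt (fun q : (V × ℝ) × C(I, V) => q.2)
      (ContinuousLinearMap.snd ℝ (V × ℝ) C(I, V)) q₀ := hasFDerivAt_snd
    have h3 : HasFDerivAt (fun q : (V × ℝ) × C(I, V) => constCLM q.1.1)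
      (constCLM.comp ((ContinuousLinearMap.fst ℝ V ℝ).comp
        (ContinuousLinearMap.fst ℝ (V × ℝ) C(I, V)))) q₀ :=
      (constCLM (V := V)).hasFDerivAt.comp q₀ (hasFDerivAt_fst.comp q₀ h1)
    have h4 : HasFDerivAt (fun q : (V × ℝ) × C(I, V) => q.1.2)
      ((ContinuousLinearMap.snd ℝ V ℝ).comp (ContinuousLinearMap.fst ℝ (V × ℝ) C(I, V))) q₀ :=
      hasFDerivAt_snd.comp q₀ h1
    have h5 := h4.smul (hN.differentiable (by simp) q₀).hasFDerivAt
    refine (h1.prodMk (h2.sub (h3.add h5))).congr_fderiv ?_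
    ext v <;> simp [shearEquiv, B, q₀]
  obtain ⟨e, hq₀, -, he, heΨ⟩ := exists_isDiffeo_of_hasFDerivAt isOpen_univ hΨ.contDiffOn
    (mem_univ q₀) hA
  have heΨ : ∀ q, e q = Ψ q := congrFun heΨ
  have hG₀ : e q₀ = ((x₀, 0), 0) := by
    rw [heΨ]
    simp [Ψ, G, q₀]
  -- Inside a ball contained in the source, injectivity of `e` gives uniqueness of solutions.
  obtain ⟨r, hr, hball⟩ := Metric.isOpen_iff.1 e.open_source q₀ hq₀
  let ι : V × ℝ → (V × ℝ) × C(I, V) := fun p => (p, 0)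
  have hι : ContDiff ℝ ∞ ι := contDiff_id.prodMk contDiff_const
  -- the solution of the integral equation
  let H : V × ℝ → C(I, V) := fun p => (e.symm (ι p)).2
  have hS : IsOpen (ι ⁻¹' (e.target ∩ e.symm ⁻¹' Metric.ball q₀ r)) :=
    (e.isOpen_inter_preimage_symm Metric.isOpen_ball).preimage hι.continuous
  have hmem : (x₀, (0 : ℝ)) ∈ ι ⁻¹' (e.target ∩ e.symm ⁻¹' Metric.ball q₀ r) := by
    have h1 : ι (x₀, 0) = e q₀ := hG₀.symm
    refine ⟨h1 ▸ e.map_source hq₀, ?_⟩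
    rw [mem_preimage, h1, e.left_inv hq₀]
    exact Metric.mem_ball_self hr
  obtain ⟨N, T, hN, hT, hxN, h0T, hNT⟩ := isOpen_prod_iff.1 hS x₀ 0 hmem
  obtain ⟨ε, hε, hεT⟩ := Metric.isOpen_iff.1 hT 0 h0T
  rw [Real.ball_eq_Ioo, zero_sub, zero_add] at hεT
  have hsub : ∀ x ∈ N, ∀ s ∈ Ioo (-ε) ε, ι (x, s) ∈ e.target ∧ e.symm (ι (x, s)) ∈
      Metric.ball q₀ r := fun x hx s hs => hNT (mk_mem_prod hx (hεT hs))
  have hfst : ∀ x ∈ N, ∀ s ∈ Ioo (-ε) ε, e.symm (ι (x, s)) = ((x, s), H (x, s)) :=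
    fun x hx s hs => by
      refine Prod.ext ?_ rfl
      have h1 := e.right_inv (hsub x hx s hs).1
      rw [heΨ] at h1
      exact (congrArg Prod.fst h1 :)
  have heq : ∀ x ∈ N, ∀ s ∈ Ioo (-ε) ε, ∀ t : I, H (x, s) t =
      x + s • ∫ τ in (0 : ℝ)..t, f (H (x, s) (projIcc 0 1 zero_le_one τ)) :=
    fun x hx s hs t => by
      have h1 := e.right_inv (hsub x hx s hs).1
      rw [heΨ, hfst x hx s hs] at h1
      have h2 := congrArg Prod.snd h1
      exact congrArg (fun γ => γ t) (sub_eq_zero.1 h2)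
  -- The path `τ ↦ H (x, s) (u τ)` solves the equation with `s` replaced by `s u`. It stays in the
  -- ball, because the center is a constant path at time zero, so uniqueness identifies it with `H
  -- (x, s u)`.
  have hscale : ∀ x ∈ N, ∀ s ∈ Ioo (-ε) ε, ∀ u : I, s * u ∈ Ioo (-ε) ε →
      H (x, s * u) 1 = H (x, s) u := by
    intro x hx s hs u hsu
    let γ : C(I, V) := (H (x, s)).comp ⟨fun τ => u * τ, by fun_prop⟩
    have hb := (hsub x hx s hs).2
    rw [hfst x hx s hs, Metric.mem_ball, Prod.dist_eq, Prod.dist_eq, max_lt_iff, max_lt_iff] at hb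
    obtain ⟨⟨hb1, hb2⟩, hb3⟩ := hb
    have hγ : ((x, s * (u : ℝ)), γ) ∈ e.source := by
      refine hball ?_
      rw [Metric.mem_ball, Prod.dist_eq, Prod.dist_eq, max_lt_iff, max_lt_iff]
      refine ⟨⟨hb1, ?_⟩, ?_⟩
      · rw [Real.dist_eq] at hb2 ⊢
        have h1 : s - q₀.1.2 = s := sub_zero s
        have h2 : s * (u : ℝ) - q₀.1.2 = s * u := sub_zero _
        rw [h1] at hb2
        rw [h2, abs_mul, abs_of_nonneg u.2.1]
        exact (mul_le_of_le_one_right (abs_nonneg s) u.2.2).trans_lt hb2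
      · refine (ContinuousMap.dist_lt_iff hr).2 fun τ => ?_
        exact (ContinuousMap.dist_apply_le_dist (f := H (x, s)) (g := q₀.2) (u * τ)).trans_lt hb3
    have h1 : e ((x, s * (u : ℝ)), γ) = ι (x, s * u) := by
      rw [heΨ]
      refine Prod.ext rfl (sub_eq_zero.2 ?_)
      ext τ
      have h2 : ∫ v in (0 : ℝ)..τ, IccExtend zero_le_one (fc.comp γ) v =
          ∫ v in (0 : ℝ)..τ, f (H (x, s) (projIcc 0 1 zero_le_one (u * v))) := by
        refine integral_congr fun v hv => ?_
        rw [uIcc_of_le τ.2.1] at hv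
        have h3 : v ∈ I := ⟨hv.1, hv.2.trans τ.2.2⟩
        change f (H (x, s) (u * projIcc 0 1 zero_le_one v)) = _
        have h4 : projIcc 0 1 zero_le_one ((u : ℝ) * v) = u * ⟨v, h3⟩ :=
          projIcc_val zero_le_one (u * ⟨v, h3⟩ : I)
        rw [projIcc_of_mem _ h3, h4]
      change H (x, s) (u * τ) = x + (s * (u : ℝ)) • ∫ v in (0 : ℝ)..τ,
        IccExtend zero_le_one (fc.comp γ) v
      rw [h2, mul_smul, smul_integral_comp_mul_left (fun v => f (H (x, s)
        (projIcc 0 1 zero_le_one v))), mul_zero, heq x hx s hs]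
      rfl
    have h2 : H (x, s * u) = γ := by
      change (e.symm (ι (x, s * u))).2 = γ
      rw [← h1, e.left_inv hγ]
    rw [h2]
    change H (x, s) (u * 1) = _
    rw [mul_one]
  -- Rescaling converts the equation on the unit interval into the usual integral equation for the
  -- endpoint as a function of `s`.
  have hint : ∀ x ∈ N, ∀ s ∈ Ioo (-ε) ε, H (x, s) 1 = x + ∫ v in (0 : ℝ)..s, f (H (x, v) 1) := by
    intro x hx s hs
    have h2 : ∫ v in (0 : ℝ)..(1 : I), f (H (x, s) (projIcc 0 1 zero_le_one v)) =
        ∫ v in (0 : ℝ)..1, f (H (x, s * v) 1) := by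
      refine integral_congr fun v hv => ?_
      rw [uIcc_of_le (1 : I).2.1] at hv
      change v ∈ Icc (0 : ℝ) 1 at hv
      rw [projIcc_of_mem _ hv]
      refine congrArg f (hscale x hx s hs ⟨v, hv⟩ ?_).symm
      rw [mem_Ioo, ← abs_lt] at hs ⊢
      rw [abs_mul]
      change |s| * |v| < ε
      rw [abs_of_nonneg hv.1]
      exact (mul_le_of_le_one_right (abs_nonneg s) hv.2).trans_lt hs
    rw [heq x hx s hs, h2, smul_integral_comp_mul_left (fun v => f (H (x, v) 1)), mul_zero, mul_one]
  have hF : ContDiffOn ℝ ∞ (fun p => H p 1) (N ×ˢ Ioo (-ε) ε) := by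
    have h1 : ContDiffOn ℝ ∞ e.symm e.target := contMDiffOn_iff_contDiffOn.1 he.2
    exact (ContinuousMap.evalCLM ℝ (1 : I)).contDiff.comp_contDiffOn (contDiff_snd.comp_contDiffOn
      (h1.comp hι.contDiffOn fun (p : V × ℝ) (hp : p ∈ N ×ˢ Ioo (-ε) ε) =>
        (hsub p.1 hp.1 p.2 hp.2).1))
  have h0 : (0 : ℝ) ∈ Ioo (-ε) ε := ⟨neg_lt_zero.2 hε, hε⟩
  refine ⟨N, ε, fun p => H p 1, hN, hxN, hε, hF, fun x hx => ?_, fun x hx s hs => ?_⟩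
  · change H (x, 0) 1 = x
    rw [hint x hx 0 h0, integral_same, add_zero]
  · have hc : ContinuousOn (fun s => f (H (x, s) 1)) (Ioo (-ε) ε) :=
      hf.continuous.comp_continuousOn (hF.continuousOn.comp
        (Continuous.prodMk_right x).continuousOn fun s hs => ⟨hx, hs⟩)
    have h1 := integral_hasDerivAt_right ((hc.mono (ordConnected_Ioo.uIcc_subset h0 hs)).intervalIntegrable)
      (hc.stronglyMeasurableAtFilter isOpen_Ioo s hs) (hc.continuousAt (isOpen_Ioo.mem_nhds hs))
    refine (h1.const_add x).congr_of_eventuallyEq ?_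
    filter_upwards [isOpen_Ioo.mem_nhds hs] with v hv using hint x hx v hv

end Flow

/-! ### Straightening of line fields. -/

section FlowBox

variable {E : Type u} [NormedAddCommGroup E] [NormedSpace ℝ E] [FiniteDimensional ℝ E]

/-- Nonvanishing vector fields can be straightened. -/
lemma exists_straightening {O : Set (E × ℝ)} (hO : IsOpen O) {f : E × ℝ → E × ℝ}
    (hf : ContDiffOn ℝ ∞ f O) {x₀ : E × ℝ} (hx₀ : x₀ ∈ O) (hfx : f x₀ ≠ 0) :
    ∃ Θ : OpenPartialHomeomorph (E × ℝ) (E × ℝ), x₀ ∈ Θ.target ∧ Θ.symm x₀ = 0 ∧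
      IsDiffeo (E × ℝ) (E × ℝ) Θ ∧ Θ.target ⊆ O ∧
      ∀ q ∈ Θ.source, fderiv ℝ Θ q (0, 1) = f (Θ q) := by
  have : CompleteSpace (E × ℝ) := FiniteDimensional.complete ℝ _
  obtain ⟨r, hr, hrO⟩ := Metric.nhds_basis_closedBall.mem_iff.1 (hO.mem_nhds hx₀)
  -- `exists_smooth_flow` needs a globally smooth field, so `f` is cut off outside a ball in `O`.
  let b : ContDiffBump x₀ := ⟨r / 2, r, half_pos hr, half_lt_self hr⟩
  have hf' : ContDiff ℝ ∞ fun x => b x • f x := by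
    refine contDiff_iff_contDiffAt.2 fun x => ?_
    by_cases hx : x ∈ O
    · exact b.contDiff.contDiffAt.smul (hf.contDiffAt (hO.mem_nhds hx))
    · have hx' : x ∈ (Metric.closedBall x₀ r)ᶜ := fun h => hx (hrO h)
      refine (contDiffAt_const (c := (0 : E × ℝ))).congr_of_eventuallyEq ?_
      filter_upwards [Metric.isClosed_closedBall.isOpen_compl.mem_nhds hx'] with y hy
      rw [b.zero_of_le_dist (le_of_not_ge hy), zero_smul]
  obtain ⟨N, ε, F, hN, hxN, hε, hF, hF0, hFd⟩ := exists_smooth_flow hf' x₀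
  -- A linear isomorphism sending the last direction to `f x₀`. The initial hypersurface `x₀ + A (y,
  -- 0)` is transversal to the field.
  obtain ⟨A, hA⟩ := SeparatingDual.exists_continuousLinearEquiv_apply_eq (R := ℝ)
    (x := ((0, 1) : E × ℝ)) (by simp) hfx
  let P : E × ℝ → E × ℝ := fun q => x₀ + A (q.1, 0)
  have hP : ContDiff ℝ ∞ P := contDiff_const.add
    (A.contDiff.comp (contDiff_fst.prodMk contDiff_const))
  let S : Set (E × ℝ) := (fun q => (P q, q.2)) ⁻¹' (N ×ˢ Ioo (-ε) ε)
  have hPS : ContDiff ℝ ∞ fun q => (P q, q.2) := hP.prodMk contDiff_snd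
  have hS : IsOpen S := (hN.prod isOpen_Ioo).preimage hPS.continuous
  let θ : E × ℝ → E × ℝ := fun q => F (P q, q.2)
  have hθ : ContDiffOn ℝ ∞ θ S := hF.comp hPS.contDiffOn fun q hq => hq
  have h0 : (0 : ℝ) ∈ Ioo (-ε) ε := ⟨neg_lt_zero.2 hε, hε⟩
  have hP0 : P 0 = x₀ := by
    simp [P, show ((0 : E), (0 : ℝ)) = 0 from rfl]
  have h0S : (0 : E × ℝ) ∈ S := ⟨by simpa [hP0] using hxN, h0⟩
  have hθ0 : θ 0 = x₀ := by
    change F (P 0, 0) = x₀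
    rw [hP0, hF0 x₀ hxN]
  have hcurve : ∀ q ∈ S, fderiv ℝ θ q (0, 1) = b (θ q) • f (θ q) := by
    intro q hq
    have h1 := ((hθ.contDiffAt (hS.mem_nhds hq)).differentiableAt (by simp)).hasFDerivAt
    have h2 : HasDerivAt (fun s : ℝ => ((q.1, s) : E × ℝ)) (0, 1) q.2 :=
      (hasDerivAt_const q.2 q.1).prodMk (hasDerivAt_id q.2)
    exact (h1.comp_hasDerivAt (f := fun s : ℝ => ((q.1, s) : E × ℝ)) q.2 h2).unique
      (hFd (P q) hq.1 q.2 hq.2)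
  -- Along `E` the derivative comes from `F (x, 0) = x`; along the last direction it comes from the
  -- differential equation at `x₀`.
  have hθA : HasFDerivAt θ (A : E × ℝ →L[ℝ] E × ℝ) 0 := by
    have h1 := ((hθ.contDiffAt (hS.mem_nhds h0S)).differentiableAt (by simp)).hasFDerivAt
    refine h1.congr_fderiv (ContinuousLinearMap.ext fun q => ?_)
    have h2 : fderiv ℝ θ 0 (q.1, 0) = A (q.1, 0) := by
      have h3 : HasFDerivAt (fun x : E => θ (x, 0)) ((fderiv ℝ θ 0).comp
        (ContinuousLinearMap.inl ℝ E ℝ)) 0 :=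
        HasFDerivAt.comp (𝕜 := ℝ) (f := fun x : E => ((x, 0) : E × ℝ)) (0 : E) h1
          (ContinuousLinearMap.inl ℝ E ℝ).hasFDerivAt
      have h4 : HasFDerivAt (fun x : E => θ (x, 0)) ((A : E × ℝ →L[ℝ] E × ℝ).comp
        (ContinuousLinearMap.inl ℝ E ℝ)) 0 := by
        have h5 : HasFDerivAt (fun x : E => x₀ + A (x, 0)) ((A : E × ℝ →L[ℝ] E × ℝ).comp
          (ContinuousLinearMap.inl ℝ E ℝ)) 0 :=
          ((A : E × ℝ →L[ℝ] E × ℝ).comp (ContinuousLinearMap.inl ℝ E ℝ)).hasFDerivAt.const_add x₀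
        refine h5.congr_of_eventuallyEq ?_
        have hc : Continuous fun x : E => ((x, 0) : E × ℝ) := Continuous.prodMk_left 0
        filter_upwards [(hS.preimage hc).mem_nhds (show ((0 : E), (0 : ℝ)) ∈ S from h0S)] with x hx
        exact hF0 _ hx.1
      exact congrArg (fun L => L q.1) (h3.unique h4)
    have h3 : fderiv ℝ θ 0 (0, 1) = A (0, 1) := by
      rw [hcurve 0 h0S, hA, hθ0, b.one_of_mem_closedBall (Metric.mem_closedBall_self b.rIn_pos.le),
        one_smul]
    have h4 : q = (q.1, 0) + q.2 • ((0, 1) : E × ℝ) := by ext <;> simp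
    change fderiv ℝ θ 0 q = A q
    rw [h4, map_add, map_add, map_smul, map_smul, h2, h3]
  -- On the smaller ball the bump function is `1`, so the straightened field is `f` itself.
  have hO' : IsOpen (S ∩ θ ⁻¹' Metric.ball x₀ (r / 2)) :=
    hθ.continuousOn.isOpen_inter_preimage hS Metric.isOpen_ball
  have h0O' : (0 : E × ℝ) ∈ S ∩ θ ⁻¹' Metric.ball x₀ (r / 2) :=
    ⟨h0S, by rw [mem_preimage, hθ0]; exact Metric.mem_ball_self (half_pos hr)⟩
  obtain ⟨Θ, h0Θ, hΘO, hΘ, hΘθ⟩ := exists_isDiffeo_of_hasFDerivAt hO' (hθ.mono inter_subset_left)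
    h0O' hθA
  have hΘ0 : Θ 0 = x₀ := by rw [hΘθ, hθ0]
  have hball : ∀ q ∈ Θ.source, Θ q ∈ Metric.ball x₀ (r / 2) := fun q hq => by
    rw [hΘθ]
    exact (hΘO hq).2
  refine ⟨Θ, hΘ0 ▸ Θ.map_source h0Θ, by rw [← hΘ0, Θ.left_inv h0Θ], hΘ, fun x hx => ?_,
    fun q hq => ?_⟩
  · rw [← Θ.right_inv hx]
    exact hrO (Metric.ball_subset_closedBall (Metric.ball_subset_ball (half_le_self hr.le)
      (hball _ (Θ.map_target hx))))
  · have h1 := hcurve q (hΘO hq).1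
    rw [← hΘθ, b.one_of_mem_closedBall (Metric.ball_subset_closedBall (hball q hq)), one_smul] at h1
    exact h1

/-- The line field in the direction of the last coordinate. -/
def lastDirection (E : Type*) [NormedAddCommGroup E] [NormedSpace ℝ E] :
    SubspaceField (E × ℝ) (E × ℝ) :=
  fun _ => Submodule.span ℝ {((0, 1) : E × ℝ)}

lemma mem_lastDirection {q v : E × ℝ} :
    (show TangentSpace 𝓘(ℝ, E × ℝ) q from v) ∈ lastDirection E q ↔ v.1 = 0 := by
  refine Submodule.mem_span_singleton.trans ⟨?_, fun h => ⟨v.2, ?_⟩⟩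
  · rintro ⟨c, rfl⟩
    exact smul_zero c
  · exact Prod.ext ((smul_zero _).trans h.symm) (mul_one v.2)

variable {M : Type*} [TopologicalSpace M] [ChartedSpace (E × ℝ) M] [IsManifold 𝓘(ℝ, E × ℝ) ∞ M]

/-- Line fields can be straightened. -/
lemma exists_flowBox {L : SubspaceField (E × ℝ) M} (hL : IsDistribution 1 L) (z : M) :
    ∃ χ : OpenPartialHomeomorph M (E × ℝ), z ∈ χ.source ∧ χ z = 0 ∧ IsDiffeo (E × ℝ) (E × ℝ) χ ∧
      Carries χ L (lastDirection E) := by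
  have : CompleteSpace (E × ℝ) := FiniteDimensional.complete ℝ _
  obtain ⟨U, hzU, g, hg⟩ := hL.exists_frame z
  have hφ := isDiffeo_chartAt (V := E × ℝ) z
  have hzφ := mem_chart_source (E × ℝ) z
  set φ := chartAt (E × ℝ) z
  have hUφ : IsOpen (U ∩ φ.source) := hg.isOpen.inter φ.open_source
  let f : E × ℝ → E × ℝ := fun y => (pushVF φ (g 0) : VField (E × ℝ) (E × ℝ)) y
  have hf : ContDiffOn ℝ ∞ f (φ.target ∩ φ.symm ⁻¹' (U ∩ φ.source)) :=
    contMDiffOn_vectorSpace_iff_contDiffOn.1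
      (SmoothVF.pushVF hφ hUφ inter_subset_right ((hg.smooth 0).mono inter_subset_left))
  have hfφ : ∀ w ∈ φ.source, f (φ w) = mfderiv 𝓘(ℝ, E × ℝ) 𝓘(ℝ, E × ℝ) φ w (g 0 w) := fun w hw =>
    pushVF_apply (V' := E × ℝ) φ (g 0) hw
  have hfz : f (φ z) ≠ 0 := fun h0 => (hg.indep z hzU).ne_zero 0
    (hφ.mfderiv_injective hzφ (((hfφ z hzφ).symm.trans h0).trans (map_zero _).symm))
  obtain ⟨Θ, hzΘ, hΘz, hΘ, hΘO, hΘf⟩ := exists_straightening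
    (φ.isOpen_inter_preimage_symm hUφ) hf ⟨φ.map_source hzφ, by
      rw [mem_preimage, φ.left_inv hzφ]
      exact ⟨hzU, hzφ⟩⟩ hfz
  -- The line field in the chart, as an intermediate stage between `L` and the last direction.
  let A : SubspaceField (E × ℝ) (E × ℝ) := fun y => Submodule.span ℝ {f y}
  have hA : Carries Θ (lastDirection E) A := by
    rw [carries_iff]
    intro q hq
    refine (pushPt_of_line Θ rfl).trans (Sigma.ext rfl (heq_of_eq
      (congrArg (fun v => Submodule.span ℝ {v}) ?_)))
    rw [mfderiv_eq_fderiv]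
    exact hΘf q hq
  refine ⟨φ.trans Θ.symm, ?_, hΘz, hφ.trans hΘ.symm, ?_⟩
  · rw [OpenPartialHomeomorph.trans_source]
    exact ⟨hzφ, hzΘ⟩
  · rw [carries_iff]
    intro w hw
    rw [OpenPartialHomeomorph.trans_source] at hw
    have hwU : w ∈ U := by
      have h1 := (hΘO hw.2).2
      rw [mem_preimage, φ.left_inv hw.1] at h1
      exact h1.1
    have hLw : L w = Submodule.span ℝ {g 0 w} := by
      rw [hg.eq w hwU]
      unfold spanField
      rw [range_unique]
      rfl
    have h1 : pushPt (E × ℝ) (E × ℝ) φ ⟨w, L w⟩ = ⟨φ w, A (φ w)⟩ :=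
      (pushPt_of_line φ hLw).trans (Sigma.ext rfl (heq_of_eq
        (congrArg (fun v => Submodule.span ℝ {v}) (hfφ w hw.1).symm)))
    rw [OpenPartialHomeomorph.coe_trans, pushPt_comp (p := ⟨w, L w⟩) (hφ.mdifferentiableAt hw.1)
      (hΘ.symm.mdifferentiableAt hw.2), h1]
    exact carries_iff.1 (hA.symm hΘ) (φ w) hw.2

variable {F : Type u} [NormedAddCommGroup F] [InnerProductSpace ℝ F] [FiniteDimensional ℝ F]

lemma isDiffeo_univBall (c : F) {r : ℝ} (hr : 0 < r) :
    IsDiffeo F F (OpenPartialHomeomorph.univBall c r) := by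
  refine ⟨OpenPartialHomeomorph.contDiff_univBall.contMDiff.contMDiffOn, ?_⟩
  rw [OpenPartialHomeomorph.univBall_target c hr]
  exact OpenPartialHomeomorph.contDiffOn_univBall_symm.contMDiffOn

/-- The derivative of a product map is the product of the derivatives, so its first component kills
the last direction. -/
lemma push_prod_lastDirection_le {φ : OpenPartialHomeomorph F F} {ψ : OpenPartialHomeomorph ℝ ℝ}
    (hφ : IsDiffeo F F φ) (hψ : IsDiffeo ℝ ℝ ψ) {q : F × ℝ} (hq : q ∈ (φ.prod ψ).source) :
    push (F × ℝ) (F × ℝ) (φ.prod ψ) q (lastDirection F q) ≤ lastDirection F (φ.prod ψ q) := by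
  have h1 : HasFDerivAt (fun q : F × ℝ => φ q.1) ((fderiv ℝ φ q.1).comp
      (ContinuousLinearMap.fst ℝ F ℝ)) q :=
    HasFDerivAt.comp q (hφ.mdifferentiableAt hq.1).differentiableAt.hasFDerivAt hasFDerivAt_fst
  have h2 : HasFDerivAt (fun q : F × ℝ => ψ q.2) ((fderiv ℝ ψ q.2).comp
      (ContinuousLinearMap.snd ℝ F ℝ)) q :=
    HasFDerivAt.comp q (hψ.mdifferentiableAt hq.2).differentiableAt.hasFDerivAt hasFDerivAt_snd
  have h3 : mfderiv 𝓘(ℝ, F × ℝ) 𝓘(ℝ, F × ℝ) (φ.prod ψ) q = _ :=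
    (mfderiv_eq_fderiv).trans (h1.prodMk h2).fderiv
  rintro _ ⟨v, hv, rfl⟩
  refine mem_lastDirection.2 ?_
  change (mfderiv 𝓘(ℝ, F × ℝ) 𝓘(ℝ, F × ℝ) (φ.prod ψ) q v : F × ℝ).1 = 0
  rw [h3]
  change fderiv ℝ φ q.1 (v : F × ℝ).1 = 0
  rw [mem_lastDirection.1 hv, map_zero]

lemma IsDiffeo.prod {φ : OpenPartialHomeomorph F F} {ψ : OpenPartialHomeomorph ℝ ℝ}
    (hφ : IsDiffeo F F φ) (hψ : IsDiffeo ℝ ℝ ψ) : IsDiffeo (F × ℝ) (F × ℝ) (φ.prod ψ) := by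
  have h : ∀ {φ : OpenPartialHomeomorph F F} {ψ : OpenPartialHomeomorph ℝ ℝ}, IsDiffeo F F φ →
      IsDiffeo ℝ ℝ ψ →
      ContMDiffOn 𝓘(ℝ, F × ℝ) 𝓘(ℝ, F × ℝ) ∞ (φ.prod ψ) (φ.prod ψ).source := fun hφ hψ =>
    (((contMDiffOn_iff_contDiffOn.1 hφ.1).comp contDiff_fst.contDiffOn fun q hq => hq.1).prodMk
      ((contMDiffOn_iff_contDiffOn.1 hψ.1).comp contDiff_snd.contDiffOn fun q hq =>
        hq.2)).contMDiffOn
  exact ⟨h hφ hψ, h hφ.symm hψ.symm⟩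

/-- Line fields can be straightened, with the whole model space as image. -/
lemma exists_flowBox_univ {M : Type*} [TopologicalSpace M] [ChartedSpace (F × ℝ) M]
    [IsManifold 𝓘(ℝ, F × ℝ) ∞ M] {L : SubspaceField (F × ℝ) M} (hL : IsDistribution 1 L) (z : M) :
    ∃ χ : OpenPartialHomeomorph M (F × ℝ), z ∈ χ.source ∧ χ.target = univ ∧
      IsDiffeo (F × ℝ) (F × ℝ) χ ∧ Carries χ L (lastDirection F) := by
  obtain ⟨χ, hz, hz0, hχ, hχL⟩ := exists_flowBox hL z
  obtain ⟨r, hr, hrχ⟩ := Metric.isOpen_iff.1 χ.open_target 0 (hz0 ▸ χ.map_source hz)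
  -- Balls of the product are products of balls in the maximum norm. Expanding each factor to the
  -- whole space keeps the last direction and turns the flow lines into full lines, which gives
  -- connected fibres later.
  let b := OpenPartialHomeomorph.univBall (0 : F) r
  let c := OpenPartialHomeomorph.univBall (0 : ℝ) r
  have hb : IsDiffeo F F b := isDiffeo_univBall 0 hr
  have hc : IsDiffeo ℝ ℝ c := isDiffeo_univBall 0 hr
  have hbc := hb.prod hc
  have htarget : (b.prod c).target = Metric.ball (0 : F × ℝ) r := by
    rw [OpenPartialHomeomorph.prod_target, OpenPartialHomeomorph.univBall_target _ hr,
      OpenPartialHomeomorph.univBall_target _ hr, ball_prod_same]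
    rfl
  have hcarr : Carries (b.prod c) (lastDirection F) (lastDirection F) :=
    carries_of_push_le hbc (fun q hq => push_prod_lastDirection_le hb hc hq)
      fun q hq => push_prod_lastDirection_le hb.symm hc.symm hq
  refine ⟨χ.trans (b.prod c).symm, ?_, ?_, hχ.trans hbc.symm,
    hχL.trans hχ hbc.symm (hcarr.symm hbc)⟩
  · rw [OpenPartialHomeomorph.trans_source]
    refine ⟨hz, ?_⟩
    change χ z ∈ (b.prod c).target
    rw [htarget, hz0]
    exact Metric.mem_ball_self hr
  · rw [OpenPartialHomeomorph.trans_target]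
    refine eq_univ_of_forall fun q => ⟨?_, hrχ ?_⟩
    · change q ∈ (b.prod c).source
      rw [OpenPartialHomeomorph.prod_source, OpenPartialHomeomorph.univBall_source,
        OpenPartialHomeomorph.univBall_source]
      exact ⟨mem_univ _, mem_univ _⟩
    · rw [← htarget]
      refine (b.prod c).map_source ?_
      rw [OpenPartialHomeomorph.prod_source, OpenPartialHomeomorph.univBall_source,
        OpenPartialHomeomorph.univBall_source]
      exact ⟨mem_univ _, mem_univ _⟩

end FlowBox

/-! ### Invariant distributions are constant along the flow. -/

section Descent

variable {E : Type u} [NormedAddCommGroup E] [NormedSpace ℝ E] [FiniteDimensional ℝ E]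

/-- The unit vector field in the direction of the last coordinate. -/
def lastVF (E : Type*) [NormedAddCommGroup E] [NormedSpace ℝ E] : VField (E × ℝ) (E × ℝ) :=
  fun _ => ((0, 1) : E × ℝ)

/-- For a constant field only the derivative of `g` survives in the bracket. -/
lemma lieB_lastVF (g : E × ℝ → E × ℝ) (x : E × ℝ) :
    lieB (lastVF E) g x = fderiv ℝ g x (0, 1) := by
  have h : VectorField.mlieBracketWithin 𝓘(ℝ, E × ℝ) (lastVF E) g univ =
      VectorField.lieBracketWithin ℝ (lastVF E) g univ :=
    VectorField.mlieBracketWithin_eq_lieBracketWithin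
  have h' : lieB (lastVF E) g = VectorField.mlieBracketWithin 𝓘(ℝ, E × ℝ) (lastVF E) g univ :=
    VectorField.mlieBracketWithin_univ.symm
  refine (congrFun (h'.trans h) x).trans ?_
  have h0 : fderivWithin ℝ (fun _ : E × ℝ => ((0, 1) : E × ℝ)) univ x = 0 :=
    fderivWithin_const_apply _
  change fderivWithin ℝ g univ x (0, 1) -
    fderivWithin ℝ (fun _ : E × ℝ => ((0, 1) : E × ℝ)) univ x (g x) = _
  rw [h0, fderivWithin_univ]
  exact sub_zero _

lemma isSectionOn_lastVF (U : Set (E × ℝ)) : IsSectionOn (lastDirection E) U (lastVF E) :=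
  ⟨contMDiffOn_vectorSpace_iff_contDiffOn.2 contDiffOn_const,
    fun _ _ => Submodule.mem_span_singleton_self _⟩

/-- Parallel transport along the last coordinate does not increase the span of a family which is
closed under the derivative. -/
lemma span_le_of_lieB_mem {r : ℕ} {U : Set (E × ℝ)} {g : Fin r → E × ℝ → E × ℝ}
    (hU : IsOpen U) (hg : ∀ i, ContDiffOn ℝ ∞ (g i) U) {y : E} {a b : ℝ} (hab : a ≤ b)
    (hsub : ∀ s ∈ Icc a b, (y, s) ∈ U)
    (hcomb : ∀ i, SmoothComb (V := E × ℝ) (M := E × ℝ) g U (lieB (lastVF E) (g i))) :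
    Submodule.span ℝ (range fun i => g i (y, b)) ≤
      Submodule.span ℝ (range fun i => g i (y, a)) := by
  choose c hc hcg using hcomb
  rw [Submodule.span_le]
  rintro _ ⟨k, rfl⟩
  by_contra hk
  -- A form that kills the span at `a` but not `g k` at `b`. Its values on the `g i` solve a
  -- homogeneous linear system along the line and start at zero, so they vanish at `b`, a
  -- contradiction.
  obtain ⟨l, hl, hla⟩ := Submodule.exists_dual_map_eq_bot_of_notMem hk inferInstance
  let l' : E × ℝ →L[ℝ] ℝ := LinearMap.toContinuousLinearMap l
  let G : ℝ → Fin r → ℝ := fun s i => l' (g i (y, s))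
  let G' : ℝ → Fin r → ℝ := fun s i => ∑ j, c i j (y, s) * G s j
  have hcurve : ContinuousOn (fun s : ℝ => ((y, s) : E × ℝ)) (Icc a b) := by fun_prop
  have hG : ∀ s ∈ Icc a b, HasDerivAt G (G' s) s := by
    intro s hs
    refine hasDerivAt_pi.2 fun i => ?_
    have h2 := (((hg i).contDiffAt (hU.mem_nhds (hsub s hs))).differentiableAt (by simp)).hasFDerivAt
    have h3 : HasDerivAt (fun s : ℝ => ((y, s) : E × ℝ)) (0, 1) s :=
      (hasDerivAt_const s y).prodMk (hasDerivAt_id s)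
    have h4 := l'.hasFDerivAt.comp_hasDerivAt s
      (h2.comp_hasDerivAt (f := fun s : ℝ => ((y, s) : E × ℝ)) s h3)
    refine h4.congr_deriv ?_
    rw [← lieB_lastVF, hcg i _ (hsub s hs)]
    exact (map_sum l' _ _).trans (Finset.sum_congr rfl fun j _ => l'.map_smul _ _)
  -- Compactness of the interval bounds the coefficients, as the uniqueness estimate requires.
  have hKc : ContinuousOn (fun s => ∑ i, ∑ j, |c i j (y, s)|) (Icc a b) :=
    continuousOn_finsetSum _ fun i _ => continuousOn_finsetSum _ fun j _ =>
      ((hc i j).continuousOn.comp hcurve hsub).abs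
  obtain ⟨K, hK⟩ := (isCompact_Icc.image_of_continuousOn hKc).bddAbove
  have hG0 : G a = 0 := by
    funext i
    have h1 : l (g i (y, a)) ∈ (Submodule.span ℝ (range fun i => g i (y, a))).map l :=
      Submodule.mem_map_of_mem (Submodule.subset_span ⟨i, rfl⟩)
    rw [hla] at h1
    exact h1
  have hbound : ∀ s ∈ Ico a b, ‖G' s‖ ≤ K * ‖G s‖ := by
    intro s hs
    have h1 : ∑ i, ∑ j, |c i j (y, s)| ≤ K := hK ⟨s, Ico_subset_Icc_self hs, rfl⟩
    have h0 : 0 ≤ K := (Finset.sum_nonneg fun i _ => Finset.sum_nonneg fun j _ =>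
      abs_nonneg (c i j (y, s))).trans h1
    refine (pi_norm_le_iff_of_nonneg (by positivity)).2 fun i => ?_
    calc ‖G' s i‖ ≤ ∑ j, ‖c i j (y, s) * G s j‖ := norm_sum_le _ _
      _ ≤ ∑ j, |c i j (y, s)| * ‖G s‖ := Finset.sum_le_sum fun j _ => by
        rw [norm_mul, Real.norm_eq_abs (c i j (y, s))]
        exact mul_le_mul_of_nonneg_left (norm_le_pi_norm _ _) (abs_nonneg _)
      _ = (∑ j, |c i j (y, s)|) * ‖G s‖ := (Finset.sum_mul _ _ _).symm
      _ ≤ K * ‖G s‖ := by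
        gcongr
        exact (Finset.single_le_sum (f := fun i => ∑ j, |c i j (y, s)|)
          (fun i _ => Finset.sum_nonneg fun j _ => abs_nonneg _) (Finset.mem_univ i)).trans h1
  have h0 := eq_zero_of_abs_deriv_le_mul_abs_self_of_eq_zero_right
    (fun s hs => (hG s hs).continuousAt.continuousWithinAt)
    (fun s hs => (hG s (Ico_subset_Icc_self hs)).hasDerivWithinAt) hG0 hbound b
    (right_mem_Icc.2 hab)
  exact hl (congrFun h0 k)

/-- A distribution which is invariant under the last direction is constant along it. -/
lemma eq_of_bracket_lastDirection {r : ℕ} {F : E × ℝ → Submodule ℝ (E × ℝ)}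
    (hF : IsDistribution (V := E × ℝ) (M := E × ℝ) r F) (h : bracket (lastDirection E) F = F) (y : E) (s t : ℝ) :
    F (y, s) = F (y, t) := by
  have : CompleteSpace (E × ℝ) := FiniteDimensional.complete ℝ _
  -- It suffices to prove local constancy in the last variable, since `ℝ` is connected.
  have hloc : IsLocallyConstant fun s : ℝ => F (y, s) := by
    refine (IsLocallyConstant.iff_eventually_eq _).2 fun s => ?_
    obtain ⟨U, hsU, g, hg⟩ := hF.exists_frame (y, s)
    have hcurve : Continuous fun s : ℝ => ((y, s) : E × ℝ) := by fun_prop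
    obtain ⟨δ, hδ, hsub⟩ := Metric.isOpen_iff.1 (hg.isOpen.preimage hcurve) s hsU
    have hcomb : ∀ i, SmoothComb g U (lieB (lastVF E) (g i)) := fun i =>
      hg.smoothComb hg.isOpen subset_rfl ⟨SmoothVF.lieB hg.isOpen
        (isSectionOn_lastVF U).1 (hg.smooth i), fun x hx => by
          have h1 := lieB_mem_bracket hg.isOpen (isSectionOn_lastVF U) (hg.isSectionOn i) hx
          rwa [h] at h1⟩
    have heq : ∀ t ∈ Metric.ball s δ, F (y, t) =
        Submodule.span ℝ (range fun i => (g i (y, t) : E × ℝ)) := fun t ht => hg.eq _ (hsub ht)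
    have hfin : ∀ t, Module.finrank ℝ (F (y, t)) = r := fun t =>
      hF.finrank_eq (y, t)
    -- Transport gives only an inclusion, but the ranks agree.
    have hle : ∀ a ∈ Metric.ball s δ, ∀ b ∈ Metric.ball s δ, a ≤ b →
        F (y, b) = F (y, a) := fun a ha b hb hab => by
      refine Submodule.eq_of_le_of_finrank_eq ?_ ((hfin b).trans (hfin a).symm)
      rw [heq a ha, heq b hb]
      refine span_le_of_lieB_mem hg.isOpen
        (fun i => contMDiffOn_vectorSpace_iff_contDiffOn.1 (hg.smooth i)) hab (fun u hu => hsub ?_) hcomb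
      rw [Real.ball_eq_Ioo] at ha hb ⊢
      exact ⟨ha.1.trans_le hu.1, hu.2.trans_lt hb.2⟩
    have hs := Metric.mem_ball_self (x := s) hδ
    filter_upwards [Metric.ball_mem_nhds s hδ] with t ht
    rcases le_total s t with hst | hst
    · exact hle s hs t ht hst
    · exact (hle t ht s hs hst).symm
  exact hloc.apply_eq_of_preconnectedSpace s t

end Descent

/-! ### Existence and smoothness of reductions. -/

section Reduction

/-- This is rank–nullity for the restriction of `f` to the preimage, which contains the whole
kernel. -/
lemma finrank_comap_of_surjective {A B : Type*} [AddCommGroup A] [Module ℝ A] [AddCommGroup B]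
    [Module ℝ B] [FiniteDimensional ℝ A] {f : A →ₗ[ℝ] B} (hf : Function.Surjective f)
    (S : Submodule ℝ B) :
    Module.finrank ℝ (S.comap f) = Module.finrank ℝ S + Module.finrank ℝ (LinearMap.ker f) := by
  have h := (f.domRestrict (S.comap f)).finrank_range_add_finrank_ker
  rw [LinearMap.range_domRestrict, Submodule.map_comap_eq_of_surjective hf,
    LinearMap.ker_domRestrict] at h
  rw [← h]
  congr 1
  exact (Submodule.comapSubtypeEquivOfLe (LinearMap.ker_le_comap f)).finrank_eq

variable {V : Type*} [NormedAddCommGroup V] [NormedSpace ℝ V] [CompleteSpace V]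
  [FiniteDimensional ℝ V]
variable {M : Type*} [TopologicalSpace M] [ChartedSpace V M] [IsManifold 𝓘(ℝ, V) ∞ M]
variable {V' : Type*} [NormedAddCommGroup V'] [NormedSpace ℝ V'] [CompleteSpace V']
  [FiniteDimensional ℝ V']
variable {M' : Type*} [TopologicalSpace M'] [ChartedSpace V' M'] [IsManifold 𝓘(ℝ, V') ∞ M']

lemma carries_pull {φ : OpenPartialHomeomorph M M'} (hφ : IsDiffeo V V' φ)
    (A' : SubspaceField V' M') : Carries φ (fun x => pull V V' φ x (A' (φ x))) A' :=
  fun _ hx => Submodule.map_comap_eq_of_surjective (hφ.mfderiv_surjective hx) _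

lemma IsFrameOn.pushVF {ι : Type*} {φ : OpenPartialHomeomorph M M'} (hφ : IsDiffeo V V' φ)
    {A : SubspaceField V M} {A' : SubspaceField V' M'} (hA : Carries φ A A') {U : Set M}
    {g : ι → VField V M} (hg : IsFrameOn A U g) :
    IsFrameOn A' (φ.target ∩ φ.symm ⁻¹' (U ∩ φ.source)) fun i => pushVF φ (g i) := by
  have hO : IsOpen (U ∩ φ.source) := hg.isOpen.inter φ.open_source
  have hpush : ∀ w ∈ U ∩ φ.source, (fun i => (TwoThreeFive.pushVF φ (g i) : VField V' M') (φ w)) =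
      fun i => mfderiv 𝓘(ℝ, V) 𝓘(ℝ, V') φ w (g i w) := fun w hw =>
    funext fun i => pushVF_apply φ (g i) hw.2
  have hmem : ∀ y ∈ φ.target ∩ φ.symm ⁻¹' (U ∩ φ.source), ∃ w ∈ U ∩ φ.source, φ w = y :=
    fun y hy => ⟨φ.symm y, hy.2, φ.right_inv hy.1⟩
  refine ⟨φ.isOpen_inter_preimage_symm hO, fun i => SmoothVF.pushVF hφ hO inter_subset_right
    ((hg.smooth i).mono inter_subset_left), fun y hy => ?_, fun y hy => ?_⟩
  · obtain ⟨w, hw, rfl⟩ := hmem y hy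
    rw [hpush w hw]
    exact (hg.indep w hw.1).map' (mfderiv 𝓘(ℝ, V) 𝓘(ℝ, V') φ w).toLinearMap
      (LinearMap.ker_eq_bot.2 (hφ.mfderiv_injective hw.2))
  · obtain ⟨w, hw, rfl⟩ := hmem y hy
    unfold spanField
    rw [hpush w hw, ← hA w hw.2, hg.eq w hw.1]
    refine (Submodule.map_span _ _).trans (congrArg _ ?_)
    rw [← range_comp]
    rfl

lemma IsDistribution.of_carries {r : ℕ} {φ : OpenPartialHomeomorph M M'} (hφ : IsDiffeo V V' φ)
    (htarget : φ.target = univ) {A : SubspaceField V M} {A' : SubspaceField V' M'}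
    (hA : Carries φ A A') (h : IsDistribution r A) : IsDistribution r A' :=
  isDistribution_of_frames fun y => by
    obtain ⟨U, hU, g, hg⟩ := h.exists_frame (φ.symm y)
    have hy : y ∈ φ.target := htarget ▸ mem_univ y
    exact ⟨φ.target ∩ φ.symm ⁻¹' (U ∩ φ.source), ⟨hy, hU, φ.map_target hy⟩, _, hg.pushVF hφ hA⟩

/-- Fields of subspaces of constant rank with sufficiently many sections are distributions. -/
lemma isDistribution_of_sections {r : ℕ} {A : SubspaceField V M}
    (hr : ∀ x, Module.finrank ℝ (A x) = r)
    (h : ∀ x, ∀ v ∈ A x, ∃ (U : Set M) (X : VField V M), IsOpen U ∧ x ∈ U ∧ IsSectionOn A U X ∧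
      X x = v) : IsDistribution r A := by
  refine isDistribution_of_frames fun x => ?_
  have hfin (x : M) : FiniteDimensional ℝ (TangentSpace 𝓘(ℝ, V) x) :=
    inferInstanceAs (FiniteDimensional ℝ V)
  let b := Module.finBasisOfFinrankEq ℝ (A x) (hr x)
  choose U X hU hxU hX hXb using fun i => h x (b i) (b i).2
  have hO : IsOpen (⋂ i, U i) := isOpen_iInter_of_finite hU
  have hXO : ∀ i, IsSectionOn A (⋂ i, U i) (X i) := fun i => (hX i).mono (iInter_subset U i)
  obtain ⟨N, hN, hxN, hNO, hli⟩ := SmoothVF.exists_open_linearIndependent hO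
    (fun i => (hXO i).1) (mem_iInter.2 hxU) (by
      have h1 : (fun i => X i x) = fun i => (b i : TangentSpace 𝓘(ℝ, V) x) := funext hXb
      rw [h1]
      exact b.linearIndependent.map' (A x).subtype (A x).ker_subtype)
  refine ⟨N, hxN, X, hN, fun i => (hXO i).1.mono hNO, hli, fun y hy => ?_⟩
  refine (Submodule.eq_of_le_of_finrank_eq (spanField_le fun i => (hXO i).2 y (hNO hy)) ?_).symm
  rw [hr]
  exact (finrank_span_eq_card (hli y hy)).trans (Fintype.card_fin r)

/-- The distribution of a reduction is smooth. -/
lemma IsReduction.isDistribution {r : ℕ} {U : Set M} {p : M → M'} {L F : SubspaceField V M}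
    {D : SubspaceField V' M'} (h : IsReduction U p L F D) (hL : IsDistribution 1 L)
    (hF : IsDistribution (r + 1) F) : IsDistribution r D := by
  have hex : ∀ y, ∃ w ∈ U, p w = y := fun y => h.image_eq.ge (mem_univ y)
  refine isDistribution_of_sections (fun y => ?_) fun y v hv => ?_
  · obtain ⟨w, hw, rfl⟩ := hex y
    have hfin : FiniteDimensional ℝ (TangentSpace 𝓘(ℝ, V) w) :=
      inferInstanceAs (FiniteDimensional ℝ V)
    have h1 := finrank_comap_of_surjective
      (f := (mfderiv 𝓘(ℝ, V) 𝓘(ℝ, V') p w).toLinearMap) (h.submersion w hw) (D (p w))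
    have h2 : (D (p w)).comap (mfderiv 𝓘(ℝ, V) 𝓘(ℝ, V') p w).toLinearMap = F w := h.pull_eq w hw
    have h3 : LinearMap.ker (mfderiv 𝓘(ℝ, V) 𝓘(ℝ, V') p w).toLinearMap = L w := h.ker_eq w hw
    rw [h2, h3, hF.finrank_eq, hL.finrank_eq] at h1
    omega
  · obtain ⟨w, hw, rfl⟩ := hex y
    obtain ⟨u, rfl⟩ := h.submersion w hw v
    have hu : u ∈ F w := (h.pull_eq w hw).le hv
    obtain ⟨N, hwN, g, hg⟩ := hF.exists_frame w
    rw [hg.eq w hwN] at hu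
    obtain ⟨c, hc⟩ := (Submodule.mem_span_range_iff_exists_fun ℝ).1 hu
    -- The vector extends to a section of `F` with constant coefficients in a frame.
    let X : VField V M := fun x => ∑ i, c i • g i x
    have hXs : SmoothVF N X := (SmoothVF.sum (s := Finset.univ) (X := fun i => (fun _ => c i) • g i) fun i _ =>
      SmoothVF.smul (c := fun _ => c i) contMDiffOn_const (hg.smooth i)).congr fun x _ => by
        simp [X, Finset.sum_apply]
    have hX : IsSectionOn F N X := ⟨hXs,
      fun x hx => Submodule.sum_mem _ fun i _ => Submodule.smul_mem _ _ ((hg.isSectionOn i).2 x hx)⟩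
    have hO : IsOpen (U ∩ N) := h.isOpen.inter hg.isOpen
    -- A section of `p` brings this field to the base: projecting it along `σ` gives a smooth
    -- section of `D` through `v`.
    obtain ⟨O, σ, hOo, hwO, hσ, hσU, hσw, hpσ⟩ := exists_section hO (h.smooth.mono inter_subset_left)
      ⟨hw, hwN⟩ (h.submersion w hw)
    have hsm := ContMDiffOn.comp (t := U ∩ N) (SmoothVF.mfderiv_apply hO
      (h.smooth.mono inter_subset_left) (hX.1.mono inter_subset_right)) hσ hσU
    let Y : VField V' M' := fun y => (mfderiv 𝓘(ℝ, V) 𝓘(ℝ, V') p (σ y) (X (σ y)) : V')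
    have key : ∀ (a b : M') (v : V'), a = b → (show TangentSpace 𝓘(ℝ, V') a from v) ∈ D a →
        (show TangentSpace 𝓘(ℝ, V') b from v) ∈ D b := by
      rintro a _ v rfl hv
      exact hv
    refine ⟨O, Y, hOo, hwO, ⟨hsm.congr fun y hy => ?_, fun y hy => ?_⟩, ?_⟩
    · have h1 : ∀ (a b : M') (v : V'), a = b →
          (⟨b, v⟩ : TangentBundle 𝓘(ℝ, V') M') = ⟨a, v⟩ := by
        rintro a _ v rfl
        rfl
      exact h1 _ _ _ (hpσ y hy)
    · refine key (p (σ y)) y _ (hpσ y hy) ?_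
      exact (h.pull_eq _ (hσU hy).1).ge (hX.2 _ (hσU hy).2)
    · have h1 : ∀ a, a = w → (mfderiv 𝓘(ℝ, V) 𝓘(ℝ, V') p a (X a) : V') =
          mfderiv 𝓘(ℝ, V) 𝓘(ℝ, V') p w u := by
        rintro _ rfl
        exact congrArg _ hc
      exact h1 _ hσw

end Reduction

/-- The model space, lifted to an arbitrary universe. -/
lemma exists_model_manifold : ∃ (Y : Type u) (_ : TopologicalSpace Y) (_ : ChartedSpace R5 Y)
    (_ : IsManifold 𝓘(ℝ, R5) ∞ Y) (ψ : OpenPartialHomeomorph Y R5), T2Space Y ∧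
    SecondCountableTopology Y ∧ IsDiffeo R5 R5 ψ ∧ ψ.source = univ ∧ ψ.target = univ := by
  let h : ULift.{u} R5 ≃ₜ R5 := Homeomorph.ulift
  let ψ : OpenPartialHomeomorph (ULift.{u} R5) R5 := h.toOpenPartialHomeomorph
  have hψ : ψ.source = univ := rfl
  let _ : ChartedSpace R5 (ULift.{u} R5) := ψ.singletonChartedSpace hψ
  have : IsManifold 𝓘(ℝ, R5) ∞ (ULift.{u} R5) := ψ.isManifold_singleton hψ
  exact ⟨ULift.{u} R5, inferInstance, inferInstance, this, ψ, h.symm.t2Space,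
    h.secondCountableTopology, isDiffeo_chartAt (V := R5) (⟨0⟩ : ULift.{u} R5), hψ, rfl⟩

/-- Distributions which are invariant under a line field have local reductions. -/
lemma exists_isReduction {Z : Type u} [TopologicalSpace Z] [ChartedSpace (R5 × ℝ) Z]
    [IsManifold 𝓘(ℝ, R5 × ℝ) ∞ Z] {L F : SubspaceField (R5 × ℝ) Z} {r : ℕ}
    (hL : IsDistribution 1 L) (hF : IsDistribution r F) (hLF : ∀ z, L z ≤ F z)
    (hb : bracket L F = F) (z : Z) :
    ∃ (Y : Type u) (_ : TopologicalSpace Y) (_ : ChartedSpace R5 Y)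
      (_ : IsManifold 𝓘(ℝ, R5) ∞ Y) (U : Set Z) (p : Z → Y) (D : SubspaceField R5 Y),
      T2Space Y ∧ SecondCountableTopology Y ∧ z ∈ U ∧ IsReduction U p L F D := by
  obtain ⟨Y, _, _, _, ψ, hT2, hsc, hψ, hψs, hψt⟩ := exists_model_manifold.{u}
  obtain ⟨χ, hz, hχt, hχ, hχL⟩ := exists_flowBox_univ hL z
  have hψs' : ∀ y, y ∈ ψ.source := fun y => hψs ▸ mem_univ y
  have hψt' : ∀ y, y ∈ ψ.target := fun y => hψt ▸ mem_univ y
  have hχt' : ∀ q, q ∈ χ.target := fun q => hχt ▸ mem_univ q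
  -- `F` in the flow box, where `L` is the last direction.
  let F' : R5 × ℝ → Submodule ℝ (R5 × ℝ) := fun q => pull (R5 × ℝ) (R5 × ℝ) χ.symm q (F (χ.symm q))
  have hχF : Carries χ F F' := by
    have h1 := (carries_pull hχ.symm F).symm hχ.symm
    rwa [OpenPartialHomeomorph.symm_symm] at h1
  have hF' : IsDistribution (V := R5 × ℝ) (M := R5 × ℝ) r F' := hF.of_carries hχ hχt hχF
  have hbF' : bracket (lastDirection R5) F' = F' := by
    funext q
    have h1 := Carries.bracket hχ hχL hχF (χ.symm q) (χ.map_target (hχt' q))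
    have h2 := hχF (χ.symm q) (χ.map_target (hχt' q))
    rw [hb, h2] at h1
    have key : ∀ q', q' = q → F' q' = bracket (lastDirection R5) F' q' →
        bracket (lastDirection R5) F' q = F' q := by
      rintro _ rfl h
      exact h.symm
    exact key _ (χ.right_inv (hχt' q)) h1
  have hconst := eq_of_bracket_lastDirection hF' hbF'
  let q : Z → R5 := fun w => (χ w).1
  let p : Z → Y := fun w => ψ.symm (q w)
  -- The first projection of the slice at height zero; by `hconst` every height gives the same
  -- subspace.
  let G : R5 → Submodule ℝ R5 := fun y => (F' (y, 0)).map (LinearMap.fst ℝ R5 ℝ)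
  let D : SubspaceField R5 Y := fun y => pull R5 R5 ψ y (G (ψ y))
  have hq : ContMDiffOn 𝓘(ℝ, R5 × ℝ) 𝓘(ℝ, R5) ∞ q χ.source :=
    contDiff_fst.contMDiff.comp_contMDiffOn hχ.1
  have hp : ContMDiffOn 𝓘(ℝ, R5 × ℝ) 𝓘(ℝ, R5) ∞ p χ.source :=
    hψ.2.comp hq fun w _ => hψt' _
  have hqd : ∀ w ∈ χ.source, MDifferentiableAt 𝓘(ℝ, R5 × ℝ) 𝓘(ℝ, R5) q w := fun w hw =>
    (hq.contMDiffAt (χ.open_source.mem_nhds hw)).mdifferentiableAt (by simp)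
  have hpd : ∀ w ∈ χ.source, MDifferentiableAt 𝓘(ℝ, R5 × ℝ) 𝓘(ℝ, R5) p w := fun w hw =>
    (hp.contMDiffAt (χ.open_source.mem_nhds hw)).mdifferentiableAt (by simp)
  have hdq : ∀ w ∈ χ.source, ∀ v, (mfderiv 𝓘(ℝ, R5 × ℝ) 𝓘(ℝ, R5) q w v : R5) =
      (mfderiv 𝓘(ℝ, R5 × ℝ) 𝓘(ℝ, R5 × ℝ) χ w v : R5 × ℝ).1 := fun w hw v =>
    mfderiv_clm_comp (ContinuousLinearMap.fst ℝ R5 ℝ) (hχ.mdifferentiableAt hw) v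
  have hdp : ∀ w ∈ χ.source, ∀ v, (mfderiv 𝓘(ℝ, R5) 𝓘(ℝ, R5) ψ (p w)
      (mfderiv 𝓘(ℝ, R5 × ℝ) 𝓘(ℝ, R5) p w v) : R5) =
      (mfderiv 𝓘(ℝ, R5 × ℝ) 𝓘(ℝ, R5 × ℝ) χ w v : R5 × ℝ).1 := fun w hw v => by
    rw [← hdq w hw v]
    have h1 := mfderiv_comp w (hψ.mdifferentiableAt (hψs' (p w))) (hpd w hw)
    have h2 : ψ ∘ p = q := funext fun w => ψ.right_inv (hψt' _)
    rw [h2] at h1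
    exact (congrArg (fun A => A v) h1).symm
  have hpush : ∀ {A : SubspaceField (R5 × ℝ) Z} {A' : SubspaceField (R5 × ℝ) (R5 × ℝ)},
      Carries χ A A' → ∀ w ∈ χ.source, ∀ v, mfderiv 𝓘(ℝ, R5 × ℝ) 𝓘(ℝ, R5 × ℝ) χ w v ∈ A' (χ w) ↔
        v ∈ A w := fun {A A'} hA w hw v => by
    rw [← hA w hw]
    refine ⟨?_, fun hv => ⟨v, hv, rfl⟩⟩
    rintro ⟨u, hu, huv⟩
    rwa [← hχ.mfderiv_injective hw huv]
  refine ⟨Y, inferInstance, inferInstance, inferInstance, χ.source, p, D, hT2, hsc, hz,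
    χ.open_source, hp, fun w hw u => ?_, fun w hw => ?_, ?_, fun y => ?_, fun w hw => ?_⟩
  · obtain ⟨v, hv⟩ := hχ.mfderiv_surjective hw
      ((mfderiv 𝓘(ℝ, R5) 𝓘(ℝ, R5) ψ (p w) u, 0) : R5 × ℝ)
    refine ⟨v, hψ.mfderiv_injective (hψs' (p w)) ((hdp w hw v).trans ?_)⟩
    rw [hv]
  · ext v
    rw [← hpush hχL w hw v]
    refine Iff.trans ?_ mem_lastDirection.symm
    rw [← hdp w hw v]
    refine ⟨fun hv => ?_, fun hv => ?_⟩
    · have hv : mfderiv 𝓘(ℝ, R5 × ℝ) 𝓘(ℝ, R5) p w v = 0 := hv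
      rw [hv]
      exact map_zero _
    · exact hψ.mfderiv_injective (hψs' (p w)) (hv.trans (map_zero _).symm)
  · refine eq_univ_of_forall fun y => ⟨χ.symm (ψ y, 0), χ.map_target (hχt' _), ?_⟩
    change ψ.symm (χ (χ.symm (ψ y, 0))).1 = y
    rw [χ.right_inv (hχt' _), ψ.left_inv (hψs' y)]
  -- As the flow box is the whole model space, each fibre is the image of a full line.
  · have h1 : χ.source ∩ p ⁻¹' {y} = range fun s : ℝ => χ.symm (ψ y, s) := by
      ext w
      refine ⟨?_, ?_⟩
      · rintro ⟨hw, rfl⟩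
        refine ⟨(χ w).2, ?_⟩
        change χ.symm (ψ (ψ.symm (χ w).1), (χ w).2) = w
        rw [ψ.right_inv (hψt' _)]
        exact χ.left_inv hw
      · rintro ⟨s, rfl⟩
        refine ⟨χ.map_target (hχt' _), ?_⟩
        change ψ.symm (χ (χ.symm (ψ y, s))).1 = y
        rw [χ.right_inv (hχt' _), ψ.left_inv (hψs' y)]
    rw [h1]
    have hc : Continuous χ.symm := by
      have h2 := χ.continuousOn_symm
      rwa [hχt, continuousOn_univ] at h2
    exact isConnected_range (hc.comp (Continuous.prodMk_right (ψ y)))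
  · ext v
    rw [← hpush hχF w hw v]
    have h1 : v ∈ pull (R5 × ℝ) R5 p w (D (p w)) ↔
        (mfderiv 𝓘(ℝ, R5 × ℝ) 𝓘(ℝ, R5 × ℝ) χ w v : R5 × ℝ).1 ∈ G (χ w).1 := by
      have h2 : ψ (p w) = (χ w).1 := ψ.right_inv (hψt' _)
      rw [← h2, ← hdp w hw v]
      rfl
    rw [h1]
    have h3 : F' (χ w) = F' ((χ w).1, 0) := hconst (χ w).1 (χ w).2 0
    rw [h3]
    refine ⟨?_, fun hv => ⟨_, hv, rfl⟩⟩
    rintro ⟨u, hu, huv⟩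
    -- Because `L ≤ F`, the space `F'` contains the last direction, so membership depends on the
    -- first component only.
    have hle : ∀ k : R5 × ℝ, k.1 = 0 → k ∈ F' ((χ w).1, 0) := fun k hk => by
      rw [← h3]
      have h4 : push (R5 × ℝ) (R5 × ℝ) χ w (L w) ≤ push (R5 × ℝ) (R5 × ℝ) χ w (F w) :=
        Submodule.map_mono (hLF w)
      rw [hχL w hw, hχF w hw] at h4
      exact h4 (mem_lastDirection.2 hk)
    let k : R5 × ℝ := mfderiv 𝓘(ℝ, R5 × ℝ) 𝓘(ℝ, R5 × ℝ) χ w v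
    have h5 := Submodule.sub_mem _ hu (hle (u - k) (sub_eq_zero.2 huv))
    rwa [sub_sub_cancel] at h5

/-! ### Reductions are (2,3,5)-distributions. -/

section Reconstruction

variable {V : Type*} [NormedAddCommGroup V] [NormedSpace ℝ V] [CompleteSpace V]
  [FiniteDimensional ℝ V]
variable {M : Type*} [TopologicalSpace M] [ChartedSpace V M] [IsManifold 𝓘(ℝ, V) ∞ M]
variable {V' : Type*} [NormedAddCommGroup V'] [NormedSpace ℝ V'] [CompleteSpace V']
  [FiniteDimensional ℝ V']
variable {M' : Type*} [TopologicalSpace M'] [ChartedSpace V' M'] [IsManifold 𝓘(ℝ, V') ∞ M']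
variable {U : Set M} {p : M → M'} {O : Set M'} {a b : VField V' M'} {T g₁ g₂ : VField V M}

namespace IsLiftFrame

lemma mono (h : IsLiftFrame U p O a b T g₁ g₂) {N : Set M} (hN : IsOpen N) (hNU : N ⊆ U) :
    IsLiftFrame N p O a b T g₁ g₂ :=
  ⟨hN, h.isOpen_base, h.smooth_map.mono hNU, fun _ hw => h.mapsTo (hNU hw), h.smooth_a, h.smooth_b,
    h.smooth_T.mono hNU, h.smooth_g₁.mono hNU, h.smooth_g₂.mono hNU, fun w hw => h.ne_zero w (hNU hw),
    fun w hw => h.ker w (hNU hw), fun w hw => h.map_T w (hNU hw), fun w hw => h.map_g₁ w (hNU hw),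
    fun w hw => h.map_g₂ w (hNU hw)⟩

/-- The kernel is a line, so any nowhere vanishing kernel field spans it. This allows `T` to be the
first field of a bracket frame. -/
lemma replace_T (h : IsLiftFrame U p O a b T g₁ g₂) {S : VField V M} (hS : SmoothVF U S)
    (hS0 : ∀ w ∈ U, S w ≠ 0) (hmap : ∀ w ∈ U, mfderiv 𝓘(ℝ, V) 𝓘(ℝ, V') p w (S w) = 0) :
    IsLiftFrame U p O a b S g₁ g₂ :=
  { h with
    smooth_T := hS
    ne_zero := hS0
    ker := fun w hw v hv => by
      obtain ⟨c, hc⟩ := Submodule.mem_span_singleton.1 (h.ker w hw _ (hmap w hw))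
      obtain ⟨d, hd⟩ := Submodule.mem_span_singleton.1 (h.ker w hw v hv)
      have hc0 : c ≠ 0 := by
        rintro rfl
        exact hS0 w hw (by rw [← hc, zero_smul])
      refine Submodule.mem_span_singleton.2 ⟨d * c⁻¹, ?_⟩
      rw [← hc, smul_smul, mul_assoc, inv_mul_cancel₀ hc0, mul_one, hd]
    map_T := hmap }

/-- The fields `T, g₁, g₂` and the iterated brackets of `g₁, g₂`. -/
def six (T g₁ g₂ : VField V M) : Fin 6 → VField V M := Fin.cons T (fiveFrame g₁ g₂)

/-- These brackets lie in the line of `T`, and smooth coefficients follow since `T` does not vanish.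
-/
lemma smoothComb_lieB_T (h : IsLiftFrame U p O a b T g₁ g₂) (i : Fin 6) :
    SmoothComb (fun _ : Fin 1 => T) U (lieB T (six T g₁ g₂ i)) := by
  refine Fin.cases ?_ (fun i => ?_) i
  · exact (SmoothComb.zero _ U).congr fun x _ => lieB_self T x
  · refine smoothComb_of_mem_span h.isOpen (fun _ => h.smooth_T) (fun x hx =>
      LinearIndependent.of_subsingleton (0 : Fin 1) (h.ne_zero x hx))
      (h.smooth_T.lieB h.isOpen (h.smooth_five i)) fun x hx => ?_
    rw [range_const]
    exact h.lieB_T i hx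

lemma smooth_six (h : IsLiftFrame U p O a b T g₁ g₂) (i : Fin 6) :
    SmoothVF U (six T g₁ g₂ i) :=
  Fin.cases h.smooth_T h.smooth_five i

/-- Iterated brackets of combinations of `T, g₁, g₂`. -/
lemma smoothComb_six (h : IsLiftFrame U p O a b T g₁ g₂) {X Y : VField V M}
    (hX : SmoothComb ![T, g₁, g₂] U X) (hY : SmoothComb ![T, g₁, g₂] U Y) :
    SmoothComb (six T g₁ g₂) U (lieB X Y) ∧ SmoothComb (six T g₁ g₂) U (lieB X (lieB X Y)) ∧
      SmoothComb (six T g₁ g₂) U (lieB T (lieB X (lieB X Y))) := by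
  have hU := h.isOpen
  let h3 : Fin 3 → VField V M := ![T, g₁, g₂]
  let h4 : Fin 4 → VField V M := ![T, g₁, g₂, lieB g₁ g₂]
  let h6 := six T g₁ g₂
  have s6 := h.smooth_six
  have s4 : ∀ i, SmoothVF U (h4 i) := by
    intro i; fin_cases i; exacts [s6 0, s6 1, s6 2, s6 3]
  have s3 : ∀ i, SmoothVF U (h3 i) := by
    intro i; fin_cases i; exacts [s6 0, s6 1, s6 2]
  have m4 : ∀ i, SmoothComb h6 U (h4 i) := by
    intro i; fin_cases i
    exacts [SmoothComb.self h6 U 0, SmoothComb.self h6 U 1, SmoothComb.self h6 U 2,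
      SmoothComb.self h6 U 3]
  have m3 : ∀ i, SmoothComb h4 U (h3 i) := by
    intro i; fin_cases i
    exacts [SmoothComb.self h4 U 0, SmoothComb.self h4 U 1, SmoothComb.self h4 U 2]
  have mT : ∀ _ : Fin 1, SmoothComb h4 U T := fun _ => SmoothComb.self h4 U 0
  have neg : ∀ {k : ℕ} {g : Fin k → VField V M} {A B : VField V M}, SmoothComb g U (lieB A B) →
      SmoothComb g U (lieB B A) := fun hAB => hAB.neg.congr fun x _ => lieB_swap _ _ x
  have z4 : ∀ c, SmoothComb h4 U (lieB c c) := fun c =>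
    (SmoothComb.zero _ U).congr fun x _ => lieB_self c x
  have T4 : ∀ i : Fin 6, SmoothComb h4 U (lieB T (six T g₁ g₂ i)) := fun i =>
    (h.smoothComb_lieB_T i).trans mT
  have hXY : SmoothComb h4 U (lieB X Y) := by
    refine SmoothComb.lieB hU hX hY s3 s3 m3 m3 fun i j => ?_
    have b12 : SmoothComb h4 U (lieB g₁ g₂) := SmoothComb.self h4 U 3
    fin_cases i <;> fin_cases j
    exacts [z4 T, T4 1, T4 2, neg (T4 1), z4 g₁, b12, neg (T4 2), neg b12, z4 g₂]
  have hXXY : SmoothComb h6 U (lieB X (lieB X Y)) := by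
    refine SmoothComb.lieB hU hX hXY s3 s4 (fun i => (m3 i).trans m4) m4 fun i j => ?_
    have b12 : SmoothComb h6 U (lieB g₁ g₂) := SmoothComb.self h6 U 3
    have b13 : SmoothComb h6 U (lieB g₁ (lieB g₁ g₂)) := SmoothComb.self h6 U 4
    have b23 : SmoothComb h6 U (lieB g₂ (lieB g₁ g₂)) := SmoothComb.self h6 U 5
    have z6 : ∀ c, SmoothComb h6 U (lieB c c) := fun c => (z4 c).trans m4
    have T6 : ∀ i : Fin 6, SmoothComb h6 U (lieB T (six T g₁ g₂ i)) := fun i => (T4 i).trans m4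
    fin_cases i <;> fin_cases j
    exacts [z6 T, T6 1, T6 2, T6 3, neg (T6 1), z6 g₁, b12, b13, neg (T6 2), neg b12, z6 g₂, b23]
  refine ⟨hXY.trans m4, hXXY, ?_⟩
  -- A further bracket with `T` yields nothing outside the span, by `smoothComb_lieB_T`.
  exact SmoothComb.lieB hU (SmoothComb.self (fun _ : Fin 1 => T) U 0) hXXY (fun _ => h.smooth_T) s6
    (fun i => (mT i).trans m4) (fun i => SmoothComb.self h6 U i) fun _ j => (T4 j).trans m4

/-- The converse of `IsLiftFrame.linearIndependent`. -/
lemma linearIndependent_base (h : IsLiftFrame U p O a b T g₁ g₂) {w : M} (hw : w ∈ U)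
    (h6 : LinearIndependent ℝ fun i => six T g₁ g₂ i w) :
    LinearIndependent ℝ fun i => fiveFrame a b i (p w) := by
  have h1 : (fun i => six T g₁ g₂ i w) = Fin.cons (T w) fun i => fiveFrame g₁ g₂ i w := by
    funext i
    refine Fin.cases rfl (fun i => rfl) i
  rw [h1, linearIndependent_finCons] at h6
  have h2 : (fun i => fiveFrame a b i (p w)) =
      (mfderiv 𝓘(ℝ, V) 𝓘(ℝ, V') p w).toLinearMap ∘ fun i => fiveFrame g₁ g₂ i w :=
    funext fun i => (h.map_five i hw).symm
  rw [h2]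
  refine h6.1.map (Submodule.disjoint_def.2 fun v hv hv0 => ?_)
  obtain ⟨c, rfl⟩ := Submodule.mem_span_singleton.1 (h.ker w hw v hv0)
  by_contra hc
  have hc0 : c ≠ 0 := fun h0 => hc (by rw [h0, zero_smul])
  exact h6.2 ((Submodule.smul_mem_iff _ hc0).1 hv)

end IsLiftFrame

variable {K L : SubspaceField V M} {D : SubspaceField V' M'}

/-- Near each point, a frame of a pseudo-product structure and lifts of a frame of a reduction. -/
lemma IsReduction.exists_isLiftFrame (hKL : IsPseudoProductG2 K L)
    (h : IsReduction U p L (derived (sumField K L) 1) D) {z : M} (hz : z ∈ U) {η : Fin 2 → VField V' M'}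
    (hη : IsFrameOn D O η) (hzO : p z ∈ O) :
    ∃ (N : Set M) (f : Fin 6 → VField V M) (g₁ g₂ : VField V M), z ∈ N ∧ N ⊆ U ∧
      IsBracketFrame N K L f ∧ IsLiftFrame N p O (η 0) (η 1) (f 0) g₁ g₂ ∧
      IsFrameOn (derived (sumField K L) 1) N ![f 0, g₁, g₂] := by
  obtain ⟨U₁, hzU₁, f, hf⟩ := hKL.exists_frame z
  obtain ⟨N, T, g₁, g₂, hzN, hNU, hl⟩ := TwoThreeFive.exists_isLiftFrame h.isOpen h.smooth hz
    (h.submersion z hz) hη.isOpen hzO (hη.smooth 0) (hη.smooth 1) fun w hw => by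
      rw [h.ker_eq w hw]
      exact hKL.rank_L.finrank_eq w
  have hN : IsOpen (N ∩ U₁) := hl.isOpen.inter hf.isOpen
  replace hf := hf.mono hN inter_subset_right
  replace hl := hl.mono hN inter_subset_left
  have hL0 : ∀ w ∈ N ∩ U₁, f 0 w ∈ L w := fun w hw => by
    rw [hf.L_eq w hw]
    exact mem_spanOn f (by simp) w
  replace hl := hl.replace_T (hf.smooth 0) (fun w hw => (hf.indep w hw).ne_zero 0) fun w hw => by
    have h1 := hL0 w hw
    rw [← h.ker_eq w (hNU hw.1)] at h1
    exact h1
  refine ⟨N ∩ U₁, f, g₁, g₂, ⟨hzN, hzU₁⟩, fun w hw => hNU hw.1, hf, hl, ?_⟩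
  refine isFrameOn_of_le hN (fun i => ?_) (fun w hw => ?_) fun w hw => ?_
  · fin_cases i
    exacts [hl.smooth_T, hl.smooth_g₁, hl.smooth_g₂]
  · rw [← h.pull_eq w (hNU hw.1)]
    have h0 : ∀ i, (![f 0, g₁, g₂] : Fin 3 → VField V M) i w ∈ spanField ![f 0, g₁, g₂] w :=
      fun i => mem_spanField _ i w
    refine hl.pull_le hw (h0 0) fun u hu => ?_
    rw [hη.eq _ (hl.mapsTo hw)] at hu
    obtain ⟨c, rfl⟩ := (Submodule.mem_span_range_iff_exists_fun ℝ).1 hu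
    refine ⟨c 0 • g₁ w + c 1 • g₂ w, Submodule.add_mem _ (Submodule.smul_mem _ _ (h0 1))
      (Submodule.smul_mem _ _ (h0 2)), ?_⟩
    rw [map_add, map_smul, map_smul, hl.map_g₁ w hw, hl.map_g₂ w hw, Fin.sum_univ_two]
  · exact hKL.growth 1 (by norm_num) w

/-- Each reduction of a pseudo-product structure of `G₂`-type is a `(2,3,5)`-distribution. -/
lemma IsReduction.is235 (hKL : IsPseudoProductG2 K L) (hV' : Module.finrank ℝ V' = 5)
    (hD : IsDistribution 2 D) (h : IsReduction U p L (derived (sumField K L) 1) D) : Is235 D where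
  dim := hV'
  isDistribution := hD
  frame y := by
    obtain ⟨z, hz, rfl⟩ : ∃ w ∈ U, p w = y := h.image_eq.ge (mem_univ y)
    obtain ⟨O, hzO, η, hη⟩ := hD.exists_frame (p z)
    obtain ⟨N, f, g₁, g₂, hzN, hNU, hf, hl, hF⟩ := h.exists_isLiftFrame hKL hz hη hzO
    -- The first three frame fields lie in `∂E`, which is also framed by `f 0, g₁, g₂`. The
    -- remaining three are iterated brackets of these, so `smoothComb_six` controls them.
    have hsec : ∀ i : Fin 6, i.val < 3 → SmoothComb ![f 0, g₁, g₂] N (f i) := fun i hi =>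
      hF.smoothComb hl.isOpen subset_rfl ⟨hf.smooth i, fun w hw => by
        rw [hf.toIsG2Frame.derived_eq_one (IsG2Frame.sumField_eq hf.K_eq hf.L_eq) w hw]
        exact mem_flag f hi w⟩
    have hm : ∀ i, SmoothComb (IsLiftFrame.six (f 0) g₁ g₂) N ((![f 0, g₁, g₂] : Fin 3 → _) i) := by
      intro i; fin_cases i
      exacts [SmoothComb.self (IsLiftFrame.six (f 0) g₁ g₂) N 0,
        SmoothComb.self (IsLiftFrame.six (f 0) g₁ g₂) N 1,
        SmoothComb.self (IsLiftFrame.six (f 0) g₁ g₂) N 2]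
    obtain ⟨h3, h4, h5⟩ := hl.smoothComb_six (hsec 1 (by simp)) (hsec 2 (by simp))
    rw [← hf.eq_3, ← hf.eq_4] at h4 h5
    rw [← hf.eq_3] at h3
    rw [← hf.eq_5] at h5
    have hall : ∀ i, f i z ∈ Submodule.span ℝ (range fun i => IsLiftFrame.six (f 0) g₁ g₂ i z) := by
      intro i
      fin_cases i
      exacts [((hsec 0 (by simp)).trans hm).mem_span hzN, ((hsec 1 (by simp)).trans hm).mem_span hzN,
        ((hsec 2 (by simp)).trans hm).mem_span hzN, h3.mem_span hzN, h4.mem_span hzN, h5.mem_span hzN]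
    have htop := hf.toIsG2Frame.flag_six hKL.dim hzN
    -- The frame `f` spans the tangent space and lies in the span of the six lifted fields, so these
    -- are independent.
    have h6 : LinearIndependent ℝ fun i => IsLiftFrame.six (f 0) g₁ g₂ i z :=
      linearIndependent_of_top_le_span_of_card_eq_finrank
        (htop.ge.trans (flag_le fun i _ => hall i)) (by
          rw [Fintype.card_fin]
          exact hKL.dim.symm)
    obtain ⟨N', hN', hzN', hN'O, hli⟩ := SmoothVF.exists_open_linearIndependent hη.isOpen
      (fiveFrame_smooth hη.isOpen (hη.smooth 0) (hη.smooth 1)) hzO (hl.linearIndependent_base hzN h6)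
    refine ⟨N', hN', hzN', η 0, η 1, (hη.isSectionOn 0).mono hN'O, (hη.isSectionOn 1).mono hN'O,
      fun y hy => ?_⟩
    rw [← fiveFrame_apply]
    exact hli y hy

end Reconstruction

/-! ### The identification with the prolongation of the reduction. -/

section LineMap

variable {V : Type*} [NormedAddCommGroup V] [NormedSpace ℝ V] [CompleteSpace V]
  [FiniteDimensional ℝ V]
variable {M : Type*} [TopologicalSpace M] [ChartedSpace V M] [IsManifold 𝓘(ℝ, V) ∞ M]
variable {V' : Type*} [NormedAddCommGroup V'] [NormedSpace ℝ V'] [CompleteSpace V']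
  [FiniteDimensional ℝ V']
variable {M' : Type*} [TopologicalSpace M'] [ChartedSpace V' M'] [IsManifold 𝓘(ℝ, V') ∞ M']
variable {U : Set M} {p : M → M'} {K L : SubspaceField V M} {D : SubspaceField V' M'}
  {hD : IsDistribution 2 D}

lemma spanOn_singleton (f : Fin 6 → VField V M) (i : Fin 6) (x : M) :
    spanOn f {i} x = Submodule.span ℝ {f i x} := by
  refine le_antisymm (spanOn_le fun j hj => ?_) ?_
  · rw [Finset.mem_singleton.1 hj]
    exact Submodule.mem_span_singleton_self _
  · rw [Submodule.span_singleton_le_iff_mem]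
    exact mem_spanOn f (Finset.mem_singleton_self i) x

lemma mem_derived_one {v : VField V M} {x : M} (h : v x ∈ K x) :
    v x ∈ derived (sumField K L) 1 x :=
  (le_sup_left.trans (le_sup_left.trans le_sup_left) :
    K x ≤ derived (sumField K L) 1 x) h

namespace IsReduction

/-- `K` lies in `∂E`, the preimage of `D`, and meets the kernel `L` of `dp` trivially. Its image is
therefore a line in `D`. -/
lemma exists_toSigma (hKL : IsPseudoProductG2 K L)
    (h : IsReduction U p L (derived (sumField K L) 1) D) {w : M} (hw : w ∈ U) :
    ∃ ζ : ProjSpace hD, ζ.toSigma = pushPt V V' p ⟨w, K w⟩ := by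
  obtain ⟨U₁, hwU₁, f, hf⟩ := hKL.exists_frame w
  have hK := (hf.K_eq w hwU₁).trans (spanOn_singleton f 1 w)
  have hfK : f 1 w ∈ K w := by
    rw [hK]
    exact Submodule.mem_span_singleton_self _
  have h1 : f 1 w ∈ pull V V' p w (D (p w)) := by
    rw [h.pull_eq w hw]
    exact mem_derived_one hfK
  obtain ⟨ζ, hζ⟩ := ProjSpace.exists_toSigma (hD := hD) h1 fun h0 => by
    have h2 : f 1 w ∈ L w := by
      rw [← h.ker_eq w hw]
      exact h0
    exact (hf.indep w hwU₁).ne_zero 1 (Submodule.disjoint_def.1 (hKL.disjoint w) _ hfK h2)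
  exact ⟨ζ, hζ.trans (pushPt_of_line p hK).symm⟩

variable {Ψ : M → ProjSpace hD}

lemma contMDiffOn_lineMap (hKL : IsPseudoProductG2 K L)
    (h : IsReduction U p L (derived (sumField K L) 1) D)
    (hΨ : ∀ w ∈ U, (Ψ w).toSigma = pushPt V V' p ⟨w, K w⟩) :
    ContMDiffOn 𝓘(ℝ, V) 𝓘(ℝ, V' × ℝ) ∞ Ψ U := by
  intro z hz
  obtain ⟨U₁, hzU₁, f, hf⟩ := hKL.exists_frame z
  have hN : IsOpen (U ∩ U₁) := h.isOpen.inter hf.isOpen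
  have h1 := ProjSpace.contMDiffOn_of_toSigma hN (f := Ψ)
    (SmoothVF.mfderiv_apply hN (h.smooth.mono inter_subset_left)
      ((hf.smooth 1).mono inter_subset_right)) fun w hw =>
      (hΨ w hw.1).trans (pushPt_of_line p ((hf.K_eq w hw.2).trans (spanOn_singleton f 1 w)))
  exact (h1.contMDiffAt (hN.mem_nhds ⟨hz, hzU₁⟩)).contMDiffWithinAt

/-- Differentiate `base ∘ Ψ = p`; as before, the equality is read in the model space. -/
lemma mfderiv_base_lineMap (hKL : IsPseudoProductG2 K L)
    (h : IsReduction U p L (derived (sumField K L) 1) D)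
    (hΨ : ∀ w ∈ U, (Ψ w).toSigma = pushPt V V' p ⟨w, K w⟩) {w : M} (hw : w ∈ U)
    (v : TangentSpace 𝓘(ℝ, V) w) :
    (show V' from mfderiv 𝓘(ℝ, V' × ℝ) 𝓘(ℝ, V') (ProjSpace.base (hD := hD)) (Ψ w)
      (mfderiv 𝓘(ℝ, V) 𝓘(ℝ, V' × ℝ) Ψ w v)) = mfderiv 𝓘(ℝ, V) 𝓘(ℝ, V') p w v := by
  have h0 := ((contMDiffOn_lineMap hKL h hΨ).contMDiffAt (h.isOpen.mem_nhds hw)).mdifferentiableAt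
    (n := ∞) (by simp)
  have h1 := mfderiv_comp w (ProjSpace.mdifferentiableAt_base (Ψ w)) h0
  have h3 : ProjSpace.base (hD := hD) ∘ Ψ =ᶠ[𝓝 w] p :=
    Filter.eventually_of_mem (h.isOpen.mem_nhds hw) fun w hw => congrArg Sigma.fst (hΨ w hw)
  have h4 := h3.mfderiv_eq (I := 𝓘(ℝ, V)) (I' := 𝓘(ℝ, V'))
  rw [h1] at h4
  exact congrArg (fun L => L v) h4

/-- The lines `p_* K` turn along the fibres of `p`. -/
lemma mfderiv_lineMap_ne_zero (hKL : IsPseudoProductG2 K L)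
    (h : IsReduction U p L (derived (sumField K L) 1) D)
    (hΨ : ∀ w ∈ U, (Ψ w).toSigma = pushPt V V' p ⟨w, K w⟩) {z : M} (hz : z ∈ U)
    {v : TangentSpace 𝓘(ℝ, V) z} (hv : mfderiv 𝓘(ℝ, V) 𝓘(ℝ, V' × ℝ) Ψ z v = 0) : v = 0 := by
  have hsm := contMDiffOn_lineMap hKL h hΨ
  by_contra hv0
  -- A vector killed by `dΨ` is killed by `dp`, hence lies in `L`.
  have hvL : v ∈ L z := by
    rw [← h.ker_eq z hz]
    refine (mfderiv_base_lineMap hKL h hΨ hz v).symm.trans ?_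
    rw [hv]
    exact map_zero _
  have hbase : ∀ w ∈ U, (Ψ w).base = p w := fun w hw => congrArg Sigma.fst (hΨ w hw)
  obtain ⟨O, η, N, t, hη, hN, hzN, hNO, ht, hline⟩ := ProjSpace.exists_slope (Ψ z)
  obtain ⟨N₁, f, g₁, g₂, hzN₁, hN₁U, hf, hl, hF⟩ := h.exists_isLiftFrame hKL hz hη
    ((hbase z hz).symm ▸ hNO hzN)
  have hN₂ : IsOpen (N₁ ∩ Ψ ⁻¹' N) :=
    (hsm.continuousOn.mono hN₁U).isOpen_inter_preimage hl.isOpen hN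
  replace hl := hl.mono hN₂ inter_subset_left
  replace hf := hf.mono hN₂ inter_subset_left
  replace hF := hF.mono hN₂ inter_subset_left
  have hzN₂ : z ∈ N₁ ∩ Ψ ⁻¹' N := ⟨hzN₁, hzN⟩
  have hN₂U : N₁ ∩ Ψ ⁻¹' N ⊆ U := fun w hw => hN₁U hw.1
  have hN₂N : MapsTo Ψ (N₁ ∩ Ψ ⁻¹' N) N := fun w hw => hw.2
  generalize N₁ ∩ Ψ ⁻¹' N = S at *
  let τ : M → ℝ := t ∘ Ψ
  have hτ : SmoothFn V S τ := ht.comp (hsm.mono hN₂U) hN₂N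
  -- `v` is a nonzero multiple of `f 0`, so the slope of the line `p_* K` is stationary along `f 0`
  -- at `z`.
  have hτ0 : dirDeriv τ (f 0) z = 0 := by
    have h1 : L z = Submodule.span ℝ {f 0 z} := (hf.L_eq z hzN₂).trans (spanOn_singleton f 0 z)
    rw [h1] at hvL
    obtain ⟨c, rfl⟩ := Submodule.mem_span_singleton.1 hvL
    have hc : c ≠ 0 := fun hc => hv0 (by rw [hc, zero_smul])
    have h2 : mfderiv 𝓘(ℝ, V) 𝓘(ℝ, V' × ℝ) Ψ z (f 0 z) = 0 := by
      rw [map_smul] at hv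
      exact (smul_eq_zero.1 hv).resolve_left hc
    have h3 := mfderiv_comp z ((ht.contMDiffAt (hN.mem_nhds (hN₂N hzN₂))).mdifferentiableAt
      (n := ∞) (by simp)) ((hsm.contMDiffAt (h.isOpen.mem_nhds hz)).mdifferentiableAt
      (n := ∞) (by simp))
    refine (congrArg (fun A => A (f 0 z)) h3).trans ?_
    simp only [ContinuousLinearMap.comp_apply]
    rw [h2]
    exact map_zero _
  obtain ⟨c, hc, hcf⟩ := hF.smoothComb hN₂ subset_rfl (X := f 1) ⟨hf.smooth 1, fun w hw => by
    refine mem_derived_one ?_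
    rw [hf.K_eq w hw]
    exact mem_spanOn f (by simp) w⟩
  -- `f 1` has components `c 0, c 1, c 2` along `f 0, g₁, g₂`. Its projection spans the line of
  -- slope `τ`, which fixes the ratio of the last two.
  have hslope : ∀ w ∈ S, c 2 w = τ w * c 1 w := by
    intro w hw
    have h1 : (⟨(Ψ w).base, Submodule.span ℝ {η 0 (Ψ w).base + τ w • η 1 (Ψ w).base}⟩ :
        Σ y : M', Submodule ℝ (TangentSpace 𝓘(ℝ, V') y)) =
        ⟨p w, Submodule.span ℝ {mfderiv 𝓘(ℝ, V) 𝓘(ℝ, V') p w (f 1 w)}⟩ := by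
      have h0 : (⟨(Ψ w).base, Submodule.span ℝ {η 0 (Ψ w).base + τ w • η 1 (Ψ w).base}⟩ :
          Σ y : M', Submodule ℝ (TangentSpace 𝓘(ℝ, V') y)) = ⟨(Ψ w).base, (Ψ w).line⟩ :=
        Sigma.ext rfl (heq_of_eq (hline _ (hN₂N hw)).symm)
      exact h0.trans ((hΨ w (hN₂U hw)).trans
        (pushPt_of_line p ((hf.K_eq w hw).trans (spanOn_singleton f 1 w))))
    have h2 : ∀ (b y : M') (s : ℝ) (u : TangentSpace 𝓘(ℝ, V') y),
        (⟨b, Submodule.span ℝ {η 0 b + s • η 1 b}⟩ :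
          Σ y : M', Submodule ℝ (TangentSpace 𝓘(ℝ, V') y)) = ⟨y, Submodule.span ℝ {u}⟩ →
        ∃ r : ℝ, r • (η 0 y + s • η 1 y) = u := by
      intro b y s u hby
      obtain rfl : b = y := congrArg Sigma.fst hby
      refine Submodule.mem_span_singleton.1 ?_
      exact (eq_of_heq (Sigma.ext_iff.1 hby).2).ge (Submodule.mem_span_singleton_self u)
    obtain ⟨r, hr⟩ := h2 _ _ _ _ h1
    have h3 : mfderiv 𝓘(ℝ, V) 𝓘(ℝ, V') p w (f 1 w) = c 1 w • η 0 (p w) + c 2 w • η 1 (p w) := by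
      rw [hcf w hw, Fin.sum_univ_three, map_add, map_add, map_smul, map_smul, map_smul]
      change c 0 w • mfderiv 𝓘(ℝ, V) 𝓘(ℝ, V') p w (f 0 w) +
        c 1 w • mfderiv 𝓘(ℝ, V) 𝓘(ℝ, V') p w (g₁ w) +
        c 2 w • mfderiv 𝓘(ℝ, V) 𝓘(ℝ, V') p w (g₂ w) = _
      rw [hl.map_T w hw, hl.map_g₁ w hw, hl.map_g₂ w hw, smul_zero, zero_add]
    have h4 := Fintype.linearIndependent_iff.1 (hη.indep _ (hl.mapsTo hw))
      ![r - c 1 w, r * τ w - c 2 w] (by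
        rw [Fin.sum_univ_two]
        change (r - c 1 w) • η 0 (p w) + (r * τ w - c 2 w) • η 1 (p w) = 0
        have h5 := hr.trans h3
        rw [smul_add, smul_smul] at h5
        rw [sub_smul, sub_smul, sub_add_sub_comm, h5, sub_self])
    have h5 : r - c 1 w = 0 := h4 0
    have h6 : r * τ w - c 2 w = 0 := h4 1
    rw [← sub_eq_zero.1 h5, ← sub_eq_zero.1 h6, mul_comm]
  have hsg : ∀ i, SmoothVF S ((![f 0, g₁ + τ • g₂] : Fin 2 → VField V M) i) := by
    intro i
    fin_cases i
    exacts [hf.smooth 0, hl.smooth_g₁.add (hl.smooth_g₂.smul hτ)]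
  have hcf' : ∀ w ∈ S, f 1 w =
      ∑ i, (![c 0, c 1] : Fin 2 → M → ℝ) i w • (![f 0, g₁ + τ • g₂] : Fin 2 → VField V M) i w := by
    intro w hw
    rw [hcf w hw, Fin.sum_univ_three, Fin.sum_univ_two]
    change c 0 w • f 0 w + c 1 w • g₁ w + c 2 w • g₂ w =
      c 0 w • f 0 w + c 1 w • (g₁ w + τ w • g₂ w)
    rw [hslope w hw, smul_add, smul_smul, mul_comm, add_assoc]
  have hbr := lieB_comb_right (X := f 0) hN₂ hsg (c := ![c 0, c 1]) (by
    intro i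
    fin_cases i
    exacts [hc 0, hc 1]) hcf' hzN₂
  have h12 : f 1 z = c 0 z • f 0 z + c 1 z • (g₁ + τ • g₂) z := by
    refine (hcf' z hzN₂).trans ?_
    rw [Fin.sum_univ_two]
    rfl
  have hindep := hf.indep z hzN₂
  have hf0 : f 0 z ∈ flag f 2 z := mem_flag f (by simp) z
  have hf1 : f 1 z ∈ flag f 2 z := mem_flag f (by simp) z
  -- Otherwise `f 1` would be proportional to `f 0` at `z`. So `g₁ + τ g₂` lies in the span of `f 0`
  -- and `f 1` at `z`.
  have hc1 : c 1 z ≠ 0 := by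
    intro h0
    rw [h0, zero_smul, add_zero] at h12
    refine not_mem_flag hindep 1 ?_
    rw [h12]
    exact Submodule.smul_mem _ _ (mem_flag f (by simp) z)
  have hg : (g₁ + τ • g₂) z ∈ flag f 2 z := by
    rw [← Submodule.smul_mem_iff _ hc1]
    have h13 : c 1 z • (g₁ + τ • g₂) z = f 1 z - c 0 z • f 0 z := by
      rw [h12, add_sub_cancel_left]
    rw [h13]
    exact Submodule.sub_mem _ hf1 (Submodule.smul_mem _ _ hf0)
  have hT : ∀ i, lieB (f 0) (fiveFrame g₁ g₂ i) z ∈ flag f 2 z := fun i =>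
    (Submodule.span_singleton_le_iff_mem _ _).2 hf0 (hl.lieB_T i hzN₂)
  -- With `τ` stationary, this bracket is a multiple of `f 0`. Then `[f 0, f 1]` lies in `E` at `z`,
  -- contrary to the independence of `f 2`.
  have hbg : lieB (f 0) (g₁ + τ • g₂) z ∈ flag f 2 z := by
    rw [lieB_add_right hN₂ hl.smooth_g₁ (hl.smooth_g₂.smul hτ) hzN₂,
      lieB_smul_right hN₂ hτ hl.smooth_g₂ hzN₂, hτ0, zero_smul, zero_add]
    exact Submodule.add_mem _ (hT 0) (Submodule.smul_mem _ _ (hT 1))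
  refine not_mem_flag hindep 2 ?_
  have h2 : lieB (f 0) (f 1) z ∈ flag f 2 z := by
    rw [hbr, Fin.sum_univ_two]
    change dirDeriv (c 0) (f 0) z • f 0 z + c 0 z • lieB (f 0) (f 0) z +
      (dirDeriv (c 1) (f 0) z • (g₁ + τ • g₂) z + c 1 z • lieB (f 0) (g₁ + τ • g₂) z) ∈ _
    rw [lieB_self, smul_zero, add_zero]
    exact Submodule.add_mem _ (Submodule.smul_mem _ _ hf0) (Submodule.add_mem _
      (Submodule.smul_mem _ _ hg) (Submodule.smul_mem _ _ hbg))
  rw [hf.eq_2]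
  exact h2

/-- The map `w ↦ (p w, p_* K_w)` identifies a pseudo-product structure with the prolongation of
its reduction. -/
lemma exists_lineMap (hKL : IsPseudoProductG2 K L) (hV' : Module.finrank ℝ V' = 5)
    (h : IsReduction U p L (derived (sumField K L) 1) D)
    {K₀ : SubspaceField (V' × ℝ) (ProjSpace hD)} (hK₀ : IsG2Splitting hD K₀) {z : M} (hz : z ∈ U) :
    ∃ Φ : OpenPartialHomeomorph M (ProjSpace hD), z ∈ Φ.source ∧ Φ.source ⊆ U ∧
      IsDiffeo V (V' × ℝ) Φ ∧ Carries Φ K K₀ ∧ Carries Φ L (vertical hD) ∧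
      ∀ w ∈ Φ.source, (Φ w).toSigma = pushPt V V' p ⟨w, K w⟩ := by
  obtain ⟨z₀, -⟩ := h.exists_toSigma (hD := hD) hKL hz
  let Ψ : M → ProjSpace hD := fun w => ProjSpace.ofSigma z₀ (pushPt V V' p ⟨w, K w⟩)
  have hΨ : ∀ w ∈ U, (Ψ w).toSigma = pushPt V V' p ⟨w, K w⟩ := fun w hw =>
    ProjSpace.toSigma_ofSigma z₀ (h.exists_toSigma hKL hw)
  -- Both tangent spaces have dimension six, so injectivity is enough.
  have hbij : Function.Bijective (mfderiv 𝓘(ℝ, V) 𝓘(ℝ, V' × ℝ) Ψ z) :=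
    let A : V →ₗ[ℝ] V' × ℝ := (mfderiv 𝓘(ℝ, V) 𝓘(ℝ, V' × ℝ) Ψ z).toLinearMap
    have hA : Function.Injective A := (injective_iff_map_eq_zero A).2 fun v hv =>
      mfderiv_lineMap_ne_zero hKL h hΨ hz hv
    ⟨hA, (LinearMap.injective_iff_surjective_of_finrank_eq_finrank (f := A) (by
      rw [hKL.dim, Module.finrank_prod, hV', Module.finrank_self])).1 hA⟩
  obtain ⟨Φ, hzΦ, hΦU, hΦ, hΦΨ⟩ := exists_isDiffeo h.isOpen (contMDiffOn_lineMap hKL h hΨ) hz hbij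
  have hΦs : ∀ w ∈ Φ.source, (Φ w).toSigma = pushPt V V' p ⟨w, K w⟩ := fun w hw => by
    rw [hΦΨ w hw]
    exact hΨ w (hΦU hw)
  have hd : ∀ w ∈ Φ.source, ∀ v : TangentSpace 𝓘(ℝ, V) w,
      (show V' from mfderiv 𝓘(ℝ, V' × ℝ) 𝓘(ℝ, V') (ProjSpace.base (hD := hD)) (Φ w)
      (mfderiv 𝓘(ℝ, V) 𝓘(ℝ, V' × ℝ) Φ w v)) = mfderiv 𝓘(ℝ, V) 𝓘(ℝ, V') p w v := fun w hw v => by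
    have h1 := mfderiv_comp w (ProjSpace.mdifferentiableAt_base (Φ w)) (hΦ.mdifferentiableAt hw)
    have h3 : ProjSpace.base (hD := hD) ∘ Φ =ᶠ[𝓝 w] p :=
      Filter.eventually_of_mem (Φ.open_source.mem_nhds hw) fun w hw =>
        congrArg Sigma.fst (hΦs w hw)
    have h4 := h3.mfderiv_eq (I := 𝓘(ℝ, V)) (I' := 𝓘(ℝ, V'))
    rw [h1] at h4
    exact congrArg (fun L => L v) h4
  have hcL : Carries Φ L (vertical hD) := fun w hw => by
    have h1 : L w = pull V (V' × ℝ) Φ w (vertical hD (Φ w)) := by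
      rw [← h.ker_eq w (hΦU hw)]
      ext v
      exact ⟨fun h1 => (hd w hw v).trans h1, fun h1 => (hd w hw v).symm.trans h1⟩
    rw [h1]
    exact carries_pull hΦ (vertical hD) w hw
  -- `E` is the sum of `K` and the kernel of `dp`, hence the preimage of the line `p_* K`.
  have hcE : Carries Φ (sumField K L) (cartanProlongation hD) := fun w hw => by
    have h1 : sumField K L w = pull V (V' × ℝ) Φ w (cartanProlongation hD (Φ w)) := by
      ext v
      have h2 : v ∈ pull V (V' × ℝ) Φ w (cartanProlongation hD (Φ w)) ↔
          mfderiv 𝓘(ℝ, V) 𝓘(ℝ, V') p w v ∈ push V V' p w (K w) := by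
        rw [← hd w hw v]
        exact ProjSpace.mem_line_iff (hΦs w hw) _
      rw [h2]
      refine ⟨fun h3 => ?_, ?_⟩
      · obtain ⟨a, ha, b, hb, rfl⟩ := Submodule.mem_sup.1 h3
        rw [← h.ker_eq w (hΦU hw)] at hb
        refine ⟨a, ha, ?_⟩
        have hb : mfderiv 𝓘(ℝ, V) 𝓘(ℝ, V') p w b = 0 := hb
        rw [map_add, hb, add_zero]
        rfl
      · rintro ⟨a, ha, hav⟩
        refine Submodule.mem_sup.2 ⟨a, ha, v - a, ?_, add_sub_cancel a v⟩
        rw [← h.ker_eq w (hΦU hw)]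
        refine (map_sub _ v a).trans ?_
        rw [sub_eq_zero]
        exact hav.symm
    rw [h1]
    exact carries_pull hΦ (cartanProlongation hD) w hw
  refine ⟨Φ, hzΦ, hΦU, hΦ, ?_, hcL, hΦs⟩
  -- Both complements are recovered from `E` in the same natural way, so nothing is left to compute.
  rw [hKL.eq_charDir, hK₀.eq_prolongK]
  exact Carries.charDir hΦ hcE (Carries.derived hΦ hcE 3)

end IsReduction

end LineMap

/-! ### Local isomorphism classes. -/

section Classification

lemma IsPseudoProductG2.isDistribution_derived_one {V : Type*} [NormedAddCommGroup V]
    [NormedSpace ℝ V] [CompleteSpace V] [FiniteDimensional ℝ V] {M : Type*} [TopologicalSpace M]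
    [ChartedSpace V M] [IsManifold 𝓘(ℝ, V) ∞ M] {K L : SubspaceField V M}
    (h : IsPseudoProductG2 K L) : IsDistribution 3 (derived (sumField K L) 1) := by
  refine isDistribution_of_frames fun z => ?_
  obtain ⟨U, hz, f, hf⟩ := h.exists_frame z
  refine ⟨U, hz, ![f 0, f 1, f 2], isFrameOn_of_le hf.isOpen (fun i => ?_) (fun x hx => ?_)
    fun x _ => h.growth 1 (by norm_num) x⟩
  · fin_cases i
    exacts [hf.smooth 0, hf.smooth 1, hf.smooth 2]
  · rw [hf.toIsG2Frame.derived_eq_one (IsG2Frame.sumField_eq hf.K_eq hf.L_eq) x hx]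
    have hm := fun i : Fin 3 => mem_spanField ![f 0, f 1, f 2] i x
    refine flag_le fun i hi => ?_
    fin_cases i <;> first | (exfalso; simp at hi; done) | skip
    exacts [hm 0, hm 1, hm 2]

section Lift

variable {V : Type*} [NormedAddCommGroup V] [NormedSpace ℝ V] [CompleteSpace V]
  [FiniteDimensional ℝ V]
variable {Y : Type*} [TopologicalSpace Y] [ChartedSpace V Y] [IsManifold 𝓘(ℝ, V) ∞ Y]
variable {Y' : Type*} [TopologicalSpace Y'] [ChartedSpace V Y'] [IsManifold 𝓘(ℝ, V) ∞ Y']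
variable {D : SubspaceField V Y} {D' : SubspaceField V Y'}

lemma IsG2Splitting.exists_lift {hD : IsDistribution 2 D} {hD' : IsDistribution 2 D'}
    {K : SubspaceField (V × ℝ) (ProjSpace hD)} {K' : SubspaceField (V × ℝ) (ProjSpace hD')}
    (hK : IsG2Splitting hD K) (hK' : IsG2Splitting hD' K') {φ : OpenPartialHomeomorph Y Y'}
    (hφ : IsDiffeo V V φ) (hφD : Carries φ D D') :
    ∃ Φ : OpenPartialHomeomorph (ProjSpace hD) (ProjSpace hD'),
      Φ.source = ProjSpace.base ⁻¹' φ.source ∧ IsDiffeo (V × ℝ) (V × ℝ) Φ ∧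
      Carries Φ K K' ∧ Carries Φ (vertical hD) (vertical hD') ∧
      ∀ w ∈ Φ.source, (Φ w).toSigma = pushPt V V φ w.toSigma := by
  have h := ProjSpace.isDiffeo_liftHomeo (hD := hD) (hD' := hD') hφ hφD
  refine ⟨ProjSpace.liftHomeo hD hD' hφ hφD, rfl, h, ?_, ProjSpace.carries_vertical hφ hφD,
    ProjSpace.covers_lift hφ hφD⟩
  rw [hK.eq_prolongK, hK'.eq_prolongK]
  exact ProjSpace.carries_prolongK h (ProjSpace.carries_cartan hφ hφD)

lemma IsG2Splitting.exists_covered (hD : Is235 D) (hD' : Is235 D')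
    {K : SubspaceField (V × ℝ) (ProjSpace hD.isDistribution)}
    {K' : SubspaceField (V × ℝ) (ProjSpace hD'.isDistribution)}
    (hK : IsG2Splitting hD.isDistribution K) (hK' : IsG2Splitting hD'.isDistribution K')
    {Φ : OpenPartialHomeomorph (ProjSpace hD.isDistribution) (ProjSpace hD'.isDistribution)}
    (hΦ : IsDiffeo (V × ℝ) (V × ℝ) Φ) (hΦK : Carries Φ K K')
    (hL : Carries Φ (vertical hD.isDistribution) (vertical hD'.isDistribution))
    {z : ProjSpace hD.isDistribution} (hz : z ∈ Φ.source) :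
    ∃ (φ : OpenPartialHomeomorph Y Y') (W : Set (ProjSpace hD.isDistribution)),
      IsDiffeo V V φ ∧ Carries φ D D' ∧ IsOpen W ∧ z ∈ W ∧ W ⊆ Φ.source ∧
      W ⊆ ProjSpace.base ⁻¹' φ.source ∧
      ∀ w ∈ W, (Φ w).toSigma = pushPt V V φ w.toSigma := by
  refine TwoThreeFive.exists_covered hD hD' hΦ hL ?_ hz
  rw [← hK.2, ← hK'.2]
  exact hΦK.sumField hL

end Lift

/-- `∂E` contains `L` and is invariant under it, so it descends to the local leaf space, where
`IsReduction.is235` applies. -/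
lemma exists_reduction {Z : Type u} [TopologicalSpace Z] [ChartedSpace (R5 × ℝ) Z]
    [IsManifold 𝓘(ℝ, R5 × ℝ) ∞ Z] {K L : SubspaceField (R5 × ℝ) Z}
    (hKL : IsPseudoProductG2 K L) (z : Z) :
    ∃ (Y : Type u) (_ : TopologicalSpace Y) (_ : ChartedSpace R5 Y)
      (_ : IsManifold 𝓘(ℝ, R5) ∞ Y) (U : Set Z) (p : Z → Y) (D : SubspaceField R5 Y),
      T2Space Y ∧ SecondCountableTopology Y ∧ z ∈ U ∧ Is235 D ∧
      IsReduction U p L (derived (sumField K L) 1) D := by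
  obtain ⟨Y, _, _, _, U, p, D, hT2, hsc, hz, h⟩ := exists_isReduction hKL.rank_L
    hKL.isDistribution_derived_one
    (fun z => (le_sup_right : L z ≤ K z ⊔ L z).trans (le_sup_left.trans le_sup_left))
    hKL.bracket_L_1 z
  exact ⟨Y, _, _, _, U, p, D, hT2, hsc, hz, h.is235 hKL finrank_euclideanSpace_fin
    (h.isDistribution hKL.rank_L hKL.isDistribution_derived_one), h⟩

/-- The prolongation, on local isomorphism classes. -/
def prolongClass : Quotient DirectedGerm235.setoid.{u} → Quotient PseudoProductGerm.setoid.{u} :=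
  Quotient.lift (fun G => Quotient.mk _ (G.prolong _ G.is235.isG2Splitting)) (by
    rintro G G' ⟨φ, hφ, hx, hφD, hl⟩
    obtain ⟨Φ, hs, hΦ, hK, hL, hc⟩ := G.is235.isG2Splitting.exists_lift
      G'.is235.isG2Splitting hφ hφD
    have hz : G.point ∈ Φ.source := by
      rw [hs]
      exact hx
    exact Quotient.sound ⟨Φ, hΦ, hz, ProjSpace.toSigma_injective ((hc _ hz).trans hl), hK, hL⟩)

/-- An isomorphism of prolongations covers one of the distributions, and it sends the marked line to
the marked line because it acts on lines by the derivative. -/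
lemma prolongClass_injective : Function.Injective prolongClass.{u} := by
  intro a b
  refine Quotient.inductionOn₂ a b fun G G' h => ?_
  obtain ⟨Φ, hΦ, hz, hp, hK, hL⟩ := Quotient.exact h
  obtain ⟨φ, W, hφ, hφD, -, hzW, -, hWφ, hc⟩ := G.is235.isG2Splitting.exists_covered G.is235
    G'.is235 G'.is235.isG2Splitting hΦ hK hL hz
  exact Quotient.sound ⟨φ, hφ, hWφ hzW, hφD, (hc _ hzW).symm.trans (congrArg _ hp)⟩

/-- A preimage is a local reduction, marked by the image of the base point under the line map. -/
lemma prolongClass_surjective : Function.Surjective prolongClass.{u} := by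
  intro a
  refine Quotient.inductionOn a fun H => ?_
  obtain ⟨Y, _, _, _, U, p, D, -, -, hz, hD, h⟩ := exists_reduction H.isG2 H.point
  obtain ⟨Φ, hzΦ, -, hΦ, hK, hL, -⟩ := h.exists_lineMap H.isG2 finrank_euclideanSpace_fin
    hD.isG2Splitting hz
  let G : DirectedGerm235.{u} := ⟨Y, D, hD, Φ H.point⟩
  refine ⟨Quotient.mk _ G, (Quotient.sound ?_ : _ = Quotient.mk _ (G.prolong _ _)).symm⟩
  exact ⟨Φ, hΦ, hzΦ, rfl, hK, hL⟩

end Classification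

end TwoThreeFive

end

/-! ### The theorem. -/

open TwoThreeFive

theorem theorem2p2 :
    -- the prolongation `E = K ⊕ L` on `P(D)`; `D` is the reduction of `∂E` by `L`
    (∀ (Y : Type u) [TopologicalSpace Y] [ChartedSpace R5 Y] [IsManifold 𝓘(ℝ, R5) ∞ Y]
        (D : SubspaceField R5 Y) (hD : Is235 D),
      (∃ K : SubspaceField (R5 × ℝ) (ProjSpace hD.isDistribution),
        IsG2Splitting hD.isDistribution K ∧
        -- `K` is determined by `E`, `L` and `[𝓚, ∂⁽³⁾𝓔] = ∂⁽³⁾𝓔`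
        ∀ K' : SubspaceField (R5 × ℝ) (ProjSpace hD.isDistribution),
          IsDistribution 1 K' →
          sumField K' (vertical hD.isDistribution) = cartanProlongation hD.isDistribution →
          bracket K' (derived (cartanProlongation hD.isDistribution) 3) =
            derived (cartanProlongation hD.isDistribution) 3 →
          K' = K) ∧
      IsReduction univ (ProjSpace.base (hD := hD.isDistribution)) (vertical hD.isDistribution)
        (derived (cartanProlongation hD.isDistribution) 1) D) ∧
    -- naturality: local isomorphisms of `D` and of `(K, L)` correspond to each other
    (∀ (Y Y' : Type u) [TopologicalSpace Y] [ChartedSpace R5 Y] [IsManifold 𝓘(ℝ, R5) ∞ Y]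
        [TopologicalSpace Y'] [ChartedSpace R5 Y'] [IsManifold 𝓘(ℝ, R5) ∞ Y']
        (D : SubspaceField R5 Y) (D' : SubspaceField R5 Y') (hD : Is235 D) (hD' : Is235 D')
        (K : SubspaceField (R5 × ℝ) (ProjSpace hD.isDistribution))
        (K' : SubspaceField (R5 × ℝ) (ProjSpace hD'.isDistribution)),
      IsG2Splitting hD.isDistribution K → IsG2Splitting hD'.isDistribution K' →
      -- every local isomorphism lifts
      (∀ φ : OpenPartialHomeomorph Y Y', IsDiffeo R5 R5 φ → Carries φ D D' →
        ∃ Φ : OpenPartialHomeomorph (ProjSpace hD.isDistribution) (ProjSpace hD'.isDistribution),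
          Φ.source = ProjSpace.base ⁻¹' φ.source ∧ IsDiffeo (R5 × ℝ) (R5 × ℝ) Φ ∧
          Carries Φ K K' ∧ Carries Φ (vertical hD.isDistribution) (vertical hD'.isDistribution) ∧
          ∀ w ∈ Φ.source, (Φ w).toSigma = pushPt R5 R5 φ w.toSigma) ∧
      -- every local isomorphism of the prolongations is locally such a lift
      (∀ Φ : OpenPartialHomeomorph (ProjSpace hD.isDistribution) (ProjSpace hD'.isDistribution),
        IsDiffeo (R5 × ℝ) (R5 × ℝ) Φ → Carries Φ K K' →
        Carries Φ (vertical hD.isDistribution) (vertical hD'.isDistribution) →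
        ∀ z ∈ Φ.source, ∃ (φ : OpenPartialHomeomorph Y Y') (W : Set (ProjSpace hD.isDistribution)),
          IsDiffeo R5 R5 φ ∧ Carries φ D D' ∧ IsOpen W ∧ z ∈ W ∧ W ⊆ Φ.source ∧
          W ⊆ ProjSpace.base ⁻¹' φ.source ∧
          ∀ w ∈ W, (Φ w).toSigma = pushPt R5 R5 φ w.toSigma) ∧
      -- without directions: `D` at `y` and `D'` at `y'` are locally isomorphic iff their
      -- prolongations are so at some points over `y` and `y'`
      (∀ (y : Y) (y' : Y'),
        (∃ φ : OpenPartialHomeomorph Y Y', IsDiffeo R5 R5 φ ∧ Carries φ D D' ∧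
          y ∈ φ.source ∧ φ y = y') ↔
        ∃ Φ : OpenPartialHomeomorph (ProjSpace hD.isDistribution) (ProjSpace hD'.isDistribution),
          IsDiffeo (R5 × ℝ) (R5 × ℝ) Φ ∧ Carries Φ K K' ∧
          Carries Φ (vertical hD.isDistribution) (vertical hD'.isDistribution) ∧
          ∃ z ∈ Φ.source, z.base = y ∧ (Φ z).base = y')) ∧
    -- the reduction of a pseudo-product structure of `G₂`-type
    (∀ (Z : Type u) [TopologicalSpace Z] [ChartedSpace (R5 × ℝ) Z]
        [IsManifold 𝓘(ℝ, R5 × ℝ) ∞ Z] (K L : SubspaceField (R5 × ℝ) Z),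
      IsPseudoProductG2 K L →
      -- `L` is the Cauchy characteristic of `∂E`
      (∀ z : Z, cauchyChar (derived (sumField K L) 1) z = (L z : Set _)) ∧
      -- locally `∂E` has a reduction by `L`
      (∀ z : Z, ∃ (Y : Type u) (_ : TopologicalSpace Y) (_ : ChartedSpace R5 Y)
          (_ : IsManifold 𝓘(ℝ, R5) ∞ Y) (U : Set Z) (p : Z → Y) (D : SubspaceField R5 Y),
        T2Space Y ∧ SecondCountableTopology Y ∧ z ∈ U ∧ Is235 D ∧
        IsReduction U p L (derived (sumField K L) 1) D) ∧
      -- each reduction `D` is a `(2,3,5)`-distribution and its prolongation is locally `(Z, K, L)`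
      (∀ (Y : Type u) [TopologicalSpace Y] [ChartedSpace R5 Y] [IsManifold 𝓘(ℝ, R5) ∞ Y]
          (U : Set Z) (p : Z → Y) (D : SubspaceField R5 Y) (hD : IsDistribution 2 D),
        IsReduction U p L (derived (sumField K L) 1) D →
        Is235 D ∧
        ∀ K₀ : SubspaceField (R5 × ℝ) (ProjSpace hD), IsG2Splitting hD K₀ →
          ∀ z ∈ U, ∃ Φ : OpenPartialHomeomorph Z (ProjSpace hD),
            z ∈ Φ.source ∧ Φ.source ⊆ U ∧ IsDiffeo (R5 × ℝ) (R5 × ℝ) Φ ∧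
            Carries Φ K K₀ ∧ Carries Φ L (vertical hD) ∧
            ∀ w ∈ Φ.source, (Φ w).toSigma = pushPt (R5 × ℝ) R5 p ⟨w, K w⟩)) ∧
    -- the bijection of local isomorphism classes
    ∃ P : Quotient DirectedGerm235.setoid.{u} → Quotient PseudoProductGerm.setoid.{u},
      Function.Bijective P ∧
      ∀ (G : DirectedGerm235.{u})
        (K : SubspaceField (R5 × ℝ) (ProjSpace G.is235.isDistribution))
        (hK : IsG2Splitting G.is235.isDistribution K),
        P (Quotient.mk _ G) = Quotient.mk _ (G.prolong K hK) := by
  refine ⟨fun Y _ _ _ D hD => ⟨⟨prolongK hD.isDistribution, hD.isG2Splitting,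
    fun K' hK' hE hb => ?_⟩, hD.isReduction_base⟩, fun Y Y' _ _ _ _ _ _ D D' hD hD' K K' hK hK' =>
    ⟨fun φ hφ hφD => hK.exists_lift hK' hφ hφD, fun Φ hΦ hΦK hL z hz =>
      hK.exists_covered hD hD' hK' hΦ hΦK hL hz, fun y y' => ⟨?_, ?_⟩⟩,
    fun Z _ _ _ K L hKL => ⟨hKL.cauchyChar_eq, exists_reduction hKL,
      fun Y _ _ _ U p D hD h => ⟨h.is235 hKL finrank_euclideanSpace_fin hD,
        fun K₀ hK₀ z hz => h.exists_lineMap hKL finrank_euclideanSpace_fin hK₀ hz⟩⟩,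
    prolongClass, ⟨prolongClass_injective, prolongClass_surjective⟩, fun G K hK => ?_⟩
  · have h := hD.isG2Splitting
    refine h.1.eq_of_bracket hK' (hE.trans h.2.symm) ?_
    rw [h.2]
    exact hb
  · rintro ⟨φ, hφ, hφD, hy, rfl⟩
    obtain ⟨Φ, hs, hΦ, hΦK, hL, hc⟩ := hK.exists_lift hK' hφ hφD
    -- Any direction at `y` will do; the fibre is nonempty.
    obtain ⟨z, rfl⟩ := (isConnected_fibre hD.isDistribution y).nonempty
    have hz : z ∈ Φ.source := by
      rw [hs]
      exact hy
    exact ⟨Φ, hΦ, hΦK, hL, z, hz, rfl, congrArg Sigma.fst (hc z hz)⟩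
  · rintro ⟨Φ, hΦ, hΦK, hL, z, hz, rfl, rfl⟩
    obtain ⟨φ, W, hφ, hφD, -, hzW, -, hWφ, hc⟩ := hK.exists_covered hD hD' hK' hΦ hΦK hL hz
    exact ⟨φ, hφ, hφD, hWφ hzW, (congrArg Sigma.fst (hc z hzW)).symm⟩
  -- The class was defined with the canonical complement, and every splitting equals it.
  · obtain rfl := hK.eq_prolongK
    rfl
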